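/- **Definitions.** A *$G$-structure* on a connected open set $U$ of a locally connected space is a triple $(\widehat U,G_U,\pi_U)$: a connected, locally connected space $\widehat U$ with a continuous action of a topological group $G_U$ (not necessarily effective) and a continuous map $\pi_U:\widehat U\to U$ inducing a homeomorphism $\widehat U/G_U\cong U$. For a connected open $W\subset U$, every connected component $\widehat W$ of $\pi_U^{-1}(W)$, with its stabilizer $G_W\subset G_U$ and $\pi_U|_{\widehat W}$, is an *induced* $G$-structure on $W$. An isomorphism of $G$-structures is a pair $(\phi,\lambda)$ of a homeomorphism over the base and an isomorphism of topological groups such that $\phi$ is $\lambda$-equivariant. An *orbispace* $X$ is a locally connected space $X_{top}$ with a base $\mathcal U$ of connected open sets (the basic open sets), closed under passing to connected open subsets, a $G$-structure on each $U\in\mathcal U$, and for $U,V\in\mathcal U$ a set $Tran(U,V)$ of transition maps, non-empty if $U\cap V\neq\emptyset$, such that: (a) each $\xi\in Tran(U,V)$ has an underlying isomorphism $(\phi_\xi,\lambda_\xi)$ from a $G$-structure of a component of $U\cap V$ induced from $\widehat U$ to one induced from $\widehat V$ (different $\xi$ may have the same underlying isomorphism); (b) for $g\in G_U$, $h\in G_V$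 there is an element $h\circ\xi\circ g\in Tran(U,V)$ with the evident underlying isomorphism and the evident action laws; any two elements over the same component of $U\cap V$ are related in this way; and $h^{-1}\circ\xi\circ g=\xi$ if and only if $g$ lies in the domain of $\lambda_\xi$ and $\lambda_\xi(g)=h$; (c) the identity lies in $Tran(U,U)$, so that $Tran(U,U)=G_U$; (d) for $\xi\in Tran(U,V)$, $\eta\in Tran(V,W)$ and each point $x$ at which $\phi_\eta\circ\phi_\xi$ is defined there is a composition $\eta\circ\xi\in Tran(U,W)$ at $x$, which agrees with $\phi_\eta\circ\phi_\xi$ at $x$, depends only on the connected component of $x$ in the set where $\phi_\eta\circ\phi_\xi$ is defined, is associative, and agrees with (b) for elements of $G_U=Tran(U,U)$ and $G_V=Tran(V,V)$. $Tran(U,V)$ has the topology coming from the maps $(h,g)\mapsto h\circ\xi\circ g$. $X$ is connected if $X_{top}$ is. A *base-point structure* is $\underline p=(p,U_o,\hat p)$ with $p\in U_o\in\mathcal U$ and $\hat p\in\pi_{U_o}^{-1}(p)$. A *system* from $Y$ to $X$ consists of basic open sets $V_\alpha$ covering $Y$, basic open sets $U_\alpha$ of $X$, continuous maps $f_\alpha:\widehat{V_\alpha}\to\widehat{U_\alpha}$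 and continuous maps $\rho_{\beta\alpha}:Tran(V_\alpha,V_\beta)\to Tran(U_\alpha,U_\beta)$ with $f_\beta\circ\imath=\rho_{\beta\alpha}(\imath)\circ f_\alpha$ and $\rho_{\gamma\alpha}(\jmath\circ\imath)=\rho_{\gamma\beta}(\jmath)\circ\rho_{\beta\alpha}(\imath)$ (at every point where this makes sense). It induces a continuous map $f:Y_{top}\to X_{top}$ and homomorphisms $\rho_\alpha=\rho_{\alpha\alpha}:G_{V_\alpha}\to G_{U_\alpha}$. A *refinement* is a system $(\{V_i\},\{U_i\},\{f_i\},\{\xi_{ji}\})$ together with an index map $\theta$ with $V_i\subset V_{\theta(i)}$ and transition maps $\imath_i\in Tran(V_i,V_{\theta(i)})$, $\imath_i'\in Tran(U_i,U_{\theta(i)})$ such that $f_i=(\imath_i')^{-1}\circ f_{\theta(i)}\circ\imath_i$ and $\xi_{ji}(a)=(\imath_j')^{-1}\circ\rho_{\theta(j)\theta(i)}(\imath_j\circ a\circ\imath_i^{-1})\circ\imath_i'$. A *morphism* is a class of systems, two systems being equivalent if they have a common refinement. For *based* morphisms $(Y,\underline q)\to(X,\underline p)$, $\underline q=(q,V_o,\hat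 q)$, $\underline p=(p,U_o,\hat p)$, the systems contain an index $o$ with the given $V_o$, $U_o$ and $f_o(\hat q)=\hat p$, and refinements preserve $o$ with identity transition maps there. A morphism $\tilde\pi:Y\to X$ is an *orbispace covering morphism* if it has a representing system $(\{V_\alpha\},\{U_\alpha\},\{\pi_\alpha\},\{\rho_{\beta\alpha}\})$ such that every connected component of every $\pi^{-1}(U_\alpha)$ is some $V_\beta$ with $U_\beta=U_\alpha$; every $\rho_\alpha$ is injective, and $gh^{-1}\in\rho_\alpha(G_{V_\alpha})$ whenever $g,h\in G_{U_\alpha}$ are joined by a path in $G_{U_\alpha}$; every $\pi_\alpha$ is a homeomorphism; and $\pi$ is surjective. A based morphism is called a covering morphism if its underlying morphism is one. A *based loop* at $\underline p$ is a class of systems consisting of a subdivision $0=t_0<\dots<t_{n+1}=1$ with $n\ge1$, continuous maps $c_k:[t_k,t_{k+1}]\to\widehat{U_k}$, and transition maps $\xi_k\in Tran(U_k,U_{k+1})$ with $\xi_k(c_k(t_{k+1}))=c_{k+1}(t_{k+1})$, where $U_0=U_n=U_o$ and $c_0(0)=c_n(1)=\hat p$, modulo refinement (with identity transition maps on the first and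 last piece). The based loop space $\Omega(X,\underline p)$ has the compact-open topology, generated by the sets of classes of systems with a given subdivision and given $U_k$ for which $c_k$ sends a given compact set into a given open set and $\xi_k$ lies in a given open set. $\pi_1(X,\underline p)$ is the set of path components of $\Omega(X,\underline p)$, a group under concatenation. A based morphism $\tilde f:(Y,\underline q)\to(X,\underline p)$ induces $f_\#:\pi_1(Y,\underline q)\to\pi_1(X,\underline p)$ by composition with loops. $X$ is *locally strongly path-connected* if $\widehat U$ is locally path-connected for every $U\in\mathcal U$, and *semilocally 1-connected* if every $p\in X$ lies in some $U\in\mathcal U$ such that $\pi_1(\widehat U,\hat p)\to\pi_1(X,(p,U,\hat p))$ is trivial for every $\hat p\in\pi_U^{-1}(p)$. A *universal covering* of $X$ is an orbispace covering morphism $Y\to X$ with $Y$ connected, locally strongly path-connected and with trivial fundamental group at every base-point structure. **Theorem 4.1.9.** Let $X$ be a connected, locally strongly path-connected, semilocally 1-connected orbispace, and let $\underline p=(p,U_o,\hat p)$ be a base-point structure of $X$. Then for every subgroup $H$ of $\pi_1(X,\underline p)$ there are a connected orbispace $Y$, a base-point structure $\underline q$ of $Y$, and a based orbispace covering morphism $\tilde\pi:(Y,\underline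 q)\to(X,\underline p)$ such that $\pi_\#(\pi_1(Y,\underline q))=H$. In particular, $X$ has a universal covering. -/

import Mathlib

open scoped Pointwise

universe u

/-! ## Orbispaces -/

/-- A locally connected space together with a base of connected open sets (indexed injectively by
`ι`), each of which carries a `G`-structure: a connected, locally connected space `hat i` with a
continuous action of a topological group `G i` and a map `proj i` to the space that induces a
homeomorphism of the orbit space with `U i`. (As `U i` is open and orbit maps are open, the latter
says that `proj i` is continuous, open, has image `U i`, and has the orbits as its fibres.)
The base is closed under passing to connected open subsets. -/
structure ChartedBase where
  carrier : Type u
  [topCarrier : TopologicalSpace carrier]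
  [locConn : LocallyConnectedSpace carrier]
  ι : Type u
  U : ι → Set carrier
  U_injective : Function.Injective U
  isBasis : TopologicalSpace.IsTopologicalBasis (Set.range U)
  U_connected : ∀ i, IsConnected (U i)
  saturated : ∀ (i : ι) (W : Set carrier), IsOpen W → IsConnected W → W ⊆ U i → ∃ j, U j = W
  hat : ι → Type u
  [topHat : ∀ i, TopologicalSpace (hat i)]
  [connHat : ∀ i, ConnectedSpace (hat i)]
  [locConnHat : ∀ i, LocallyConnectedSpace (hat i)]
  G : ι → Type u
  [groupG : ∀ i, Group (G i)]
  [topG : ∀ i, TopologicalSpace (G i)]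
  [topGroupG : ∀ i, IsTopologicalGroup (G i)]
  [action : ∀ i, MulAction (G i) (hat i)]
  [contAction : ∀ i, ContinuousSMul (G i) (hat i)]
  proj : ∀ i, hat i → carrier
  proj_continuous : ∀ i, Continuous (proj i)
  proj_isOpenMap : ∀ i, IsOpenMap (proj i)
  range_proj : ∀ i, Set.range (proj i) = U i
  proj_eq_iff : ∀ (i : ι) (x y : hat i), proj i x = proj i y ↔ ∃ g : G i, g • x = y

attribute [instance] ChartedBase.topCarrier ChartedBase.locConn ChartedBase.topHat
  ChartedBase.connHat ChartedBase.locConnHat ChartedBase.groupG ChartedBase.topG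
  ChartedBase.topGroupG ChartedBase.action ChartedBase.contAction

/-- An orbispace: a charted base with sets of transition maps. A transition map `ξ : Tran i j`
is an abstract element with an underlying isomorphism `(φ ξ, lam ξ)` from an induced `G`-structure
of a connected component of `U i ∩ U j` (a component of its preimage in `hat i`, with the
stabilizer of that component in `G i`) to an induced one in `hat j`. Different elements may have
the same underlying isomorphism.

Since `φ η ∘ φ ξ` may be defined on a disconnected set, the composition of transition maps is
taken at a point `x` where it is defined, and depends only on the component of `x`. -/
structure Orbispace extends ChartedBase.{u} where
  Tran : ι → ι → Type u
  /-- a) transition maps are isomorphisms of induced `G`-structures -/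
  φ : ∀ {i j : ι}, Tran i j → OpenPartialHomeomorph (hat i) (hat j)
  source_nonempty : ∀ {i j : ι} (ξ : Tran i j), (φ ξ).source.Nonempty
  /-- the components of the preimage of `U i ∩ U j` in `hat i` are the components of the preimages
  of the components of `U i ∩ U j` -/
  source_eq : ∀ {i j : ι} (ξ : Tran i j) (x : hat i), x ∈ (φ ξ).source →
    (φ ξ).source = connectedComponentIn (proj i ⁻¹' (U i ∩ U j)) x
  target_eq : ∀ {i j : ι} (ξ : Tran i j) (y : hat j), y ∈ (φ ξ).target →
    (φ ξ).target = connectedComponentIn (proj j ⁻¹' (U i ∩ U j)) y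
  proj_φ : ∀ {i j : ι} (ξ : Tran i j) (x : hat i), x ∈ (φ ξ).source →
    proj j (φ ξ x) = proj i x
  lam : ∀ {i j : ι} (ξ : Tran i j), MulAction.stabilizer (G i) (φ ξ).source ≃ₜ*
    MulAction.stabilizer (G j) (φ ξ).target
  φ_smul : ∀ {i j : ι} (ξ : Tran i j) (g : MulAction.stabilizer (G i) (φ ξ).source) (x : hat i),
    x ∈ (φ ξ).source → φ ξ ((g : G i) • x) = (lam ξ g : G j) • φ ξ x
  tran_nonempty : ∀ i j : ι, (U i ∩ U j).Nonempty → Nonempty (Tran i j)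
  /-- b) `bi h ξ g` is `h ∘ ξ ∘ g` -/
  bi : ∀ {i j : ι}, G j → Tran i j → G i → Tran i j
  bi_one : ∀ {i j : ι} (ξ : Tran i j), bi 1 ξ 1 = ξ
  bi_bi : ∀ {i j : ι} (h h' : G j) (ξ : Tran i j) (g g' : G i),
    bi h' (bi h ξ g) g' = bi (h' * h) ξ (g * g')
  bi_source : ∀ {i j : ι} (h : G j) (ξ : Tran i j) (g : G i) (x : hat i),
    x ∈ (φ (bi h ξ g)).source ↔ g • x ∈ (φ ξ).source
  φ_bi : ∀ {i j : ι} (h : G j) (ξ : Tran i j) (g : G i) (x : hat i), g • x ∈ (φ ξ).source →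
    φ (bi h ξ g) x = h • φ ξ (g • x)
  lam_bi : ∀ {i j : ι} (h : G j) (ξ : Tran i j) (g : G i)
    (k : MulAction.stabilizer (G i) (φ (bi h ξ g)).source)
    (k' : MulAction.stabilizer (G i) (φ ξ).source), (k' : G i) = g * (k : G i) * g⁻¹ →
    (lam (bi h ξ g) k : G j) = h * (lam ξ k' : G j) * h⁻¹
  bi_transitive : ∀ {i j : ι} (ξ η : Tran i j),
    proj i '' (φ ξ).source = proj i '' (φ η).source → ∃ (h : G j) (g : G i), η = bi h ξ g
  bi_eq_iff : ∀ {i j : ι} (h : G j) (ξ : Tran i j) (g : G i),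
    bi h⁻¹ ξ g = ξ ↔ ∃ hg : g ∈ MulAction.stabilizer (G i) (φ ξ).source, (lam ξ ⟨g, hg⟩ : G j) = h
  /-- c) the identity -/
  one : ∀ i : ι, Tran i i
  one_source : ∀ i : ι, (φ (one i)).source = Set.univ
  φ_one : ∀ (i : ι) (x : hat i), φ (one i) x = x
  lam_one : ∀ (i : ι) (g : MulAction.stabilizer (G i) (φ (one i)).source),
    (lam (one i) g : G i) = g
  /-- d) `comp η ξ x` is the composition `η ∘ ξ` at `x`. (Compatibility of composition with `lam`
  is a consequence of the axioms.) -/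
  comp : ∀ {i j k : ι} (η : Tran j k) (ξ : Tran i j) (x : hat i),
    x ∈ (φ ξ).source → φ ξ x ∈ (φ η).source → Tran i k
  comp_mem : ∀ {i j k : ι} (η : Tran j k) (ξ : Tran i j) (x : hat i) (hx : x ∈ (φ ξ).source)
    (hy : φ ξ x ∈ (φ η).source), x ∈ (φ (comp η ξ x hx hy)).source
  φ_comp : ∀ {i j k : ι} (η : Tran j k) (ξ : Tran i j) (x : hat i) (hx : x ∈ (φ ξ).source)
    (hy : φ ξ x ∈ (φ η).source), φ (comp η ξ x hx hy) x = φ η (φ ξ x)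
  comp_const : ∀ {i j k : ι} (η : Tran j k) (ξ : Tran i j) (x x' : hat i)
    (hx : x ∈ (φ ξ).source) (hy : φ ξ x ∈ (φ η).source)
    (hx' : x' ∈ (φ ξ).source) (hy' : φ ξ x' ∈ (φ η).source),
    x' ∈ connectedComponentIn {z | z ∈ (φ ξ).source ∧ φ ξ z ∈ (φ η).source} x →
    comp η ξ x' hx' hy' = comp η ξ x hx hy
  comp_assoc : ∀ {i j k l : ι} (ζ : Tran k l) (η : Tran j k) (ξ : Tran i j) (x : hat i)
    (hx : x ∈ (φ ξ).source) (hy : φ ξ x ∈ (φ η).source) (hz : φ η (φ ξ x) ∈ (φ ζ).source)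
    (hx' : x ∈ (φ (comp η ξ x hx hy)).source) (hy' : φ (comp η ξ x hx hy) x ∈ (φ ζ).source)
    (hz' : φ ξ x ∈ (φ (comp ζ η (φ ξ x) hy hz)).source),
    comp ζ (comp η ξ x hx hy) x hx' hy' = comp (comp ζ η (φ ξ x) hy hz) ξ x hx hz'
  comp_bi_one : ∀ {i j : ι} (ξ : Tran i j) (g : G i) (x : hat i)
    (hx : x ∈ (φ (bi g (one i) 1)).source) (hy : φ (bi g (one i) 1) x ∈ (φ ξ).source),
    comp ξ (bi g (one i) 1) x hx hy = bi 1 ξ g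
  bi_one_comp : ∀ {i j : ι} (h : G j) (ξ : Tran i j) (x : hat i)
    (hx : x ∈ (φ ξ).source) (hy : φ ξ x ∈ (φ (bi h (one j) 1)).source),
    comp (bi h (one j) 1) ξ x hx hy = bi h ξ 1

namespace Orbispace

/-- The topology on a set of transition maps inherited from the topological groups on both sides:
the finest one for which all the maps `(h, g) ↦ h ∘ ξ ∘ g` are continuous. -/
instance tranTopology (X : Orbispace.{u}) (i j : X.ι) : TopologicalSpace (X.Tran i j) :=
  ⨆ ξ : X.Tran i j, TopologicalSpace.coinduced (fun p : X.G j × X.G i => X.bi p.1 ξ p.2)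
    inferInstance

/-- An element of `G i` as a transition map from `U i` to itself. -/
def ofG (X : Orbispace.{u}) (i : X.ι) (g : X.G i) : X.Tran i i := X.bi g (X.one i) 1

/-- The orbispace is connected if its underlying space is. -/
def Connected (X : Orbispace.{u}) : Prop := ConnectedSpace X.carrier

/-- The space in the `G`-structure of every basic open set is locally path-connected. -/
def LocallyStronglyPathConnected (X : Orbispace.{u}) : Prop :=
  ∀ i, LocallyPathConnectedSpace (X.hat i)

/-- The disjoint union of the spaces `hat i`. A point `⟨i, x⟩` of it is the same as a base-point
structure of the orbispace: a point `proj i x`, a basic open set `U i` that contains it, and a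
preimage `x` of the point in `hat i`. -/
abbrev BasePoint (X : Orbispace.{u}) : Type u := (i : X.ι) × X.hat i

/-- The disjoint union of all the sets of transition maps. -/
abbrev Trans (X : Orbispace.{u}) : Type u := (i : X.ι) × (j : X.ι) × X.Tran i j

/-- A transition map together with a point of its domain. -/
structure Arrow (X : Orbispace.{u}) where
  {i : X.ι}
  {j : X.ι}
  tr : X.Tran i j
  pt : X.hat i
  mem : pt ∈ (X.φ tr).source

namespace Arrow

variable {X : Orbispace.{u}}

/-- The point at which the transition map is taken. -/
def source (a : X.Arrow) : X.BasePoint := ⟨a.i, a.pt⟩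

/-- Its image. -/
def target (a : X.Arrow) : X.BasePoint := ⟨a.j, X.φ a.tr a.pt⟩

/-- The transition map alone. -/
def trans (a : X.Arrow) : X.Trans := ⟨a.i, a.j, a.tr⟩

/-- The identity transition map at a point. -/
def id (p : X.BasePoint) : X.Arrow :=
  ⟨X.one p.1, p.2, by rw [X.one_source]; trivial⟩

theorem id_source (p : X.BasePoint) : (Arrow.id p).source = p := rfl

theorem id_target (p : X.BasePoint) : (Arrow.id p).target = p := by
  change (⟨p.1, X.φ (X.one p.1) p.2⟩ : X.BasePoint) = p
  rw [X.φ_one]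

/-- `IsComp b a c` says `c = b ∘ a`, the composition being taken at the source of `a`. -/
inductive IsComp : X.Arrow → X.Arrow → X.Arrow → Prop
  | mk {i j k : X.ι} (η : X.Tran j k) (ξ : X.Tran i j) (x : X.hat i)
      (hx : x ∈ (X.φ ξ).source) (hy : X.φ ξ x ∈ (X.φ η).source) :
      IsComp ⟨η, X.φ ξ x, hy⟩ ⟨ξ, x, hx⟩ ⟨X.comp η ξ x hx hy, x, X.comp_mem η ξ x hx hy⟩

end Arrow

/-! ## Based loops, the loop space, and the fundamental group -/

/-- A based system from the circle `[0,1]/{0 ~ 1}` to `X` with base-point structure `p`: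
a subdivision `0 = t 0 < t 1 < ⋯ < t (n+1) = 1` with `n ≥ 1`, on each `[t k, t (k+1)]`, `k ≤ n`,
a continuous map `c k` into one of the spaces `hat i` (the interval is connected, so a
continuous map to their disjoint union is the same), and transition maps between the successive
pieces that match the ends. The first piece starts, and the last one ends, at `p`.
The values of `t`, `c`, `g` outside these ranges are irrelevant. -/
structure Loop (X : Orbispace.{u}) (p : X.BasePoint) where
  n : ℕ
  one_le : 1 ≤ n
  t : ℕ → ℝ
  t_zero : t 0 = 0
  t_last : t (n + 1) = 1
  t_lt : ∀ k ≤ n, t k < t (k + 1)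
  c : ℕ → ℝ → X.BasePoint
  c_cont : ∀ k ≤ n, ContinuousOn (c k) (Set.Icc (t k) (t (k + 1)))
  g : ℕ → X.Arrow
  g_source : ∀ k < n, (g k).source = c k (t (k + 1))
  g_target : ∀ k < n, (g k).target = c (k + 1) (t (k + 1))
  start : c 0 0 = p
  finish : c n 1 = p

namespace Loop

variable {X : Orbispace.{u}} {p : X.BasePoint}

/-- The domain of the `k`-th piece. -/
def piece (σ : X.Loop p) (k : ℕ) : Set ℝ := Set.Icc (σ.t k) (σ.t (k + 1))

/-- The transition of `σ` at time `s` from the `a`-th to the `b`-th piece, for `b = a` or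
`b = a + 1`. -/
def Step (σ : X.Loop p) (a b : ℕ) (s : ℝ) (r : X.Arrow) : Prop :=
  (b = a ∧ r = Arrow.id (σ.c a s)) ∨ (b = a + 1 ∧ r = σ.g a)

/-- `τ` is a refinement of `σ`: the `k`-th piece of `τ` lies in the `θ k`-th piece of `σ`, and
there are transition maps `j k` (at the points of the path: `J k s`) from the chart of the `k`-th
piece of `τ` to that of the `θ k`-th piece of `σ`, which carry the maps and the transitions of `τ`
to those of `σ`. The transition maps for the first and the last piece are the identity.
Isomorphic systems are those for which `θ` can be the identity. -/
def Refines (τ σ : X.Loop p) : Prop :=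
  ∃ (θ : ℕ → ℕ) (J : ℕ → ℝ → X.Arrow),
    θ 0 = 0 ∧ θ τ.n = σ.n ∧
    (∀ k ≤ τ.n, θ k ≤ σ.n ∧ τ.piece k ⊆ σ.piece (θ k)) ∧
    (∀ k ≤ τ.n, ∃ T : X.Trans, ∀ s ∈ τ.piece k,
      (J k s).trans = T ∧ (J k s).source = τ.c k s ∧ (J k s).target = σ.c (θ k) s) ∧
    (∀ s ∈ τ.piece 0, J 0 s = Arrow.id (τ.c 0 s)) ∧
    (∀ s ∈ τ.piece τ.n, J τ.n s = Arrow.id (τ.c τ.n s)) ∧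
    (∀ k < τ.n, ∃ r d : X.Arrow, σ.Step (θ k) (θ (k + 1)) (τ.t (k + 1)) r ∧
      Arrow.IsComp (J (k + 1) (τ.t (k + 1))) (τ.g k) d ∧
      Arrow.IsComp r (J k (τ.t (k + 1))) d)

/-- The loop with two pieces, cut at time `1/2`, given by a loop in a space `hat i`. -/
noncomputable def ofPath {i : X.ι} {x : X.hat i} (γ : Path x x) : X.Loop ⟨i, x⟩ where
  n := 1
  one_le := le_rfl
  t k := k / 2
  t_zero := by norm_num
  t_last := by norm_num
  t_lt k _ := by push_cast; linarith
  c _ s := ⟨i, γ.extend s⟩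
  c_cont _ _ := (continuous_sigmaMk.comp γ.continuous_extend).continuousOn
  g _ := Arrow.id ⟨i, γ.extend (1 / 2)⟩
  g_source k hk := by
    obtain rfl : k = 0 := by omega
    rw [Arrow.id_source]; norm_num
  g_target k hk := by
    obtain rfl : k = 0 := by omega
    rw [Arrow.id_target]; norm_num
  start := by simp
  finish := by simp

/-- The constant loop. -/
noncomputable def const (p : X.BasePoint) : X.Loop p := ofPath (Path.refl p.2)

/-- The concatenation: first `a`, then `b`, both at double speed; the two middle pieces are joined
by the identity transition map. -/
noncomputable def concat (a b : X.Loop p) : X.Loop p where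
  n := a.n + 1 + b.n
  one_le := by omega
  t k := if k ≤ a.n then a.t k / 2 else (1 + b.t (k - (a.n + 1))) / 2
  t_zero := by simp [a.t_zero]
  t_last := by
    have h : ¬ (a.n + 1 + b.n + 1 ≤ a.n) := by omega
    have h' : a.n + 1 + b.n + 1 - (a.n + 1) = b.n + 1 := by omega
    rw [if_neg h, h', b.t_last]; norm_num
  t_lt k hk := by
    by_cases h : k ≤ a.n
    · rw [if_pos h]
      have := a.t_lt k h
      by_cases h1 : k + 1 ≤ a.n
      · rw [if_pos h1]; linarith
      · obtain rfl : k = a.n := by omega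
        rw [if_neg h1, Nat.sub_self, b.t_zero]
        rw [a.t_last] at this; linarith
    · have h1 : ¬ (k + 1 ≤ a.n) := by omega
      have h2 : k + 1 - (a.n + 1) = k - (a.n + 1) + 1 := by omega
      rw [if_neg h, if_neg h1, h2]
      have := b.t_lt (k - (a.n + 1)) (by omega)
      linarith
  c k s := if k ≤ a.n then a.c k (2 * s) else b.c (k - (a.n + 1)) (2 * s - 1)
  c_cont k hk := by
    by_cases h : k ≤ a.n
    · simp only [if_pos h]
      refine (a.c_cont k h).comp (by fun_prop) fun s hs => ?_
      obtain ⟨hs1, hs2⟩ := hs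
      by_cases h1 : k + 1 ≤ a.n
      · rw [if_pos h1] at hs2
        exact ⟨by linarith, by linarith⟩
      · obtain rfl : k = a.n := by omega
        rw [if_neg h1, Nat.sub_self, b.t_zero] at hs2
        exact ⟨by linarith, by rw [a.t_last]; linarith⟩
    · have h1 : ¬ (k + 1 ≤ a.n) := by omega
      have h2 : k + 1 - (a.n + 1) = k - (a.n + 1) + 1 := by omega
      simp only [if_neg h, if_neg h1, h2]
      refine (b.c_cont (k - (a.n + 1)) (by omega)).comp (by fun_prop) fun s hs => ?_
      obtain ⟨hs1, hs2⟩ := hs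
      exact ⟨by linarith, by linarith⟩
  g k := if k < a.n then a.g k else if k = a.n then Arrow.id p else b.g (k - (a.n + 1))
  g_source k hk := by
    rcases lt_trichotomy k a.n with h | h | h
    · have h1 : k ≤ a.n := h.le
      have h2 : k + 1 ≤ a.n := h
      simp only [if_pos h, if_pos h1, if_pos h2]
      rw [a.g_source k h]; congr 1; ring
    · subst h
      simp [b.t_zero, a.finish, Arrow.id_source]
    · have h0 : ¬ (k < a.n) := by omega
      have h0' : ¬ (k = a.n) := by omega
      have h1 : ¬ (k ≤ a.n) := by omega
      have h2 : ¬ (k + 1 ≤ a.n) := by omega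
      have h3 : k + 1 - (a.n + 1) = k - (a.n + 1) + 1 := by omega
      simp only [if_neg h0, if_neg h0', if_neg h1, if_neg h2, h3]
      rw [b.g_source _ (by omega)]; congr 1; ring
  g_target k hk := by
    rcases lt_trichotomy k a.n with h | h | h
    · have h2 : k + 1 ≤ a.n := h
      simp only [if_pos h, if_pos h2]
      rw [a.g_target k h]; congr 1; ring
    · subst h
      simp [b.t_zero, b.start, Arrow.id_target]
    · have h0 : ¬ (k < a.n) := by omega
      have h0' : ¬ (k = a.n) := by omega
      have h2 : ¬ (k + 1 ≤ a.n) := by omega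
      have h3 : k + 1 - (a.n + 1) = k - (a.n + 1) + 1 := by omega
      simp only [if_neg h0, if_neg h0', if_neg h2, h3]
      rw [b.g_target _ (by omega)]; congr 1; ring
  start := by simp [a.start]
  finish := by
    have h : ¬ (a.n + 1 + b.n ≤ a.n) := by omega
    have h' : a.n + 1 + b.n - (a.n + 1) = b.n := by omega
    rw [if_neg h, h']
    have : (2 * 1 - 1 : ℝ) = 1 := by norm_num
    rw [this, b.finish]

end Loop

/-- The based loop space: based systems from the circle modulo the equivalence relation generated
by refinement. -/
def LoopSpace (X : Orbispace.{u}) (p : X.BasePoint) : Type u :=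
  Quot (Loop.Refines (X := X) (p := p))

/-- The basic sets of the compact-open topology: the classes of all the systems `τ` with the same
subdivision and the same charts as `σ`, whose `k`-th map sends the compact set `K k` into the open
set `V k` and whose `k`-th transition map lies in the open set `A k`. -/
def loopNhd {X : Orbispace.{u}} {p : X.BasePoint} (σ : X.Loop p) (K : ℕ → Set ℝ)
    (V : ℕ → Set X.BasePoint) (A : ℕ → Set X.Trans) : Set (X.LoopSpace p) :=
  {γ | ∃ τ : X.Loop p, Quot.mk _ τ = γ ∧ τ.n = σ.n ∧ (∀ k ≤ σ.n + 1, τ.t k = σ.t k) ∧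
    (∀ k ≤ σ.n, ∀ s ∈ σ.piece k, (τ.c k s).1 = (σ.c k s).1) ∧
    (∀ k ≤ σ.n, Set.MapsTo (τ.c k) (K k) (V k)) ∧ (∀ k < σ.n, (τ.g k).trans ∈ A k)}

/-- The compact-open topology on the based loop space. -/
instance loopSpaceTopology (X : Orbispace.{u}) (p : X.BasePoint) :
    TopologicalSpace (X.LoopSpace p) :=
  TopologicalSpace.generateFrom {O | ∃ (σ : X.Loop p) (K : ℕ → Set ℝ)
    (V : ℕ → Set X.BasePoint) (A : ℕ → Set X.Trans),
    (∀ k ≤ σ.n, IsCompact (K k) ∧ K k ⊆ σ.piece k ∧ IsOpen (V k) ∧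
      Set.MapsTo (σ.c k) (K k) (V k)) ∧
    (∀ k < σ.n, IsOpen (A k) ∧ (σ.g k).trans ∈ A k) ∧ O = loopNhd σ K V A}

/-- The underlying set of the fundamental group: the path components of the based loop space. -/
def Pi1 (X : Orbispace.{u}) (p : X.BasePoint) : Type u := ZerothHomotopy (X.LoopSpace p)

/-- The class of a loop in the fundamental group. The product of two classes is the class of the
concatenation, the neutral element is the class of the constant loop. -/
def Loop.cls {X : Orbispace.{u}} {p : X.BasePoint} (σ : X.Loop p) : X.Pi1 p :=
  Quotient.mk (pathSetoid (X.LoopSpace p)) (Quot.mk _ σ)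

/-- `H` is a subgroup of the fundamental group: it contains the neutral element, and it is closed
under products and inverses. -/
structure IsSubgroupPi1 (X : Orbispace.{u}) (p : X.BasePoint) (H : Set (X.Pi1 p)) : Prop where
  one_mem : (Loop.const p).cls ∈ H
  mul_mem : ∀ a b : X.Loop p, a.cls ∈ H → b.cls ∈ H → (a.concat b).cls ∈ H
  inv_mem : ∀ a b : X.Loop p, a.cls ∈ H → (a.concat b).cls = (Loop.const p).cls → b.cls ∈ H

/-- Every point `x` lies in a basic open set `U i` such that for every preimage `y` of `x` in
`hat i` the homomorphism from the fundamental group of `hat i` at `y` to that of `X` at the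
base-point structure `⟨i, y⟩` is trivial. -/
def SemilocallyOneConnected (X : Orbispace.{u}) : Prop :=
  ∀ x : X.carrier, ∃ i : X.ι, x ∈ X.U i ∧ ∀ y : X.hat i, X.proj i y = x →
    ∀ γ : Path y y, (Loop.ofPath γ).cls = (Loop.const (⟨i, y⟩ : X.BasePoint)).cls

/-! ## Morphisms -/

/-- A system of local equivariant maps from `Y` to `X`: basic open sets `V α` that cover `Y`, basic
open sets `W α` of `X`, continuous maps `f α` and continuous maps `ρ` between the sets of
transition maps, compatible with the action of transition maps and with their composition.
The induced continuous map `top` of the underlying spaces is determined by the other data. -/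
structure Sys (Y X : Orbispace.{u}) where
  Λ : Type u
  V : Λ → Y.ι
  W : Λ → X.ι
  cover : ∀ y : Y.carrier, ∃ α, y ∈ Y.U (V α)
  f : ∀ α, Y.hat (V α) → X.hat (W α)
  f_cont : ∀ α, Continuous (f α)
  ρ : ∀ {α β : Λ}, Y.Tran (V α) (V β) → X.Tran (W α) (W β)
  ρ_cont : ∀ α β : Λ, Continuous (ρ : Y.Tran (V α) (V β) → X.Tran (W α) (W β))
  map_mem : ∀ {α β : Λ} (a : Y.Tran (V α) (V β)) (x : Y.hat (V α)), x ∈ (Y.φ a).source →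
    f α x ∈ (X.φ (ρ a)).source
  map_φ : ∀ {α β : Λ} (a : Y.Tran (V α) (V β)) (x : Y.hat (V α)), x ∈ (Y.φ a).source →
    f β (Y.φ a x) = X.φ (ρ a) (f α x)
  map_comp : ∀ {α β γ : Λ} (b : Y.Tran (V β) (V γ)) (a : Y.Tran (V α) (V β))
    (x : Y.hat (V α)) (hx : x ∈ (Y.φ a).source) (hy : Y.φ a x ∈ (Y.φ b).source)
    (hx' : f α x ∈ (X.φ (ρ a)).source) (hy' : X.φ (ρ a) (f α x) ∈ (X.φ (ρ b)).source),
    ρ (Y.comp b a x hx hy) = X.comp (ρ b) (ρ a) (f α x) hx' hy'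
  top : Y.carrier → X.carrier
  top_cont : Continuous top
  top_proj : ∀ (α : Λ) (x : Y.hat (V α)), top (Y.proj (V α) x) = X.proj (W α) (f α x)

namespace Sys

variable {Y X : Orbispace.{u}}

/-- The system `κ` is induced by `σ` through the index map `θ`, the injections `j α` and the
transition maps `j' α`: `f_κ = j'⁻¹ ∘ f_σ ∘ j` and `ρ_κ(a) = j'⁻¹ ∘ ρ_σ(j ∘ a ∘ j⁻¹) ∘ j'`.
Isomorphic systems are those for which `θ` and the `j α` can be identities. -/
def RefinesVia (κ σ : Sys Y X) (θ : κ.Λ → σ.Λ) (j : ∀ α, Y.Tran (κ.V α) (σ.V (θ α)))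
    (j' : ∀ α, X.Tran (κ.W α) (σ.W (θ α))) : Prop :=
  (∀ α, Y.U (κ.V α) ⊆ Y.U (σ.V (θ α))) ∧
  (∀ α (x : Y.hat (κ.V α)), κ.f α x ∈ (X.φ (j' α)).source ∧
    X.φ (j' α) (κ.f α x) = σ.f (θ α) (Y.φ (j α) x)) ∧
  (∀ α β (a : Y.Tran (κ.V α) (κ.V β)) (x : Y.hat (κ.V α)) (_ : x ∈ (Y.φ a).source),
    ∃ (b : Y.Tran (σ.V (θ α)) (σ.V (θ β)))
      (h₁ : x ∈ (Y.φ (j α)).source) (h₂ : Y.φ (j α) x ∈ (Y.φ b).source)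
      (h₃ : x ∈ (Y.φ a).source) (h₄ : Y.φ a x ∈ (Y.φ (j β)).source)
      (k₁ : κ.f α x ∈ (X.φ (j' α)).source)
      (k₂ : X.φ (j' α) (κ.f α x) ∈ (X.φ (σ.ρ b)).source)
      (k₃ : κ.f α x ∈ (X.φ (κ.ρ a)).source)
      (k₄ : X.φ (κ.ρ a) (κ.f α x) ∈ (X.φ (j' β)).source),
      Y.comp b (j α) x h₁ h₂ = Y.comp (j β) a x h₃ h₄ ∧
      X.comp (σ.ρ b) (j' α) (κ.f α x) k₁ k₂ = X.comp (j' β) (κ.ρ a) (κ.f α x) k₃ k₄)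

/-- `κ` is a refinement of `σ`. -/
def Refines (κ σ : Sys Y X) : Prop := ∃ θ j j', RefinesVia κ σ θ j j'

/-- Two systems are directly equivalent if they have a common refinement. -/
def DirectEquiv (σ τ : Sys Y X) : Prop := ∃ κ : Sys Y X, κ.Refines σ ∧ κ.Refines τ

/-- The conditions on a system to exhibit an orbispace covering: every connected component of the
preimage of a `W α` is one of the `V β`, with `W β = W α`; every group homomorphism
`G (V α) → G (W α)` is injective and its image contains `g h⁻¹` whenever `g` and `h` are joined by
a path; every `f α` is a homeomorphism; the map of the underlying spaces is surjective. -/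
structure IsCovering (σ : Sys Y X) : Prop where
  component : ∀ (α : σ.Λ) (y : Y.carrier), σ.top y ∈ X.U (σ.W α) →
    ∃ β : σ.Λ, Y.U (σ.V β) = connectedComponentIn (σ.top ⁻¹' X.U (σ.W α)) y ∧ σ.W β = σ.W α
  injective : ∀ α : σ.Λ, Function.Injective fun k : Y.G (σ.V α) => σ.ρ (Y.ofG (σ.V α) k)
  joined : ∀ (α : σ.Λ) (g h : X.G (σ.W α)), Joined g h →
    ∃ k : Y.G (σ.V α), σ.ρ (Y.ofG (σ.V α) k) = X.ofG (σ.W α) (g * h⁻¹)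
  homeo : ∀ α : σ.Λ, IsHomeomorph (σ.f α)
  surjective : Function.Surjective σ.top

end Sys

/-- A morphism of orbispaces: a class of systems modulo direct equivalence. -/
def Mor (Y X : Orbispace.{u}) : Type (u + 1) := Quot (Sys.DirectEquiv (Y := Y) (X := X))

/-- An orbispace covering morphism: one of the representing systems satisfies the conditions. -/
def Mor.IsCovering {Y X : Orbispace.{u}} (m : Mor Y X) : Prop :=
  ∃ σ : Sys Y X, Quot.mk _ σ = m ∧ σ.IsCovering

/-- A universal covering: a covering morphism from a connected, locally strongly path-connected
orbispace with trivial fundamental group. -/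
def Mor.IsUniversalCovering {Y X : Orbispace.{u}} (m : Mor Y X) : Prop :=
  m.IsCovering ∧ Y.Connected ∧ Y.LocallyStronglyPathConnected ∧
    ∀ q : Y.BasePoint, ∀ γ : Y.Loop q, γ.cls = (Loop.const q).cls

/-- A based system from `(Y, q)` to `(X, p)`: a system with a distinguished index `o` for which
`V o` and `W o` are the basic open sets of the base-point structures, and `f o` maps the one lifted
base point to the other. -/
structure BasedSys (Y : Orbispace.{u}) (q : Y.BasePoint) (X : Orbispace.{u}) (p : X.BasePoint)
    extends Sys Y X where
  o : Λ
  base : ∃ x : Y.hat (V o), (⟨V o, x⟩ : Y.BasePoint) = q ∧ (⟨W o, f o x⟩ : X.BasePoint) = p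

namespace BasedSys

variable {Y : Orbispace.{u}} {q : Y.BasePoint} {X : Orbispace.{u}} {p : X.BasePoint}

/-- Refinement of based systems: the base index is preserved, with identity transition maps. -/
def Refines (κ σ : BasedSys Y q X p) : Prop :=
  ∃ θ j j', Sys.RefinesVia κ.toSys σ.toSys θ j j' ∧ θ κ.o = σ.o ∧
    (∃ i, (⟨_, _, j κ.o⟩ : Y.Trans) = ⟨i, i, Y.one i⟩) ∧
    (∃ i, (⟨_, _, j' κ.o⟩ : X.Trans) = ⟨i, i, X.one i⟩)

/-- Two based systems are directly equivalent if they have a common based refinement. -/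
def DirectEquiv (σ τ : BasedSys Y q X p) : Prop :=
  ∃ κ : BasedSys Y q X p, κ.Refines σ ∧ κ.Refines τ

/-- The loop `δ` in `X` is the composition of the loop `γ` in `Y` with the based system `s`: the
`k`-th piece of `γ` lies in the chart `V (α k)`, and the pieces and transition maps of `δ` are the
images of those of `γ` under `f` and `ρ`; the first and the last index are the base index. -/
def Push (s : BasedSys Y q X p) (γ : Y.Loop q) (δ : X.Loop p) : Prop :=
  γ.n = δ.n ∧ (∀ k ≤ γ.n + 1, γ.t k = δ.t k) ∧
  ∃ α : ℕ → s.Λ, α 0 = s.o ∧ α γ.n = s.o ∧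
    (∀ k ≤ γ.n, ∀ r ∈ γ.piece k, ∃ x : Y.hat (s.V (α k)),
      γ.c k r = ⟨s.V (α k), x⟩ ∧ δ.c k r = ⟨s.W (α k), s.f (α k) x⟩) ∧
    (∀ k < γ.n, ∃ ξ : Y.Tran (s.V (α k)) (s.V (α (k + 1))),
      (γ.g k).trans = ⟨_, _, ξ⟩ ∧ (δ.g k).trans = ⟨_, _, s.ρ ξ⟩)

end BasedSys

/-- A based morphism: a class of based systems modulo direct equivalence. -/
def BasedMor (Y : Orbispace.{u}) (q : Y.BasePoint) (X : Orbispace.{u}) (p : X.BasePoint) :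
    Type (u + 1) :=
  Quot (BasedSys.DirectEquiv (Y := Y) (q := q) (X := X) (p := p))

namespace BasedMor

variable {Y : Orbispace.{u}} {q : Y.BasePoint} {X : Orbispace.{u}} {p : X.BasePoint}

/-- The underlying morphism of a based morphism. -/
def toMor (m : BasedMor Y q X p) : Mor Y X :=
  Quot.map BasedSys.toSys
    (fun _ _ ⟨κ, ⟨θ, j, j', h, _⟩, ⟨θ₂, j₂, j'₂, h₂, _⟩⟩ =>
      ⟨κ.toSys, ⟨θ, j, j', h⟩, ⟨θ₂, j₂, j'₂, h₂⟩⟩) m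

/-- The graph of the homomorphism of fundamental groups induced by a based morphism: the class of
a loop `γ` is sent to the class of the composition of `γ` with the morphism. -/
def InducedPi1 (m : BasedMor Y q X p) (a : Y.Pi1 q) (b : X.Pi1 p) : Prop :=
  ∃ (s : BasedSys Y q X p) (γ : Y.Loop q) (δ : X.Loop p),
    Quot.mk _ s = m ∧ s.Push γ δ ∧ γ.cls = a ∧ δ.cls = b

/-- The image of the induced homomorphism of fundamental groups. -/
def imagePi1 (m : BasedMor Y q X p) : Set (X.Pi1 p) := {b | ∃ a, m.InducedPi1 a b}

end BasedMor

end Orbispace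

namespace Orbispace

noncomputable section

open CategoryTheory Category Topology Filter Set
open MulAction (stabilizer)

variable {X Y : Orbispace.{u}}

section

variable {i j k : X.ι} {b b' : X.BasePoint} {S : Type*} {l : Filter S} {x x' : X.hat i} {ξ : X.Tran i j}

/-! ### Algebra of transition maps -/

lemma comp_congr {η η' : X.Tran j k} {ξ' : X.Tran i j} (h₁ : η = η') (h₂ : ξ = ξ') (h₃ : x = x')
    (hx : x ∈ (X.φ ξ).source) (hy : X.φ ξ x ∈ (X.φ η).source) :
    X.comp η ξ x hx hy = X.comp η' ξ' x' (h₃ ▸ h₂ ▸ hx) (h₃ ▸ h₂ ▸ h₁ ▸ hy) := by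
  subst h₁ h₂ h₃; rfl

lemma mem_one (i : X.ι) (x : X.hat i) : x ∈ (X.φ (X.one i)).source := by
  rw [X.one_source]; trivial

lemma φ_ofG (g : X.G i) (x : X.hat i) : X.φ (X.ofG i g) x = g • x := by
  rw [ofG, X.φ_bi _ _ _ _ (mem_one _ _), X.φ_one, one_smul]

lemma mem_ofG (g : X.G i) (x : X.hat i) : x ∈ (X.φ (X.ofG i g)).source := by
  rw [ofG, X.bi_source]; exact mem_one _ _

lemma ofG_one (i : X.ι) : X.ofG i 1 = X.one i := X.bi_one _

lemma comp_one (ξ : X.Tran i j) (x : X.hat i) (hx) (hy) : X.comp ξ (X.one i) x hx hy = ξ := by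
  rw [comp_congr rfl (ofG_one i).symm rfl]
  exact (X.comp_bi_one _ _ _ _ _).trans (X.bi_one _)

lemma one_comp (ξ : X.Tran i j) (x : X.hat i) (hx) (hy) : X.comp (X.one j) ξ x hx hy = ξ := by
  rw [comp_congr (ofG_one j).symm rfl rfl]
  exact (X.bi_one_comp _ _ _ _ _).trans (X.bi_one _)

lemma source_self (ξ : X.Tran i i) : (X.φ ξ).source = univ := by
  obtain ⟨x, hx⟩ := X.source_nonempty ξ
  have h : X.proj i ⁻¹' (X.U i ∩ X.U i) = univ := by
    rw [inter_self, ← X.range_proj]; exact preimage_range _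
  rw [X.source_eq ξ x hx, h, connectedComponentIn_univ, PreconnectedSpace.connectedComponent_eq_univ]

lemma bi_lam (ξ : X.Tran i j) (g : stabilizer (X.G i) (X.φ ξ).source) :
    X.bi 1 ξ g = X.bi (X.lam ξ g : X.G j) ξ 1 := by
  have h := (X.bi_eq_iff (X.lam ξ g : X.G j) ξ g).2 ⟨g.2, rfl⟩
  have h2 := congrArg (fun η => X.bi (X.lam ξ g : X.G j) η 1) h
  simpa [X.bi_bi] using h2

lemma exists_ofG (ξ : X.Tran i i) : ∃ g, ξ = X.ofG i g := by
  obtain ⟨h, g, rfl⟩ := X.bi_transitive (X.one i) ξ (by rw [source_self, source_self])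
  refine ⟨h * g, ?_⟩
  have hg : g ∈ stabilizer (X.G i) (X.φ (X.one i)).source := by rw [X.one_source]; simp
  have := bi_lam (X.one i) ⟨g, hg⟩
  rw [X.lam_one] at this
  have h2 := X.bi_bi 1 h (X.one i) g 1
  rw [show X.bi 1 (X.one i) g = X.bi g (X.one i) 1 from this, X.bi_bi] at h2
  simpa [ofG] using h2.symm

lemma bi_left_inj (ξ : X.Tran i j) {g h : X.G j} : X.bi g ξ 1 = X.bi h ξ 1 ↔ g = h := by
  refine ⟨fun e => ?_, fun e => by rw [e]⟩
  have h1 : X.bi (g⁻¹ * h)⁻¹ ξ 1 = ξ := by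
    have := X.bi_bi g h⁻¹ ξ 1 1
    rw [e, X.bi_bi] at this
    simpa [X.bi_one] using this.symm
  obtain ⟨hg, h2⟩ := (X.bi_eq_iff _ _ _).1 h1
  have h3 : (⟨1, hg⟩ : stabilizer (X.G i) (X.φ ξ).source) = 1 := rfl
  rw [h3, map_one] at h2
  exact inv_mul_eq_one.1 (by simpa using h2.symm)

lemma ofG_injective (i : X.ι) : Function.Injective (X.ofG i) := fun _ _ h => (bi_left_inj _).1 h

/-- Transition maps that carry one lifted point to another. -/
def Hom (b b' : X.BasePoint) : Type u :=
  {ξ : X.Tran b.1 b'.1 // b.2 ∈ (X.φ ξ).source ∧ X.φ ξ b.2 = b'.2}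

lemma ofG_comp (h : X.G j) (ξ : X.Tran i j) (x : X.hat i) (hx) (hy) :
    X.comp (X.ofG j h) ξ x hx hy = X.bi h ξ 1 := X.bi_one_comp h ξ x hx hy

lemma comp_ofG (ξ : X.Tran i j) (g : X.G i) (x : X.hat i) (hx) (hy) :
    X.comp ξ (X.ofG i g) x hx hy = X.bi 1 ξ g := X.comp_bi_one ξ g x hx hy

instance : Category X.BasePoint where
  Hom := Hom
  id b := ⟨X.one b.1, mem_one _ _, X.φ_one _ _⟩
  comp {a b c} f g := ⟨X.comp g.1 f.1 a.2 f.2.1 (by rw [f.2.2]; exact g.2.1), X.comp_mem _ _ _ _ _, by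
    rw [X.φ_comp, f.2.2, g.2.2]⟩
  id_comp f := Subtype.ext (comp_one _ _ _ _)
  comp_id f := Subtype.ext (one_comp _ _ _ _)
  assoc {a b c d} f g h := by
    refine Subtype.ext ?_
    have hg : X.φ f.1 a.2 ∈ (X.φ g.1).source := by rw [f.2.2]; exact g.2.1
    have hh : X.φ g.1 (X.φ f.1 a.2) ∈ (X.φ h.1).source := by rw [f.2.2, g.2.2]; exact h.2.1
    change X.comp h.1 (X.comp g.1 f.1 a.2 _ _) a.2 _ _ = X.comp (X.comp h.1 g.1 b.2 _ _) f.1 a.2 _ _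
    rw [X.comp_assoc h.1 g.1 f.1 a.2 f.2.1 hg hh _ _ (X.comp_mem _ _ _ _ _)]
    grind

lemma comp_val {a c : X.BasePoint} (f : a ⟶ b) (g : b ⟶ c) :
    (f ≫ g).1 = X.comp g.1 f.1 a.2 f.2.1 (by rw [f.2.2]; exact g.2.1) := rfl

/-- The element of `b ⟶ b'` given by a transition map. -/
def homMk (ξ : X.Tran i j) (x : X.hat i) (hx : x ∈ (X.φ ξ).source) :
    (⟨i, x⟩ : X.BasePoint) ⟶ ⟨j, X.φ ξ x⟩ := ⟨ξ, hx, rfl⟩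

lemma Hom.proj_eq (f : b ⟶ b') : X.proj b.1 b.2 = X.proj b'.1 b'.2 := by
  rw [← f.2.2, X.proj_φ _ _ f.2.1]

lemma proj_mem (x : X.hat i) : X.proj i x ∈ X.U i := by
  rw [← X.range_proj]; exact mem_range_self _

lemma exists_smul {y : X.hat i} (h : X.proj i x = X.proj i y) :
    ∃ g : X.G i, g • x = y := (X.proj_eq_iff i x y).1 h

lemma proj_smul (g : X.G i) (x : X.hat i) : X.proj i (g • x) = X.proj i x :=
  ((X.proj_eq_iff i x (g • x)).2 ⟨g, rfl⟩).symm

lemma exists_proj {x : X.carrier} (h : x ∈ X.U i) : ∃ y, X.proj i y = x := by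
  rwa [← X.range_proj] at h

lemma target_of_subset (ξ : X.Tran i j) (h : X.U j ⊆ X.U i) : (X.φ ξ).target = univ := by
  obtain ⟨x, hx⟩ := X.source_nonempty ξ
  rw [X.target_eq ξ _ ((X.φ ξ).map_source hx), inter_eq_self_of_subset_right h]
  have : X.proj j ⁻¹' X.U j = univ := by rw [← X.range_proj]; exact preimage_range _
  rw [this, connectedComponentIn_univ, PreconnectedSpace.connectedComponent_eq_univ]

lemma source_of_subset (ξ : X.Tran i j) (h : X.U i ⊆ X.U j) : (X.φ ξ).source = univ := by
  obtain ⟨x, hx⟩ := X.source_nonempty ξ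
  rw [X.source_eq ξ _ hx, inter_eq_self_of_subset_left h]
  have : X.proj i ⁻¹' X.U i = univ := by rw [← X.range_proj]; exact preimage_range _
  rw [this, connectedComponentIn_univ, PreconnectedSpace.connectedComponent_eq_univ]

lemma isOpen_U (i : X.ι) : IsOpen (X.U i) := X.isBasis.isOpen ⟨i, rfl⟩

lemma exists_U_subset {x : X.carrier} {O : Set X.carrier} (hO : IsOpen O) (hx : x ∈ O) :
    ∃ k, x ∈ X.U k ∧ X.U k ⊆ O := by
  obtain ⟨_, ⟨k, rfl⟩, h1, h2⟩ := X.isBasis.exists_subset_of_mem_open hx hO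
  exact ⟨k, h1, h2⟩

lemma hom_of_subset (h : X.proj b.1 b.2 = X.proj b'.1 b'.2) (hU : X.U b.1 ⊆ X.U b'.1) :
    Nonempty (b ⟶ b') := by
  obtain ⟨ξ⟩ := X.tran_nonempty b.1 b'.1 ⟨_, proj_mem b.2, hU (proj_mem b.2)⟩
  have hb : b.2 ∈ (X.φ ξ).source := by rw [source_of_subset ξ hU]; trivial
  obtain ⟨g, hg⟩ := exists_smul (X := X) (i := b'.1) (x := X.φ ξ b.2) (y := b'.2)
    (by rw [X.proj_φ _ _ hb, h])
  exact ⟨⟨X.bi g ξ 1, by rw [X.bi_source]; simpa using hb, by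
    rw [X.φ_bi _ _ _ _ (by simpa using hb)]; simpa using hg⟩⟩

lemma hom_of_superset (h : X.proj b.1 b.2 = X.proj b'.1 b'.2) (hU : X.U b'.1 ⊆ X.U b.1) :
    Nonempty (b ⟶ b') := by
  obtain ⟨ξ⟩ := X.tran_nonempty b.1 b'.1 ⟨_, hU (proj_mem b'.2), proj_mem b'.2⟩
  have hb : b'.2 ∈ (X.φ ξ).target := by rw [target_of_subset ξ hU]; trivial
  have hs := (X.φ ξ).map_target hb
  have hp := X.proj_φ ξ _ hs
  rw [(X.φ ξ).right_inv hb] at hp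
  obtain ⟨g, hg⟩ := exists_smul (X := X) (i := b.1) (x := b.2) (y := (X.φ ξ).symm b'.2)
    (by rw [h, hp])
  have hm : g • b.2 ∈ (X.φ ξ).source := by rwa [hg]
  exact ⟨⟨X.bi 1 ξ g, by rwa [X.bi_source], by
    rw [X.φ_bi _ _ _ _ hm, hg, (X.φ ξ).right_inv hb, one_smul]⟩⟩

lemma exists_hom (h : X.proj b.1 b.2 = X.proj b'.1 b'.2) : Nonempty (b ⟶ b') := by
  obtain ⟨k, hk, hkU⟩ := exists_U_subset ((isOpen_U b.1).inter (isOpen_U b'.1))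
    ⟨proj_mem b.2, h ▸ proj_mem b'.2⟩
  obtain ⟨z, hz⟩ := exists_proj hk
  obtain ⟨f⟩ := hom_of_superset (b := b) (b' := ⟨k, z⟩) hz.symm (hkU.trans inter_subset_left)
  obtain ⟨g⟩ := hom_of_subset (b := ⟨k, z⟩) (b' := b') (hz.trans h) (hkU.trans inter_subset_right)
  exact ⟨f ≫ g⟩

/-- Group elements as automorphisms. -/
def homG (g : X.G i) (x : X.hat i) : (⟨i, x⟩ : X.BasePoint) ⟶ ⟨i, g • x⟩ :=
  ⟨X.ofG i g, mem_ofG _ _, φ_ofG _ _⟩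

lemma exists_rightInv (f : b ⟶ b') : ∃ g : b' ⟶ b, f ≫ g = 𝟙 b := by
  obtain ⟨η⟩ := exists_hom (X := X) (b := b') (b' := b) (Hom.proj_eq f).symm
  obtain ⟨g, hg⟩ := exists_ofG (f ≫ η).1
  have hgb : g • b.2 = b.2 := by rw [← φ_ofG, ← hg]; exact (f ≫ η).2.2
  have hgb' : g⁻¹ • b.2 = b.2 := by rw [inv_smul_eq_iff, hgb]
  let γ : b ⟶ b := ⟨X.ofG b.1 g⁻¹, mem_ofG _ _, by rw [φ_ofG, hgb']⟩
  refine ⟨η ≫ γ, ?_⟩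
  rw [← assoc]
  refine Subtype.ext ?_
  rw [comp_val, comp_congr rfl hg rfl]
  change X.comp (X.ofG b.1 g⁻¹) _ _ _ _ = X.one _
  rw [ofG_comp, ofG, X.bi_bi]
  simp [X.bi_one]

instance : Groupoid X.BasePoint where
  inv f := (exists_rightInv f).choose
  comp_inv f := (exists_rightInv f).choose_spec
  inv_comp {b b'} f := by
    have h1 := (exists_rightInv f).choose_spec
    obtain ⟨h, h2⟩ := exists_rightInv (exists_rightInv f).choose
    have : f = h := by rw [← comp_id f, ← h2, ← assoc, h1, id_comp]
    rw [← this] at h2; exact h2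

/-! ### Constancy of compositions -/

lemma isPreconnected_source (ξ : X.Tran i j) : IsPreconnected (X.φ ξ).source := by
  obtain ⟨x, hx⟩ := X.source_nonempty ξ
  rw [X.source_eq ξ x hx]; exact isPreconnected_connectedComponentIn

lemma comp_eq_of_isPreconnected (η : X.Tran j k) (ξ : X.Tran i j) {s : Set (X.hat i)}
    (hs : IsPreconnected s) (hsub : ∀ z ∈ s, z ∈ (X.φ ξ).source ∧ X.φ ξ z ∈ (X.φ η).source)
    (hx : x ∈ s) (hx' : x' ∈ s) (h₁) (h₂) (h₃) (h₄) : X.comp η ξ x' h₃ h₄ = X.comp η ξ x h₁ h₂ :=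
  X.comp_const η ξ x x' h₁ h₂ h₃ h₄ (hs.subset_connectedComponentIn hx hsub hx')

lemma exists_inv (ξ : X.Tran i j) : ∃ η : X.Tran j i,
    (X.φ η).source = (X.φ ξ).target ∧ ∀ x (hx : x ∈ (X.φ ξ).source),
      X.φ η (X.φ ξ x) = x ∧ ∀ hy, X.comp η ξ x hx hy = X.one i := by
  obtain ⟨x, hx⟩ := X.source_nonempty ξ
  let f := homMk ξ x hx
  let η := Groupoid.inv f
  have hη : X.comp η.1 ξ x hx η.2.1 = X.one i := congrArg Subtype.val (Groupoid.comp_inv f)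
  have hs : (X.φ η.1).source = (X.φ ξ).target := by
    rw [X.source_eq η.1 _ η.2.1, X.target_eq ξ _ ((X.φ ξ).map_source hx), inter_comm]
  have key : ∀ y (hy : y ∈ (X.φ ξ).source) (hy'), X.comp η.1 ξ y hy hy' = X.one i := by
    intro y hy hy'
    rw [← hη]
    exact comp_eq_of_isPreconnected _ _ (isPreconnected_source ξ)
      (fun z hz => ⟨hz, by rw [hs]; exact (X.φ ξ).map_source hz⟩) hx hy _ _ _ _
  refine ⟨η.1, hs, fun y hy => ⟨?_, key y hy⟩⟩
  have hy' : X.φ ξ y ∈ (X.φ η.1).source := by rw [hs]; exact (X.φ ξ).map_source hy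
  rw [← X.φ_comp η.1 ξ y hy hy', key y hy hy', X.φ_one]

/-- The inverse of a transition map. -/
def inv (ξ : X.Tran i j) : X.Tran j i := (exists_inv ξ).choose

lemma inv_source (ξ : X.Tran i j) : (X.φ (inv ξ)).source = (X.φ ξ).target :=
  (exists_inv ξ).choose_spec.1

lemma φ_mem_inv (hx : x ∈ (X.φ ξ).source) : X.φ ξ x ∈ (X.φ (inv ξ)).source := by
  rw [inv_source]; exact (X.φ ξ).map_source hx

lemma φ_inv_φ (hx : x ∈ (X.φ ξ).source) :
    X.φ (inv ξ) (X.φ ξ x) = x := ((exists_inv ξ).choose_spec.2 x hx).1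

lemma inv_comp (ξ : X.Tran i j) (x : X.hat i) (hx : x ∈ (X.φ ξ).source) (hy) :
    X.comp (inv ξ) ξ x hx hy = X.one i := ((exists_inv ξ).choose_spec.2 x hx).2 hy

@[elab_as_elim]
lemma Hom.rec_homMk {motive : ∀ b b' : X.BasePoint, (b ⟶ b') → Prop}
    (h : ∀ (i j : X.ι) (ξ : X.Tran i j) (x : X.hat i) (hx : x ∈ (X.φ ξ).source),
      motive ⟨i, x⟩ ⟨j, X.φ ξ x⟩ (homMk ξ x hx)) (b b' : X.BasePoint) (f : b ⟶ b') :
    motive b b' f := by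
  obtain ⟨i, x⟩ := b
  obtain ⟨j, y⟩ := b'
  have key : ∀ (ξ : X.Tran i j) (hx : x ∈ (X.φ ξ).source) (y : X.hat j) (e : X.φ ξ x = y),
      motive ⟨i, x⟩ ⟨j, y⟩ ⟨ξ, hx, e⟩ := by
    rintro ξ hx _ rfl
    exact h i j ξ x hx
  exact key f.1 f.2.1 y f.2.2

lemma Hom.inv_val (f : b ⟶ b') : (Groupoid.inv f).1 = Orbispace.inv f.1 := by
  refine Hom.rec_homMk (fun i j ξ x hx => ?_) b b' f
  let f : (⟨i, x⟩ : X.BasePoint) ⟶ ⟨j, X.φ ξ x⟩ := ⟨ξ, hx, rfl⟩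
  let g : (⟨j, X.φ ξ x⟩ : X.BasePoint) ⟶ ⟨i, x⟩ := ⟨Orbispace.inv ξ, φ_mem_inv hx, φ_inv_φ hx⟩
  change (Groupoid.inv f).1 = g.1
  have : Groupoid.inv f = g := by
    have h : f ≫ g = 𝟙 _ := Subtype.ext (inv_comp ξ x hx _)
    rw [← comp_id (Groupoid.inv f), ← id_comp g, ← Groupoid.inv_comp f,
      assoc, h]
  rw [this]

/-! ### The topology on transition maps -/

lemma continuous_bi (ξ : X.Tran i j) : Continuous fun p : X.G j × X.G i => X.bi p.1 ξ p.2 := by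
  rw [continuous_iff_coinduced_le]
  exact le_iSup (fun ξ : X.Tran i j => TopologicalSpace.coinduced
    (fun p : X.G j × X.G i => X.bi p.1 ξ p.2) inferInstance) ξ

lemma continuous_bi_left (ξ : X.Tran i j) : Continuous fun g : X.G j => X.bi g ξ 1 :=
  (continuous_bi ξ).comp (by fun_prop : Continuous fun g : X.G j => (g, (1 : X.G i)))

lemma isOpen_tran {A : Set (X.Tran i j)} :
    IsOpen A ↔ ∀ ξ, IsOpen ((fun p : X.G j × X.G i => X.bi p.1 ξ p.2) ⁻¹' A) := by
  rw [show IsOpen A = IsOpen[X.tranTopology i j] A from rfl]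
  rw [tranTopology, isOpen_iSup_iff]
  simp only [isOpen_coinduced]

lemma mem_stabilizer_source (ξ : X.Tran i j) {g : X.G i} (hx : x ∈ (X.φ ξ).source)
    (hg : g • x ∈ (X.φ ξ).source) : g ∈ stabilizer (X.G i) (X.φ ξ).source := by
  have hpre : (Homeomorph.smul g) '' (X.proj i ⁻¹' (X.U i ∩ X.U j)) =
      X.proj i ⁻¹' (X.U i ∩ X.U j) := by
    ext y; constructor
    · rintro ⟨z, hz, rfl⟩
      simpa [proj_smul] using hz
    · intro hy
      exact ⟨g⁻¹ • y, by simpa [proj_smul] using hy, by simp⟩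
  have hxm : x ∈ X.proj i ⁻¹' (X.U i ∩ X.U j) := by
    have := X.source_eq ξ x hx ▸ hx
    exact connectedComponentIn_subset _ _ this
  rw [MulAction.mem_stabilizer_iff]
  have := (Homeomorph.smul g).image_connectedComponentIn hxm
  rw [hpre, ← X.source_eq ξ x hx] at this
  rw [← image_smul]
  rw [show (fun x : X.hat i => g • x) '' (X.φ ξ).source = _ from this]
  exact (X.source_eq ξ _ hg).symm

lemma isOpen_stabilizer_source (ξ : X.Tran i j) :
    IsOpen (stabilizer (X.G i) (X.φ ξ).source : Set (X.G i)) := by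
  obtain ⟨x, hx⟩ := X.source_nonempty ξ
  have : (stabilizer (X.G i) (X.φ ξ).source : Set (X.G i)) =
      (fun g : X.G i => g • x) ⁻¹' (X.φ ξ).source := by
    ext g
    refine ⟨fun h => ?_, fun h => mem_stabilizer_source ξ hx h⟩
    have h' : g • (X.φ ξ).source = (X.φ ξ).source := h
    rw [mem_preimage, ← h']
    exact smul_mem_smul_set hx
  rw [this]
  exact (X.φ ξ).open_source.preimage (by fun_prop)

lemma isOpen_stabilizer_target (ξ : X.Tran i j) :
    IsOpen (stabilizer (X.G j) (X.φ ξ).target : Set (X.G j)) := by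
  rw [← inv_source]; exact isOpen_stabilizer_source _

open Classical in
/-- The isomorphism `lam ξ`, extended to the whole group. -/
def lamExt (ξ : X.Tran i j) (g : X.G i) : X.G j :=
  if h : g ∈ stabilizer (X.G i) (X.φ ξ).source then X.lam ξ ⟨g, h⟩ else 1

lemma bi_lamExt (ξ : X.Tran i j) {g : X.G i}
    (hg : g ∈ stabilizer (X.G i) (X.φ ξ).source) :
    X.bi 1 ξ g = X.bi (lamExt ξ g) ξ 1 := by
  rw [lamExt, dif_pos hg]; exact bi_lam ξ ⟨g, hg⟩

lemma tendsto_lamExt (ξ : X.Tran i j) : Tendsto (lamExt ξ) (𝓝 1) (𝓝 1) := by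
  have hO := isOpen_stabilizer_source ξ
  have h1 : Tendsto (fun g : stabilizer (X.G i) (X.φ ξ).source => (X.lam ξ g : X.G j))
      (𝓝 1) (𝓝 1) := by
    have hc : Continuous fun g : stabilizer (X.G i) (X.φ ξ).source =>
      (X.lam ξ g : X.G j) := continuous_subtype_val.comp (X.lam ξ).continuous
    have := hc.tendsto 1
    simpa using this
  have h2 : 𝓝 (1 : X.G i) = map ((↑) : stabilizer (X.G i) (X.φ ξ).source → X.G i)
      (𝓝 1) := (hO.isOpenEmbedding_subtypeVal.map_nhds_eq 1).symm
  rw [h2, tendsto_map'_iff]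
  refine h1.congr fun g => ?_
  simp [lamExt, g.2]

lemma nhds_tran (ξ : X.Tran i j) : 𝓝 ξ = map (fun g => X.bi g ξ 1) (𝓝 (1 : X.G j)) := by
  refine le_antisymm (fun A hA => ?_) ?_
  · rw [mem_map, mem_nhds_iff] at hA
    obtain ⟨N, hNA, hN, h1⟩ := hA
    refine mem_nhds_iff.2 ⟨(fun g => X.bi g ξ 1) '' N, image_subset_iff.2 hNA, ?_,
      ⟨1, h1, X.bi_one _⟩⟩
    rw [isOpen_tran]
    intro η
    rw [isOpen_iff_mem_nhds]
    rintro ⟨h₀, g₀⟩ ⟨u₀, hu₀, he⟩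
    dsimp only at he
    have c1 : Tendsto (fun p : X.G j × X.G i => g₀⁻¹ * p.2) (𝓝 (h₀, g₀)) (𝓝 1) := by
      have : Continuous fun p : X.G j × X.G i => g₀⁻¹ * p.2 := by fun_prop
      simpa using this.tendsto (h₀, g₀)
    have c2 : Tendsto (fun p : X.G j × X.G i => p.1 * h₀⁻¹ * u₀) (𝓝 (h₀, g₀)) (𝓝 u₀) := by
      have : Continuous fun p : X.G j × X.G i => p.1 * h₀⁻¹ * u₀ := by fun_prop
      simpa using this.tendsto (h₀, g₀)
    have c3 := c2.mul ((tendsto_lamExt ξ).comp c1)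
    rw [mul_one] at c3
    filter_upwards [c3 (hN.mem_nhds hu₀), c1 ((isOpen_stabilizer_source ξ).mem_nhds (one_mem _))]
      with p hp1 hp2
    refine ⟨_, hp1, ?_⟩
    dsimp only [Function.comp]
    have e1 : X.bi p.1 η p.2 = X.bi (p.1 * h₀⁻¹) (X.bi h₀ η g₀) (g₀⁻¹ * p.2) := by
      rw [X.bi_bi]; simp
    rw [e1, ← he, X.bi_bi]
    have e2 := bi_lamExt ξ hp2
    have e3 := X.bi_bi 1 (p.1 * h₀⁻¹ * u₀) ξ (g₀⁻¹ * p.2) 1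
    rw [e2, X.bi_bi] at e3
    simpa using e3
  · rw [← tendsto_id', tendsto_map'_iff]
    have := (continuous_bi_left ξ).tendsto 1
    rw [X.bi_one] at this
    exact this

lemma exists_bi_of_tendsto {η : S → X.Tran i j} (h : Tendsto η l (𝓝 ξ)) :
    ∃ v : S → X.G j, Tendsto v l (𝓝 1) ∧ ∀ᶠ s in l, η s = X.bi (v s) ξ 1 := by
  classical
  rw [nhds_tran] at h
  let v : S → X.G j := fun s => if hs : ∃ g, η s = X.bi g ξ 1 then hs.choose else 1
  have hv : ∀ᶠ s in l, η s = X.bi (v s) ξ 1 := by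
    have : range (fun g => X.bi g ξ 1) ∈ map (fun g => X.bi g ξ 1) (𝓝 (1 : X.G j)) := range_mem_map
    filter_upwards [h this] with s hs
    obtain ⟨g, hg⟩ := hs
    have hs : ∃ g, η s = X.bi g ξ 1 := ⟨g, hg.symm⟩
    simp only [v, dif_pos hs]; exact hs.choose_spec
  refine ⟨v, fun N hN => ?_, hv⟩
  have := h (image_mem_map hN)
  change ∀ᶠ s in l, v s ∈ N
  filter_upwards [this, hv] with s hs hs2
  obtain ⟨g, hg, hg2⟩ := hs
  rw [hs2] at hg2
  rwa [← (bi_left_inj ξ).1 hg2]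

lemma exists_bi_right_of_tendsto {η : S → X.Tran i j} (h : Tendsto η l (𝓝 ξ)) :
    ∃ w : S → X.G i, Tendsto w l (𝓝 1) ∧ ∀ᶠ s in l, η s = X.bi 1 ξ (w s) := by
  classical
  obtain ⟨v, hv, hev⟩ := exists_bi_of_tendsto h
  have hO := isOpen_stabilizer_target ξ
  let w : X.G j → X.G i := fun g => if hg : g ∈ stabilizer (X.G j) (X.φ ξ).target then
    ((X.lam ξ).symm ⟨g, hg⟩ : X.G i) else 1
  have hw : Tendsto w (𝓝 1) (𝓝 1) := by
    have h1 : Tendsto (fun g : stabilizer (X.G j) (X.φ ξ).target =>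
        ((X.lam ξ).symm g : X.G i)) (𝓝 1) (𝓝 1) := by
      have hc : Continuous fun g : stabilizer (X.G j) (X.φ ξ).target =>
        ((X.lam ξ).symm g : X.G i) := continuous_subtype_val.comp (X.lam ξ).symm.continuous
      simpa using hc.tendsto 1
    rw [← show map ((↑) : stabilizer (X.G j) (X.φ ξ).target → X.G j)
      (𝓝 1) = 𝓝 (1 : X.G j) from hO.isOpenEmbedding_subtypeVal.map_nhds_eq 1, tendsto_map'_iff]
    refine h1.congr fun g => ?_
    simp only [w, Function.comp, dif_pos g.2]
  refine ⟨w ∘ v, hw.comp hv, ?_⟩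
  filter_upwards [hev, hv (hO.mem_nhds (one_mem _))] with s hs hs2
  have hs2' : v s ∈ stabilizer (X.G j) (X.φ ξ).target := hs2
  rw [hs]
  have := bi_lam ξ ((X.lam ξ).symm ⟨v s, hs2'⟩)
  rw [show X.lam ξ ((X.lam ξ).symm ⟨v s, hs2'⟩) = ⟨v s, hs2'⟩ from (X.lam ξ).apply_symm_apply _]
    at this
  simp only [Function.comp, w, dif_pos hs2']
  exact this.symm

end

section

variable {b b' x y z : X.BasePoint} {k l : ℕ} {r : ℝ} {α θ θ' : ℕ → ℕ}

lemma fst_eq_of_isPreconnected {I : Set ℝ} (hI : _root_.IsPreconnected I) {c : ℝ → X.BasePoint}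
    (hc : ContinuousOn c I) {s : ℝ} (hr : r ∈ I) (hs : s ∈ I) : (c r).1 = (c s).1 := by
  let : TopologicalSpace X.ι := ⊥
  have : DiscreteTopology X.ι := ⟨rfl⟩
  have h : Continuous (Sigma.fst : X.BasePoint → X.ι) := continuous_sigma fun i => continuous_const
  exact hI.constant (h.comp_continuousOn hc) hr hs

/-! ### Arrows and homs -/

namespace Arrow

/-- The arrow underlying a hom. -/
def ofHom (f : b ⟶ b') : X.Arrow := ⟨f.1, b.2, f.2.1⟩

lemma ofHom_source (f : b ⟶ b') : (ofHom f).source = b := rfl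

lemma ofHom_target (f : b ⟶ b') : (ofHom f).target = b' := Sigma.ext rfl (heq_of_eq f.2.2)

lemma ofHom_trans (f : b ⟶ b') : (ofHom f).trans = ⟨b.1, b'.1, f.1⟩ := rfl

lemma ofHom_id (b : X.BasePoint) : ofHom (𝟙 b) = Arrow.id b := rfl

lemma exists_ofHom {a : X.Arrow} (h : a.source = b) (h' : a.target = b') :
    ∃ f : b ⟶ b', a = ofHom f := by
  subst h h'
  exact ⟨⟨a.tr, a.mem, rfl⟩, rfl⟩

lemma ofHom_injective {f f' : b ⟶ b'} (h : ofHom f = ofHom f') : f = f' := by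
  simp only [ofHom, Arrow.mk.injEq, heq_eq_eq, true_and, and_true] at h
  exact Subtype.ext h

lemma isComp_ofHom (f : x ⟶ y) (g : y ⟶ z) : IsComp (ofHom g) (ofHom f) (ofHom (f ≫ g)) := by
  induction x, y, f using Hom.rec_homMk with
  | h i j ξ x hx => exact IsComp.mk g.1 ξ x hx g.2.1

lemma IsComp.exists_hom {a b c : X.Arrow} (h : IsComp b a c) :
    ∃ (x y z : X.BasePoint) (f : x ⟶ y) (g : y ⟶ z),
      a = ofHom f ∧ b = ofHom g ∧ c = ofHom (f ≫ g) := by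
  cases h with
  | mk η ξ x hx hy => exact ⟨_, _, _, homMk ξ x hx, homMk η _ hy, rfl, rfl, rfl⟩

lemma IsComp.eq_ofHom {f : x ⟶ y} {g : y ⟶ z} {c : X.Arrow} (h : IsComp (ofHom g) (ofHom f) c) :
    c = ofHom (f ≫ g) := by
  obtain ⟨x', y', z', f', g', hf, hg, rfl⟩ := h.exists_hom
  have h1 : x = x' := by simpa only [ofHom_source] using congrArg Arrow.source hf
  have h2 : y = y' := by simpa only [ofHom_target] using congrArg Arrow.target hf
  have h3 : z = z' := by simpa only [ofHom_target] using congrArg Arrow.target hg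
  subst h1 h2 h3
  rw [ofHom_injective hf, ofHom_injective hg]

/-- The square with top `a`, bottom `a'` and sides `j`, `j'` commutes. -/
def IsSq (a a' j j' : X.Arrow) : Prop := ∃ d, IsComp j' a d ∧ IsComp a' j d

lemma isSq_ofHom {x' y' : X.BasePoint} {a : x ⟶ y} {a' : x' ⟶ y'} {j : x ⟶ x'} {j' : y ⟶ y'} :
    IsSq (ofHom a) (ofHom a') (ofHom j) (ofHom j') ↔ a ≫ j' = j ≫ a' := by
  constructor
  · rintro ⟨d, h1, h2⟩
    exact ofHom_injective (h1.eq_ofHom.symm.trans h2.eq_ofHom)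
  · intro h
    exact ⟨_, isComp_ofHom _ _, by rw [h]; exact isComp_ofHom _ _⟩

open Classical in
/-- The composition of two arrows (a junk value if they are not composable). -/
def comp (b a : X.Arrow) : X.Arrow := if h : ∃ c, IsComp b a c then h.choose else a

lemma comp_ofHom (f : x ⟶ y) (g : y ⟶ z) : comp (ofHom g) (ofHom f) = ofHom (f ≫ g) := by
  have h : ∃ c, IsComp (ofHom g) (ofHom f) c := ⟨_, isComp_ofHom f g⟩
  rw [comp, dif_pos h]
  exact h.choose_spec.eq_ofHom

/-- The inverse arrow. -/
def inv (a : X.Arrow) : X.Arrow :=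
  ofHom (Groupoid.inv (⟨a.tr, a.mem, rfl⟩ : a.source ⟶ a.target))

lemma inv_ofHom (f : x ⟶ y) : inv (ofHom f) = ofHom (Groupoid.inv f) := by
  induction x, y, f using Hom.rec_homMk with
  | h i j ξ x hx => rfl

lemma inv_trans {a : X.Arrow} : (inv a).trans = ⟨a.j, a.i, Orbispace.inv a.tr⟩ := by
  have h := Hom.inv_val (⟨a.tr, a.mem, rfl⟩ : a.source ⟶ a.target)
  rw [inv, ofHom_trans, h]; rfl

lemma exists_of_trans {a : X.Arrow} {i j : X.ι} {ξ : X.Tran i j} (h : a.trans = ⟨i, j, ξ⟩) :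
    ∃ (x : X.hat i) (hx : x ∈ (X.φ ξ).source), a = ⟨ξ, x, hx⟩ := by
  obtain ⟨ξ', x, hx⟩ := a
  simp only [Arrow.trans, Sigma.mk.injEq] at h
  obtain ⟨rfl, h⟩ := h
  obtain ⟨rfl, h⟩ := Sigma.mk.inj_iff.1 (eq_of_heq h)
  obtain rfl := eq_of_heq h
  exact ⟨x, hx, rfl⟩

lemma trans_comp_const {I : Set ℝ} (hI : _root_.IsPreconnected I) {J J' : ℝ → X.Arrow} {T T' : X.Trans}
    (hJ : ∀ s ∈ I, (J s).trans = T) (hJ' : ∀ s ∈ I, (J' s).trans = T')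
    (hs : ∀ s ∈ I, (J s).target = (J' s).source)
    (hc : ContinuousOn (fun s => (J s).source) I) :
    ∃ T'' : X.Trans, ∀ s ∈ I, (comp (J' s) (J s)).trans = T'' := by
  rcases I.eq_empty_or_nonempty with rfl | ⟨s₀, hs₀⟩
  · exact ⟨T, by simp⟩
  refine ⟨(comp (J' s₀) (J s₀)).trans, fun s hsI => ?_⟩
  obtain ⟨i, j, ξ⟩ := T
  obtain ⟨j', k, η⟩ := T'
  have h1 : ∀ s ∈ I, ∃ (x : X.hat i) (hx : x ∈ (X.φ ξ).source), J s = ⟨ξ, x, hx⟩ :=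
    fun s hs => exists_of_trans (hJ s hs)
  have h2 : ∀ s ∈ I, ∃ (x : X.hat j') (hx : x ∈ (X.φ η).source), J' s = ⟨η, x, hx⟩ :=
    fun s hs => exists_of_trans (hJ' s hs)
  have hjj : j = j' := by
    obtain ⟨x, hx, e⟩ := h1 s₀ hs₀
    obtain ⟨y, hy, e'⟩ := h2 s₀ hs₀
    have := hs s₀ hs₀
    rw [e, e'] at this
    exact congrArg Sigma.fst this
  subst hjj
  choose! z hz hzJ using h1
  have h3 : ∀ s (hs : s ∈ I), ∃ hy : X.φ ξ (z s) ∈ (X.φ η).source,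
      comp (J' s) (J s) = ⟨X.comp η ξ (z s) (hz s hs) hy, z s, X.comp_mem _ _ _ _ _⟩ := by
    intro s hsI
    obtain ⟨y, hy, e'⟩ := h2 s hsI
    have e := hs s hsI
    rw [hzJ s hsI, e'] at e
    have e2 : X.φ ξ (z s) = y := by simpa [Arrow.target, Arrow.source] using e
    subst e2
    refine ⟨hy, ?_⟩
    rw [hzJ s hsI, e']
    exact comp_ofHom (homMk ξ (z s) (hz s hsI)) (homMk η _ hy)
  have hzc : ContinuousOn z I := by
    have : ContinuousOn (fun s => (⟨i, z s⟩ : X.BasePoint)) I :=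
      hc.congr fun s hs => by simp only [hzJ s hs]; rfl
    exact Topology.IsEmbedding.sigmaMk.isInducing.continuousOn_iff.2 this
  obtain ⟨hy, e⟩ := h3 s hsI
  obtain ⟨hy₀, e₀⟩ := h3 s₀ hs₀
  rw [e, e₀]
  simp only [Arrow.trans]
  have := comp_eq_of_isPreconnected η ξ (hI.image z hzc) (by
    rintro _ ⟨r, hr, rfl⟩
    exact ⟨hz r hr, (h3 r hr).choose⟩) (mem_image_of_mem z hs₀) (mem_image_of_mem z hsI)
    (hz s₀ hs₀) hy₀ (hz s hsI) hy
  rw [this]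

end Arrow

/-! ### Partitions of the unit interval -/

/-- A partition of the unit interval into at least two pieces. -/
structure Part where
  n : ℕ
  one_le : 1 ≤ n
  t : ℕ → ℝ
  t_zero : t 0 = 0
  t_last : t (n + 1) = 1
  t_lt : ∀ k ≤ n, t k < t (k + 1)

namespace Part

/-- The pieces of a partition. -/
def piece (P : Part) (k : ℕ) : Set ℝ := Icc (P.t k) (P.t (k + 1))

variable {P Q R S : Part}

lemma t_strict (h : k < l) (hl : l ≤ P.n + 1) : P.t k < P.t l := by
  induction l with
  | zero => omega
  | succ l ih =>
    rcases Nat.lt_succ_iff_lt_or_eq.1 h with h' | rfl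
    · exact (ih h' (by omega)).trans (P.t_lt l (by omega))
    · exact P.t_lt k (by omega)

lemma t_mono (h : k ≤ l) (hl : l ≤ P.n + 1) : P.t k ≤ P.t l := by
  rcases h.eq_or_lt with rfl | h
  · rfl
  · exact (t_strict h hl).le

lemma lt_of_t_lt (hk : k ≤ P.n + 1) (h : P.t k < P.t l) : k < l := by
  by_contra hc
  exact absurd (P.t_mono (not_lt.1 hc) hk) (not_le.2 h)

lemma le_of_t_le (hk : k ≤ P.n + 1) (h : P.t k ≤ P.t l) : k ≤ l := by
  by_contra hc
  exact absurd (P.t_strict (not_le.1 hc) hk) (not_lt.2 h)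

lemma left_mem (hk : k ≤ P.n) : P.t k ∈ P.piece k := left_mem_Icc.2 (P.t_lt k hk).le

lemma right_mem (hk : k ≤ P.n) : P.t (k + 1) ∈ P.piece k := right_mem_Icc.2 (P.t_lt k hk).le

lemma t_mem (hk : k ≤ P.n + 1) : P.t k ∈ Icc (0 : ℝ) 1 := by
  rw [← P.t_zero, ← P.t_last]
  exact ⟨P.t_mono (Nat.zero_le _) hk, P.t_mono hk le_rfl⟩

lemma piece_subset (hk : k ≤ P.n) : P.piece k ⊆ Icc 0 1 :=
  Icc_subset_Icc (P.t_mem (by omega)).1 (P.t_mem (by omega)).2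

lemma zero_mem : (0 : ℝ) ∈ P.piece 0 := by
  have := P.left_mem (Nat.zero_le _); rwa [P.t_zero] at this

lemma one_mem : (1 : ℝ) ∈ P.piece P.n := by have := P.right_mem le_rfl; rwa [P.t_last] at this

lemma exists_piece (hr : r ∈ Ico (0 : ℝ) 1) : ∃ k ≤ P.n, r ∈ Ico (P.t k) (P.t (k + 1)) := by
  have key : ∀ l ≤ P.n + 1, r < P.t l → ∃ k < l, r ∈ Ico (P.t k) (P.t (k + 1)) := by
    intro l
    induction l with
    | zero => intro _ h; rw [P.t_zero] at h; exact absurd hr.1 (not_le.2 h)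
    | succ l ih =>
      intro hl h
      grind
  obtain ⟨k, hk, h⟩ := key (P.n + 1) le_rfl (by rw [P.t_last]; exact hr.2)
  exact ⟨k, by omega, h⟩

/-- `P` is a subdivision of `Q`, the `k`-th piece of `P` lying in the `θ k`-th one of `Q`. -/
structure Sub (P Q : Part) (θ : ℕ → ℕ) : Prop where
  le : ∀ k ≤ P.n, θ k ≤ Q.n
  sub : ∀ k ≤ P.n, P.piece k ⊆ Q.piece (θ k)

lemma eq_of_piece_subset {l' : ℕ} (hk : k ≤ P.n) (hl : l ≤ Q.n) (hl' : l' ≤ Q.n)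
    (h : P.piece k ⊆ Q.piece l) (h' : P.piece k ⊆ Q.piece l') : l = l' := by
  have a := h (P.left_mem hk)
  have b := h (P.right_mem hk)
  have a' := h' (P.left_mem hk)
  have b' := h' (P.right_mem hk)
  have c := P.t_lt k hk
  have h1 : l < l' + 1 := Q.lt_of_t_lt (by omega) (by linarith [a.1, b'.2])
  have h2 : l' < l + 1 := Q.lt_of_t_lt (by omega) (by linarith [a'.1, b.2])
  omega

namespace Sub

lemma refl (P : Part) : P.Sub P id := ⟨fun _ h => h, fun _ _ => Subset.rfl⟩

lemma trans (h : P.Sub Q θ) (h' : Q.Sub R α) : P.Sub R (α ∘ θ) :=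
  ⟨fun k hk => h'.le _ (h.le k hk), fun k hk => (h.sub k hk).trans (h'.sub _ (h.le k hk))⟩

variable {θ θ' : ℕ → ℕ}

lemma zero (h : P.Sub Q θ) : θ 0 = 0 := by
  have h1 := (h.sub 0 (Nat.zero_le _) P.zero_mem).1
  rw [← Q.t_zero] at h1
  have := Q.le_of_t_le (by have := h.le 0 (Nat.zero_le _); omega) h1
  omega

lemma last (h : P.Sub Q θ) : θ P.n = Q.n := by
  have h1 := (h.sub P.n le_rfl P.one_mem).2
  rw [← Q.t_last] at h1
  have := Q.le_of_t_le le_rfl h1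
  have := h.le P.n le_rfl
  omega

lemma step (h : P.Sub Q θ) (hk : k < P.n) : θ (k + 1) = θ k ∨ θ (k + 1) = θ k + 1 := by
  have a := h.sub k hk.le (P.left_mem hk.le)
  have b := h.sub k hk.le (P.right_mem hk.le)
  have a' := h.sub (k + 1) hk (P.left_mem hk)
  have b' := h.sub (k + 1) hk (P.right_mem hk)
  have c := P.t_lt k hk.le
  have c' := P.t_lt (k + 1) hk
  have l := h.le k hk.le
  have l' := h.le (k + 1) hk
  have h1 : θ k < θ (k + 1) + 1 := Q.lt_of_t_lt (by omega) (by linarith [a.1, b'.2])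
  have h2 : θ (k + 1) ≤ θ k + 1 := Q.le_of_t_le (by omega) (by linarith [a'.1, b.2])
  omega

lemma t_eq (h : P.Sub Q θ) (hk : k < P.n) (hs : θ (k + 1) = θ k + 1) :
    P.t (k + 1) = Q.t (θ k + 1) :=
  le_antisymm (h.sub k hk.le (P.right_mem hk.le)).2 (hs ▸ (h.sub (k + 1) hk (P.left_mem hk)).1)

lemma unique (h : P.Sub Q θ) (h' : P.Sub Q θ') (hk : k ≤ P.n) : θ k = θ' k :=
  eq_of_piece_subset hk (h.le k hk) (h'.le k hk) (h.sub k hk) (h'.sub k hk)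

end Sub

lemma exists_sub (h : ∀ l ≤ Q.n + 1, ∃ k ≤ P.n + 1, P.t k = Q.t l) : ∃ θ, P.Sub Q θ := by
  have key : ∀ k, k ≤ P.n → ∃ l, l ≤ Q.n ∧ P.piece k ⊆ Q.piece l := by
    intro k hk
    obtain ⟨l, hl, hlr⟩ := Q.exists_piece (r := P.t k) ⟨(P.t_mem (by omega)).1, by
      rw [← P.t_last]; exact P.t_strict (by omega) le_rfl⟩
    refine ⟨l, hl, Icc_subset_Icc hlr.1 ?_⟩
    obtain ⟨m, hm, hml⟩ := h (l + 1) (by omega)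
    rw [← hml] at hlr ⊢
    exact P.t_mono (P.lt_of_t_lt (by omega) hlr.2) hm
  choose! θ h1 h2 using key
  exact ⟨θ, h1, h2⟩

lemma exists_of_finset (F : Finset ℝ) (h0 : (0 : ℝ) ∈ F) (h1 : (1 : ℝ) ∈ F)
    (hF : ∀ r ∈ F, r ∈ Icc (0 : ℝ) 1) (hc : 3 ≤ F.card) :
    ∃ P : Part, (∀ r ∈ F, ∃ k ≤ P.n + 1, P.t k = r) ∧ ∀ k ≤ P.n + 1, P.t k ∈ F := by
  obtain ⟨n, hn⟩ : ∃ n, F.card = n + 2 := ⟨F.card - 2, by omega⟩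
  let e := F.orderEmbOfFin hn
  have hlt : ∀ k l (hk : k < n + 2) (hl : l < n + 2), k < l → e ⟨k, hk⟩ < e ⟨l, hl⟩ :=
    fun k l hk hl h => e.strictMono h
  have hsurj : ∀ r ∈ F, ∃ k, ∃ hk : k < n + 2, e ⟨k, hk⟩ = r := by
    intro r hr
    have : r ∈ range e := by rw [Finset.range_orderEmbOfFin]; exact hr
    obtain ⟨⟨k, hk⟩, h⟩ := this
    exact ⟨k, hk, h⟩
  refine ⟨⟨n, by omega, fun k => if h : k < n + 2 then e ⟨k, h⟩ else 0, ?_, ?_, ?_⟩, ?_, ?_⟩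
  · rw [dif_pos (by omega)]
    obtain ⟨k, hk, h⟩ := hsurj 0 h0
    refine le_antisymm ?_ (hF _ (F.orderEmbOfFin_mem hn _)).1
    rw [← h]
    exact e.monotone (Fin.mk_le_mk.2 (Nat.zero_le _))
  · rw [dif_pos (by omega)]
    obtain ⟨k, hk, h⟩ := hsurj 1 h1
    refine le_antisymm (hF _ (F.orderEmbOfFin_mem hn _)).2 ?_
    rw [← h]
    exact e.monotone (Fin.mk_le_mk.2 (by omega))
  · grind
  · grind
  · aesop

lemma exists_common (P Q : Part) : ∃ (R : Part) (θ θ' : ℕ → ℕ), R.Sub P θ ∧ R.Sub Q θ' := by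
  classical
  let F : Finset ℝ := (Finset.range (P.n + 2)).image P.t ∪ (Finset.range (Q.n + 2)).image Q.t
  have hP : ∀ k ≤ P.n + 1, P.t k ∈ F := fun k hk => Finset.mem_union_left _
    (Finset.mem_image_of_mem _ (Finset.mem_range.2 (by omega)))
  have hQ : ∀ k ≤ Q.n + 1, Q.t k ∈ F := fun k hk => Finset.mem_union_right _
    (Finset.mem_image_of_mem _ (Finset.mem_range.2 (by omega)))
  obtain ⟨R, hR, -⟩ := exists_of_finset F (by rw [← P.t_zero]; exact hP 0 (by omega))
    (by rw [← P.t_last]; exact hP _ le_rfl) (by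
      intro r hr
      rcases Finset.mem_union.1 hr with h | h
      all_goals
        obtain ⟨k, hk, rfl⟩ := Finset.mem_image.1 h
        exact t_mem (by have := Finset.mem_range.1 hk; omega)) (by
      have hsub : ({P.t 0, P.t 1, P.t (P.n + 1)} : Finset ℝ) ⊆ F := by grind
      refine le_trans ?_ (Finset.card_le_card hsub)
      have := P.one_le
      have a := P.t_strict (k := 0) (l := 1) (by omega) (by omega)
      have b := P.t_strict (k := 1) (l := P.n + 1) (by omega) le_rfl
      rw [Finset.card_eq_three.2 ⟨_, _, _, a.ne, (a.trans b).ne, b.ne, rfl⟩])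
  obtain ⟨θ, h⟩ := exists_sub (P := R) (Q := P) fun l hl => hR _ (hP l hl)
  obtain ⟨θ', h'⟩ := exists_sub (P := R) (Q := Q) fun l hl => hR _ (hQ l hl)
  exact ⟨R, θ, θ', h, h'⟩

/-- The partition into `m + 2` pieces of equal length. -/
def unif (m : ℕ) : Part where
  n := m + 1
  one_le := by omega
  t k := k / (m + 2)
  t_zero := by simp
  t_last := by grind
  t_lt k _ := by
    push_cast
    gcongr
    linarith

lemma exists_fine (P : Part) {ε : ℝ} (hε : 0 < ε) :
    ∃ (R : Part) (θ : ℕ → ℕ), R.Sub P θ ∧ ∀ k ≤ R.n, R.t (k + 1) - R.t k < ε := by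
  obtain ⟨m, hm⟩ := exists_nat_gt (1 / ε)
  obtain ⟨R, θ, θ', h, h'⟩ := exists_common P (unif m)
  refine ⟨R, θ, h, fun k hk => ?_⟩
  have a := h'.sub k hk (R.left_mem hk)
  have b := h'.sub k hk (R.right_mem hk)
  have c : (unif m).t (θ' k + 1) - (unif m).t (θ' k) = 1 / (m + 2) := by
    simp only [unif]; push_cast; ring
  have d : 1 / ((m : ℝ) + 2) < ε := by
    rw [div_lt_iff₀ (by positivity)]
    rw [div_lt_iff₀ hε] at hm
    nlinarith
  linarith [a.1, b.2]

end Part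

/-! ### Ways: systems from the unit interval -/

/-- A system from the unit interval to the orbispace on a given partition, with given ends. -/
structure WayOn (P : Part) (x y : X.BasePoint) where
  c : ℕ → ℝ → X.BasePoint
  c_cont : ∀ k ≤ P.n, ContinuousOn (c k) (P.piece k)
  g : ℕ → X.Arrow
  g_source : ∀ k < P.n, (g k).source = c k (P.t (k + 1))
  g_target : ∀ k < P.n, (g k).target = c (k + 1) (P.t (k + 1))
  start : c 0 0 = x
  finish : c P.n 1 = y

namespace WayOn

variable {P Q R S : Part} {x y z : X.BasePoint}

/-- The transition at time `s` from the `a`-th to the `b`-th piece, for `b = a` or `b = a + 1`. -/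
def step (σ : WayOn P x y) (a b : ℕ) (s : ℝ) : X.Arrow :=
  if b = a then Arrow.id (σ.c a s) else σ.g a

lemma step_self (σ : WayOn P x y) (a : ℕ) (s : ℝ) : σ.step a a s = Arrow.id (σ.c a s) :=
  if_pos rfl

lemma step_succ (σ : WayOn P x y) (a : ℕ) (s : ℝ) : σ.step a (a + 1) s = σ.g a :=
  if_neg (by omega)

lemma step_source (σ : WayOn P x y) (h : R.Sub P θ) (hk : k < R.n) :
    (σ.step (θ k) (θ (k + 1)) (R.t (k + 1))).source = σ.c (θ k) (R.t (k + 1)) := by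
  rcases h.step hk with e | e
  · rw [e, step_self]; rfl
  · have := h.le (k + 1) hk
    rw [h.t_eq hk e, e, step_succ, σ.g_source _ (by omega)]

lemma step_target (σ : WayOn P x y) (h : R.Sub P θ) (hk : k < R.n) :
    (σ.step (θ k) (θ (k + 1)) (R.t (k + 1))).target = σ.c (θ (k + 1)) (R.t (k + 1)) := by
  rcases h.step hk with e | e
  · rw [e, step_self, Arrow.id_target]
  · have := h.le (k + 1) hk
    rw [h.t_eq hk e, e, step_succ, σ.g_target _ (by omega)]

/-- The restriction of a system to a subdivision. -/
def sub (σ : WayOn P x y) (h : R.Sub P θ) : WayOn R x y where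
  c k := σ.c (θ k)
  c_cont k hk := (σ.c_cont _ (h.le k hk)).mono (h.sub k hk)
  g k := σ.step (θ k) (θ (k + 1)) (R.t (k + 1))
  g_source _ hk := σ.step_source h hk
  g_target _ hk := σ.step_target h hk
  start := by rw [h.zero, σ.start]
  finish := by rw [h.last, σ.finish]

/-- The transition maps `J` identify the restrictions of `σ` and `τ` to a common subdivision. -/
structure Gauge (σ : WayOn P x y) (τ : WayOn Q x y) (R : Part) (θ θ' : ℕ → ℕ)
    (J : ℕ → ℝ → X.Arrow) : Prop where
  left : R.Sub P θ
  right : R.Sub Q θ'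
  flat : ∀ k ≤ R.n, ∃ T : X.Trans, ∀ s ∈ R.piece k, (J k s).trans = T
  source : ∀ k ≤ R.n, ∀ s ∈ R.piece k, (J k s).source = σ.c (θ k) s
  target : ∀ k ≤ R.n, ∀ s ∈ R.piece k, (J k s).target = τ.c (θ' k) s
  zero : ∀ s ∈ R.piece 0, J 0 s = Arrow.id (σ.c 0 s)
  last : ∀ s ∈ R.piece R.n, J R.n s = Arrow.id (σ.c P.n s)
  sq : ∀ k < R.n, Arrow.IsSq (σ.step (θ k) (θ (k + 1)) (R.t (k + 1)))
    (τ.step (θ' k) (θ' (k + 1)) (R.t (k + 1))) (J k (R.t (k + 1))) (J (k + 1) (R.t (k + 1)))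

/-- Two systems are equivalent if they are isomorphic after passing to a common subdivision. -/
def Equiv (σ : WayOn P x y) (τ : WayOn Q x y) : Prop := ∃ R θ θ' J, Gauge σ τ R θ θ' J

lemma Gauge.restrict {σ : WayOn P x y} {τ : WayOn Q x y} {J : ℕ → ℝ → X.Arrow}
    (h : Gauge σ τ R θ θ' J) (hS : S.Sub R α) :
    Gauge σ τ S (θ ∘ α) (θ' ∘ α) (fun k => J (α k)) where
  left := hS.trans h.left
  right := hS.trans h.right
  flat k hk := by
    obtain ⟨T, hT⟩ := h.flat _ (hS.le k hk)
    exact ⟨T, fun s hs => hT s (hS.sub k hk hs)⟩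
  source k hk s hs := h.source _ (hS.le k hk) s (hS.sub k hk hs)
  target k hk s hs := h.target _ (hS.le k hk) s (hS.sub k hk hs)
  zero s hs := by
    have := hS.sub 0 (Nat.zero_le _) hs
    rw [hS.zero] at this ⊢
    exact h.zero s this
  last s hs := by
    have := hS.sub _ le_rfl hs
    rw [hS.last] at this ⊢
    exact h.last s this
  sq k hk := by
    rcases hS.step hk with e | e
    · simp only [Function.comp, e, step_self]
      have hm := hS.sub k hk.le (S.right_mem hk.le)
      obtain ⟨f, hf⟩ := Arrow.exists_ofHom (h.source _ (hS.le k hk.le) _ hm)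
        (h.target _ (hS.le k hk.le) _ hm)
      rw [hf, ← Arrow.ofHom_id, ← Arrow.ofHom_id, Arrow.isSq_ofHom, id_comp,
        comp_id]
    · have hle := hS.le (k + 1) hk
      have := h.sq (α k) (by omega)
      rw [← hS.t_eq hk e, ← e] at this
      exact this

lemma Gauge.trans {σ : WayOn P x y} {τ : WayOn Q x y} {P' : Part} {υ : WayOn P' x y}
    {α' : ℕ → ℕ} {J J' : ℕ → ℝ → X.Arrow} (h : Gauge σ τ R θ θ' J) (h' : Gauge τ υ R α α' J') :
    Gauge σ υ R θ α' (fun k s => Arrow.comp (J' k s) (J k s)) := by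
  have hα : ∀ k ≤ R.n, α k = θ' k := fun k hk => h'.left.unique h.right hk
  have key : ∀ k ≤ R.n, ∀ s ∈ R.piece k, ∃ (f : σ.c (θ k) s ⟶ τ.c (θ' k) s)
      (f' : τ.c (θ' k) s ⟶ υ.c (α' k) s), J k s = Arrow.ofHom f ∧ J' k s = Arrow.ofHom f' := by
    intro k hk s hs
    obtain ⟨f, hf⟩ := Arrow.exists_ofHom (h.source k hk s hs) (h.target k hk s hs)
    obtain ⟨f', hf'⟩ := Arrow.exists_ofHom ((h'.source k hk s hs).trans (by rw [hα k hk]))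
      (h'.target k hk s hs)
    exact ⟨f, f', hf, hf'⟩
  refine ⟨h.left, h'.right, fun k hk => ?_, fun k hk s hs => ?_, fun k hk s hs => ?_,
    fun s hs => ?_, fun s hs => ?_, fun k hk => ?_⟩
  · obtain ⟨T, hT⟩ := h.flat k hk
    obtain ⟨T', hT'⟩ := h'.flat k hk
    refine Arrow.trans_comp_const (I := R.piece k) isPreconnected_Icc hT hT' (fun s hs => ?_) ?_
    · rw [h.target k hk s hs, h'.source k hk s hs, hα k hk]
    · exact ((σ.c_cont _ (h.left.le k hk)).mono (h.left.sub k hk)).congr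
        fun s hs => h.source k hk s hs
  · obtain ⟨f, f', e, e'⟩ := key k hk s hs
    simp only [e, e', Arrow.comp_ofHom, Arrow.ofHom_source]
  · obtain ⟨f, f', e, e'⟩ := key k hk s hs
    simp only [e, e', Arrow.comp_ofHom, Arrow.ofHom_target]
  · have e1 := h.zero s hs
    have e2 := h'.zero s hs
    have e3 : τ.c 0 s = σ.c 0 s := by
      have := h.target 0 (Nat.zero_le _) s hs
      rw [e1, Arrow.id_target, h.right.zero] at this
      exact this.symm
    simp only [e1, e2, e3, ← Arrow.ofHom_id, Arrow.comp_ofHom, id_comp]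
  · have e1 := h.last s hs
    have e2 := h'.last s hs
    have e3 : τ.c Q.n s = σ.c P.n s := by
      have := h.target _ le_rfl s hs
      rw [e1, Arrow.id_target, h.right.last] at this
      exact this.symm
    simp only [e1, e2, e3, ← Arrow.ofHom_id, Arrow.comp_ofHom, id_comp]
  · have hm := R.right_mem hk.le
    have hm' : R.t (k + 1) ∈ R.piece (k + 1) := R.left_mem hk
    obtain ⟨f, f', e, e'⟩ := key k hk.le _ hm
    obtain ⟨f₁, f₁', e₁, e₁'⟩ := key (k + 1) hk _ hm'
    obtain ⟨a, ha⟩ := Arrow.exists_ofHom (σ.step_source h.left hk) (σ.step_target h.left hk)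
    obtain ⟨a', ha'⟩ := Arrow.exists_ofHom (τ.step_source h.right hk) (τ.step_target h.right hk)
    obtain ⟨a'', ha''⟩ := Arrow.exists_ofHom (υ.step_source h'.right hk)
      (υ.step_target h'.right hk)
    have s1 := h.sq k hk
    have s2 := h'.sq k hk
    rw [hα k hk.le, hα (k + 1) hk] at s2
    rw [ha, ha', e, e₁, Arrow.isSq_ofHom] at s1
    rw [ha', ha'', e', e₁', Arrow.isSq_ofHom] at s2
    rw [ha, ha'', e, e', e₁, e₁', Arrow.comp_ofHom, Arrow.comp_ofHom, Arrow.isSq_ofHom,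
      ← assoc, s1, assoc, s2, assoc]

lemma Gauge.symm {σ : WayOn P x y} {τ : WayOn Q x y} {J : ℕ → ℝ → X.Arrow}
    (h : Gauge σ τ R θ θ' J) : Gauge τ σ R θ' θ (fun k s => (J k s).inv) := by
  have key : ∀ k ≤ R.n, ∀ s ∈ R.piece k, ∃ f : σ.c (θ k) s ⟶ τ.c (θ' k) s,
      J k s = Arrow.ofHom f := fun k hk s hs =>
    Arrow.exists_ofHom (h.source k hk s hs) (h.target k hk s hs)
  refine ⟨h.right, h.left, fun k hk => ?_, fun k hk s hs => ?_, fun k hk s hs => ?_,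
    fun s hs => ?_, fun s hs => ?_, fun k hk => ?_⟩
  · obtain ⟨⟨i, j, ξ⟩, hT⟩ := h.flat k hk
    refine ⟨⟨j, i, Orbispace.inv ξ⟩, fun s hs => ?_⟩
    obtain ⟨x, hx, e⟩ := Arrow.exists_of_trans (hT s hs)
    rw [Arrow.inv_trans, e]
  · obtain ⟨f, e⟩ := key k hk s hs
    rw [e, Arrow.inv_ofHom, Arrow.ofHom_source]
  · obtain ⟨f, e⟩ := key k hk s hs
    rw [e, Arrow.inv_ofHom, Arrow.ofHom_target]
  · have e1 := h.zero s hs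
    have e3 : τ.c 0 s = σ.c 0 s := by
      have := h.target 0 (Nat.zero_le _) s hs
      rw [e1, Arrow.id_target, h.right.zero] at this
      exact this.symm
    rw [e1, e3, ← Arrow.ofHom_id, Arrow.inv_ofHom]
    congr 1; simp
  · have e1 := h.last s hs
    have e3 : τ.c Q.n s = σ.c P.n s := by
      have := h.target _ le_rfl s hs
      rw [e1, Arrow.id_target, h.right.last] at this
      exact this.symm
    rw [e1, e3, ← Arrow.ofHom_id, Arrow.inv_ofHom]
    congr 1; simp
  · obtain ⟨f, e⟩ := key k hk.le _ (R.right_mem hk.le)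
    obtain ⟨f₁, e₁⟩ := key (k + 1) hk _ (R.left_mem hk)
    obtain ⟨a, ha⟩ := Arrow.exists_ofHom (σ.step_source h.left hk) (σ.step_target h.left hk)
    obtain ⟨a', ha'⟩ := Arrow.exists_ofHom (τ.step_source h.right hk) (τ.step_target h.right hk)
    have s1 := h.sq k hk
    rw [ha, ha', e, e₁, Arrow.isSq_ofHom] at s1
    rw [ha, ha', e, e₁, Arrow.inv_ofHom, Arrow.inv_ofHom, Arrow.isSq_ofHom, Groupoid.inv_eq_inv,
      Groupoid.inv_eq_inv, IsIso.comp_inv_eq, assoc, s1, IsIso.inv_hom_id_assoc]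

lemma Gauge.of_sub (σ : WayOn P x y) (h : R.Sub P θ) :
    Gauge (σ.sub h) σ R id θ (fun k s => Arrow.id (σ.c (θ k) s)) := by
  refine ⟨Part.Sub.refl R, h, fun k hk => ?_, fun k hk s hs => rfl,
    fun k hk s hs => Arrow.id_target _, fun s hs => rfl, fun s hs => rfl, fun k hk => ?_⟩
  · obtain ⟨i, hi⟩ : ∃ i, ∀ s ∈ R.piece k, (σ.c (θ k) s).1 = i := by
      refine ⟨(σ.c (θ k) (R.t k)).1, fun s hs => ?_⟩
      exact fst_eq_of_isPreconnected (I := R.piece k) isPreconnected_Icc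
        ((σ.c_cont _ (h.le k hk)).mono (h.sub k hk)) hs (R.left_mem hk)
    refine ⟨⟨i, i, X.one i⟩, fun s hs => ?_⟩
    rw [← hi s hs]; rfl
  · obtain ⟨a, ha⟩ := Arrow.exists_ofHom (σ.step_source h hk) (σ.step_target h hk)
    rw [show (σ.sub h).step (id k) (id (k + 1)) (R.t (k + 1)) =
      σ.step (θ k) (θ (k + 1)) (R.t (k + 1)) from step_succ _ _ _]
    rw [ha, ← Arrow.ofHom_id, ← Arrow.ofHom_id, Arrow.isSq_ofHom, id_comp,
      comp_id]

lemma Equiv.symm {σ : WayOn P x y} {τ : WayOn Q x y} (h : Equiv σ τ) : Equiv τ σ := by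
  obtain ⟨R, θ, θ', J, h⟩ := h
  exact ⟨_, _, _, _, h.symm⟩

lemma Equiv.trans {σ : WayOn P x y} {τ : WayOn Q x y} {υ : WayOn R x y} (h : Equiv σ τ)
    (h' : Equiv τ υ) : Equiv σ υ := by
  obtain ⟨R, θ, θ', J, h⟩ := h
  obtain ⟨R', α, α', J', h'⟩ := h'
  obtain ⟨S, β, β', hβ, hβ'⟩ := Part.exists_common R R'
  exact ⟨_, _, _, _, (h.restrict hβ).trans (h'.restrict hβ')⟩

lemma equiv_sub (σ : WayOn P x y) (h : R.Sub P θ) : Equiv (σ.sub h) σ :=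
  ⟨_, _, _, _, Gauge.of_sub σ h⟩

lemma Equiv.refl (σ : WayOn P x y) : Equiv σ σ :=
  (equiv_sub σ (Part.Sub.refl P)).symm.trans (equiv_sub σ (Part.Sub.refl P))

end WayOn

/-- All systems from the unit interval with given ends. -/
abbrev Way (x y : X.BasePoint) : Type u := (P : Part) × WayOn P x y

instance waySetoid (x y : X.BasePoint) : Setoid (Way x y) where
  r σ τ := WayOn.Equiv σ.2 τ.2
  iseqv := ⟨fun σ => WayOn.Equiv.refl σ.2, fun h => h.symm, fun h h' => h.trans h'⟩

/-- Systems from the unit interval modulo equivalence. -/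
def WaySpace (x y : X.BasePoint) : Type u := Quotient (waySetoid x y)

namespace WayOn

variable {P Q R : Part} {x y z : X.BasePoint}

/-- The class of a system. -/
def q (σ : WayOn P x y) : WaySpace x y := Quotient.mk (waySetoid x y) ⟨P, σ⟩

lemma q_eq_iff {σ : WayOn P x y} {τ : WayOn Q x y} : σ.q = τ.q ↔ Equiv σ τ :=
  Quotient.eq (r := waySetoid x y)

lemma exists_q (α : WaySpace x y) : ∃ (P : Part) (σ : WayOn P x y), σ.q = α := by
  obtain ⟨⟨P, σ⟩, rfl⟩ := Quotient.exists_rep α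
  exact ⟨P, σ, rfl⟩

/-- The systems on the same partition and in the same charts as `σ` with `c k` mapping `K k` to
`V k`, and with the `k`-th transition in `A k`. -/
def box (σ : WayOn P x y) (K : ℕ → Set ℝ) (V : ℕ → Set X.BasePoint) (A : ℕ → Set X.Trans) :
    Set (WayOn P x y) :=
  {τ | (∀ k ≤ P.n, ∀ s ∈ P.piece k, (τ.c k s).1 = (σ.c k s).1) ∧
    (∀ k ≤ P.n, MapsTo (τ.c k) (K k) (V k)) ∧ ∀ k < P.n, (τ.g k).trans ∈ A k}

/-- The requirements on a box that make its image a basic open set. -/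
def IsBox (σ : WayOn P x y) (K : ℕ → Set ℝ) (V : ℕ → Set X.BasePoint) (A : ℕ → Set X.Trans) :
    Prop :=
  (∀ k ≤ P.n, IsCompact (K k) ∧ K k ⊆ P.piece k ∧ IsOpen (V k) ∧ MapsTo (σ.c k) (K k) (V k)) ∧
    ∀ k < P.n, IsOpen (A k) ∧ (σ.g k).trans ∈ A k

end WayOn

instance waySpaceTopology (x y : X.BasePoint) : TopologicalSpace (WaySpace x y) :=
  TopologicalSpace.generateFrom {O | ∃ (P : Part) (σ : WayOn P x y) (K : ℕ → Set ℝ)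
    (V : ℕ → Set X.BasePoint) (A : ℕ → Set X.Trans), σ.IsBox K V A ∧
      O = WayOn.q '' σ.box K V A}

lemma WayOn.IsBox.isOpen {P : Part} {σ : WayOn P x y} {K : ℕ → Set ℝ} {V : ℕ → Set X.BasePoint}
    {A : ℕ → Set X.Trans} (h : σ.IsBox K V A) : IsOpen (WayOn.q '' σ.box K V A) :=
  TopologicalSpace.isOpen_generateFrom_of_mem ⟨P, σ, K, V, A, h, rfl⟩

/-! ### Loops as ways -/

namespace Loop

variable {p : X.BasePoint}

/-- The partition of a loop. -/
def part (σ : X.Loop p) : Part := ⟨σ.n, σ.one_le, σ.t, σ.t_zero, σ.t_last, σ.t_lt⟩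

/-- A loop as a system from the unit interval. -/
def way (σ : X.Loop p) : WayOn σ.part p p :=
  ⟨σ.c, σ.c_cont, σ.g, σ.g_source, σ.g_target, σ.start, σ.finish⟩

/-- A system from the unit interval with equal ends as a loop. -/
def ofWay {P : Part} (σ : WayOn P p p) : X.Loop p :=
  ⟨P.n, P.one_le, P.t, P.t_zero, P.t_last, P.t_lt, σ.c, σ.c_cont, σ.g, σ.g_source, σ.g_target,
    σ.start, σ.finish⟩

lemma equiv_of_refines {τ σ : X.Loop p} (h : τ.Refines σ) : WayOn.Equiv τ.way σ.way := by
  obtain ⟨θ, J, h0, hl, hθ, hJ, hz, hL, hs⟩ := h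
  refine ⟨τ.part, id, θ, J, Part.Sub.refl _, ⟨fun k hk => (hθ k hk).1, fun k hk => (hθ k hk).2⟩,
    fun k hk => ?_, fun k hk s hs => ?_, fun k hk s hs => ?_, hz, hL, fun k hk => ?_⟩
  · obtain ⟨T, hT⟩ := hJ k hk
    exact ⟨T, fun s hs => (hT s hs).1⟩
  · exact ((hJ k hk).choose_spec s hs).2.1
  · exact ((hJ k hk).choose_spec s hs).2.2
  · obtain ⟨r, d, hr, h1, h2⟩ := hs k hk
    have e : σ.way.step (θ k) (θ (k + 1)) (τ.t (k + 1)) = r := by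
      rcases hr with ⟨e, rfl⟩ | ⟨e, rfl⟩
      · rw [e, WayOn.step_self]; rfl
      · rw [e, WayOn.step_succ]; rfl
    refine ⟨d, ?_, ?_⟩
    · rw [show τ.way.step (id k) (id (k + 1)) (τ.part.t (k + 1)) = τ.g k from
        WayOn.step_succ _ _ _]
      exact h1
    · rw [show τ.part.t (k + 1) = τ.t (k + 1) from rfl, e]; exact h2

lemma refines_of_gauge {P Q R : Part} {σ : WayOn P p p} {τ : WayOn Q p p} {J : ℕ → ℝ → X.Arrow}
    (h : WayOn.Gauge σ τ R θ θ' J) : (ofWay (σ.sub h.left)).Refines (ofWay τ) := by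
  refine ⟨θ', J, h.right.zero, h.right.last, fun k hk => ⟨h.right.le k hk, h.right.sub k hk⟩,
    fun k hk => ?_, fun s hs => ?_, fun s hs => ?_, fun k hk => ?_⟩
  · obtain ⟨T, hT⟩ := h.flat k hk
    exact ⟨T, fun s hs => ⟨hT s hs, h.source k hk s hs, h.target k hk s hs⟩⟩
  · refine (h.zero s hs).trans ?_
    change _ = Arrow.id (σ.c (θ 0) s)
    rw [h.left.zero]
  · refine (h.last s hs).trans ?_
    change _ = Arrow.id (σ.c (θ R.n) s)
    rw [h.left.last]
  · obtain ⟨d, h1, h2⟩ := h.sq k hk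
    refine ⟨_, d, ?_, h1, h2⟩
    rcases h.right.step hk with e | e
    · exact Or.inl ⟨e, by rw [e, WayOn.step_self]; rfl⟩
    · exact Or.inr ⟨e, by rw [e, WayOn.step_succ]; rfl⟩

lemma quot_eq_of_equiv {P Q : Part} {σ : WayOn P p p} {τ : WayOn Q p p} (h : WayOn.Equiv σ τ) :
    (Quot.mk _ (ofWay σ) : X.LoopSpace p) = Quot.mk _ (ofWay τ) := by
  obtain ⟨R, θ, θ', J, h⟩ := h
  rw [← Quot.sound (refines_of_gauge h)]
  exact (Quot.sound (refines_of_gauge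
    (h.trans h.symm : WayOn.Gauge σ σ R θ θ _))).symm

/-- The class of a loop in the space of systems from the unit interval. -/
def toWaySpace : X.LoopSpace p → WaySpace p p :=
  Quot.lift (fun σ => σ.way.q) fun _ _ h => WayOn.q_eq_iff.2 (equiv_of_refines h)

/-- The inverse of `toWaySpace`. -/
def ofWaySpace : WaySpace p p → X.LoopSpace p :=
  Quotient.lift (fun σ => Quot.mk _ (ofWay σ.2)) fun _ _ h => quot_eq_of_equiv h

lemma ofWaySpace_toWaySpace (α : X.LoopSpace p) : ofWaySpace (toWaySpace α) = α := by
  induction α using Quot.ind; rfl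

lemma toWaySpace_ofWaySpace (α : WaySpace p p) : toWaySpace (ofWaySpace α) = α := by
  induction α using Quotient.ind; rfl

lemma preimage_box (σ : X.Loop p) (K : ℕ → Set ℝ) (V : ℕ → Set X.BasePoint)
    (A : ℕ → Set X.Trans) : toWaySpace ⁻¹' (WayOn.q '' σ.way.box K V A) = loopNhd σ K V A := by
  ext α
  constructor
  · rintro ⟨τ, ⟨h1, h2, h3⟩, h4⟩
    exact ⟨ofWay τ, by rw [← ofWaySpace_toWaySpace α, ← h4]; rfl, rfl, fun _ _ => rfl, h1, h2, h3⟩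
  · rintro ⟨τ, rfl, hn, ht, h1, h2, h3⟩
    have hpc : ∀ k ≤ σ.n, σ.part.piece k = τ.part.piece k := fun k hk => by
      simp only [Part.piece, part]
      rw [ht k (by omega), ht (k + 1) (by omega)]
    let τ' : WayOn σ.part p p := ⟨τ.c, fun k hk => by rw [hpc k hk]; exact τ.c_cont k (hn ▸ hk), τ.g,
      fun k hk => by
        rw [← show τ.t (k + 1) = σ.part.t (k + 1) from ht (k + 1) (Nat.succ_le_succ hk.le)]
        exact τ.g_source k (hn ▸ hk),
      fun k hk => by
        rw [← show τ.t (k + 1) = σ.part.t (k + 1) from ht (k + 1) (Nat.succ_le_succ hk.le)]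
        exact τ.g_target k (hn ▸ hk), τ.start, by
        rw [← show τ.n = σ.part.n from hn]; exact τ.finish⟩
    have hsub : σ.part.Sub τ.part id := ⟨fun k hk => hk.trans hn.ge, fun k hk => (hpc k hk).subset⟩
    refine ⟨τ', ⟨h1, h2, h3⟩, ?_⟩
    have h5 : τ.way.sub hsub = τ' := by
      have : (τ.way.sub hsub).g = τ'.g := funext fun k => WayOn.step_succ _ _ _
      have h6 : (τ.way.sub hsub).c = τ'.c := rfl
      cases h : τ.way.sub hsub
      grind
    rw [← h5]
    exact WayOn.q_eq_iff.2 (WayOn.equiv_sub _ hsub)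

lemma continuous_toWaySpace : Continuous (toWaySpace (X := X) (p := p)) := by
  refine continuous_generateFrom_iff.2 ?_
  rintro _ ⟨P, σ, K, V, A, h, rfl⟩
  exact TopologicalSpace.isOpen_generateFrom_of_mem
    ⟨ofWay σ, K, V, A, h.1, h.2, preimage_box (ofWay σ) K V A⟩

lemma continuous_ofWaySpace : Continuous (ofWaySpace (X := X) (p := p)) := by
  refine continuous_generateFrom_iff.2 ?_
  rintro _ ⟨σ, K, V, A, h1, h2, rfl⟩
  have hb : σ.way.IsBox K V A := ⟨h1, h2⟩
  rw [← preimage_box, ← preimage_comp, show toWaySpace ∘ ofWaySpace (X := X) (p := p) = id from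
    funext toWaySpace_ofWaySpace, preimage_id]
  exact hb.isOpen

end Loop

end

open Arrow (ofHom exists_ofHom id_target ofHom_target ofHom_id isSq_ofHom comp_ofHom inv_ofHom
  ofHom_injective isComp_ofHom ofHom_source ofHom_trans IsSq)

section

variable {i j : X.ι} {S : Type*} {l : Filter S} {x : X.hat i} {ξ : X.Tran i j}

/-! ### Continuity properties of arrows -/

open Classical in
/-- The action of an element of `G i` on the points in the chart `i`. -/
def gmul (i : X.ι) (u : X.G i) (b : X.BasePoint) : X.BasePoint :=
  if h : b.1 = i then ⟨i, u • (h ▸ b.2 : X.hat i)⟩ else b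

lemma gmul_mk (u : X.G i) (x : X.hat i) : gmul i u ⟨i, x⟩ = ⟨i, u • x⟩ := by simp [gmul]

lemma gmul_one (b : X.BasePoint) : gmul i 1 b = b := by
  by_cases h : b.1 = i
  · obtain ⟨j, x⟩ := b
    obtain rfl : j = i := h
    rw [gmul_mk, one_smul]
  · rw [gmul, dif_neg h]

lemma continuous_gmul (i : X.ι) : Continuous fun p : X.G i × X.BasePoint => gmul i p.1 p.2 := by
  rw [continuous_iff_continuousAt]
  rintro ⟨u, j, x⟩
  have hn : 𝓝 (u, (⟨j, x⟩ : X.BasePoint)) =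
      map (Prod.map id (Sigma.mk j)) (𝓝 u ×ˢ 𝓝 x) := by
    rw [nhds_prod_eq, Sigma.nhds_mk, ← Filter.prod_map_map_eq', map_id]
  rw [ContinuousAt, hn, tendsto_map'_iff, ← nhds_prod_eq]
  by_cases h : j = i
  · subst h
    have e : (fun p : X.G j × X.BasePoint => gmul j p.1 p.2) ∘ Prod.map id (Sigma.mk j) =
        fun p : X.G j × X.hat j => (⟨j, p.1 • p.2⟩ : X.BasePoint) := by
      ext1 p
      exact gmul_mk _ _
    rw [e, gmul_mk]
    exact ((continuous_sigmaMk (σ := X.hat)).comp continuous_smul).tendsto (u, x)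
  · have e : (fun p : X.G i × X.BasePoint => gmul i p.1 p.2) ∘ Prod.map id (Sigma.mk j) =
        fun p : X.G i × X.hat j => (⟨j, p.2⟩ : X.BasePoint) := by
      ext1 p
      exact dif_neg h
    rw [e, show gmul i u ⟨j, x⟩ = (⟨j, x⟩ : X.BasePoint) from dif_neg h]
    exact ((continuous_sigmaMk (σ := X.hat)).comp continuous_snd).tendsto (u, x)

lemma tendsto_gmul (i : X.ι) {C : Set X.BasePoint} (hC : IsCompact C) :
    Tendsto (fun p : X.G i × X.BasePoint => gmul i p.1 p.2) (𝓝 1 ×ˢ 𝓝ˢ C) (𝓝ˢ C) := by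
  rw [← nhdsSet_singleton, ← isCompact_singleton.nhdsSet_prod_eq hC]
  refine (continuous_gmul i).tendsto_nhdsSet ?_
  rintro ⟨u, b⟩ ⟨hu, hb⟩
  obtain rfl : u = 1 := hu
  change gmul i 1 b ∈ C
  rwa [gmul_one]

lemma φ_lamExt (ξ : X.Tran i j) {g : X.G i}
    (hg : g ∈ stabilizer (X.G i) (X.φ ξ).source) (hx : x ∈ (X.φ ξ).source) :
    X.φ ξ (g • x) = lamExt ξ g • X.φ ξ x := by
  rw [lamExt, dif_pos hg]
  exact X.φ_smul ξ ⟨g, hg⟩ x hx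

lemma isOpen_fst (i : X.ι) : IsOpen {b : X.BasePoint | b.1 = i} := by
  have : {b : X.BasePoint | b.1 = i} = range (Sigma.mk i) := by grind
  rw [this]
  exact isOpen_range_sigmaMk

lemma exists_of_tendsto_trans {f : S → X.Trans} (h : Tendsto f l (𝓝 ⟨i, j, ξ⟩)) :
    ∃ η : S → X.Tran i j, Tendsto η l (𝓝 ξ) ∧ ∀ᶠ s in l, f s = ⟨i, j, η s⟩ := by
  classical
  rw [Sigma.nhds_mk, Sigma.nhds_mk, map_map] at h
  set m : X.Tran i j → X.Trans := Sigma.mk i ∘ Sigma.mk j with hm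
  have hinj : Function.Injective m := sigma_mk_injective.comp sigma_mk_injective
  let η : S → X.Tran i j := fun s => if hs : ∃ ζ, f s = m ζ then hs.choose else ξ
  have hv : ∀ᶠ s in l, f s = m (η s) := by
    have : range m ∈ map m (𝓝 ξ) := range_mem_map
    filter_upwards [h this] with s hs
    obtain ⟨g, hg⟩ := hs
    have hs : ∃ ζ, f s = m ζ := ⟨g, hg.symm⟩
    simp only [η, dif_pos hs]; exact hs.choose_spec
  refine ⟨η, fun N hN => ?_, hv⟩
  change ∀ᶠ s in l, η s ∈ N
  filter_upwards [h (image_mem_map hN), hv] with s hs hs2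
  obtain ⟨g, hg, hg2⟩ := hs
  rw [hs2] at hg2
  rwa [← hinj hg2]

lemma tendsto_trans_mk {η : S → X.Tran i j} (h : Tendsto η l (𝓝 ξ)) :
    Tendsto (fun s => (⟨i, j, η s⟩ : X.Trans)) l (𝓝 ⟨i, j, ξ⟩) :=
  ((continuous_sigmaMk (σ := fun i : X.ι => (j : X.ι) × X.Tran i j)).comp
    (continuous_sigmaMk (σ := fun j : X.ι => X.Tran i j))).continuousAt.tendsto.comp h

lemma eventually_comp_eq {k : X.ι} (η : X.Tran j k) (ξ : X.Tran i j) (x : X.hat i) (hx) (hy) :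
    ∀ᶠ z in 𝓝 x, ∃ hz hw, X.comp η ξ z hz hw = X.comp η ξ x hx hy := by
  have hO : IsOpen ((X.φ ξ).source ∩ X.φ ξ ⁻¹' (X.φ η).source) :=
    (X.φ ξ).isOpen_inter_preimage (X.φ η).open_source
  have hmem : x ∈ (X.φ ξ).source ∩ X.φ ξ ⁻¹' (X.φ η).source := ⟨hx, hy⟩
  filter_upwards [connectedComponentIn_mem_nhds (hO.mem_nhds hmem)] with z hz
  have hz' := connectedComponentIn_subset _ _ hz
  exact ⟨hz'.1, hz'.2, X.comp_const η ξ x z hx hy hz'.1 hz'.2 hz⟩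

namespace Arrow

lemma ext_of_trans {a a' : X.Arrow} (h : a.trans = a'.trans) (h' : a.source = a'.source) :
    a = a' := by
  obtain ⟨y, hy, e⟩ := exists_of_trans (ξ := a'.tr) h
  subst e
  have hy' : y = a'.pt := sigma_mk_injective (β := X.hat) h'
  subst hy'
  rfl

open Classical in
/-- The transition map `T` at the point `b` (a junk value if `b` is not in its domain). -/
def of (T : X.Trans) (b : X.BasePoint) : X.Arrow :=
  if h : ∃ a : X.Arrow, a.trans = T ∧ a.source = b then h.choose else Arrow.id b

lemma of_eq {T : X.Trans} {b : X.BasePoint} {a : X.Arrow} (h : a.trans = T) (h' : a.source = b) :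
    of T b = a := by
  have hh : ∃ a : X.Arrow, a.trans = T ∧ a.source = b := ⟨a, h, h'⟩
  rw [of, dif_pos hh]
  exact ext_of_trans (hh.choose_spec.1.trans h.symm) (hh.choose_spec.2.trans h'.symm)

lemma of_trans_source (a : X.Arrow) : of a.trans a.source = a := of_eq rfl rfl

lemma eventually_of (a : X.Arrow) :
    ∀ᶠ b in 𝓝 a.source, (of a.trans b).trans = a.trans ∧ (of a.trans b).source = b := by
  obtain ⟨ξ, x, hx⟩ := a
  change ∀ᶠ b in 𝓝 (⟨_, x⟩ : X.BasePoint), _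
  rw [Sigma.nhds_mk, eventually_map]
  filter_upwards [(X.φ ξ).open_source.mem_nhds hx] with z hz
  have h := of_eq (T := Arrow.trans ⟨ξ, x, hx⟩) (b := ⟨_, z⟩) (a := ⟨ξ, z, hz⟩) rfl rfl
  rw [h]; exact ⟨rfl, rfl⟩

lemma continuousAt_of_target (a : X.Arrow) :
    Tendsto (fun b => (of a.trans b).target) (𝓝 a.source) (𝓝 a.target) := by
  obtain ⟨ξ, x, hx⟩ := a
  change Tendsto _ (𝓝 (⟨_, x⟩ : X.BasePoint)) (𝓝 (⟨_, X.φ ξ x⟩ : X.BasePoint))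
  rw [Sigma.nhds_mk, tendsto_map'_iff]
  have h : Tendsto (fun z => (⟨_, X.φ ξ z⟩ : X.BasePoint)) (𝓝 x) (𝓝 ⟨_, X.φ ξ x⟩) :=
    (continuous_sigmaMk (σ := X.hat)).continuousAt.tendsto.comp ((X.φ ξ).continuousAt hx)
  refine h.congr' ?_
  filter_upwards [(X.φ ξ).open_source.mem_nhds hx] with z hz
  have h := of_eq (T := Arrow.trans ⟨ξ, x, hx⟩) (b := ⟨_, z⟩) (a := ⟨ξ, z, hz⟩) rfl rfl
  simp only [Function.comp, h]; rfl

lemma continuousOn_target {I : Set ℝ} {J : ℝ → X.Arrow} {T : X.Trans}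
    (hT : ∀ s ∈ I, (J s).trans = T) (hc : ContinuousOn (fun s => (J s).source) I) :
    ContinuousOn (fun s => (J s).target) I := by
  intro s hs
  have h := (continuousAt_of_target (J s)).comp (hc s hs)
  rw [hT s hs] at h
  refine Tendsto.congr' ?_ h
  filter_upwards [self_mem_nhdsWithin] with r hr
  simp only [Function.comp, ← hT r hr, of_trans_source]

lemma eventually_exists_hom {b : S → X.BasePoint} (h : Tendsto b l (𝓝 ⟨i, x⟩)) :
    ∃ z : S → X.hat i, Tendsto z l (𝓝 x) ∧ ∀ᶠ s in l, b s = ⟨i, z s⟩ := by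
  classical
  rw [Sigma.nhds_mk] at h
  let z : S → X.hat i := fun s => if hs : ∃ ζ : X.hat i, b s = ⟨i, ζ⟩ then hs.choose else x
  have hv : ∀ᶠ s in l, b s = ⟨i, z s⟩ := by
    have : range (Sigma.mk i) ∈ map (Sigma.mk i) (𝓝 x) := range_mem_map
    filter_upwards [h this] with s hs
    obtain ⟨g, hg⟩ := hs
    have hs : ∃ ζ : X.hat i, b s = ⟨i, ζ⟩ := ⟨g, hg.symm⟩
    simp only [z, dif_pos hs]; exact hs.choose_spec
  refine ⟨z, fun N hN => ?_, hv⟩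
  change ∀ᶠ s in l, z s ∈ N
  filter_upwards [h (image_mem_map hN), hv] with s hs hs2
  obtain ⟨g, hg, hg2⟩ := hs
  rw [hs2] at hg2
  rwa [← sigma_mk_injective hg2]

/-- Conjugation by fixed transition maps is continuous. -/
lemma tendsto_conj {x y x' y' : X.BasePoint} (a : x ⟶ y) (J : x ⟶ x') (J' : y ⟶ y')
    {f : S → X.Arrow} (hf : Tendsto (fun s => (f s).trans) l (𝓝 (ofHom a).trans))
    (hs : Tendsto (fun s => (f s).source) l (𝓝 x)) (ht : Tendsto (fun s => (f s).target) l (𝓝 y)) :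
    Tendsto (fun s => (comp (of (ofHom J').trans (f s).target)
      (comp (f s) (inv (of (ofHom J).trans (f s).source)))).trans) l
      (𝓝 (ofHom (Groupoid.inv J ≫ a ≫ J')).trans) := by
  induction x, x', J using Hom.rec_homMk with
  | h i i' ζ x hx =>
  obtain ⟨j, y⟩ := y
  obtain ⟨j', y'⟩ := y'
  obtain ⟨η, hη, hηf⟩ := exists_of_tendsto_trans (ξ := a.1) hf
  obtain ⟨v, hv, hvη⟩ := exists_bi_of_tendsto hη
  obtain ⟨z, hz, hzf⟩ := eventually_exists_hom hs
  set c₀ : X.Tran i' j' := (Groupoid.inv (homMk ζ x hx) ≫ a ≫ J').1 with hc₀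
  have key : ∀ᶠ s in l, (comp (of (ofHom J').trans (f s).target)
      (comp (f s) (inv (of (ofHom (homMk ζ x hx)).trans (f s).source)))).trans =
      ⟨i', j', X.bi (lamExt J'.1 (v s)) c₀ 1⟩ := by
    have hax : x ∈ (X.φ a.1).source := a.2.1
    have hay : X.φ a.1 x = y := a.2.2
    have hJy : X.φ a.1 x ∈ (X.φ J'.1).source := by rw [hay]; exact J'.2.1
    have e1 := eventually_comp_eq J'.1 a.1 x hax hJy
    have hc₁ : c₀ = X.comp (X.comp J'.1 a.1 x hax hJy) (Orbispace.inv ζ) (X.φ ζ x) (φ_mem_inv hx)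
        (by rw [φ_inv_φ hx]; exact X.comp_mem _ _ _ _ _) := by
      rw [hc₀, comp_val]
      exact comp_congr rfl (Hom.inv_val _) rfl _ _
    have e2 := (((X.φ ζ).continuousAt hx).eventually (eventually_comp_eq (X.comp J'.1 a.1 x hax hJy)
      (Orbispace.inv ζ) (X.φ ζ x) (φ_mem_inv hx)
      (by rw [φ_inv_φ hx]; exact X.comp_mem _ _ _ _ _)))
    filter_upwards [hηf, hvη, hzf, hz.eventually e1, hz.eventually e2,
      hz.eventually ((X.φ ζ).open_source.mem_nhds hx),
      hv.eventually ((isOpen_stabilizer_source J'.1).mem_nhds (one_mem _))]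
      with s s1 s2 s3 ⟨hwa, hwJ, s4⟩ ⟨h5, h5', s5⟩ hwζ s7
    generalize z s = w at *
    have hφ : X.φ J'.1 (v s • X.φ a.1 w) = lamExt J'.1 (v s) • X.φ J'.1 (X.φ a.1 w) := by
      exact φ_lamExt J'.1 s7 hwJ
    have hmem : v s • X.φ a.1 w ∈ (X.φ J'.1).source := by
      rw [← show v s • (X.φ J'.1).source = _ from s7]
      exact smul_mem_smul_set hwJ
    let Jw := homMk ζ w hwζ
    let aw := homMk a.1 w hwa
    let J0 := homMk J'.1 _ hwJ
    let J1 : (⟨j, v s • X.φ a.1 w⟩ : X.BasePoint) ⟶ ⟨j', lamExt J'.1 (v s) • X.φ J'.1 (X.φ a.1 w)⟩ :=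
      ⟨J'.1, hmem, hφ⟩
    have hsq : homG (v s) (X.φ a.1 w) ≫ J1 = J0 ≫ homG (lamExt J'.1 (v s)) _ := by
      refine Subtype.ext ?_
      rw [comp_val, comp_val]
      exact (comp_ofG _ _ _ _ _).trans ((bi_lamExt _ s7).trans (ofG_comp _ _ _ _ _).symm)
    have hfs : f s = ofHom (aw ≫ homG (v s) _) := by
      refine ext_of_trans ?_ s3
      rw [s1, s2, ofHom_trans]
      exact congrArg (fun η => (⟨i, j, η⟩ : X.Trans)) (ofG_comp _ _ _ _ _).symm
    have hof1 : of (ofHom (homMk ζ x hx)).trans (f s).source = ofHom Jw := by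
      rw [hfs, ofHom_source]; exact of_eq rfl rfl
    have hof2 : of (ofHom J').trans (f s).target = ofHom J1 := by
      rw [hfs, ofHom_target]; exact of_eq rfl rfl
    rw [hof1, hof2, hfs, inv_ofHom, comp_ofHom, comp_ofHom, assoc, assoc, hsq,
      ← assoc aw, ← assoc, ofHom_trans]
    refine congrArg (fun η => (⟨i', j', η⟩ : X.Trans)) ?_
    rw [comp_val]
    refine (ofG_comp _ _ _ _ _).trans ?_
    congr 1
    rw [hc₁, ← s5, comp_val]
    exact comp_congr s4 (Hom.inv_val _) rfl _ _
  have hlim : Tendsto (fun s => X.bi (lamExt J'.1 (v s)) c₀ 1) l (𝓝 c₀) := by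
    have := ((continuous_bi_left c₀).tendsto 1).comp ((tendsto_lamExt J'.1).comp hv)
    rwa [X.bi_one] at this
  exact (tendsto_trans_mk hlim).congr' (key.mono fun s hs => hs.symm)

end Arrow

end

section

variable {k : ℕ} {r : ℝ} {S : Type*} {l : Filter S}

lemma eventually_forall_mem {K : Set ℝ} (hK : IsCompact K) {p : S → ℝ → Prop}
    (h : ∀ r ∈ K, ∀ᶠ q : S × ℝ in l ×ˢ 𝓝[K] r, p q.1 q.2) : ∀ᶠ s in l, ∀ r ∈ K, p s r := by
  refine hK.induction_on (p := fun T => ∀ᶠ s in l, ∀ r ∈ T, p s r) (by simp) ?_ ?_ ?_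
  · exact fun A B hAB hB => hB.mono fun s hs r hr => hs r (hAB hr)
  · intro A B hA hB
    filter_upwards [hA, hB] with s h1 h2 r hr
    exact hr.elim (h1 r) (h2 r)
  · intro r hr
    obtain ⟨pa, ha, pb, hb, hab⟩ := eventually_prod_iff.1 (h r hr)
    exact ⟨_, hb, ha.mono fun s hs r' hr' => hab hs hr'⟩

lemma exists_of_eventually {T : Type*} {p : S → T → Prop} (f : S → T)
    (h : ∀ᶠ s in l, ∃ t, p s t) : ∃ g : S → T, ∀ᶠ s in l, p s (g s) := by
  classical
  refine ⟨fun s => if hs : ∃ t, p s t then hs.choose else f s, h.mono fun s hs => ?_⟩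
  simp only [dif_pos hs]
  exact hs.choose_spec

lemma Arrow.id_trans_congr {b b' : X.BasePoint} (h : b.1 = b'.1) :
    (Arrow.id b).trans = (Arrow.id b').trans := by
  obtain ⟨i, x⟩ := b
  obtain ⟨i', x'⟩ := b'
  obtain rfl : i = i' := h
  rfl

namespace Part

variable {P R : Part} {θ : ℕ → ℕ}

lemma exists_piece_Ioc (hr : r ∈ Ioc (0 : ℝ) 1) : ∃ k ≤ P.n, r ∈ Ioc (P.t k) (P.t (k + 1)) := by
  rcases hr.2.eq_or_lt with rfl | h
  · exact ⟨P.n, le_rfl, by have := P.t_lt P.n le_rfl; rwa [P.t_last] at this, P.t_last.ge⟩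
  · obtain ⟨k, hk, h1, h2⟩ := P.exists_piece ⟨hr.1.le, h⟩
    rcases h1.eq_or_lt with h1 | h1
    · obtain ⟨m, rfl⟩ : ∃ m, k = m + 1 := ⟨k - 1, by
        rcases Nat.eq_zero_or_pos k with rfl | hk0
        · rw [P.t_zero] at h1; exact absurd hr.1 (by simp [h1])
        · omega⟩
      exact ⟨m, by omega, by rw [← h1]; exact P.t_lt m (by omega), h1.ge⟩
    · exact ⟨k, hk, h1, h2.le⟩

lemma Sub.exists_junction (h : R.Sub P θ) {l : ℕ} (hl : l < P.n) :
    ∃ m < R.n, θ m = l ∧ θ (m + 1) = l + 1 ∧ R.t (m + 1) = P.t (l + 1) := by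
  have h0 : P.t (l + 1) ∈ Ioc (0 : ℝ) 1 := by
    refine ⟨?_, (P.t_mem (by omega)).2⟩
    rw [← P.t_zero]; exact P.t_strict (by omega) (by omega)
  have h1 : P.t (l + 1) < 1 := by rw [← P.t_last]; exact P.t_strict (by omega) le_rfl
  obtain ⟨m, hm, hm1, hm2⟩ := R.exists_piece_Ioc h0
  have a := h.sub m hm (R.left_mem hm)
  have b := h.sub m hm (R.right_mem hm)
  have c := h.le m hm
  have d := P.t_lt l hl.le
  have e1 : θ m < l + 1 := P.lt_of_t_lt (by omega) (a.1.trans_lt hm1)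
  have e2 : l < θ m + 1 := P.lt_of_t_lt (by omega) (by linarith [b.2])
  have e3 : θ m = l := by omega
  rw [e3] at a b
  have e4 : R.t (m + 1) = P.t (l + 1) := le_antisymm b.2 hm2
  have hmn : m < R.n := by
    rcases hm.lt_or_eq with h | rfl
    · exact h
    · rw [R.t_last] at e4; linarith
  refine ⟨m, hmn, e3, ?_, e4⟩
  rcases h.step hmn with e | e
  · have f := h.sub (m + 1) hmn (R.right_mem hmn)
    rw [e, e3] at f
    have := R.t_lt (m + 1) hmn
    linarith [f.2]
  · rw [e, e3]

lemma Sub.exists_mem_piece (h : R.Sub P θ) {l : ℕ} (hl : l ≤ P.n) (hr : r ∈ P.piece l) :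
    ∃ m ≤ R.n, θ m = l ∧ r ∈ R.piece m := by
  have hr1 := P.piece_subset hl hr
  rcases hr.2.lt_or_eq with h1 | h1
  · obtain ⟨m, hm, hm1, hm2⟩ := R.exists_piece (r := r) ⟨hr1.1, h1.trans_le (P.t_mem (by omega)).2⟩
    have a := h.sub m hm (R.left_mem hm)
    have b := h.sub m hm (R.right_mem hm)
    have c := h.le m hm
    have e1 : θ m < l + 1 := P.lt_of_t_lt (by omega) (by linarith [a.1])
    have e2 : l < θ m + 1 := P.lt_of_t_lt (by omega) (by linarith [b.2, hr.1])
    exact ⟨m, hm, by omega, hm1, hm2.le⟩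
  · have d := P.t_lt l hl
    obtain ⟨m, hm, hm1, hm2⟩ := R.exists_piece_Ioc (r := r) ⟨by linarith [(P.t_mem (k := l) (by omega)).1], hr1.2⟩
    have a := h.sub m hm (R.left_mem hm)
    have b := h.sub m hm (R.right_mem hm)
    have c := h.le m hm
    have e1 : θ m < l + 1 := P.lt_of_t_lt (by omega) (by linarith [a.1])
    have e2 : l < θ m + 1 := P.lt_of_t_lt (by omega) (by linarith [b.2])
    exact ⟨m, hm, by omega, hm1.le, hm2⟩

/-- The pieces of `R` in the `l`-th piece of `P` that contain `r`. -/
def fibre (R : Part) (θ : ℕ → ℕ) (l : ℕ) (r : ℝ) : Set ℕ := {m | m ≤ R.n ∧ θ m = l ∧ r ∈ R.piece m}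

lemma fibre_finite (R : Part) (θ : ℕ → ℕ) (l : ℕ) (r : ℝ) : (R.fibre θ l r).Finite :=
  (finite_le_nat R.n).subset fun _ h => h.1

lemma Sub.nhdsWithin_le (h : R.Sub P θ) {l : ℕ} (hl : l ≤ P.n) :
    𝓝[P.piece l] r ≤ ⨆ m ∈ R.fibre θ l r, 𝓝[R.piece m] r := by
  rw [← nhdsWithin_biUnion (R.fibre_finite θ l r)]
  refine nhdsWithin_le_iff.2 ?_
  have h1 : ∀ᶠ r' in 𝓝 r, ∀ m ∈ {m | m ≤ R.n}, r ∉ R.piece m → r' ∉ R.piece m := by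
    refine (eventually_all_finite (finite_le_nat R.n)).2 fun m _ => ?_
    by_cases hm : r ∈ R.piece m
    · simp_all
    · filter_upwards [(isClosed_Icc (a := R.t m) (b := R.t (m + 1))).isOpen_compl.mem_nhds hm]
        with r' hr' _ using hr'
  filter_upwards [mem_nhdsWithin_of_mem_nhds h1, self_mem_nhdsWithin] with r' h2 h3
  obtain ⟨m, hm, hml, hmr⟩ := h.exists_mem_piece hl h3
  refine mem_biUnion (x := m) ⟨hm, hml, ?_⟩ hmr
  by_contra hc
  exact h2 m hm hc hmr

end Part

namespace WayOn

variable {P Q R : Part} {x y z : X.BasePoint} {S : Type*} {l : Filter S}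

lemma fst_eq (σ : WayOn P x y) (hk : k ≤ P.n) {s : ℝ} (hr : r ∈ P.piece k) (hs : s ∈ P.piece k) :
    (σ.c k r).1 = (σ.c k s).1 :=
  fst_eq_of_isPreconnected (I := P.piece k) isPreconnected_Icc (σ.c_cont k hk) hr hs

lemma equiv_of_gauge {σ τ : WayOn P x y} (J : ℕ → ℝ → X.Arrow)
    (flat : ∀ k ≤ P.n, ∃ T : X.Trans, ∀ s ∈ P.piece k, (J k s).trans = T)
    (source : ∀ k ≤ P.n, ∀ s ∈ P.piece k, (J k s).source = σ.c k s)
    (target : ∀ k ≤ P.n, ∀ s ∈ P.piece k, (J k s).target = τ.c k s)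
    (zero : ∀ s ∈ P.piece 0, J 0 s = Arrow.id (σ.c 0 s))
    (last : ∀ s ∈ P.piece P.n, J P.n s = Arrow.id (σ.c P.n s))
    (sq : ∀ k < P.n, IsSq (σ.g k) (τ.g k) (J k (P.t (k + 1))) (J (k + 1) (P.t (k + 1)))) :
    Equiv σ τ :=
  ⟨P, id, id, J, Part.Sub.refl P, Part.Sub.refl P, flat, source, target, zero, last, fun k hk => by
    simpa only [id, step_succ] using sq k hk⟩

lemma flat_id (σ : WayOn P x y) (hk : k ≤ P.n) :
    ∃ T : X.Trans, ∀ s ∈ P.piece k, (Arrow.id (σ.c k s)).trans = T := by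
  refine ⟨(Arrow.id (σ.c k (P.t k))).trans, fun s hs => ?_⟩
  exact Arrow.id_trans_congr (σ.fst_eq hk hs (P.left_mem hk))

lemma exists_hom_g (σ : WayOn P x y) (hk : k < P.n) :
    ∃ f : σ.c k (P.t (k + 1)) ⟶ σ.c (k + 1) (P.t (k + 1)), σ.g k = ofHom f :=
  exists_ofHom (σ.g_source k hk) (σ.g_target k hk)

lemma equiv_of_eqOn {σ τ : WayOn P x y} (hc : ∀ k ≤ P.n, EqOn (σ.c k) (τ.c k) (P.piece k))
    (hg : ∀ k < P.n, σ.g k = τ.g k) : Equiv σ τ := by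
  refine equiv_of_gauge (fun k s => Arrow.id (σ.c k s)) (fun k hk => σ.flat_id hk)
    (fun _ _ _ _ => rfl) (fun k hk s hs => (id_target _).trans (hc k hk hs))
    (fun _ _ => rfl) (fun _ _ => rfl) fun k hk => ?_
  obtain ⟨f, hf⟩ := σ.exists_hom_g hk
  rw [← hg k hk, hf, ← ofHom_id, ← ofHom_id, isSq_ofHom, id_comp,
    comp_id]

/-- The isomorphic system obtained by applying transition maps to all the pieces. -/
def gauge (σ : WayOn P x y) (J : ℕ → ℝ → X.Arrow)
    (flat : ∀ k ≤ P.n, ∃ T : X.Trans, ∀ s ∈ P.piece k, (J k s).trans = T)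
    (source : ∀ k ≤ P.n, ∀ s ∈ P.piece k, (J k s).source = σ.c k s)
    (zero : ∀ s ∈ P.piece 0, J 0 s = Arrow.id (σ.c 0 s))
    (last : ∀ s ∈ P.piece P.n, J P.n s = Arrow.id (σ.c P.n s)) : WayOn P x y where
  c k r := (J k r).target
  c_cont k hk := by
    obtain ⟨T, hT⟩ := flat k hk
    exact Arrow.continuousOn_target hT ((σ.c_cont k hk).congr (source k hk))
  g k := Arrow.comp (J (k + 1) (P.t (k + 1))) (Arrow.comp (σ.g k) (Arrow.inv (J k (P.t (k + 1)))))
  g_source k hk := by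
    obtain ⟨f, hf⟩ := σ.exists_hom_g hk
    obtain ⟨j, hj⟩ := exists_ofHom (source k hk.le _ (P.right_mem hk.le)) rfl
    obtain ⟨j', hj'⟩ := exists_ofHom (source (k + 1) hk _ (P.left_mem hk)) rfl
    rw [hf, hj, hj', inv_ofHom, comp_ofHom, comp_ofHom, ofHom_source]
    exact (ofHom_target j).symm
  g_target k hk := by
    obtain ⟨f, hf⟩ := σ.exists_hom_g hk
    obtain ⟨j, hj⟩ := exists_ofHom (source k hk.le _ (P.right_mem hk.le)) rfl
    obtain ⟨j', hj'⟩ := exists_ofHom (source (k + 1) hk _ (P.left_mem hk)) rfl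
    rw [hf, hj, hj', inv_ofHom, comp_ofHom, comp_ofHom, ofHom_target]
    exact (ofHom_target j').symm
  start := by rw [zero _ P.zero_mem, id_target, σ.start]
  finish := by rw [last _ P.one_mem, id_target, σ.finish]

lemma equiv_gauge (σ : WayOn P x y) (J : ℕ → ℝ → X.Arrow) (flat) (source) (zero) (last) :
    Equiv (σ.gauge J flat source zero last) σ := by
  refine (equiv_of_gauge J flat source (fun _ _ _ _ => rfl) zero last fun k hk => ?_).symm
  obtain ⟨f, hf⟩ := σ.exists_hom_g hk
  obtain ⟨j, hj⟩ := exists_ofHom (source k hk.le _ (P.right_mem hk.le)) rfl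
  obtain ⟨j', hj'⟩ := exists_ofHom (source (k + 1) hk _ (P.left_mem hk)) rfl
  change IsSq _ (Arrow.comp _ _) _ _
  rw [hf, hj, hj', inv_ofHom, comp_ofHom, comp_ofHom, isSq_ofHom,
    Groupoid.inv_eq_inv]
  simp

/-- Convergence of a family of systems on the same partition. The values at `r` of the `k`-th
piece are required to approach the compact set `C k r`. -/
structure Conv (l : Filter S) (σ' : S → WayOn P x y) (σ : WayOn P x y)
    (C : ℕ → ℝ → Set X.BasePoint) : Prop where
  compact : ∀ k ≤ P.n, ∀ r ∈ P.piece k, IsCompact (C k r)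
  chart : ∀ k ≤ P.n, ∀ r ∈ P.piece k, ∀ b ∈ C k r, b.1 = (σ.c k r).1
  c : ∀ k ≤ P.n, ∀ r ∈ P.piece k,
    Tendsto (fun p : S × ℝ => (σ' p.1).c k p.2) (l ×ˢ 𝓝[P.piece k] r) (𝓝ˢ (C k r))
  g : ∀ k < P.n, Tendsto (fun s => ((σ' s).g k).trans) l (𝓝 (σ.g k).trans)

/-- Convergence of a family of systems on the same partition to a system. -/
abbrev Lim (l : Filter S) (σ' : S → WayOn P x y) (σ : WayOn P x y) : Prop :=
  Conv l σ' σ fun k r => {σ.c k r}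

variable {σ : WayOn P x y} {σ' : S → WayOn P x y} {C : ℕ → ℝ → Set X.BasePoint}

lemma Conv.mono {D : ℕ → ℝ → Set X.BasePoint} (h : Conv l σ' σ C)
    (hCD : ∀ k ≤ P.n, ∀ r ∈ P.piece k, C k r ⊆ D k r)
    (hD : ∀ k ≤ P.n, ∀ r ∈ P.piece k, IsCompact (D k r))
    (hD' : ∀ k ≤ P.n, ∀ r ∈ P.piece k, ∀ b ∈ D k r, b.1 = (σ.c k r).1) : Conv l σ' σ D :=
  ⟨hD, hD', fun k hk r hr => (h.c k hk r hr).mono_right (nhdsSet_mono (hCD k hk r hr)), h.g⟩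

lemma Conv.mono_filter {l' : Filter S} (h : Conv l σ' σ C) (hl : l' ≤ l) : Conv l' σ' σ C :=
  ⟨h.compact, h.chart, fun k hk r hr => (h.c k hk r hr).mono_left (Filter.prod_mono_left _ hl),
    fun k hk => (h.g k hk).mono_left hl⟩

lemma Lim.mk (hc : ∀ k ≤ P.n, ∀ r ∈ P.piece k,
      Tendsto (fun p : S × ℝ => (σ' p.1).c k p.2) (l ×ˢ 𝓝[P.piece k] r) (𝓝 (σ.c k r)))
    (hg : ∀ k < P.n, Tendsto (fun s => ((σ' s).g k).trans) l (𝓝 (σ.g k).trans)) : Lim l σ' σ :=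
  ⟨fun _ _ _ _ => isCompact_singleton, fun _ _ _ _ b hb => by rw [mem_singleton_iff.1 hb],
    fun k hk r hr => by rw [nhdsSet_singleton]; exact hc k hk r hr, hg⟩

lemma Lim.tendsto (h : Lim l σ' σ) (hk : k ≤ P.n) (hr : r ∈ P.piece k) :
    Tendsto (fun p : S × ℝ => (σ' p.1).c k p.2) (l ×ˢ 𝓝[P.piece k] r) (𝓝 (σ.c k r)) := by
  have := h.c k hk r hr
  rwa [nhdsSet_singleton] at this

lemma Lim.tendsto_apply (h : Lim l σ' σ) (hk : k ≤ P.n) (hr : r ∈ P.piece k) :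
    Tendsto (fun s => (σ' s).c k r) l (𝓝 (σ.c k r)) :=
  (h.tendsto hk hr).comp (tendsto_id.prodMk (tendsto_const_nhdsWithin hr))

lemma Conv.eventually_mem (h : Conv l σ' σ C) (hk : k ≤ P.n) {K : Set ℝ} (hK : IsCompact K)
    (hKP : K ⊆ P.piece k) {V : Set X.BasePoint} (hV : IsOpen V) (hC : ∀ r ∈ K, C k r ⊆ V) :
    ∀ᶠ s in l, MapsTo ((σ' s).c k) K V :=
  eventually_forall_mem (p := fun s r => (σ' s).c k r ∈ V) hK fun r hr =>
    ((h.c k hk r (hKP hr)).mono_left (Filter.prod_mono_right _ (nhdsWithin_mono r hKP))).eventually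
      (hV.mem_nhdsSet.2 (hC r hr))

lemma Conv.chart_eq (h : Conv l σ' σ C) (hk : k ≤ P.n) :
    ∀ᶠ s in l, ∀ r ∈ P.piece k, ((σ' s).c k r).1 = (σ.c k r).1 := by
  filter_upwards [h.eventually_mem hk (K := P.piece k) isCompact_Icc Subset.rfl
    (isOpen_fst (σ.c k (P.t k)).1) fun r hr b hb =>
      (h.chart k hk r hr b hb).trans (σ.fst_eq hk hr (P.left_mem hk))] with s hs r hr
  exact (hs hr).trans (σ.fst_eq hk (P.left_mem hk) hr)

lemma exists_gauge (σ' : S → WayOn P x y) (J : S → ℕ → ℝ → X.Arrow)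
    (h : ∀ᶠ s in l,
      (∀ k ≤ P.n, ∃ T : X.Trans, ∀ r ∈ P.piece k, (J s k r).trans = T) ∧
      (∀ k ≤ P.n, ∀ r ∈ P.piece k, (J s k r).source = (σ' s).c k r) ∧
      (∀ r ∈ P.piece 0, J s 0 r = Arrow.id ((σ' s).c 0 r)) ∧
      ∀ r ∈ P.piece P.n, J s P.n r = Arrow.id ((σ' s).c P.n r)) :
    ∃ τ' : S → WayOn P x y, ∀ᶠ s in l, Equiv (τ' s) (σ' s) ∧
      (∀ k r, (τ' s).c k r = (J s k r).target) ∧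
      ∀ k, (τ' s).g k = Arrow.comp (J s (k + 1) (P.t (k + 1)))
        (Arrow.comp ((σ' s).g k) (Arrow.inv (J s k (P.t (k + 1))))) := by
  have key : ∀ᶠ s in l, ∃ τ : WayOn P x y, Equiv τ (σ' s) ∧
      (∀ k r, τ.c k r = (J s k r).target) ∧
      ∀ k, τ.g k = Arrow.comp (J s (k + 1) (P.t (k + 1)))
        (Arrow.comp ((σ' s).g k) (Arrow.inv (J s k (P.t (k + 1))))) := h.mono fun s hs =>
    ⟨(σ' s).gauge (J s) hs.1 hs.2.1 hs.2.2.1 hs.2.2.2, equiv_gauge _ _ _ _ _ _,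
      fun _ _ => rfl, fun _ => rfl⟩
  obtain ⟨τ', hτ'⟩ := exists_of_eventually σ' key
  exact ⟨τ', hτ'⟩

end WayOn

end

lemma tendsto_bi {S : Type*} {l : Filter S} {i j : X.ι} {ξ : X.Tran i j} {η : S → X.Tran i j}
    {a : S → X.G j} {b : S → X.G i} (h : Tendsto η l (𝓝 ξ)) (ha : Tendsto a l (𝓝 1))
    (hb : Tendsto b l (𝓝 1)) : Tendsto (fun s => X.bi (a s) (η s) (b s)) l (𝓝 ξ) := by
  obtain ⟨v, hv, hvη⟩ := exists_bi_of_tendsto h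
  have h1 := (continuous_bi ξ).tendsto (1, 1)
  rw [X.bi_one, nhds_prod_eq] at h1
  have h2 : Tendsto (fun s => (a s * v s, b s)) l (𝓝 1 ×ˢ 𝓝 1) := by
    refine Tendsto.prodMk ?_ hb
    simpa using ha.mul hv
  refine (h1.comp h2).congr' (hvη.mono fun s hs => ?_)
  change X.bi (a s * v s) ξ (b s) = X.bi (a s) (η s) (b s)
  rw [hs, X.bi_bi, one_mul]

lemma trans_mk_inj {i j : X.ι} {ξ η : X.Tran i j}
    (h : (⟨i, j, ξ⟩ : X.Trans) = ⟨i, j, η⟩) : ξ = η :=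
  sigma_mk_injective (sigma_mk_injective (β := fun i : X.ι => (j : X.ι) × X.Tran i j) h)

lemma prod_biSup_le {α β ι : Type*} (l : Filter α) {M : Set ι} (hM : M.Finite)
    (g : ι → Filter β) : l ×ˢ (⨆ m ∈ M, g m) ≤ ⨆ m ∈ M, l ×ˢ g m := by
  induction M, hM using Set.Finite.induction_on with
  | empty => simp
  | insert _ _ ih =>
    rw [iSup_insert, iSup_insert, Filter.prod_sup]
    exact sup_le_sup le_rfl ih

namespace WayOn

variable {P Q R : Part} {x y z : X.BasePoint} {S : Type*} {l : Filter S}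
  {σ : WayOn P x y} {σ' : S → WayOn P x y} {C : ℕ → ℝ → Set X.BasePoint}

/-- The chart of the `k`-th piece. -/
def ch (σ : WayOn P x y) (k : ℕ) : X.ι := (σ.c k (P.t k)).1

lemma fst_eq_ch (σ : WayOn P x y) {k : ℕ} (hk : k ≤ P.n) {r : ℝ} (hr : r ∈ P.piece k) :
    (σ.c k r).1 = σ.ch k := σ.fst_eq hk hr (P.left_mem hk)

lemma exists_trans (σ : WayOn P x y) {k : ℕ} (hk : k < P.n) :
    ∃ ξ : X.Tran (σ.ch k) (σ.ch (k + 1)), (σ.g k).trans = ⟨_, _, ξ⟩ := by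
  have h1 : (σ.g k).i = σ.ch k := by
    rw [← σ.fst_eq_ch hk.le (P.right_mem hk.le), ← σ.g_source k hk]; rfl
  have h2 : (σ.g k).j = σ.ch (k + 1) := by
    rw [← σ.fst_eq_ch hk (P.left_mem hk), ← σ.g_target k hk]; rfl
  rw [← h1, ← h2]
  exact ⟨_, rfl⟩

/-- Gauging by elements of the groups that converge to the neutral element. -/
lemma Conv.exists_gauge_smul (h : Conv l σ' σ C) (u : ∀ k, S → X.G (σ.ch k))
    (hu : ∀ k, Tendsto (u k) l (𝓝 1)) (h0 : u 0 = 1) (hn : u P.n = 1) :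
    ∃ τ' : S → WayOn P x y, (∀ᶠ s in l, Equiv (τ' s) (σ' s)) ∧ Conv l τ' σ C ∧
      ∀ k < P.n, ∀ η : S → X.Tran (σ.ch k) (σ.ch (k + 1)),
        (∀ᶠ s in l, ((σ' s).g k).trans = ⟨_, _, η s⟩) →
        ∀ᶠ s in l, ((τ' s).g k).trans = ⟨_, _, X.bi (u (k + 1) s) (η s) (u k s)⁻¹⟩ := by
  let J : S → ℕ → ℝ → X.Arrow := fun s k r =>
    Arrow.of ⟨σ.ch k, σ.ch k, X.ofG _ (u k s)⟩ ((σ' s).c k r)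
  have hch : ∀ᶠ s in l, ∀ k ≤ P.n, ∀ r ∈ P.piece k, ((σ' s).c k r).1 = σ.ch k := by
    refine (eventually_all_finite (finite_le_nat P.n)).2 fun k hk => ?_
    filter_upwards [h.chart_eq hk] with s hs r hr
    rw [hs r hr, σ.fst_eq_ch hk hr]
  have hJ : ∀ s k r z, (σ' s).c k r = ⟨σ.ch k, z⟩ → J s k r = ofHom (homG (u k s) z) := by
    intro s k r z hz
    exact Arrow.of_eq rfl hz.symm
  have hex : ∀ {i : X.ι} {b : X.BasePoint}, b.1 = i → ∃ z : X.hat i, b = ⟨i, z⟩ := by grind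
  have hid : ∀ s, ∀ k ≤ P.n, u k = 1 → (∀ r ∈ P.piece k, ((σ' s).c k r).1 = σ.ch k) →
      ∀ r ∈ P.piece k, J s k r = Arrow.id ((σ' s).c k r) := by
    intro s k hk huk hs r hr
    obtain ⟨z, hz⟩ := hex (hs r hr)
    refine Arrow.of_eq ?_ rfl
    rw [huk, Arrow.id_trans_congr (b' := ⟨σ.ch k, z⟩) (hs r hr), Pi.one_apply, ofG_one]; rfl
  obtain ⟨τ', hτ'⟩ := exists_gauge (l := l) σ' J (by
    filter_upwards [hch] with s hs
    refine ⟨fun k hk => ⟨⟨σ.ch k, σ.ch k, X.ofG _ (u k s)⟩, fun r hr => ?_⟩, fun k hk r hr => ?_,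
      hid s 0 (Nat.zero_le _) h0 (hs 0 (Nat.zero_le _)), hid s _ le_rfl hn (hs _ le_rfl)⟩
    · obtain ⟨z, hz⟩ := hex (hs k hk r hr)
      rw [hJ s k r z hz]; rfl
    · obtain ⟨z, hz⟩ := hex (hs k hk r hr)
      rw [hJ s k r z hz, hz]; rfl)
  have hg : ∀ k < P.n, ∀ η : S → X.Tran (σ.ch k) (σ.ch (k + 1)),
        (∀ᶠ s in l, ((σ' s).g k).trans = ⟨_, _, η s⟩) →
        ∀ᶠ s in l, ((τ' s).g k).trans = ⟨_, _, X.bi (u (k + 1) s) (η s) (u k s)⁻¹⟩ := by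
    intro k hk η hη
    filter_upwards [hτ', hch, hη] with s ⟨_, _, h3⟩ h4 h5
    rw [h3]
    obtain ⟨z, hz⟩ := hex (h4 k hk.le _ (P.right_mem hk.le))
    obtain ⟨z', hz'⟩ := hex (h4 (k + 1) hk _ (P.left_mem hk))
    rw [hJ _ _ _ _ hz, hJ _ _ _ _ hz']
    obtain ⟨f, hf⟩ := exists_ofHom (((σ' s).g_source k hk).trans hz)
      (((σ' s).g_target k hk).trans hz')
    have hfη : f.1 = η s := by
      rw [hf] at h5
      exact trans_mk_inj h5
    rw [hf, inv_ofHom, comp_ofHom, comp_ofHom, ofHom_trans, ← hfη]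
    refine congrArg (fun η => (⟨_, _, η⟩ : X.Trans)) ?_
    have hmem : u k s • z ∈ (X.φ (X.bi (u (k + 1) s) f.1 (u k s)⁻¹)).source := by
      rw [X.bi_source, inv_smul_smul]; exact f.2.1
    let e : (⟨σ.ch k, u k s • z⟩ : X.BasePoint) ⟶ ⟨σ.ch (k + 1), u (k + 1) s • z'⟩ :=
      ⟨X.bi (u (k + 1) s) f.1 (u k s)⁻¹, hmem, by
        rw [X.φ_bi _ _ _ _ (by rw [inv_smul_smul]; exact f.2.1), inv_smul_smul, f.2.2]⟩
    have he : homG (u k s) z ≫ e = f ≫ homG (u (k + 1) s) z' := by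
      refine Subtype.ext ?_
      rw [comp_val, comp_val]
      refine (comp_ofG _ _ _ _ _).trans (Eq.trans ?_ (ofG_comp _ _ _ _ _).symm)
      change X.bi 1 (X.bi (u (k + 1) s) f.1 (u k s)⁻¹) (u k s) = _
      rw [X.bi_bi, one_mul, inv_mul_cancel]
    rw [assoc, ← he, ← assoc, Groupoid.inv_comp, id_comp]
  refine ⟨τ', hτ'.mono fun s hs => hs.1, ⟨h.compact, h.chart, fun k hk r hr => ?_, fun k hk => ?_⟩,
    hg⟩
  · have h1 : Tendsto (fun p : S × ℝ => gmul (σ.ch k) (u k p.1) ((σ' p.1).c k p.2))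
        (l ×ˢ 𝓝[P.piece k] r) (𝓝ˢ (C k r)) :=
      (tendsto_gmul _ (h.compact k hk r hr)).comp
        (((hu k).comp tendsto_fst).prodMk (h.c k hk r hr))
    refine h1.congr' ?_
    filter_upwards [(hτ'.and hch).prod_mk (self_mem_nhdsWithin (a := r) (s := P.piece k))]
      with p ⟨⟨⟨_, h2, _⟩, h3⟩, h4⟩
    obtain ⟨z, hz⟩ := hex (h3 k hk _ h4)
    rw [h2, hJ _ _ _ _ hz, hz, gmul_mk, ofHom_target]
  · obtain ⟨ξ, hξ⟩ := σ.exists_trans hk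
    have h1 := h.g k hk
    rw [hξ] at h1 ⊢
    obtain ⟨η, h2, h3⟩ := exists_of_tendsto_trans h1
    have h4 := tendsto_bi h2 (hu (k + 1)) (by simpa using (hu k).inv : Tendsto (fun s => (u k s)⁻¹) l (𝓝 1))
    exact (tendsto_trans_mk h4).congr' ((hg k hk η h3).mono fun s hs => hs.symm)

/-- All the transition maps except one can be made equal to those of the limit. -/
lemma Conv.exists_fix (h : Conv l σ' σ C) {k₀ : ℕ} (hk₀ : k₀ < P.n) :
    ∃ τ' : S → WayOn P x y, (∀ᶠ s in l, Equiv (τ' s) (σ' s)) ∧ Conv l τ' σ C ∧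
      ∀ᶠ s in l, ∀ k < P.n, k ≠ k₀ → ((τ' s).g k).trans = (σ.g k).trans := by
  classical
  have hex : ∀ k < P.n, ∃ (ξ : X.Tran (σ.ch k) (σ.ch (k + 1)))
      (η : S → X.Tran (σ.ch k) (σ.ch (k + 1))), (σ.g k).trans = ⟨_, _, ξ⟩ ∧
      Tendsto η l (𝓝 ξ) ∧ ∀ᶠ s in l, ((σ' s).g k).trans = ⟨_, _, η s⟩ := by
    intro k hk
    obtain ⟨ξ, hξ⟩ := σ.exists_trans hk
    have h1 := h.g k hk
    rw [hξ] at h1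
    obtain ⟨η, h2, h3⟩ := exists_of_tendsto_trans h1
    exact ⟨ξ, η, hξ, h2, h3⟩
  choose ξ η hξ hη hηg using hex
  have fwd : ∀ m ≤ k₀, ∃ u : ∀ k, S → X.G (σ.ch k), (∀ k, Tendsto (u k) l (𝓝 1)) ∧ u 0 = 1 ∧
      ∀ k (hk : k < P.n), k < m →
        ∀ᶠ s in l, X.bi (u (k + 1) s) (η k hk s) (u k s)⁻¹ = ξ k hk := by
    intro m
    induction m with
    | zero => exact fun _ => ⟨fun _ => 1, fun _ => tendsto_const_nhds, rfl, by simp⟩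
    | succ m ih =>
      intro hm
      obtain ⟨u, hu, hu0, hur⟩ := ih (by omega)
      have hmn : m < P.n := by omega
      obtain ⟨v, hv, hvη⟩ := exists_bi_of_tendsto (tendsto_bi (hη m hmn)
        (tendsto_const_nhds (x := (1 : X.G (σ.ch (m + 1)))))
        (by simpa using (hu m).inv : Tendsto (fun s => (u m s)⁻¹) l (𝓝 1)))
      refine ⟨Function.update u (m + 1) v⁻¹, fun k => ?_, ?_, fun k hk hkm => ?_⟩
      · by_cases hk : k = m + 1
        · subst hk
          rw [Function.update_self]
          have := hv.inv
          rw [inv_one] at this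
          exact this
        · rw [Function.update_of_ne hk]; exact hu k
      · grind
      · rw [Function.update_of_ne (a := k) (by omega)]
        rcases Nat.lt_succ_iff_lt_or_eq.1 hkm with h' | rfl
        · rw [Function.update_of_ne (by omega)]; exact hur k hk h'
        · rw [Function.update_self]
          filter_upwards [hvη] with s hs
          have := congrArg (fun ζ => X.bi (v s)⁻¹ ζ 1) hs
          simpa [X.bi_bi, X.bi_one] using this
  have bwd : ∀ m ≤ P.n - (k₀ + 1), ∃ u : ∀ k, S → X.G (σ.ch k), (∀ k, Tendsto (u k) l (𝓝 1)) ∧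
      u P.n = 1 ∧ ∀ k (hk : k < P.n), P.n - m ≤ k →
        ∀ᶠ s in l, X.bi (u (k + 1) s) (η k hk s) (u k s)⁻¹ = ξ k hk := by
    intro m
    induction m with
    | zero => exact fun _ => ⟨fun _ => 1, fun _ => tendsto_const_nhds, rfl, fun k hk h => by omega⟩
    | succ m ih =>
      intro hm
      obtain ⟨u, hu, hu0, hur⟩ := ih (by omega)
      obtain ⟨a, ha⟩ : ∃ a, P.n - (m + 1) = a := ⟨_, rfl⟩
      have hmn : a < P.n := by omega
      obtain ⟨v, hv, hvη⟩ := exists_bi_right_of_tendsto (tendsto_bi (hη a hmn)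
        (hu (a + 1)) (tendsto_const_nhds (x := (1 : X.G (σ.ch a)))))
      refine ⟨Function.update u a v, fun k => ?_, ?_, fun k hk hkm => ?_⟩
      · by_cases hk : k = a
        · subst hk
          rw [Function.update_self]; exact hv
        · rw [Function.update_of_ne hk]; exact hu k
      · rw [Function.update_of_ne (by omega)]; exact hu0
      · rw [Function.update_of_ne (a := k + 1) (by omega)]
        by_cases h' : k = a
        · subst h'
          rw [Function.update_self]
          filter_upwards [hvη] with s hs
          have := congrArg (fun ζ => X.bi 1 ζ (v s)⁻¹) hs
          simpa [X.bi_bi, X.bi_one] using this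
        · rw [Function.update_of_ne h']; exact hur k hk (by omega)
  obtain ⟨u, hu, hu0, hur⟩ := fwd k₀ le_rfl
  obtain ⟨u', hu', hu'0, hur'⟩ := bwd _ le_rfl
  obtain ⟨τ', h1, h2, h3⟩ := h.exists_gauge_smul (fun k => if k ≤ k₀ then u k else u' k)
    (fun k => by split_ifs <;> simp [hu, hu']) (by simp [hu0])
    (by simp only [if_neg (not_le.2 hk₀), hu'0])
  refine ⟨τ', h1, h2, (eventually_all_finite (finite_lt_nat P.n)).2 fun k hk => ?_⟩
  by_cases hkk : k = k₀
  · exact Eventually.of_forall fun _ h => absurd hkk h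
  rcases lt_or_gt_of_ne hkk with h' | h'
  · filter_upwards [h3 k hk _ (hηg k hk), hur k hk h'] with s h4 h5 _
    grind
  · filter_upwards [h3 k hk _ (hηg k hk), hur' k hk (by omega)] with s h4 h5 _
    grind

/-! ### Undoing a subdivision -/

lemma exists_unsub {θ : ℕ → ℕ} (h : R.Sub P θ) (κ : WayOn R x y)
    (hid : ∀ m < R.n, θ (m + 1) = θ m → κ.g m = Arrow.id (κ.c m (R.t (m + 1)))) :
    ∃ τ : WayOn P x y, Equiv τ κ ∧ (∀ m ≤ R.n, ∀ r ∈ R.piece m, τ.c (θ m) r = κ.c m r) ∧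
      ∀ m < R.n, θ (m + 1) = θ m + 1 → τ.g (θ m) = κ.g m := by
  classical
  have hlt : ∀ m m', m < m' → m' ≤ R.n → θ m = θ m' → ∀ r ∈ R.piece m, r ∈ R.piece m' →
      κ.c m r = κ.c m' r := by
    intro m m' hm hm' hθ r hr hr'
    have e1 : m' < m + 1 + 1 := by
      by_contra hc
      have := R.t_strict (k := m + 1) (l := m') (by omega) (by omega)
      linarith [hr.2, hr'.1]
    obtain rfl : m' = m + 1 := by omega
    obtain rfl : r = R.t (m + 1) := le_antisymm hr.2 hr'.1
    have h1 := hid m hm' hθ.symm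
    have h2 := κ.g_target m hm'
    rw [h1, id_target] at h2
    exact h2
  have hcons : ∀ m ≤ R.n, ∀ m' ≤ R.n, θ m = θ m' → ∀ r ∈ R.piece m, r ∈ R.piece m' →
      κ.c m r = κ.c m' r := by
    intro m hm m' hm' hθ r hr hr'
    rcases lt_trichotomy m m' with hl | rfl | hl
    · exact hlt m m' hl hm' hθ r hr hr'
    · rfl
    · grind
  let c : ℕ → ℝ → X.BasePoint := fun l r => if hm : ∃ m, m ∈ R.fibre θ l r then κ.c hm.choose r else x
  have hc : ∀ m ≤ R.n, ∀ r ∈ R.piece m, c (θ m) r = κ.c m r := by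
    intro m hm r hr
    have h' : ∃ m', m' ∈ R.fibre θ (θ m) r := ⟨m, hm, rfl, hr⟩
    simp only [c, dif_pos h']
    exact hcons _ h'.choose_spec.1 _ hm h'.choose_spec.2.1 _ h'.choose_spec.2.2 hr
  let g : ℕ → X.Arrow := fun l => if hm : ∃ m, m < R.n ∧ θ m = l ∧ θ (m + 1) = l + 1 then
    κ.g hm.choose else Arrow.id x
  have hg : ∀ m < R.n, θ (m + 1) = θ m + 1 → g (θ m) = κ.g m := by
    intro m hm hθ
    have h' : ∃ m', m' < R.n ∧ θ m' = θ m ∧ θ (m' + 1) = θ m + 1 := ⟨m, hm, rfl, hθ⟩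
    simp only [g, dif_pos h']
    obtain ⟨h1, h2, h3⟩ := h'.choose_spec
    have e1 := h.t_eq h1 (by rw [h3, h2])
    have e2 := h.t_eq hm hθ
    rw [h2, ← e2] at e1
    have e3 := R.le_of_t_le (by omega) e1.le
    have e4 := R.le_of_t_le (by omega) e1.ge
    congr 1; omega
  let τ : WayOn P x y := {
    c := c
    c_cont := by
      intro l hl r hr
      refine Tendsto.mono_left ?_ (h.nhdsWithin_le hl)
      refine tendsto_iSup.2 fun m => tendsto_iSup.2 fun ⟨hm, hml, hmr⟩ => ?_
      subst hml
      exact ((κ.c_cont m hm).congr fun r hr => hc m hm r hr) r hmr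
    g := g
    g_source := by
      intro l hl
      obtain ⟨m, hm, rfl, h2, h3⟩ := h.exists_junction hl
      rw [hg m hm h2, κ.g_source m hm, ← h3, hc m hm.le _ (R.right_mem hm.le)]
    g_target := by
      intro l hl
      obtain ⟨m, hm, rfl, h2, h3⟩ := h.exists_junction hl
      rw [hg m hm h2, κ.g_target m hm, ← h3, ← h2, hc _ hm _ (R.left_mem hm)]
    start := by
      have := hc 0 (Nat.zero_le _) 0 R.zero_mem
      rw [h.zero] at this
      rw [this, κ.start]
    finish := by
      have := hc _ le_rfl 1 R.one_mem
      rw [h.last] at this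
      rw [this, κ.finish] }
  refine ⟨τ, (equiv_sub τ h).symm.trans (equiv_of_eqOn (fun m hm r hr => hc m hm r hr)
    fun m hm => ?_), hc, hg⟩
  change τ.step _ _ _ = _
  rcases h.step hm with e | e
  · rw [e, step_self, hid m hm e]
    exact congrArg _ (hc m hm.le _ (R.right_mem hm.le))
  · rw [e, step_succ]; exact hg m hm e

lemma Conv.exists_unsub {θ : ℕ → ℕ} {h : R.Sub P θ} {κ' : S → WayOn R x y}
    (hκ : Conv l κ' (σ.sub h) C) :
    ∃ τ' : S → WayOn P x y, (∀ᶠ s in l, Equiv (τ' s) (κ' s)) ∧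
      Conv l τ' σ fun k r => ⋃ m ∈ R.fibre θ k r, C m r := by
  obtain ⟨k₀, hk₀, hk1, hk2, -⟩ := h.exists_junction (l := P.n - 1) (by have := P.one_le; omega)
  obtain ⟨κ'', h1, h2, h3⟩ := hκ.exists_fix hk₀
  have hch : ∀ᶠ s in l, ∀ k ≤ R.n, ∀ r ∈ R.piece k, ((κ'' s).c k r).1 = (σ.c (θ k) r).1 :=
    (eventually_all_finite (finite_le_nat R.n)).2 fun k hk => h2.chart_eq hk
  have key : ∀ᶠ s in l, ∃ τ : WayOn P x y, Equiv τ (κ'' s) ∧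
      (∀ m ≤ R.n, ∀ r ∈ R.piece m, τ.c (θ m) r = (κ'' s).c m r) ∧
      ∀ m < R.n, θ (m + 1) = θ m + 1 → τ.g (θ m) = (κ'' s).g m := by
    filter_upwards [h3, hch] with s hs hs'
    refine WayOn.exists_unsub h (κ'' s) fun m hm hθ => ?_
    refine Arrow.ext_of_trans ?_ ((κ'' s).g_source m hm)
    rw [hs m hm (by rintro rfl; omega)]
    change (σ.step _ _ _).trans = _
    rw [hθ, step_self]
    exact (Arrow.id_trans_congr (hs' m hm.le _ (R.right_mem hm.le))).symm
  obtain ⟨τ', hτ'⟩ := exists_of_eventually (fun _ => σ) key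
  refine ⟨τ', ?_, fun k hk r hr => ?_, ?_, fun k hk r hr => ?_, fun k hk => ?_⟩
  · filter_upwards [h1, hτ'] with s a b using b.1.trans a
  · exact (R.fibre_finite θ k r).isCompact_biUnion fun m hm => hκ.compact m hm.1 r hm.2.2
  · intro k hk r hr b hb
    obtain ⟨m, ⟨hm, rfl, hmr⟩, hb'⟩ := mem_iUnion₂.1 hb
    exact hκ.chart m hm r hmr b hb'
  · refine Tendsto.mono_left ?_ (Filter.prod_mono_right _ (h.nhdsWithin_le hk))
    refine Tendsto.mono_left ?_ (prod_biSup_le l (R.fibre_finite θ k r) _)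
    refine tendsto_iSup.2 fun m => tendsto_iSup.2 fun hm => ?_
    refine ((h2.c m hm.1 r hm.2.2).mono_right (nhdsSet_mono
      (subset_biUnion_of_mem (u := fun m => C m r) hm))).congr' ?_
    filter_upwards [hτ'.prod_mk (self_mem_nhdsWithin (a := r) (s := R.piece m))] with p hp
    rw [← hm.2.1]
    exact (hp.1.2.1 m hm.1 _ hp.2).symm
  · obtain ⟨m, hm, rfl, hm2, -⟩ := h.exists_junction hk
    have := h2.g m hm
    change Tendsto _ _ (𝓝 (σ.step _ _ _).trans) at this
    rw [hm2, step_succ] at this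
    refine this.congr' (hτ'.mono fun s hs => ?_)
    exact congrArg Arrow.trans (hs.2.2 m hm hm2).symm

end WayOn

namespace WayOn

variable {P Q R : Part} {x y z : X.BasePoint} {S : Type*} {l : Filter S}
  {σ : WayOn P x y} {σ' : S → WayOn P x y} {C : ℕ → ℝ → Set X.BasePoint}

lemma Lim.sub {θ : ℕ → ℕ} (h : R.Sub P θ) (hσ : Lim l σ' σ) :
    Lim l (fun s => (σ' s).sub h) (σ.sub h) := by
  refine Lim.mk (fun k hk r hr => (hσ.tendsto (h.le k hk) (h.sub k hk hr)).mono_left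
    (Filter.prod_mono_right _ (nhdsWithin_mono r (h.sub k hk)))) fun k hk => ?_
  change Tendsto (fun s => ((σ' s).step _ _ _).trans) l (𝓝 (σ.step _ _ _).trans)
  rcases h.step hk with e | e
  · simp only [e, step_self]
    refine tendsto_const_nhds.congr' ?_
    filter_upwards [hσ.chart_eq (h.le k hk.le)] with s hs
    exact Arrow.id_trans_congr (hs _ (h.sub k hk.le (R.right_mem hk.le))).symm
  · simp only [e, step_succ]
    exact hσ.g _ (by have := h.le (k + 1) hk; omega)

/-- A family converging to a system can be transported to an equivalent system. -/
lemma Lim.exists_of_equiv {τ : WayOn Q x y} (hσ : Lim l σ' σ) (he : Equiv σ τ) :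
    ∃ τ' : S → WayOn Q x y, (∀ᶠ s in l, Equiv (τ' s) (σ' s)) ∧ Lim l τ' τ := by
  obtain ⟨R, θ, θ', J, hJ⟩ := he
  have hκ := hσ.sub hJ.left
  set κ := σ.sub hJ.left with hκdef
  set κ' : S → WayOn R x y := fun s => (σ' s).sub hJ.left with hκ'def
  have hflat : ∀ k ≤ R.n, ∀ r ∈ R.piece k, (J k r).trans = (J k (R.t k)).trans := by
    intro k hk r hr
    obtain ⟨T, hT⟩ := hJ.flat k hk
    rw [hT r hr, hT _ (R.left_mem hk)]
  let J' : S → ℕ → ℝ → X.Arrow := fun s k r => Arrow.of (J k (R.t k)).trans ((κ' s).c k r)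
  have hJ' : ∀ᶠ s in l, ∀ k ≤ R.n, ∀ r ∈ R.piece k,
      (J' s k r).trans = (J k (R.t k)).trans ∧ (J' s k r).source = (κ' s).c k r := by
    refine (eventually_all_finite (finite_le_nat R.n)).2 fun k hk => ?_
    refine eventually_forall_mem (isCompact_Icc (a := R.t k) (b := R.t (k + 1))) fun r hr => ?_
    have h1 := hκ.tendsto hk hr
    have h2 := (J k r).eventually_of
    rw [hJ.source k hk r hr, hflat k hk r hr] at h2
    exact h1.eventually h2
  have hid : ∀ k ≤ R.n, (∀ r ∈ R.piece k, J k r = Arrow.id (κ.c k r)) → ∀ᶠ s in l,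
      ∀ r ∈ R.piece k, J' s k r = Arrow.id ((κ' s).c k r) := by
    intro k hk h
    filter_upwards [hκ.chart_eq hk] with s hs r hr
    refine Arrow.of_eq ?_ rfl
    rw [← hflat k hk r hr, h r hr]
    exact Arrow.id_trans_congr (hs r hr)
  obtain ⟨τ'', hτ''⟩ := exists_gauge (l := l) κ' J' (by
    filter_upwards [hJ', hid 0 (Nat.zero_le _) (fun r hr => (hJ.zero r hr).trans (by
        change _ = Arrow.id (σ.c (θ 0) r); rw [hJ.left.zero])),
      hid R.n le_rfl (fun r hr => (hJ.last r hr).trans (by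
        change _ = Arrow.id (σ.c (θ R.n) r); rw [hJ.left.last]))] with s h1 h2 h3
    exact ⟨fun k hk => ⟨_, fun r hr => (h1 k hk r hr).1⟩, fun k hk r hr => (h1 k hk r hr).2,
      h2, h3⟩)
  have hlim : Lim l τ'' (τ.sub hJ.right) := by
    refine Lim.mk (fun k hk r hr => ?_) fun k hk => ?_
    · have h1 := (J k r).continuousAt_of_target
      rw [hJ.source k hk r hr, hflat k hk r hr, hJ.target k hk r hr] at h1
      refine (h1.comp (hκ.tendsto hk hr)).congr' ?_
      filter_upwards [hτ''.prod_mk (univ_mem (f := 𝓝[R.piece k] r))] with p hp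
      exact (hp.1.2.1 k p.2).symm
    · have hm := R.right_mem hk.le
      have hm' : R.t (k + 1) ∈ R.piece (k + 1) := R.left_mem hk
      obtain ⟨a, ha⟩ := exists_ofHom (σ.step_source hJ.left hk) (σ.step_target hJ.left hk)
      obtain ⟨a', ha'⟩ := exists_ofHom (τ.step_source hJ.right hk)
        (τ.step_target hJ.right hk)
      obtain ⟨j, hj⟩ := exists_ofHom (hJ.source k hk.le _ hm) (hJ.target k hk.le _ hm)
      obtain ⟨j', hj'⟩ := exists_ofHom (hJ.source (k + 1) hk _ hm')
        (hJ.target (k + 1) hk _ hm')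
      have hsq := hJ.sq k hk
      rw [ha, ha', hj, hj', isSq_ofHom] at hsq
      have h1 := hκ.g k hk
      change Tendsto _ l (𝓝 (σ.step _ _ _).trans) at h1
      rw [ha] at h1
      have h2 := Arrow.tendsto_conj a j j' h1
        ((hκ.tendsto_apply hk.le hm).congr fun s => ((κ' s).g_source k hk).symm)
        ((hκ.tendsto_apply hk hm').congr fun s => ((κ' s).g_target k hk).symm)
      rw [hsq, ← assoc, Groupoid.inv_comp, id_comp, ← ha', ← hj, ← hj',
        hflat k hk.le _ hm, hflat (k + 1) hk _ hm'] at h2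
      change Tendsto _ l (𝓝 (τ.step _ _ _).trans)
      refine h2.congr' ?_
      filter_upwards [hτ''] with s hs
      rw [hs.2.2 k, (κ' s).g_source k hk, (κ' s).g_target k hk]
  obtain ⟨τ', h1, h2⟩ := hlim.exists_unsub
  refine ⟨τ', ?_, h2.mono (fun k hk r hr => ?_) (fun _ _ _ _ => isCompact_singleton)
    fun k hk r hr b hb => by rw [mem_singleton_iff.1 hb]⟩
  · filter_upwards [h1, hτ''] with s a b using (a.trans b.1).trans (equiv_sub _ _)
  · refine iUnion₂_subset fun m hm => ?_
    change ({τ.c (θ' m) r} : Set X.BasePoint) ⊆ {τ.c k r}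
    rw [hm.2.1]

lemma Lim.tendsto_q (hσ : Lim l σ' σ) : Tendsto (fun s => (σ' s).q) l (𝓝 σ.q) := by
  refine TopologicalSpace.tendsto_nhds_generateFrom_iff.2 ?_
  rintro _ ⟨Q, τ, K, V, A, hbox, rfl⟩ ⟨τ₀, ⟨h1, h2, h3⟩, h4⟩
  obtain ⟨τ', h5, h6⟩ := hσ.exists_of_equiv (q_eq_iff.1 h4).symm
  have e1 : ∀ᶠ s in l, ∀ k ≤ Q.n, ∀ r ∈ Q.piece k, ((τ' s).c k r).1 = (τ.c k r).1 := by
    refine (eventually_all_finite (finite_le_nat Q.n)).2 fun k hk => ?_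
    filter_upwards [h6.chart_eq hk] with s hs r hr
    rw [hs r hr, h1 k hk r hr]
  have e2 : ∀ᶠ s in l, ∀ k ≤ Q.n, MapsTo ((τ' s).c k) (K k) (V k) := by
    refine (eventually_all_finite (finite_le_nat Q.n)).2 fun k hk => ?_
    obtain ⟨b1, b2, b3, -⟩ := hbox.1 k hk
    exact h6.eventually_mem hk b1 b2 b3 fun r hr => singleton_subset_iff.2 (h2 k hk hr)
  have e3 : ∀ᶠ s in l, ∀ k < Q.n, ((τ' s).g k).trans ∈ A k := by
    refine (eventually_all_finite (finite_lt_nat Q.n)).2 fun k hk => ?_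
    exact (h6.g k hk).eventually ((hbox.2 k hk).1.mem_nhds (h3 k hk))
  filter_upwards [h5, e1, e2, e3] with s a b c d
  exact ⟨τ' s, ⟨b, c, d⟩, q_eq_iff.2 a⟩

/-! ### Neighbourhoods in the space of ways -/

/-- The compact-open neighbourhoods of a system on its partition. -/
def nhd (σ : WayOn P x y) : Filter (WayOn P x y) :=
  (⨅ (k : ℕ) (_ : k ≤ P.n) (K : Set ℝ) (_ : IsCompact K ∧ K ⊆ P.piece k) (V : Set X.BasePoint)
    (_ : IsOpen V ∧ MapsTo (σ.c k) K V), 𝓟 {τ | MapsTo (τ.c k) K V}) ⊓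
  ⨅ (k : ℕ) (_ : k < P.n), comap (fun τ => (τ.g k).trans) (𝓝 (σ.g k).trans)

lemma nhd_mapsTo (σ : WayOn P x y) {k : ℕ} (hk : k ≤ P.n) {K : Set ℝ} (hK : IsCompact K)
    (hKP : K ⊆ P.piece k) {V : Set X.BasePoint} (hV : IsOpen V) (hKV : MapsTo (σ.c k) K V) :
    {τ | MapsTo (τ.c k) K V} ∈ nhd σ := by
  refine mem_inf_of_left ?_
  refine mem_iInf_of_mem k (mem_iInf_of_mem hk (mem_iInf_of_mem K (mem_iInf_of_mem ⟨hK, hKP⟩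
    (mem_iInf_of_mem V (mem_iInf_of_mem ⟨hV, hKV⟩ (mem_principal_self _))))))

lemma lim_nhd (σ : WayOn P x y) : Lim (nhd σ) id σ := by
  refine Lim.mk (fun k hk r hr N hN => ?_) fun k hk => ?_
  · obtain ⟨V, hVN, hV, hrV⟩ := mem_nhds_iff.1 hN
    obtain ⟨ε, hε, hεV⟩ := Metric.mem_nhdsWithin_iff.1 (σ.c_cont k hk r hr (hV.mem_nhds hrV))
    have h1 := σ.nhd_mapsTo hk (K := Metric.closedBall r (ε / 2) ∩ P.piece k)
      ((isCompact_closedBall r _).inter_right isClosed_Icc) inter_subset_right hV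
      fun s hs => hεV ⟨Metric.closedBall_subset_ball (by linarith) hs.1, hs.2⟩
    rw [mem_map]
    filter_upwards [prod_mem_prod h1 (inter_mem (mem_nhdsWithin_of_mem_nhds
      (Metric.closedBall_mem_nhds r (by linarith : 0 < ε / 2))) self_mem_nhdsWithin)]
      with p hp using hVN (hp.1 hp.2)
  · exact tendsto_iff_comap.2 (inf_le_right.trans (iInf₂_le k hk))

/-- The neighbourhoods of a system given by conditions on whole pieces. -/
def coarse (σ : WayOn P x y) : Filter (WayOn P x y) where
  sets := {𝒲 | ∃ (V : ℕ → Set X.BasePoint) (A : ℕ → Set X.Trans),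
    (∀ k ≤ P.n, IsOpen (V k) ∧ MapsTo (σ.c k) (P.piece k) (V k)) ∧
    (∀ k < P.n, IsOpen (A k) ∧ (σ.g k).trans ∈ A k) ∧
    {τ : WayOn P x y | (∀ k ≤ P.n, MapsTo (τ.c k) (P.piece k) (V k)) ∧
      ∀ k < P.n, (τ.g k).trans ∈ A k} ⊆ 𝒲}
  univ_sets := ⟨fun _ => univ, fun _ => univ, by simp [isOpen_univ, mapsTo_univ], by simp,
    subset_univ _⟩
  sets_of_superset := by
    rintro 𝒲 𝒲' ⟨V, A, h1, h2, h3⟩ h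
    exact ⟨V, A, h1, h2, h3.trans h⟩
  inter_sets := by
    rintro 𝒲 𝒲' ⟨V, A, h1, h2, h3⟩ ⟨V', A', h1', h2', h3'⟩
    refine ⟨fun k => V k ∩ V' k, fun k => A k ∩ A' k,
      fun k hk => ⟨(h1 k hk).1.inter (h1' k hk).1, (h1 k hk).2.inter (h1' k hk).2⟩,
      fun k hk => ⟨(h2 k hk).1.inter (h2' k hk).1, (h2 k hk).2, (h2' k hk).2⟩, fun τ hτ => ⟨?_, ?_⟩⟩
    · exact h3 ⟨fun k hk r hr => (hτ.1 k hk hr).1, fun k hk => (hτ.2 k hk).1⟩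
    · exact h3' ⟨fun k hk r hr => (hτ.1 k hk hr).2, fun k hk => (hτ.2 k hk).2⟩

lemma conv_coarse (σ : WayOn P x y) : Conv (coarse σ) id σ fun k _ => σ.c k '' P.piece k := by
  refine ⟨fun k hk _ _ => isCompact_Icc.image_of_continuousOn (σ.c_cont k hk), ?_,
    fun k hk r hr N hN => ?_, fun k hk N hN => ?_⟩
  · rintro k hk r hr _ ⟨r', hr', rfl⟩
    exact σ.fst_eq hk hr' hr
  · obtain ⟨V, hV, hCV, hVN⟩ := mem_nhdsSet_iff_exists.1 hN
    have : {τ : WayOn P x y | MapsTo (τ.c k) (P.piece k) V} ∈ coarse σ := by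
      refine ⟨fun j => if j = k then V else univ, fun _ => univ, fun j hj => ?_, by simp,
        fun τ hτ => by simpa using hτ.1 k hk⟩
      aesop
    rw [mem_map]
    filter_upwards [prod_mem_prod this (self_mem_nhdsWithin (a := r) (s := P.piece k))]
      with p hp using hVN (hp.1 hp.2)
  · obtain ⟨A, hAN, hA, hgA⟩ := mem_nhds_iff.1 hN
    refine ⟨fun _ => univ, fun j => if j = k then A else univ, by simp [mapsTo_univ],
      fun j hj => ?_, fun τ hτ => hAN (by simpa using hτ.2 k hk)⟩
    by_cases hjk : j = k
    · grind
    · simp_all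

lemma nhds_q_le_coarse (σ : WayOn P x y) : 𝓝 σ.q ≤ map q (coarse σ) := by
  rintro W ⟨V, A, h1, h2, h3⟩
  have hbox : σ.IsBox P.piece (fun k => V k ∩ {b | b.1 = σ.ch k}) A :=
    ⟨fun k hk => ⟨isCompact_Icc, Subset.rfl, (h1 k hk).1.inter (isOpen_fst _),
      fun r hr => ⟨(h1 k hk).2 hr, σ.fst_eq_ch hk hr⟩⟩, h2⟩
  refine mem_of_superset (hbox.isOpen.mem_nhds ⟨σ, ⟨fun _ _ _ _ => rfl,
    fun k hk => (hbox.1 k hk).2.2.2, fun k hk => (h2 k hk).2⟩, rfl⟩) ?_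
  rintro _ ⟨τ, ⟨-, h4, h5⟩, rfl⟩
  exact h3 ⟨fun k hk r hr => (h4 k hk hr).1, h5⟩

/-- The topology of the space of ways at the class of a system is given by the systems on the same
partition. -/
lemma nhds_q (σ : WayOn P x y) : 𝓝 σ.q = map q (nhd σ) := by
  refine le_antisymm ?_ (lim_nhd σ).tendsto_q
  have hU : ∀ (R : Part) (θ : ℕ → ℕ) (h : R.Sub P θ), ∃ U : WayOn R x y → WayOn P x y,
      (∀ᶠ κ in coarse (σ.sub h), Equiv (U κ) κ) ∧ Conv (coarse (σ.sub h)) U σ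
        fun k r => ⋃ m ∈ R.fibre θ k r, σ.c (θ m) '' R.piece m :=
    fun R θ h => (conv_coarse (σ.sub h)).exists_unsub
  choose U hUe hUc using hU
  let 𝒮 : Filter (WayOn P x y) := {
    sets := {𝒰 | ∃ ε > 0, ∀ (R : Part) (θ : ℕ → ℕ) (h : R.Sub P θ),
      (∀ k ≤ R.n, R.t (k + 1) - R.t k < ε) → ∀ᶠ κ in coarse (σ.sub h), U R θ h κ ∈ 𝒰}
    univ_sets := ⟨1, one_pos, by simp⟩
    sets_of_superset := by
      rintro 𝒰 𝒰' ⟨ε, hε, h⟩ hs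
      exact ⟨ε, hε, fun R θ hR hm => (h R θ hR hm).mono fun κ hκ => hs hκ⟩
    inter_sets := by
      rintro 𝒰 𝒰' ⟨ε, hε, h⟩ ⟨ε', hε', h'⟩
      refine ⟨min ε ε', lt_min hε hε', fun R θ hR hm => ?_⟩
      exact (h R θ hR fun k hk => (hm k hk).trans_le (min_le_left _ _)).and
        (h' R θ hR fun k hk => (hm k hk).trans_le (min_le_right _ _)) }
  have h𝒮 : 𝒮 ≤ nhd σ := by
    refine le_inf ?_ (le_iInf₂ fun k hk => ?_)
    · refine le_iInf₂ fun k hk => le_iInf₂ fun K ⟨hK, hKP⟩ => le_iInf₂ fun V ⟨hV, hKV⟩ => ?_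
      rw [le_principal_iff]
      obtain ⟨O, hO, hOV⟩ := continuousOn_iff'.1 (σ.c_cont k hk) V hV
      have hKO : K ⊆ O := fun r hr => (hOV.subset ⟨hKV hr, hKP hr⟩).1
      obtain ⟨ε, hε, hεO⟩ := hK.exists_thickening_subset_open hO hKO
      refine ⟨ε, hε, fun R θ h hm => ?_⟩
      refine (hUc R θ h).eventually_mem hk hK hKP hV fun r hr => iUnion₂_subset fun m hmf => ?_
      rintro _ ⟨r', hr', rfl⟩
      obtain ⟨hm1, rfl, hm3⟩ := hmf
      have h1 : r' ∈ O := hεO (Metric.mem_thickening_iff.2 ⟨r, hr, by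
        have := hm m hm1
        rw [Real.dist_eq, abs_lt]
        constructor <;> linarith [hr'.1, hr'.2, hm3.1, hm3.2]⟩)
      exact (hOV.symm.subset ⟨h1, h.sub m hm1 hr'⟩).1
    · rw [← tendsto_iff_comap]
      exact fun N hN => ⟨1, one_pos, fun R θ h _ => (hUc R θ h).g k hk hN⟩
  rintro W hW
  obtain ⟨ε, hε, h⟩ := h𝒮 hW
  obtain ⟨R, θ, hR, hm⟩ := P.exists_fine hε
  rw [← q_eq_iff.2 (equiv_sub σ hR)]
  refine nhds_q_le_coarse (σ.sub hR) ?_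
  rw [mem_map]
  filter_upwards [h R θ hR hm, hUe R θ hR] with κ h1 h2
  rw [mem_preimage, ← q_eq_iff.2 h2]
  exact h1

/-- A way of proving continuity of operations on the spaces of ways. -/
lemma tendsto_of_lim {x' y' : X.BasePoint} {f : WaySpace x y → WaySpace x' y'} (σ : WayOn P x y)
    {F : WayOn P x y → WayOn Q x' y'} (hf : ∀ τ : WayOn P x y, f τ.q = (F τ).q)
    (hF : Lim (nhd σ) F (F σ)) : Tendsto f (𝓝 σ.q) (𝓝 (f σ.q)) := by
  rw [nhds_q, tendsto_map'_iff, hf]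
  exact hF.tendsto_q.congr fun τ => (hf τ).symm

end WayOn

namespace Part

/-- The partition of the unit interval made of two partitions of its halves. -/
def concat (P Q : Part) : Part where
  n := P.n + 1 + Q.n
  one_le := by omega
  t k := if k ≤ P.n then P.t k / 2 else (1 + Q.t (k - (P.n + 1))) / 2
  t_zero := by simp [P.t_zero]
  t_last := by
    have h : ¬ (P.n + 1 + Q.n + 1 ≤ P.n) := by omega
    have h' : P.n + 1 + Q.n + 1 - (P.n + 1) = Q.n + 1 := by omega
    rw [if_neg h, h', Q.t_last]; norm_num
  t_lt k hk := by
    by_cases h : k ≤ P.n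
    · rw [if_pos h]
      have := P.t_lt k h
      by_cases h1 : k + 1 ≤ P.n
      · rw [if_pos h1]; linarith
      · obtain rfl : k = P.n := by omega
        rw [if_neg h1, Nat.sub_self, Q.t_zero]
        rw [P.t_last] at this; linarith
    · have h1 : ¬ (k + 1 ≤ P.n) := by omega
      have h2 : k + 1 - (P.n + 1) = k - (P.n + 1) + 1 := by omega
      rw [if_neg h, if_neg h1, h2]
      have := Q.t_lt (k - (P.n + 1)) (by omega)
      linarith

variable (P Q : Part)

lemma concat_n : (P.concat Q).n = P.n + 1 + Q.n := rfl

lemma concat_t_left {k : ℕ} (hk : k ≤ P.n + 1) : (P.concat Q).t k = P.t k / 2 := by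
  by_cases h : k ≤ P.n
  · exact if_pos h
  · obtain rfl : k = P.n + 1 := by omega
    refine (if_neg h).trans ?_
    rw [Nat.sub_self, Q.t_zero, P.t_last]; norm_num

lemma concat_t_right (j : ℕ) : (P.concat Q).t (P.n + 1 + j) = (1 + Q.t j) / 2 := by
  refine (if_neg (by omega)).trans ?_
  rw [show P.n + 1 + j - (P.n + 1) = j by omega]

lemma mem_concat_left {k : ℕ} (hk : k ≤ P.n) {r : ℝ} :
    r ∈ (P.concat Q).piece k ↔ 2 * r ∈ P.piece k := by
  rw [piece, piece, concat_t_left P Q (by omega), concat_t_left P Q (by omega), mem_Icc, mem_Icc]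
  constructor <;> rintro ⟨h1, h2⟩ <;> constructor <;> linarith

lemma mem_concat_right (j : ℕ) {r : ℝ} :
    r ∈ (P.concat Q).piece (P.n + 1 + j) ↔ 2 * r - 1 ∈ Q.piece j := by
  rw [piece, piece, add_assoc _ j, concat_t_right, concat_t_right, mem_Icc, mem_Icc]
  constructor <;> rintro ⟨h1, h2⟩ <;> constructor <;> linarith

lemma concat_cases {n m k : ℕ} (hk : k ≤ n + 1 + m) : k ≤ n ∨ ∃ j ≤ m, k = n + 1 + j := by
  by_cases h : k ≤ n
  · exact Or.inl h
  · exact Or.inr ⟨k - (n + 1), by omega, by omega⟩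

lemma concat_cases_lt {n m k : ℕ} (hk : k < n + 1 + m) :
    k < n ∨ k = n ∨ ∃ j < m, k = n + 1 + j := by
  rcases lt_trichotomy k n with h | h | h
  · exact Or.inl h
  · exact Or.inr (Or.inl h)
  · exact Or.inr (Or.inr ⟨k - (n + 1), by omega, by omega⟩)

/-- An index map on a concatenation. -/
def jointIndex (n m : ℕ) (θ θ' : ℕ → ℕ) (k : ℕ) : ℕ :=
  if k ≤ n then θ k else m + 1 + θ' (k - (n + 1))

lemma jointIndex_left {n m k : ℕ} {θ θ' : ℕ → ℕ} (h : k ≤ n) :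
    jointIndex n m θ θ' k = θ k := if_pos h

lemma jointIndex_right {n m : ℕ} {θ θ' : ℕ → ℕ} (j : ℕ) :
    jointIndex n m θ θ' (n + 1 + j) = m + 1 + θ' j := by
  refine (if_neg (by omega)).trans ?_
  rw [show n + 1 + j - (n + 1) = j by omega]

lemma Sub.concat {P Q R R' : Part} {θ θ' : ℕ → ℕ} (h : R.Sub P θ) (h' : R'.Sub Q θ') :
    (R.concat R').Sub (P.concat Q) (jointIndex R.n P.n θ θ') := by
  constructor
  · intro k hk
    rw [concat_n]
    rcases concat_cases hk with hk | ⟨j, hj, rfl⟩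
    · rw [jointIndex_left hk]; have := h.le k hk; omega
    · rw [jointIndex_right]; have := h'.le j hj; omega
  · intro k hk r hr
    rcases concat_cases hk with hk | ⟨j, hj, rfl⟩
    · rw [jointIndex_left hk, mem_concat_left _ _ (h.le k hk)]
      exact h.sub k hk ((mem_concat_left _ _ hk).1 hr)
    · rw [jointIndex_right, mem_concat_right]
      exact h'.sub j hj ((mem_concat_right _ _ _).1 hr)

end Part

namespace WayOn

variable {P Q R : Part} {x y z : X.BasePoint} {S : Type*} {l : Filter S}

/-- The concatenation of two systems. -/
def concat (a : WayOn P x y) (b : WayOn Q y z) : WayOn (P.concat Q) x z where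
  c k s := if k ≤ P.n then a.c k (2 * s) else b.c (k - (P.n + 1)) (2 * s - 1)
  c_cont k hk := by
    rcases Part.concat_cases hk with h | ⟨j, hj, rfl⟩
    · simp only [if_pos h]
      exact (a.c_cont k h).comp (by fun_prop) fun s hs => (Part.mem_concat_left _ _ h).1 hs
    · simp only [if_neg (show ¬ P.n + 1 + j ≤ P.n by omega),
        show P.n + 1 + j - (P.n + 1) = j by omega]
      exact (b.c_cont j hj).comp (by fun_prop) fun s hs => (Part.mem_concat_right _ _ j).1 hs
  g k := if k < P.n then a.g k else if k = P.n then Arrow.id y else b.g (k - (P.n + 1))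
  g_source k hk := by
    rcases Part.concat_cases_lt hk with h | rfl | ⟨j, hj, rfl⟩
    · rw [if_pos h, if_pos h.le, a.g_source k h, Part.concat_t_left _ _ (by omega)]
      congr 1; ring
    · rw [if_neg (lt_irrefl _), if_pos rfl, if_pos le_rfl, Part.concat_t_left _ _ le_rfl, P.t_last,
        Arrow.id_source]
      rw [show 2 * (1 / 2 : ℝ) = 1 by norm_num, a.finish]
    · rw [if_neg (by omega), if_neg (by omega), if_neg (by omega), add_assoc _ j,
        Part.concat_t_right, show P.n + 1 + j - (P.n + 1) = j by omega, b.g_source j hj]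
      congr 1; ring
  g_target k hk := by
    rcases Part.concat_cases_lt hk with h | rfl | ⟨j, hj, rfl⟩
    · rw [if_pos h, if_pos (by omega), a.g_target k h, Part.concat_t_left _ _ (by omega)]
      congr 1; ring
    · rw [if_neg (lt_irrefl _), if_pos rfl, if_neg (by omega), Part.concat_t_left _ _ le_rfl,
        P.t_last, id_target, Nat.sub_self]
      rw [show 2 * (1 / 2 : ℝ) - 1 = 0 by norm_num, b.start]
    · rw [if_neg (by omega), if_neg (by omega), if_neg (by omega), add_assoc _ j,
        Part.concat_t_right, show P.n + 1 + (j + 1) - (P.n + 1) = j + 1 by omega,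
        show P.n + 1 + j - (P.n + 1) = j by omega, b.g_target j hj]
      congr 1; ring
  start := by rw [if_pos (Nat.zero_le _), mul_zero, a.start]
  finish := by
    rw [Part.concat_n, if_neg (by omega), show P.n + 1 + Q.n - (P.n + 1) = Q.n by omega,
      show (2 * 1 - 1 : ℝ) = 1 by norm_num, b.finish]

variable (a : WayOn P x y) (b : WayOn Q y z)

lemma concat_c_left {k : ℕ} (hk : k ≤ P.n) (r : ℝ) : (a.concat b).c k r = a.c k (2 * r) :=
  if_pos hk

lemma concat_c_right (j : ℕ) (r : ℝ) : (a.concat b).c (P.n + 1 + j) r = b.c j (2 * r - 1) := by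
  refine (if_neg (by omega)).trans ?_
  rw [show P.n + 1 + j - (P.n + 1) = j by omega]

lemma concat_g_left {k : ℕ} (hk : k < P.n) : (a.concat b).g k = a.g k := if_pos hk

lemma concat_g_mid : (a.concat b).g P.n = Arrow.id y := (if_neg (lt_irrefl _)).trans (if_pos rfl)

lemma concat_g_right (j : ℕ) : (a.concat b).g (P.n + 1 + j) = b.g j := by
  refine (if_neg (by omega)).trans ((if_neg (by omega)).trans ?_)
  rw [show P.n + 1 + j - (P.n + 1) = j by omega]

lemma concat_step_left {k m : ℕ} (hk : k ≤ P.n) (hm : m ≤ P.n) (hkm : m = k ∨ m = k + 1) (r : ℝ) :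
    (a.concat b).step k m r = a.step k m (2 * r) := by
  rcases hkm with rfl | rfl
  · rw [step_self, step_self, concat_c_left _ _ hk]
  · rw [step_succ, step_succ, concat_g_left _ _ (by omega)]

lemma concat_step_right {j m : ℕ} (hkm : m = j ∨ m = j + 1) (r : ℝ) :
    (a.concat b).step (P.n + 1 + j) (P.n + 1 + m) r = b.step j m (2 * r - 1) := by
  rcases hkm with rfl | rfl
  · rw [step_self, step_self, concat_c_right]
  · rw [← add_assoc, step_succ, step_succ, concat_g_right]

variable {a b}

lemma Gauge.concat {P' Q' R R' : Part} {a' : WayOn P' x y} {b' : WayOn Q' y z}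
    {θ θ' ϑ ϑ' : ℕ → ℕ} {J J' : ℕ → ℝ → X.Arrow} (h : Gauge a a' R θ θ' J)
    (h' : Gauge b b' R' ϑ ϑ' J') :
    Gauge (a.concat b) (a'.concat b') (R.concat R') (Part.jointIndex R.n P.n θ ϑ)
      (Part.jointIndex R.n P'.n θ' ϑ')
      (fun k s => if k ≤ R.n then J k (2 * s) else J' (k - (R.n + 1)) (2 * s - 1)) := by
  have eL : ∀ {k : ℕ}, k ≤ R.n → ∀ s, (fun (k : ℕ) (s : ℝ) =>
    if k ≤ R.n then J k (2 * s) else J' (k - (R.n + 1)) (2 * s - 1)) k s = J k (2 * s) :=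
    fun hk s => if_pos hk
  have eR : ∀ (j : ℕ) s, (fun (k : ℕ) (s : ℝ) =>
    if k ≤ R.n then J k (2 * s) else J' (k - (R.n + 1)) (2 * s - 1)) (R.n + 1 + j) s =
      J' j (2 * s - 1) := fun j s => by
    grind
  generalize (fun (k : ℕ) (s : ℝ) =>
    if k ≤ R.n then J k (2 * s) else J' (k - (R.n + 1)) (2 * s - 1)) = K at eL eR ⊢
  refine ⟨h.left.concat h'.left, h.right.concat h'.right, fun k hk => ?_, fun k hk s hs => ?_,
    fun k hk s hs => ?_, fun s hs => ?_, fun s hs => ?_, fun k hk => ?_⟩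
  · rcases Part.concat_cases hk with hk | ⟨j, hj, rfl⟩
    · obtain ⟨T, hT⟩ := h.flat k hk
      exact ⟨T, fun s hs => by rw [eL hk]; exact hT _ ((Part.mem_concat_left _ _ hk).1 hs)⟩
    · obtain ⟨T, hT⟩ := h'.flat j hj
      exact ⟨T, fun s hs => by rw [eR]; exact hT _ ((Part.mem_concat_right _ _ _).1 hs)⟩
  · rcases Part.concat_cases hk with hk | ⟨j, hj, rfl⟩
    · rw [eL hk, Part.jointIndex_left hk, concat_c_left _ _ (h.left.le k hk)]
      exact h.source k hk _ ((Part.mem_concat_left _ _ hk).1 hs)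
    · rw [eR, Part.jointIndex_right, concat_c_right]
      exact h'.source j hj _ ((Part.mem_concat_right _ _ _).1 hs)
  · rcases Part.concat_cases hk with hk | ⟨j, hj, rfl⟩
    · rw [eL hk, Part.jointIndex_left hk, concat_c_left _ _ (h.right.le k hk)]
      exact h.target k hk _ ((Part.mem_concat_left _ _ hk).1 hs)
    · rw [eR, Part.jointIndex_right, concat_c_right]
      exact h'.target j hj _ ((Part.mem_concat_right _ _ _).1 hs)
  · rw [eL (Nat.zero_le _), concat_c_left _ _ (Nat.zero_le _)]
    exact h.zero _ ((Part.mem_concat_left _ _ (Nat.zero_le _)).1 hs)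
  · rw [Part.concat_n, Part.concat_n, eR, concat_c_right]
    exact h'.last _ ((Part.mem_concat_right _ _ _).1 hs)
  · rcases Part.concat_cases_lt hk with hk | rfl | ⟨j, hj, rfl⟩
    · rw [eL hk.le, eL (k := k + 1) (by omega), Part.jointIndex_left hk.le,
        Part.jointIndex_left (k := k + 1) (by omega), Part.jointIndex_left hk.le,
        Part.jointIndex_left (k := k + 1) (by omega), Part.concat_t_left _ _ (by omega),
        concat_step_left _ _ (h.left.le k hk.le) (h.left.le _ hk) (h.left.step hk),
        concat_step_left _ _ (h.right.le k hk.le) (h.right.le _ hk) (h.right.step hk),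
        mul_div_cancel₀ _ (two_ne_zero)]
      exact h.sq k hk
    · have e1 : Part.jointIndex R.n P.n θ ϑ (R.n + 1) = P.n + 1 := by
        have := Part.jointIndex_right (n := R.n) (m := P.n) (θ := θ) (θ' := ϑ) 0
        rwa [h'.left.zero] at this
      have e2 : Part.jointIndex R.n P'.n θ' ϑ' (R.n + 1) = P'.n + 1 := by
        have := Part.jointIndex_right (n := R.n) (m := P'.n) (θ := θ') (θ' := ϑ') 0
        rwa [h'.right.zero] at this
      have e3 : ∀ s, K (R.n + 1) s = J' 0 (2 * s - 1) := eR 0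
      rw [e1, e2, e3, eL le_rfl, Part.jointIndex_left le_rfl, Part.jointIndex_left le_rfl,
        h.left.last, h.right.last, step_succ, step_succ, concat_g_mid, concat_g_mid,
        Part.concat_t_left _ _ le_rfl, R.t_last]
      rw [show 2 * (1 / 2 : ℝ) = 1 by norm_num, show (1 - 1 : ℝ) = 0 by norm_num,
        h.last _ R.one_mem, h'.zero _ R'.zero_mem, a.finish, b.start, ← ofHom_id,
        isSq_ofHom]
    · rw [add_assoc _ j, eR, eR, Part.jointIndex_right, Part.jointIndex_right,
        Part.jointIndex_right, Part.jointIndex_right, Part.concat_t_right,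
        concat_step_right _ _ (h'.left.step hj), concat_step_right _ _ (h'.right.step hj),
        mul_div_cancel₀ _ (two_ne_zero), add_sub_cancel_left]
      exact h'.sq j hj

lemma Equiv.concat {P' Q' : Part} {a' : WayOn P' x y} {b' : WayOn Q' y z} (h : Equiv a a')
    (h' : Equiv b b') : Equiv (a.concat b) (a'.concat b') := by
  obtain ⟨R, θ, θ', J, h⟩ := h
  obtain ⟨R', ϑ, ϑ', J', h'⟩ := h'
  exact ⟨_, _, _, _, h.concat h'⟩

lemma Lim.concat {a' : S → WayOn P x y} {b' : S → WayOn Q y z} (h : Lim l a' a)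
    (h' : Lim l b' b) : Lim l (fun s => (a' s).concat (b' s)) (a.concat b) := by
  refine Lim.mk (fun k hk r hr => ?_) fun k hk => ?_
  · rcases Part.concat_cases hk with hk | ⟨j, hj, rfl⟩
    · simp only [concat_c_left _ _ hk]
      have hr' := (Part.mem_concat_left _ _ hk).1 hr
      refine (h.tendsto hk hr').comp (tendsto_fst.prodMk (Tendsto.comp ?_ tendsto_snd))
      have hc : Continuous fun r : ℝ => 2 * r := by fun_prop
      exact hc.continuousWithinAt.tendsto_nhdsWithin fun s hs => (Part.mem_concat_left _ _ hk).1 hs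
    · simp only [concat_c_right]
      have hr' := (Part.mem_concat_right _ _ _).1 hr
      have hc : Tendsto (fun r : ℝ => 2 * r - 1) (𝓝[(P.concat Q).piece (P.n + 1 + j)] r)
          (𝓝[Q.piece j] (2 * r - 1)) :=
        (by fun_prop : Continuous fun r : ℝ => 2 * r - 1).continuousWithinAt.tendsto_nhdsWithin
          fun s hs => (Part.mem_concat_right _ _ _).1 hs
      exact (h'.tendsto hj hr').comp (tendsto_fst.prodMk (hc.comp tendsto_snd))
  · rcases Part.concat_cases_lt hk with hk | rfl | ⟨j, hj, rfl⟩
    · simp only [concat_g_left _ _ hk]; exact h.g k hk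
    · simp only [concat_g_mid]; exact tendsto_const_nhds
    · simp only [concat_g_right]; exact h'.g j hj

lemma Lim.const (a : WayOn P x y) : Lim l (fun _ => a) a :=
  Lim.mk (fun k hk r hr => (a.c_cont k hk r hr).tendsto.comp tendsto_snd)
    fun _ _ => tendsto_const_nhds

end WayOn

/-! ### Homotopy classes of ways -/

/-- The path components of the space of ways. -/
def PiSet (x y : X.BasePoint) : Type u := ZerothHomotopy (WaySpace x y)

/-- The homotopy class of a system. -/
def WayOn.cls {P : Part} {x y : X.BasePoint} (σ : WayOn P x y) : PiSet x y :=
  Quotient.mk (pathSetoid (WaySpace x y)) σ.q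

namespace WaySpace

variable {x y z : X.BasePoint}

/-- Concatenation of classes of ways. -/
def mul : WaySpace x y → WaySpace y z → WaySpace x z :=
  Quotient.map₂ (fun σ τ => ⟨_, σ.2.concat τ.2⟩) fun _ _ h _ _ h' => WayOn.Equiv.concat h h'

lemma continuous_mul_left (β : WaySpace y z) : Continuous fun α : WaySpace x y => mul α β := by
  refine continuous_iff_continuousAt.2 fun α => ?_
  obtain ⟨P, a, rfl⟩ := WayOn.exists_q α
  obtain ⟨Q, b, rfl⟩ := WayOn.exists_q β
  exact WayOn.tendsto_of_lim a (F := fun a => a.concat b) (fun _ => rfl)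
    ((WayOn.lim_nhd a).concat (WayOn.Lim.const b))

lemma continuous_mul_right (α : WaySpace x y) : Continuous fun β : WaySpace y z => mul α β := by
  refine continuous_iff_continuousAt.2 fun β => ?_
  obtain ⟨P, a, rfl⟩ := WayOn.exists_q α
  obtain ⟨Q, b, rfl⟩ := WayOn.exists_q β
  exact WayOn.tendsto_of_lim b (F := fun b => a.concat b) (fun _ => rfl)
    ((WayOn.Lim.const a).concat (WayOn.lim_nhd b))

end WaySpace

namespace PiSet

variable {x y z : X.BasePoint}

/-- The product of homotopy classes. -/
def mul : PiSet x y → PiSet y z → PiSet x z :=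
  Quotient.map₂ WaySpace.mul fun _ _ h _ _ h' =>
    (h.map (WaySpace.continuous_mul_left _)).trans (h'.map (WaySpace.continuous_mul_right _))

lemma mul_cls {P Q : Part} (a : WayOn P x y) (b : WayOn Q y z) :
    mul a.cls b.cls = (a.concat b).cls := rfl

lemma exists_cls (α : PiSet x y) : ∃ (P : Part) (σ : WayOn P x y), σ.cls = α := by
  obtain ⟨β, rfl⟩ := Quotient.exists_rep α
  obtain ⟨P, σ, rfl⟩ := WayOn.exists_q β
  exact ⟨P, σ, rfl⟩

end PiSet

namespace WayOn

variable {P Q R : Part} {x y z : X.BasePoint}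

lemma cls_eq_iff {σ : WayOn P x y} {τ : WayOn Q x y} : σ.cls = τ.cls ↔ Joined σ.q τ.q :=
  Quotient.eq (r := pathSetoid _)

lemma Equiv.cls_eq {σ : WayOn P x y} {τ : WayOn Q x y} (h : Equiv σ τ) : σ.cls = τ.cls := by
  rw [cls, cls, q_eq_iff.2 h]

lemma cls_eq_of_family (F : unitInterval → WayOn P x y)
    (hc : ∀ k ≤ P.n, ContinuousOn (fun p : unitInterval × ℝ => (F p.1).c k p.2)
      (univ ×ˢ P.piece k))
    (hg : ∀ k < P.n, Continuous fun s => ((F s).g k).trans) : (F 0).cls = (F 1).cls := by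
  refine cls_eq_iff.2 ⟨⟨⟨fun s => (F s).q, continuous_iff_continuousAt.2 fun s => ?_⟩, rfl, rfl⟩⟩
  refine Lim.tendsto_q (Lim.mk (fun k hk r hr => ?_) fun k hk => (hg k hk).continuousAt)
  have := hc k hk (s, r) ⟨trivial, hr⟩
  rwa [ContinuousWithinAt, nhdsWithin_prod_eq, nhdsWithin_univ] at this

end WayOn

namespace Loop

variable {p : X.BasePoint}

lemma cls_eq_iff {a b : X.Loop p} : a.cls = b.cls ↔ a.way.cls = b.way.cls := by
  rw [WayOn.cls_eq_iff]
  refine (Quotient.eq (r := pathSetoid (X.LoopSpace p))).trans ?_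
  constructor
  · exact fun h => h.map continuous_toWaySpace
  · exact fun h => h.map continuous_ofWaySpace

lemma concat_way_cls (a b : X.Loop p) :
    (a.concat b).way.cls = PiSet.mul a.way.cls b.way.cls := rfl

lemma exists_way_cls (α : PiSet p p) : ∃ a : X.Loop p, a.way.cls = α := by
  obtain ⟨P, σ, rfl⟩ := PiSet.exists_cls α
  exact ⟨ofWay σ, rfl⟩

end Loop

open Orbispace.Part (concat_n concat_cases concat_cases_lt concat_t_left concat_t_right mem_concat_left mem_concat_right)

namespace Part

/-- A reparametrization of the partition `P` by the partition `Q`: the `k`-th piece of `Q` is mapped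
to the `θ k`-th piece of `P`. -/
structure Map (Q P : Part) (θ : ℕ → ℕ) (h : ℕ → ℝ → ℝ) : Prop where
  cont : ∀ k ≤ Q.n, ContinuousOn (h k) (Q.piece k)
  maps : ∀ k ≤ Q.n, MapsTo (h k) (Q.piece k) (P.piece (θ k))
  le : ∀ k ≤ Q.n, θ k ≤ P.n
  zero : θ 0 = 0
  last : θ Q.n = P.n
  step : ∀ k < Q.n, (θ (k + 1) = θ k ∧ h (k + 1) (Q.t (k + 1)) = h k (Q.t (k + 1))) ∨
    (θ (k + 1) = θ k + 1 ∧ h k (Q.t (k + 1)) = P.t (θ k + 1) ∧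
      h (k + 1) (Q.t (k + 1)) = P.t (θ k + 1))
  start : h 0 0 = 0
  finish : h Q.n 1 = 1

variable {P Q R : Part} {θ : ℕ → ℕ} {h h' : ℕ → ℝ → ℝ}

lemma Sub.map (hs : Q.Sub P θ) : Map Q P θ fun _ r => r where
  cont _ _ := continuousOn_id
  maps k hk _ hr := hs.sub k hk hr
  le := hs.le
  zero := hs.zero
  last := hs.last
  step k hk := by
    rcases hs.step hk with e | e
    · exact Or.inl ⟨e, rfl⟩
    · exact Or.inr ⟨e, hs.t_eq hk e, hs.t_eq hk e⟩
  start := rfl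
  finish := rfl

lemma Map.convex (m : Map Q P θ h) (m' : Map Q P θ h') {s : ℝ} (hs : s ∈ Icc (0 : ℝ) 1) :
    Map Q P θ fun k r => (1 - s) * h k r + s * h' k r where
  cont k hk := (continuousOn_const.mul (m.cont k hk)).add (continuousOn_const.mul (m'.cont k hk))
  maps k hk r hr := by
    have h1 := m.maps k hk hr
    have h2 := m'.maps k hk hr
    have h3 : (0 : ℝ) ≤ 1 - s := by linarith [hs.2]
    exact convex_Icc _ _ h1 h2 h3 hs.1 (by ring)
  le := m.le
  zero := m.zero
  last := m.last
  step k hk := by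
    rcases m.step k hk with ⟨e, e1⟩ | ⟨e, e1, e2⟩ <;> rcases m'.step k hk with ⟨f, f1⟩ | ⟨f, f1, f2⟩
    · exact Or.inl ⟨e, by rw [e1, f1]⟩
    · omega
    · omega
    · grind
  start := by rw [m.start, m'.start]; ring
  finish := by rw [m.finish, m'.finish]; ring

lemma Map.comp {h' : ℕ → ℝ → ℝ} (m : Map Q P id h) (m' : Map R Q id h') :
    Map R P id fun k r => h k (h' k r) where
  cont k hk := (m.cont k (m'.le k hk)).comp (m'.cont k hk) (m'.maps k hk)
  maps k hk r hr := m.maps k (m'.le k hk) (m'.maps k hk hr)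
  le k hk := m.le k (m'.le k hk)
  zero := rfl
  last := m'.last.trans m.last
  step k hk := by
    have hn : R.n = Q.n := m'.last
    rcases m'.step k hk with ⟨e, -⟩ | ⟨-, f1, f2⟩
    · exact absurd e (by simp)
    rcases m.step k (hn ▸ hk) with ⟨e, -⟩ | ⟨-, e1, e2⟩
    · exact absurd e (by simp)
    grind
  start := by rw [m'.start, m.start]
  finish := by
    have hn : R.n = Q.n := m'.last
    rw [m'.finish, hn, m.finish]

lemma exists_map (P Q : Part) (hn : P.n = Q.n) : ∃ h, Map Q P id h := by
  have hne : ∀ k ≤ Q.n, 0 < Q.t (k + 1) - Q.t k := fun k hk => by linarith [Q.t_lt k hk]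
  have hne' : ∀ k ≤ Q.n, 0 < P.t (k + 1) - P.t k := fun k hk => by linarith [P.t_lt k (hn ▸ hk)]
  refine ⟨fun k r => P.t k + (r - Q.t k) / (Q.t (k + 1) - Q.t k) * (P.t (k + 1) - P.t k),
    fun k hk => by fun_prop, fun k hk r hr => ?_, fun k hk => hn ▸ hk, rfl, hn.symm,
    fun k hk => Or.inr ⟨rfl, ?_, ?_⟩, ?_, ?_⟩
  · have h1 := hne k hk
    have h2 := hne' k hk
    have h3 : 0 ≤ (r - Q.t k) / (Q.t (k + 1) - Q.t k) := div_nonneg (by linarith [hr.1]) h1.le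
    have h4 : (r - Q.t k) / (Q.t (k + 1) - Q.t k) ≤ 1 := (div_le_one h1).2 (by linarith [hr.2])
    constructor
    · simp_all
    · have := mul_le_mul_of_nonneg_right h4 h2.le
      simp only [id]; linarith
  · grind
  · simp only [id]
    rw [sub_self]; ring
  · simp only [P.t_zero, Q.t_zero]; ring
  · simp only [Q.t_last]
    have := hne _ le_rfl
    rw [Q.t_last] at this
    rw [div_self this.ne', ← hn, P.t_last]; ring

/-- Position in the block of indices with the same value of `θ`. -/
def pos (θ : ℕ → ℕ) : ℕ → ℕ
  | 0 => 0
  | k + 1 => if θ (k + 1) = θ k then pos θ k + 1 else 0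

lemma pos_le (θ : ℕ → ℕ) (k : ℕ) : pos θ k ≤ k := by
  induction k with
  | zero => exact le_rfl
  | succ k ih => rw [pos]; split_ifs <;> omega

/-- Every index map comes from a subdivision. -/
lemma Map.exists_sub (m : Map Q P θ h) : ∃ R : Part, R.n = Q.n ∧ R.Sub P θ := by
  obtain ⟨N, hNdef⟩ : ∃ N : ℝ, N = (Q.n + 1 : ℕ) := ⟨_, rfl⟩
  have hN : 0 < N := by rw [hNdef]; positivity
  let t : ℕ → ℝ := fun k => if k ≤ Q.n then
    P.t (θ k) + (P.t (θ k + 1) - P.t (θ k)) * (pos θ k / N) else 1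
  have hlt : ∀ k ≤ Q.n, P.t (θ k) ≤ t k ∧ t k < t (k + 1) ∧ t (k + 1) ≤ P.t (θ k + 1) := by
    intro k hk
    have hd : 0 < P.t (θ k + 1) - P.t (θ k) := by linarith [P.t_lt _ (m.le k hk)]
    have hp : ∀ j ≤ Q.n, (pos θ j : ℝ) / N < 1 := fun j hj => by
      rw [div_lt_one hN, hNdef]
      have := (pos_le θ j).trans hj
      exact_mod_cast Nat.lt_succ_of_le this
    have e : t k = P.t (θ k) + (P.t (θ k + 1) - P.t (θ k)) * (pos θ k / N) := if_pos hk
    have h1 : 0 ≤ (P.t (θ k + 1) - P.t (θ k)) * (pos θ k / N) :=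
      mul_nonneg hd.le (div_nonneg (Nat.cast_nonneg _) hN.le)
    have h2 := mul_lt_mul_of_pos_left (hp k hk) hd
    have h3 : t k < P.t (θ k + 1) := by rw [e]; linarith
    refine ⟨by rw [e]; linarith, ?_⟩
    rcases hk.lt_or_eq with hk' | rfl
    · have e' : t (k + 1) = P.t (θ (k + 1)) +
        (P.t (θ (k + 1) + 1) - P.t (θ (k + 1))) * (pos θ (k + 1) / N) := if_pos hk'
      rcases m.step k hk' with ⟨f, -⟩ | ⟨f, -⟩
      · have h4 := mul_lt_mul_of_pos_left (hp (k + 1) hk') hd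
        have h5 : (pos θ k : ℝ) / N < pos θ (k + 1) / N := by
          rw [pos, if_pos f]; push_cast
          gcongr; linarith
        have h6 := mul_lt_mul_of_pos_left h5 hd
        rw [e', f, e]
        exact ⟨by linarith, by linarith⟩
      · have h0 : pos θ (k + 1) = 0 := by rw [pos, if_neg (by omega)]
        simp_all
    · have e2 : t (Q.n + 1) = P.t (θ Q.n + 1) := by rw [m.last, P.t_last]; exact if_neg (by omega)
      rw [e2]; exact ⟨h3, le_rfl⟩
  refine ⟨⟨Q.n, Q.one_le, t, ?_, if_neg (by omega), fun k hk => (hlt k hk).2.1⟩, rfl, m.le,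
    fun k hk => Icc_subset_Icc (hlt k hk).1 (hlt k hk).2.2⟩
  rw [show t 0 = _ from if_pos (Nat.zero_le _), m.zero, P.t_zero]
  simp [pos]

end Part

namespace WayOn

variable {P Q R : Part} {x y z : X.BasePoint} {θ : ℕ → ℕ} {h h' : ℕ → ℝ → ℝ}

/-- The reparametrization of a system. -/
def pull (σ : WayOn P x y) (m : Part.Map Q P θ h) : WayOn Q x y where
  c k r := σ.c (θ k) (h k r)
  c_cont k hk := (σ.c_cont _ (m.le k hk)).comp (m.cont k hk) (m.maps k hk)
  g k := σ.step (θ k) (θ (k + 1)) (h k (Q.t (k + 1)))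
  g_source k hk := by
    rcases m.step k hk with ⟨e, e1⟩ | ⟨e, e1, e2⟩
    · rw [e, step_self]; rfl
    · have := m.le (k + 1) hk
      rw [e, step_succ, e1, σ.g_source _ (by omega)]
  g_target k hk := by
    rcases m.step k hk with ⟨e, e1⟩ | ⟨e, e1, e2⟩
    · rw [e, step_self, id_target, e1]
    · have := m.le (k + 1) hk
      rw [e, step_succ, e2, σ.g_target _ (by omega)]
  start := by rw [m.zero, m.start, σ.start]
  finish := by rw [m.last, m.finish, σ.finish]

lemma cls_pull_eq (σ : WayOn P x y) (m : Part.Map Q P θ h) (m' : Part.Map Q P θ h') :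
    (σ.pull m).cls = (σ.pull m').cls := by
  have key := cls_eq_of_family (fun s : unitInterval => σ.pull (m.convex m' s.2)) ?_ ?_
  · simp_all
  · intro k hk
    refine (σ.c_cont _ (m.le k hk)).comp (t := P.piece (θ k)) ?_
      fun p hp => (m.convex m' p.1.2).maps k hk hp.2
    have h1 : ContinuousOn (fun p : unitInterval × ℝ => h k p.2) (univ ×ˢ Q.piece k) :=
      (m.cont k hk).comp continuousOn_snd fun p hp => hp.2
    have h2 : ContinuousOn (fun p : unitInterval × ℝ => h' k p.2) (univ ×ˢ Q.piece k) :=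
      (m'.cont k hk).comp continuousOn_snd fun p hp => hp.2
    have h3 : Continuous fun p : unitInterval × ℝ => (p.1 : ℝ) := by fun_prop
    exact ((continuousOn_const.sub h3.continuousOn).mul h1).add (h3.continuousOn.mul h2)
  · intro k hk
    change Continuous fun s : unitInterval => (σ.step (θ k) (θ (k + 1)) _).trans
    rcases m.step k hk with ⟨e, -⟩ | ⟨e, -⟩
    · simp only [e, step_self]
      refine continuous_const.congr fun s => Arrow.id_trans_congr (b := σ.c (θ k) (P.t (θ k))) ?_
      exact σ.fst_eq (m.le k hk.le) (P.left_mem (m.le k hk.le))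
        ((m.convex m' s.2).maps k hk.le (Q.right_mem hk.le))
    · simp only [e, step_succ]; exact continuous_const

lemma cls_sub (σ : WayOn P x y) (hs : Q.Sub P θ) : (σ.sub hs).cls = σ.cls :=
  (equiv_sub σ hs).cls_eq

lemma cls_pull_of_sub (σ : WayOn P x y) (hs : Q.Sub P θ) (m : Part.Map Q P θ h) :
    (σ.pull m).cls = σ.cls := by
  rw [← cls_sub σ hs, cls_pull_eq σ m hs.map]
  exact (equiv_of_eqOn (fun k hk r hr => rfl) fun k hk => rfl).cls_eq

lemma pull_pull_cls (σ : WayOn P x y) {h' : ℕ → ℝ → ℝ} (m : Part.Map Q P id h)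
    (m' : Part.Map R Q id h') : ((σ.pull m).pull m').cls = (σ.pull (m.comp m')).cls :=
  (equiv_of_eqOn (σ := (σ.pull m).pull m') (τ := σ.pull (m.comp m')) (fun _ _ _ _ => rfl)
    fun k hk => by
      change (σ.pull m).step k (k + 1) _ = σ.step k (k + 1) _
      rw [step_succ, step_succ]
      exact step_succ _ _ _).cls_eq

end WayOn

namespace Part

variable {P Q R : Part}

/-- Reparametrization between the two partitions preserves classes. -/
def Good (X : Orbispace.{u}) (P Q : Part) : Prop :=
  P.n = Q.n ∧ ∀ (x y : X.BasePoint) (σ : WayOn P x y) (h : ℕ → ℝ → ℝ) (m : Map Q P id h),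
    (σ.pull m).cls = σ.cls

namespace Good

lemma of_eqOn (hn : P.n = Q.n) (ht : ∀ k ≤ P.n + 1, P.t k = Q.t k) : Good X P Q := by
  refine ⟨hn, fun x y σ h m => WayOn.cls_pull_of_sub σ ⟨fun k hk => hn ▸ hk, fun k hk => ?_⟩ m⟩
  rw [piece, piece, id, ht k (by omega), ht (k + 1) (by omega)]

lemma trans (h : Good X P Q) (h' : Good X Q R) : Good X P R := by
  refine ⟨h.1.trans h'.1, fun x y σ f m => ?_⟩
  obtain ⟨f₁, m₁⟩ := exists_map P Q h.1
  obtain ⟨f₂, m₂⟩ := exists_map Q R h'.1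
  rw [WayOn.cls_pull_eq σ m (m₁.comp m₂), ← WayOn.pull_pull_cls σ m₁ m₂, h'.2, h.2]

lemma symm (h : Good X P Q) : Good X Q P := by
  refine ⟨h.1.symm, fun x y τ f m => ?_⟩
  obtain ⟨f₁, m₁⟩ := exists_map P Q h.1
  rw [← h.2 x y (τ.pull m) f₁ m₁, WayOn.pull_pull_cls]
  exact WayOn.cls_pull_of_sub τ (Sub.refl Q) _

end Good

end Part

section

variable {b : X.BasePoint} {j k m : ℕ} {r t' : ℝ}

namespace Arrow

lemma isSq_id (a : X.Arrow) {b' : X.BasePoint} (h : a.source = b) (h' : a.target = b') :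
    IsSq a a (Arrow.id b) (Arrow.id b') := by
  obtain ⟨f, rfl⟩ := exists_ofHom h h'
  rw [← ofHom_id, ← ofHom_id, isSq_ofHom, comp_id, id_comp]

lemma isSq_id_left (a : X.Arrow) (h : a.source = b) : IsSq (Arrow.id b) a (Arrow.id b) a := by
  obtain ⟨b', h'⟩ : ∃ b', a.target = b' := ⟨_, rfl⟩
  obtain ⟨f, rfl⟩ := exists_ofHom h h'
  rw [← ofHom_id, isSq_ofHom]

lemma isSq_id_right (a : X.Arrow) (h : a.target = b) : IsSq a (Arrow.id b) a (Arrow.id b) := by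
  obtain ⟨b', h'⟩ : ∃ b', a.source = b' := ⟨_, rfl⟩
  obtain ⟨f, rfl⟩ := exists_ofHom h' h
  rw [← ofHom_id, isSq_ofHom]

end Arrow

namespace Part

variable {P Q R : Part}

/-- Move one of the times of a partition. -/
def lower (P : Part) (hk : k < P.n) (h1 : P.t k < t') (h2 : t' < P.t (k + 1)) : Part where
  n := P.n
  one_le := P.one_le
  t := Function.update P.t (k + 1) t'
  t_zero := by rw [Function.update_of_ne (by omega), P.t_zero]
  t_last := by rw [Function.update_of_ne (by omega), P.t_last]
  t_lt j hj := by
    have := P.t_lt j hj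
    by_cases e : j = k
    · grind
    · grind

/-- Add a time to a partition. -/
def insert (P : Part) (hk : k < P.n) (h1 : P.t k < t') (h2 : t' < P.t (k + 1)) : Part where
  n := P.n + 1
  one_le := by omega
  t j := if j ≤ k then P.t j else if j = k + 1 then t' else P.t (j - 1)
  t_zero := by rw [if_pos (Nat.zero_le _), P.t_zero]
  t_last := by rw [if_neg (by omega), if_neg (by omega), Nat.add_sub_cancel, P.t_last]
  t_lt j hj := by
    rcases lt_trichotomy j (k + 1) with h | rfl | h
    · rw [if_pos (by omega)]
      by_cases e : j = k
      · grind
      · rw [if_pos (by omega)]; exact P.t_lt j (by omega)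
    · grind
    · obtain ⟨i, rfl⟩ : ∃ i, j = i + 1 := ⟨j - 1, by omega⟩
      rw [if_neg (by omega), if_neg (by omega), if_neg (by omega), if_neg (by omega)]
      exact P.t_lt i (by omega)

section Lower

variable {k : ℕ} (hk : k < P.n) {t' : ℝ} (h1 : P.t k < t') (h2 : t' < P.t (k + 1))

lemma lower_t_self : (P.lower hk h1 h2).t (k + 1) = t' := Function.update_self _ _ _

lemma lower_t (hj : j ≠ k + 1) : (P.lower hk h1 h2).t j = P.t j := Function.update_of_ne hj _ _

lemma insert_t_left (hj : j ≤ k) : (P.insert hk h1 h2).t j = P.t j := if_pos hj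

lemma insert_t_mid : (P.insert hk h1 h2).t (k + 1) = t' := (if_neg (by omega)).trans (if_pos rfl)

lemma insert_t_right (hj : k + 1 ≤ j) : (P.insert hk h1 h2).t (j + 1) = P.t j :=
  (if_neg (by omega)).trans (if_neg (by omega))

/-- The index map that drops the index `m`. -/
def drop (m j : ℕ) : ℕ := if j ≤ m then j else j - 1

lemma drop_le (h : j ≤ m) : drop m j = j := if_pos h

lemma drop_succ (h : m ≤ j) : drop m (j + 1) = j := if_neg (by omega)

lemma insert_sub : (P.insert hk h1 h2).Sub P (drop k) := by
  constructor
  · intro j hj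
    change j ≤ P.n + 1 at hj
    rw [drop]; split_ifs <;> omega
  · intro j hj
    change j ≤ P.n + 1 at hj
    rcases lt_trichotomy j k with h | rfl | h
    · rw [drop_le h.le, piece, piece, insert_t_left _ _ _ h.le, insert_t_left _ _ _ h]
    · rw [drop_le le_rfl, piece, piece, insert_t_left _ _ _ le_rfl, insert_t_mid]
      exact Icc_subset_Icc le_rfl h2.le
    · obtain ⟨i, rfl⟩ : ∃ i, j = i + 1 := ⟨j - 1, by omega⟩
      rw [drop_succ (by omega), piece, piece]
      by_cases e : i = k
      · subst e
        rw [insert_t_mid, insert_t_right _ _ _ le_rfl]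
        exact Icc_subset_Icc h1.le le_rfl
      · rw [insert_t_right _ _ _ (by omega), insert_t_right _ _ _ (by omega)]

lemma insert_sub_lower : (P.insert hk h1 h2).Sub (P.lower hk h1 h2) (drop (k + 1)) := by
  constructor
  · intro j hj
    change j ≤ P.n + 1 at hj
    change _ ≤ P.n
    rw [drop]; split_ifs <;> omega
  · intro j hj
    change j ≤ P.n + 1 at hj
    rcases lt_trichotomy j (k + 1) with h | rfl | h
    · rw [drop_le h.le, piece, piece, insert_t_left _ _ _ (by omega), lower_t _ _ _ (by omega)]
      by_cases e : j = k
      · subst e; rw [insert_t_mid, lower_t_self]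
      · rw [insert_t_left _ _ _ (by omega), lower_t _ _ _ (by omega)]
    · rw [drop_le le_rfl, piece, piece, insert_t_mid, lower_t_self, insert_t_right _ _ _ le_rfl,
        lower_t _ _ _ (by omega)]
      exact Icc_subset_Icc le_rfl (P.t_lt _ hk).le
    · obtain ⟨i, rfl⟩ : ∃ i, j = i + 1 := ⟨j - 1, by omega⟩
      rw [drop_succ (by omega), piece, piece, insert_t_right _ _ _ (by omega),
        insert_t_right _ _ _ (by omega), lower_t _ _ _ (j := i + 1) (by omega)]
      by_cases e : i = k + 1
      · subst e; rw [lower_t_self]; exact Icc_subset_Icc h2.le le_rfl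
      · rw [lower_t _ _ _ e]

/-- Run through the piece in a shorter time. -/
def fast (P : Part) (k : ℕ) (t' r : ℝ) : ℝ :=
  min (P.t (k + 1)) (P.t k + (r - P.t k) * ((P.t (k + 1) - P.t k) / (t' - P.t k)))

include h1 h2 in
lemma fast_eq (hr : t' ≤ r) : fast P k t' r = P.t (k + 1) := by
  refine min_eq_left ?_
  have ha : 0 < t' - P.t k := by linarith
  have : (t' - P.t k) * ((P.t (k + 1) - P.t k) / (t' - P.t k)) = P.t (k + 1) - P.t k := by
    field_simp
  have h3 : (t' - P.t k) * ((P.t (k + 1) - P.t k) / (t' - P.t k)) ≤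
      (r - P.t k) * ((P.t (k + 1) - P.t k) / (t' - P.t k)) :=
    mul_le_mul_of_nonneg_right (by linarith) (div_nonneg (by linarith) ha.le)
  linarith

include h1 h2 in
lemma fast_mem (hr : P.t k ≤ r) : fast P k t' r ∈ P.piece k := by
  refine ⟨le_min (h1.trans h2).le ?_, min_le_left _ _⟩
  have : 0 ≤ (r - P.t k) * ((P.t (k + 1) - P.t k) / (t' - P.t k)) :=
    mul_nonneg (by linarith) (div_nonneg (by linarith) (by linarith))
  linarith

include h1 h2 in
lemma fast_left : fast P k t' (P.t k) = P.t k := by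
  rw [fast, sub_self, zero_mul, add_zero]
  exact min_eq_right (h1.trans h2).le

/-- A reparametrization with a pause at the end of a piece. -/
def pauseLeft (P : Part) (k : ℕ) (t' : ℝ) (j : ℕ) (r : ℝ) : ℝ :=
  if j = k then fast P k t' r else r

/-- A reparametrization with a pause at the beginning of a piece. -/
def pauseRight (P : Part) (k : ℕ) (t' : ℝ) (j : ℕ) (r : ℝ) : ℝ :=
  if j = k then fast P k t' r else if j = k + 1 then max (P.t (k + 1)) r else r

lemma continuous_fast : Continuous (fast P k t') := by unfold fast; fun_prop

include hk h1 h2 in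
lemma map_pauseLeft : Map P P id (pauseLeft P k t') where
  cont j _ := by
    unfold pauseLeft
    split_ifs
    · exact continuous_fast.continuousOn
    · exact continuousOn_id
  maps j hj r hr := by
    unfold pauseLeft
    split_ifs with e
    · subst e; exact fast_mem h1 h2 hr.1
    · exact hr
  le _ h := h
  zero := rfl
  last := rfl
  step j hj := by
    refine Or.inr ⟨rfl, ?_, ?_⟩
    · unfold pauseLeft
      split_ifs with e
      · subst e; exact fast_eq h1 h2 h2.le
      · rfl
    · unfold pauseLeft
      split_ifs with e
      · subst e; exact fast_left h1 h2
      · rfl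
  start := by
    unfold pauseLeft
    split_ifs with e
    · subst e
      have := fast_left h1 h2
      rwa [P.t_zero] at this
    · rfl
  finish := if_neg (by omega)

lemma map_pauseRight : Map (P.lower hk h1 h2) P id (pauseRight P k t') where
  cont j _ := by
    unfold pauseRight
    split_ifs
    · exact continuous_fast.continuousOn
    · fun_prop
    · exact continuousOn_id
  maps j hj r hr := by
    unfold pauseRight
    split_ifs with e e'
    · subst e
      rw [piece, lower_t _ _ _ (by omega)] at hr
      exact fast_mem h1 h2 hr.1
    · subst e'
      rw [piece, lower_t_self, lower_t _ _ _ (by omega)] at hr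
      exact ⟨le_max_left _ _, max_le (P.t_lt _ hk).le hr.2⟩
    · rw [piece, lower_t _ _ _ (by omega), lower_t _ _ _ (by omega)] at hr
      exact hr
  le _ h := h
  zero := rfl
  last := rfl
  step j hj := by
    refine Or.inr ⟨rfl, ?_, ?_⟩
    · unfold pauseRight
      split_ifs with e e'
      · subst e; rw [lower_t_self]; exact fast_eq h1 h2 le_rfl
      · subst e'
        rw [lower_t _ _ _ (by omega)]
        exact max_eq_right (P.t_lt _ hk).le
      · rw [lower_t _ _ _ (by omega)]; rfl
    · unfold pauseRight
      split_ifs with e e'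
      · subst e; rw [lower_t _ _ _ (by omega)]; exact fast_left h1 h2
      · obtain rfl : j = k := by omega
        rw [lower_t_self]; exact max_eq_left h2.le
      · rw [lower_t _ _ _ (by omega)]; rfl
  start := by
    unfold pauseRight
    split_ifs with e e'
    · subst e
      have := fast_left h1 h2
      rwa [P.t_zero] at this
    · exact e'.elim
    · rfl
  finish := by
    unfold pauseRight
    split_ifs with e e'
    · exact absurd e hk.ne'
    · rw [← e']
      refine max_eq_right ?_
      change P.t P.n ≤ 1
      exact (P.t_mem (by omega)).2
    · rfl

lemma equiv_pause {x y : X.BasePoint} (σ : WayOn P x y) :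
    WayOn.Equiv (σ.pull (map_pauseLeft hk h1 h2)) (σ.pull (map_pauseRight hk h1 h2)) := by
  set A := σ.pull (map_pauseLeft hk h1 h2) with hA
  set B := σ.pull (map_pauseRight hk h1 h2) with hB
  have hs := insert_sub hk h1 h2
  have hs' := insert_sub_lower hk h1 h2
  have hAc : ∀ j r, A.c j r = σ.c j (pauseLeft P k t' j r) := fun _ _ => rfl
  have hBc : ∀ j r, B.c j r = σ.c j (pauseRight P k t' j r) := fun _ _ => rfl
  have hAg : ∀ j, A.g j = σ.g j := fun j => WayOn.step_succ _ _ _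
  have hBg : ∀ j, B.g j = σ.g j := fun j => WayOn.step_succ _ _ _
  have e0 : ∀ j r, j ≤ k → A.c j r = B.c j r := by
    intro j r hj
    rw [hAc, hBc, pauseLeft, pauseRight]
    split_ifs <;> first | rfl | omega
  have e1 : ∀ j r, k + 1 ≤ j → P.t j ≤ r → A.c j r = B.c j r := by
    intro j r hj hr
    rw [hAc, hBc, pauseLeft, pauseRight, if_neg (by omega), if_neg (by omega)]
    grind
  have e2 : ∀ r, t' ≤ r → A.c k r = (σ.g k).source := by
    intro r hr
    rw [hAc, pauseLeft, if_pos rfl, fast_eq h1 h2 hr, σ.g_source k hk]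
  have e3 : ∀ r, r ≤ P.t (k + 1) → B.c (k + 1) r = (σ.g k).target := by
    intro r hr
    rw [hBc, pauseRight, if_neg (by omega), if_pos rfl, max_eq_left hr, σ.g_target k hk]
  let J : ℕ → ℝ → X.Arrow := fun j s => if j = k + 1 then σ.g k else Arrow.id (A.c (drop k j) s)
  have hJ : ∀ s, J (k + 1) s = σ.g k := fun s => if_pos rfl
  have hJ' : ∀ j s, j ≠ k + 1 → J j s = Arrow.id (A.c (drop k j) s) := fun j s h => if_neg h
  refine ⟨P.insert hk h1 h2, drop k, drop (k + 1), J, hs, hs', fun j hj => ?_, fun j hj s hsj => ?_,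
    fun j hj s hsj => ?_, fun s _ => hJ' _ _ (by omega), fun s _ => ?_, fun j hj => ?_⟩
  · by_cases e : j = k + 1
    · subst e; exact ⟨(σ.g k).trans, fun s _ => by rw [hJ]⟩
    · obtain ⟨T, hT⟩ := A.flat_id (hs.le j hj)
      exact ⟨T, fun s h => by rw [hJ' _ _ e]; exact hT s (hs.sub j hj h)⟩
  · by_cases e : j = k + 1
    · subst e
      rw [hJ, drop_succ le_rfl, e2]
      rw [piece, insert_t_mid] at hsj
      exact hsj.1
    · rw [hJ' _ _ e]; rfl
  · rcases lt_trichotomy j (k + 1) with h | rfl | h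
    · rw [hJ' _ _ h.ne, id_target, drop_le (by omega), drop_le h.le, e0 _ _ (by omega)]
    · rw [hJ, drop_le le_rfl, e3]
      rw [piece, insert_t_right _ _ _ le_rfl] at hsj
      exact hsj.2
    · obtain ⟨i, rfl⟩ : ∃ i, j = i + 1 := ⟨j - 1, by omega⟩
      rw [hJ' _ _ h.ne', id_target, drop_succ (by omega), drop_succ (by omega)]
      rw [piece, insert_t_right _ _ _ (by omega)] at hsj
      exact e1 _ _ (by omega) hsj.1
  · change J (P.n + 1) s = _
    rw [hJ' _ _ (by omega), drop_succ (by omega)]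
  · change j < P.n + 1 at hj
    rcases lt_trichotomy j k with h | rfl | h
    · rw [hJ' _ _ (by omega), hJ' _ _ (by omega), drop_le h.le, drop_le (by omega),
        drop_le (by omega), drop_le (by omega), WayOn.step_succ, WayOn.step_succ, hAg, hBg,
        insert_t_left _ _ _ h, ← hAg]
      exact Arrow.isSq_id _ (A.g_source j (by omega)) (A.g_target j (by omega))
    · rw [hJ' _ _ (by omega), hJ, drop_le le_rfl, drop_succ le_rfl, drop_le (by omega),
        drop_le le_rfl, WayOn.step_self, WayOn.step_succ, hBg, insert_t_mid]
      exact Arrow.isSq_id_left _ (e2 _ le_rfl).symm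
    · obtain ⟨i, rfl⟩ : ∃ i, j = i + 1 := ⟨j - 1, by omega⟩
      by_cases e : i = k
      · subst e
        rw [hJ, hJ' (i + 1 + 1) _ (by omega), drop_succ le_rfl, drop_succ (by omega), drop_le le_rfl,
          drop_succ le_rfl, WayOn.step_self, WayOn.step_succ, hAg, insert_t_right _ _ _ le_rfl,
          e1 _ _ le_rfl le_rfl]
        exact Arrow.isSq_id_right _ (e3 _ le_rfl).symm
      · rw [hJ' _ _ (by omega), hJ' _ _ (by omega), drop_succ (by omega), drop_succ (by omega),
          drop_succ (by omega), drop_succ (by omega), WayOn.step_succ, WayOn.step_succ, hAg, hBg,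
          insert_t_right _ _ _ (by omega), ← hAg]
        exact Arrow.isSq_id _ (A.g_source i (by omega)) (A.g_target i (by omega))

lemma good_lower : Good X P (P.lower hk h1 h2) := by
  refine ⟨rfl, fun x y σ h m => ?_⟩
  rw [WayOn.cls_pull_eq σ m (map_pauseRight hk h1 h2), ← (equiv_pause hk h1 h2 σ).cls_eq]
  exact WayOn.cls_pull_of_sub σ (Sub.refl P) _

end Lower

lemma good_of_le (hn : P.n = Q.n) (ht : ∀ k ≤ P.n + 1, Q.t k ≤ P.t k) : Good X P Q := by
  have key : ∀ j ≤ P.n + 1, ∃ R : Part, Good X P R ∧ R.n = P.n ∧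
      ∀ i ≤ P.n + 1, R.t i = if i ≤ j then Q.t i else P.t i := by
    intro j
    induction j with
    | zero =>
      refine fun _ => ⟨P, Good.of_eqOn rfl fun _ _ => rfl, rfl, fun i _ => ?_⟩
      split_ifs with h
      · obtain rfl : i = 0 := by omega
        rw [P.t_zero, Q.t_zero]
      · rfl
    | succ j ih =>
      intro hj
      obtain ⟨R, hR, hRn, hRt⟩ := ih (by omega)
      have hRj : R.t j = Q.t j := by rw [hRt j (by omega), if_pos le_rfl]
      have hRj' : R.t (j + 1) = P.t (j + 1) := by rw [hRt _ hj, if_neg (by omega)]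
      rcases (ht (j + 1) hj).lt_or_eq with h | h
      · have hjn : j < R.n := by
          rw [hRn]
          by_contra hc
          obtain rfl : j = P.n := by omega
          rw [P.t_last, hn, Q.t_last] at h
          exact lt_irrefl _ h
        have a1 : R.t j < Q.t (j + 1) := by rw [hRj]; exact Q.t_lt j (by omega)
        have a2 : Q.t (j + 1) < R.t (j + 1) := by rwa [hRj']
        refine ⟨R.lower hjn a1 a2, hR.trans (good_lower hjn a1 a2), hRn, fun i hi => ?_⟩
        by_cases e : i = j + 1
        · subst e; rw [lower_t_self, if_pos le_rfl]
        · rw [lower_t _ _ _ e, hRt i hi]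
          split_ifs <;> first | rfl | omega
      · grind
  obtain ⟨R, hR, hRn, hRt⟩ := key _ le_rfl
  refine hR.trans (Good.of_eqOn (hRn.trans hn) fun k hk => ?_)
  rw [hRn] at hk
  rw [hRt k hk, if_pos hk]

lemma good (hn : P.n = Q.n) : Good X P Q := by
  let M : Part := ⟨P.n, P.one_le, fun k => min (P.t k) (Q.t k), by rw [P.t_zero, Q.t_zero, min_self],
    by rw [P.t_last, hn, Q.t_last, min_self],
    fun k hk => lt_min ((min_le_left _ _).trans_lt (P.t_lt k hk))
      ((min_le_right _ _).trans_lt (Q.t_lt k (hn ▸ hk)))⟩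
  exact (good_of_le (P := P) (Q := M) rfl fun _ _ => min_le_left _ _).trans
    (good_of_le (P := Q) (Q := M) hn.symm fun _ _ => min_le_right _ _).symm

end Part

namespace WayOn

variable {P Q R : Part} {x y z : X.BasePoint} {θ : ℕ → ℕ} {h h' : ℕ → ℝ → ℝ}

lemma cls_pull (σ : WayOn P x y) (m : Part.Map Q P θ h) : (σ.pull m).cls = σ.cls := by
  obtain ⟨R, hRn, hR⟩ := m.exists_sub
  obtain ⟨f, mf⟩ := Part.exists_map R Q hRn
  have hm : Part.Map Q P θ f := by
    refine ⟨mf.cont, fun k hk r hr => hR.sub k (hRn ▸ hk) (mf.maps k hk hr), m.le, m.zero, m.last,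
      fun k hk => ?_, mf.start, mf.finish⟩
    rcases mf.step k hk with ⟨e, -⟩ | ⟨-, e1, e2⟩
    · exact absurd e (by simp)
    simp only [id] at e1 e2
    rcases m.step k hk with ⟨e, -⟩ | ⟨e, -⟩
    · exact Or.inl ⟨e, e2.trans e1.symm⟩
    · have := hR.t_eq (hRn ▸ hk) e
      exact Or.inr ⟨e, e1.trans this, e2.trans this⟩
  rw [cls_pull_eq σ m hm, ← cls_sub σ hR, ← (Part.good hRn).2 _ _ (σ.sub hR) f mf]
  refine (equiv_of_eqOn (σ := σ.pull hm) (τ := (σ.sub hR).pull mf) (fun k hk r hr => rfl)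
    fun k hk => ?_).cls_eq
  change σ.step _ _ _ = (σ.sub hR).step k (k + 1) _
  rw [step_succ]
  change σ.step _ _ _ = σ.step _ _ _
  rcases m.step k hk with ⟨e, -⟩ | ⟨e, -⟩
  · rw [e, step_self, step_self]
    rcases mf.step k hk with ⟨e, -⟩ | ⟨-, e1, -⟩
    · exact absurd e (by simp)
    · rw [e1]; rfl
  · rw [e, step_succ, step_succ]

/-- A system that is obtained from another one by reparametrization. -/
lemma cls_eq_of_map {τ : WayOn Q x y} {σ : WayOn P x y} (m : Part.Map Q P θ h)
    (hc : ∀ k ≤ Q.n, ∀ r ∈ Q.piece k, τ.c k r = σ.c (θ k) (h k r))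
    (hg : ∀ k < Q.n, τ.g k = σ.step (θ k) (θ (k + 1)) (h k (Q.t (k + 1)))) : τ.cls = σ.cls := by
  rw [← cls_pull σ m]
  exact (equiv_of_eqOn hc hg).cls_eq

end WayOn

end

open WayOn (step_succ step_self concat_g_left concat_g_right concat_g_mid concat_c_left concat_c_right)

namespace Part

/-- The partition of the unit interval with two pieces of equal length. -/
def two : Part where
  n := 1
  one_le := le_rfl
  t k := k / 2
  t_zero := by norm_num
  t_last := by norm_num
  t_lt k _ := by push_cast; linarith

lemma two_n : two.n = 1 := rfl

lemma two_t (k : ℕ) : two.t k = k / 2 := rfl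

lemma mem_two_zero {r : ℝ} : r ∈ two.piece 0 ↔ 0 ≤ r ∧ r ≤ 1 / 2 := by
  rw [piece, two_t, two_t, mem_Icc]; norm_num

lemma mem_two_one {r : ℝ} : r ∈ two.piece 1 ↔ 1 / 2 ≤ r ∧ r ≤ 1 := by
  rw [piece, two_t, two_t, mem_Icc]; norm_num

lemma two_t_one : two.t (0 + 1) = 1 / 2 := by rw [two_t]; norm_num

lemma mem_two {k : ℕ} (hk : k ≤ 1) {r : ℝ} (hr : r ∈ two.piece k) : r ∈ Icc (0 : ℝ) 1 :=
  two.piece_subset hk hr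

end Part

namespace WayOn

variable {P Q R : Part} {x y z w : X.BasePoint}

/-- A system all of whose transition maps are identities depends only on the path. -/
lemma cls_eq_of_flat {σ : WayOn P x y} {τ : WayOn Q x y} (f : ℝ → X.BasePoint)
    (hf : ContinuousOn f (Icc 0 1))
    (h1 : ∀ k ≤ P.n, ∀ r ∈ P.piece k, σ.c k r = f r)
    (h2 : ∀ k < P.n, σ.g k = Arrow.id (f (P.t (k + 1))))
    (h3 : ∀ k ≤ Q.n, ∀ r ∈ Q.piece k, τ.c k r = f r)
    (h4 : ∀ k < Q.n, τ.g k = Arrow.id (f (Q.t (k + 1)))) : σ.cls = τ.cls := by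
  obtain ⟨R, θ, θ', hθ, hθ'⟩ := Part.exists_common P Q
  have e1 : ∀ k < R.n, σ.step (θ k) (θ (k + 1)) (R.t (k + 1)) = Arrow.id (f (R.t (k + 1))) := by
    intro k hk
    rcases hθ.step hk with e | e
    · rw [e, step_self, h1 _ (hθ.le k hk.le) _ (hθ.sub k hk.le (R.right_mem hk.le))]
    · have := hθ.le (k + 1) hk
      rw [e, step_succ, h2 _ (by omega), hθ.t_eq hk e]
  have e2 : ∀ k < R.n, τ.step (θ' k) (θ' (k + 1)) (R.t (k + 1)) = Arrow.id (f (R.t (k + 1))) := by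
    intro k hk
    rcases hθ'.step hk with e | e
    · rw [e, step_self, h3 _ (hθ'.le k hk.le) _ (hθ'.sub k hk.le (R.right_mem hk.le))]
    · have := hθ'.le (k + 1) hk
      rw [e, step_succ, h4 _ (by omega), hθ'.t_eq hk e]
  refine Equiv.cls_eq ⟨R, θ, θ', fun _ s => Arrow.id (f s), hθ, hθ', fun k hk => ?_,
    fun k hk s hs => (h1 _ (hθ.le k hk) _ (hθ.sub k hk hs)).symm,
    fun k hk s hs => (id_target _).trans (h3 _ (hθ'.le k hk) _ (hθ'.sub k hk hs)).symm,
    fun s hs => ?_, fun s hs => ?_, fun k hk => ?_⟩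
  · refine ⟨(Arrow.id (f (R.t k))).trans, fun s hs => Arrow.id_trans_congr ?_⟩
    exact fst_eq_of_isPreconnected (I := R.piece k) isPreconnected_Icc
      (hf.mono (R.piece_subset hk)) hs (R.left_mem hk)
  · rw [← h1 0 (Nat.zero_le _) s (by have := hθ.sub 0 (Nat.zero_le _) hs; rwa [hθ.zero] at this)]
  · rw [← h1 P.n le_rfl s (by have := hθ.sub R.n le_rfl hs; rwa [hθ.last] at this)]
  · rw [e1 k hk, e2 k hk]
    exact Arrow.isSq_id_left _ rfl

/-- The system with two pieces, given by two paths and a transition map between them. -/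
def mk2 (γ : Path x y) (f : y ⟶ z) (γ' : Path z w) : WayOn Part.two x w where
  c k r := if k = 0 then γ.extend (2 * r) else γ'.extend (2 * r - 1)
  c_cont k _ := by
    split_ifs
    · exact (γ.continuous_extend.comp (by fun_prop)).continuousOn
    · exact (γ'.continuous_extend.comp (by fun_prop)).continuousOn
  g _ := ofHom f
  g_source k hk := by
    obtain rfl : k = 0 := by rw [Part.two_n] at hk; omega
    rw [if_pos rfl, Part.two_t_one, ofHom_source]; norm_num
  g_target k hk := by
    obtain rfl : k = 0 := by rw [Part.two_n] at hk; omega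
    rw [if_neg (by omega), Part.two_t_one, ofHom_target]; norm_num
  start := by rw [if_pos rfl]; simp
  finish := by rw [Part.two_n, if_neg (by omega)]; norm_num

/-- The system with two pieces given by a path. -/
def ofPath (γ : Path x y) : WayOn Part.two x y where
  c _ r := γ.extend r
  c_cont _ _ := γ.continuous_extend.continuousOn
  g _ := Arrow.id (γ.extend (1 / 2))
  g_source k hk := by
    obtain rfl : k = 0 := by rw [Part.two_n] at hk; omega
    rw [Part.two_t_one, Arrow.id_source]
  g_target k hk := by
    obtain rfl : k = 0 := by rw [Part.two_n] at hk; omega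
    rw [Part.two_t_one, id_target]
  start := γ.extend_zero
  finish := γ.extend_one

lemma ofPath_g (γ : Path x y) {k : ℕ} (hk : k < Part.two.n) :
    (ofPath γ).g k = Arrow.id (γ.extend (Part.two.t (k + 1))) := by
  obtain rfl : k = 0 := by rw [Part.two_n] at hk; omega
  rw [Part.two_t_one]; rfl

end WayOn

namespace PiSet

variable {x y z w v : X.BasePoint}

/-- The homotopy class of a path in one of the spaces `hat i`. -/
def path (γ : Path x y) : PiSet x y := (WayOn.ofPath γ).cls

/-- The homotopy class of a transition map. -/
def arr (f : x ⟶ y) : PiSet x y := (WayOn.mk2 (Path.refl x) f (Path.refl y)).cls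

/-- The neutral element. -/
def one (x : X.BasePoint) : PiSet x x := path (Path.refl x)

lemma path_trans (γ : Path x y) (γ' : Path y z) : path (γ.trans γ') = mul (path γ) (path γ') := by
  rw [path, path, path, mul_cls]
  refine WayOn.cls_eq_of_flat (γ.trans γ').extend (γ.trans γ').continuous_extend.continuousOn
    (fun _ _ _ _ => rfl) (fun k hk => WayOn.ofPath_g _ hk) (fun k hk r hr => ?_) fun k hk => ?_
  · rcases concat_cases hk with h | ⟨j, hj, rfl⟩
    · have hr' := Part.mem_two h ((mem_concat_left _ _ h).1 hr)
      have h2 : r ≤ 1 / 2 := by linarith [hr'.2]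
      rw [concat_c_left _ _ h, Path.extend_apply _ ⟨by linarith [hr'.1], by linarith⟩,
        Path.trans_apply, dif_pos h2]
      exact Path.extend_apply _ hr'
    · have hr' := Part.mem_two hj ((mem_concat_right _ _ j).1 hr)
      have h0 : r ∈ Icc (0 : ℝ) 1 := ⟨by linarith [hr'.1], by linarith [hr'.2]⟩
      rw [concat_c_right, Path.extend_apply _ h0]
      change γ'.extend _ = _
      grind
  · rcases concat_cases_lt hk with h | rfl | ⟨j, hj, rfl⟩
    · have h' := h
      rw [Part.two_n] at h'
      obtain rfl : k = 0 := by omega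
      rw [concat_g_left _ _ h, concat_t_left _ _ (by rw [Part.two_n]; omega),
        Part.two_t_one]
      change Arrow.id (γ.extend _) = _
      grind
    · rw [concat_g_mid, concat_t_left _ _ le_rfl, Part.two_n, Part.two_t,
        Path.extend_apply _ ⟨by norm_num, by norm_num⟩, Path.trans_apply, dif_pos (by norm_num)]
      congr 1
      grind
    · have hj' := hj
      rw [Part.two_n] at hj'
      obtain rfl : j = 0 := by omega
      rw [concat_g_right, add_assoc, concat_t_right, Part.two_t_one]
      change Arrow.id (γ'.extend _) = _
      grind

lemma path_eq_of_homotopic {γ γ' : Path x y} (h : γ.Homotopic γ') : path γ = path γ' := by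
  obtain ⟨H⟩ := h
  have hc : Continuous fun p : unitInterval × ℝ => (H.eval p.1).extend p.2 := by
    have : Continuous fun p : unitInterval × ℝ => H (p.1, projIcc 0 1 zero_le_one p.2) := by
      refine (map_continuous H).comp (continuous_fst.prodMk (continuous_projIcc.comp continuous_snd))
    exact this
  have key := WayOn.cls_eq_of_family (fun s => WayOn.ofPath (H.eval s))
    (fun k hk => hc.continuousOn) fun k hk => by
      refine continuous_const.congr (f := fun _ => (Arrow.id x).trans) fun s => ?_
      refine Arrow.id_trans_congr ?_
      have := fst_eq_of_isPreconnected isPreconnected_univ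
        ((H.eval s).continuous_extend.continuousOn (s := univ)) (mem_univ (0 : ℝ))
        (mem_univ (1 / 2))
      rwa [Path.extend_zero] at this
  rwa [H.eval_zero, H.eval_one] at key

lemma mul_one (α : PiSet x y) : mul α (one y) = α := by
  obtain ⟨P, σ, rfl⟩ := exists_cls α
  rw [one, path, mul_cls]
  set τ := WayOn.ofPath (Path.refl y) with hτ
  have hτc : ∀ k r, τ.c k r = y := fun k r => by aesop
  have hτg : ∀ k, τ.g k = Arrow.id y := fun k => by aesop
  clear_value τ
  clear hτ
  generalize Part.two = T at τ hτc hτg ⊢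
  let f : ℕ → ℝ → ℝ := fun k r => if k ≤ P.n then 2 * r else 1
  have f1 : ∀ {k} r, k ≤ P.n → f k r = 2 * r := fun r h => if_pos h
  have f2 : ∀ {k} r, P.n + 1 ≤ k → f k r = 1 := fun r h => if_neg (by omega)
  refine WayOn.cls_eq_of_map (P := P) (θ := fun k => min k P.n) (h := f)
    ⟨fun k _ => ?_, fun k hk r hr => ?_, fun k hk => min_le_right _ _, Nat.zero_min _, ?_,
      fun k hk => ?_, ?_, ?_⟩ (fun k hk r hr => ?_) fun k hk => ?_
  · simp only [f]
    split_ifs <;> fun_prop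
  · rcases concat_cases hk with h | ⟨j, hj, rfl⟩
    · rw [f1 _ h, min_eq_left h]
      exact (mem_concat_left _ _ h).1 hr
    · rw [f2 _ (by omega), min_eq_right (by omega)]
      exact P.one_mem
  · rw [concat_n]; exact min_eq_right (by omega)
  · rcases concat_cases_lt hk with h | rfl | ⟨j, hj, rfl⟩
    · rw [f1 _ h.le, f1 _ h, concat_t_left _ _ (by omega), min_eq_left h.le, min_eq_left h]
      exact Or.inr ⟨rfl, by ring, by ring⟩
    · refine Or.inl ⟨by omega, ?_⟩
      rw [concat_t_left _ _ le_rfl, Part.t_last, f1 _ le_rfl, f2 _ le_rfl]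
      norm_num
    · grind
  · rw [f1 _ (Nat.zero_le _), mul_zero]
  · rw [concat_n, f2 _ (by omega)]
  · rcases concat_cases hk with h | ⟨j, hj, rfl⟩
    · rw [concat_c_left _ _ h, f1 _ h, min_eq_left h]
    · rw [concat_c_right, f2 _ (by omega), min_eq_right (by omega), σ.finish, hτc]
  · rcases concat_cases_lt hk with h | rfl | ⟨j, hj, rfl⟩
    · rw [concat_g_left _ _ h, min_eq_left h.le, min_eq_left h, step_succ]
    · rw [concat_g_mid, min_self, min_eq_right (by omega), step_self, f1 _ le_rfl,
        concat_t_left _ _ le_rfl, P.t_last, show 2 * (1 / 2 : ℝ) = 1 by norm_num, σ.finish]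
    · rw [concat_g_right, min_eq_right (by omega), min_eq_right (by omega), step_self,
        f2 _ (by omega), σ.finish, hτg]

lemma mul_assoc (α : PiSet x y) (β : PiSet y z) (γ : PiSet z w) :
    mul (mul α β) γ = mul α (mul β γ) := by
  obtain ⟨P, a, rfl⟩ := exists_cls α
  obtain ⟨Q, b, rfl⟩ := exists_cls β
  obtain ⟨R, c, rfl⟩ := exists_cls γ
  rw [mul_cls, mul_cls, mul_cls, mul_cls]
  have hn : ((P.concat Q).concat R).n = (P.concat (Q.concat R)).n := by
    simp only [concat_n]; omega
  have cases : ∀ k ≤ ((P.concat Q).concat R).n, k ≤ P.n ∨ (∃ j ≤ Q.n, k = P.n + 1 + j) ∨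
      ∃ j ≤ R.n, k = P.n + 1 + Q.n + 1 + j := by
    intro k hk
    rcases concat_cases hk with h | ⟨j, hj, rfl⟩
    · exact (concat_cases h).imp_right Or.inl
    · exact Or.inr (Or.inr ⟨j, hj, rfl⟩)
  have cases' : ∀ k < ((P.concat Q).concat R).n, k < P.n ∨ k = P.n ∨
      (∃ j < Q.n, k = P.n + 1 + j) ∨ k = P.n + 1 + Q.n ∨ ∃ j < R.n, k = P.n + 1 + Q.n + 1 + j := by
    intro k hk
    simp only [concat_n] at hk
    rcases lt_trichotomy k P.n with h | h | h
    · exact Or.inl h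
    · exact Or.inr (Or.inl h)
    rcases lt_trichotomy k (P.n + 1 + Q.n) with h' | h' | h'
    · exact Or.inr (Or.inr (Or.inl ⟨k - (P.n + 1), by omega, by omega⟩))
    · exact Or.inr (Or.inr (Or.inr (Or.inl h')))
    · exact Or.inr (Or.inr (Or.inr (Or.inr ⟨k - (P.n + 1 + Q.n + 1), by omega, by omega⟩)))
  let f : ℕ → ℝ → ℝ := fun k r => if k ≤ P.n then 2 * r else if k ≤ P.n + 1 + Q.n then r + 1 / 4
    else (r + 1) / 2
  have f1 : ∀ {k} r, k ≤ P.n → f k r = 2 * r := fun r h => if_pos h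
  have f2 : ∀ {j} r, j ≤ Q.n → f (P.n + 1 + j) r = r + 1 / 4 := fun r h =>
    (if_neg (by omega)).trans (if_pos (by omega))
  have f3 : ∀ j r, f (P.n + 1 + Q.n + 1 + j) r = (r + 1) / 2 := fun j r =>
    (if_neg (by omega)).trans (if_neg (by omega))
  have tA1 : ∀ {k}, k ≤ P.n + 1 → ((P.concat Q).concat R).t k = P.t k / 2 / 2 := fun {k} h => by
    rw [concat_t_left _ _ (by rw [concat_n]; omega), concat_t_left _ _ h]
  have tA2 : ∀ {j}, j ≤ Q.n + 1 → ((P.concat Q).concat R).t (P.n + 1 + j) = (1 + Q.t j) / 2 / 2 :=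
    fun {j} h => by rw [concat_t_left _ _ (by rw [concat_n]; omega), concat_t_right]
  have tA3 : ∀ j, ((P.concat Q).concat R).t (P.n + 1 + Q.n + 1 + j) = (1 + R.t j) / 2 :=
    fun j => concat_t_right (P.concat Q) R j
  have tB1 : ∀ {k}, k ≤ P.n + 1 → (P.concat (Q.concat R)).t k = P.t k / 2 := fun {k} h =>
    concat_t_left _ _ h
  have tB2 : ∀ {j}, j ≤ Q.n + 1 → (P.concat (Q.concat R)).t (P.n + 1 + j) = (1 + Q.t j / 2) / 2 :=
    fun {j} h => by rw [concat_t_right, concat_t_left _ _ h]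
  have tB3 : ∀ j, (P.concat (Q.concat R)).t (P.n + 1 + Q.n + 1 + j) = (1 + (1 + R.t j) / 2) / 2 :=
    fun j => by
      rw [show P.n + 1 + Q.n + 1 + j = P.n + 1 + (Q.n + 1 + j) by omega, concat_t_right,
        concat_t_right]
  have hft : ∀ k ≤ ((P.concat Q).concat R).n,
      f k (((P.concat Q).concat R).t k) = (P.concat (Q.concat R)).t k ∧
      f k (((P.concat Q).concat R).t (k + 1)) = (P.concat (Q.concat R)).t (k + 1) := by
    intro k hk
    rcases cases k hk with h | ⟨j, hj, rfl⟩ | ⟨j, hj, rfl⟩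
    · grind
    · rw [f2 _ hj, f2 _ hj, tA2 (by omega), tB2 (by omega), add_assoc _ j, tA2 (by omega),
        tB2 (by omega)]
      constructor <;> ring
    · rw [f3, f3, add_assoc _ j, tA3, tA3, tB3, tB3]
      constructor <;> ring
  have hmono : ∀ k, Monotone (f k) := fun k r s hrs => by grind
  refine WayOn.cls_eq_of_map (θ := id) (h := f)
    ⟨fun k _ => ?_, fun k hk r hr => ?_, fun k hk => hn ▸ hk, rfl, hn, fun k hk =>
      Or.inr ⟨rfl, (hft k hk.le).2, (hft (k + 1) hk).1⟩, ?_, ?_⟩ (fun k hk r hr => ?_)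
      fun k hk => ?_
  · simp only [f]
    split_ifs <;> fun_prop
  · rw [id, Part.piece, ← (hft k hk).1, ← (hft k hk).2]
    exact ⟨hmono k hr.1, hmono k hr.2⟩
  · rw [f1 _ (Nat.zero_le _), mul_zero]
  · have := (hft _ le_rfl).2
    rw [Part.t_last] at this
    rw [this, hn, Part.t_last]
  · rcases cases k hk with h | ⟨j, hj, rfl⟩ | ⟨j, hj, rfl⟩
    · rw [f1 _ h, concat_c_left _ _ (by rw [concat_n]; omega), concat_c_left _ _ h,
        id, concat_c_left _ _ h]
    · rw [f2 _ hj, concat_c_left _ _ (by rw [concat_n]; omega), concat_c_right, id,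
        concat_c_right, concat_c_left _ _ hj]
      congr 1; ring
    · have e := concat_c_right (a.concat b) c j r
      rw [concat_n] at e
      rw [f3, e, id, show P.n + 1 + Q.n + 1 + j = P.n + 1 + (Q.n + 1 + j) by omega,
        concat_c_right, concat_c_right]
      congr 1; ring
  · rw [id, id, step_succ]
    rcases cases' k hk with h | rfl | ⟨j, hj, rfl⟩ | rfl | ⟨j, hj, rfl⟩
    · rw [concat_g_left _ _ (by rw [concat_n]; omega), concat_g_left _ _ h,
        concat_g_left _ _ h]
    · rw [concat_g_left _ _ (by rw [concat_n]; omega), concat_g_mid,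
        concat_g_mid]
    · rw [concat_g_left _ _ (by rw [concat_n]; omega), concat_g_right,
        concat_g_right, concat_g_left _ _ hj]
    · rw [concat_g_right, concat_g_mid]
      exact concat_g_mid (a.concat b) c
    · have e := concat_g_right (a.concat b) c j
      rw [concat_n] at e
      rw [e, show P.n + 1 + Q.n + 1 + j = P.n + 1 + (Q.n + 1 + j) by omega,
        concat_g_right, concat_g_right]

end PiSet

open Orbispace.Part (two two_n two_t two_t_one)

open WayOn (mk2 ofPath ofPath_g)

section

variable {k : ℕ} {r r' : ℝ}

namespace Part

lemma four_t (hk : k ≤ 4) : (two.concat two).t k = k / 4 := by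
  rcases Nat.lt_or_ge k 3 with h | h
  · rw [concat_t_left _ _ (by rw [two_n]; omega), two_t]; ring
  · obtain ⟨j, rfl⟩ := Nat.exists_eq_add_of_le (show two.n + 1 ≤ k by rw [two_n]; omega)
    rw [concat_t_right, two_t, two_n]; push_cast; ring

lemma four_n : (two.concat two).n = 3 := rfl

lemma mem_four (hk : k ≤ 3) :
    r ∈ (two.concat two).piece k ↔ (k : ℝ) / 4 ≤ r ∧ r ≤ (k + 1) / 4 := by
  rw [piece, four_t (by omega), four_t (by omega), mem_Icc]; push_cast; rfl

lemma four_sub : (two.concat two).Sub two fun k => k / 2 := by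
  constructor
  · intro k hk
    rw [four_n] at hk; rw [two_n]; omega
  · intro k hk r hr
    rw [four_n] at hk
    rw [mem_four hk] at hr
    rw [piece, two_t, two_t, mem_Icc]
    interval_cases k <;> norm_num at hr ⊢ <;> constructor <;> linarith [hr.1, hr.2]

end Part

namespace WayOn

variable {P Q R : Part} {x y z w : X.BasePoint}

lemma four_c {σ : WayOn two x y} {τ : WayOn two y z} (r : ℝ) :
    (σ.concat τ).c 0 r = σ.c 0 (2 * r) ∧ (σ.concat τ).c 1 r = σ.c 1 (2 * r) ∧
      (σ.concat τ).c 2 r = τ.c 0 (2 * r - 1) ∧ (σ.concat τ).c 3 r = τ.c 1 (2 * r - 1) ∧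
      (σ.concat τ).g 0 = σ.g 0 ∧ (σ.concat τ).g 1 = Arrow.id y ∧ (σ.concat τ).g 2 = τ.g 0 :=
  ⟨rfl, rfl, rfl, rfl, rfl, rfl, rfl⟩

lemma mk2_eq_path_mul (γ : Path x y) (f : y ⟶ z) (γ' : Path z w) :
    (mk2 γ f γ').cls = PiSet.mul (PiSet.path γ) (mk2 (Path.refl y) f γ').cls := by
  rw [PiSet.path, PiSet.mul_cls]
  refine (WayOn.cls_eq_of_map (θ := fun k => if k = 3 then 1 else 0)
    (h := fun k r => if k = 3 then 2 * r - 1 else if k = 2 then 1 / 2 else r)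
    ⟨fun k hk => ?_, fun k hk r hr => ?_, fun k hk => ?_, rfl, rfl, fun k hk => ?_, by simp,
      ?_⟩ (fun k hk r hr => ?_) fun k hk => ?_).symm
  · split_ifs <;> fun_prop
  · rw [Part.four_n] at hk
    rw [Part.mem_four hk] at hr
    interval_cases k <;> norm_num [Part.mem_two_zero, Part.mem_two_one] at hr ⊢ <;>
      constructor <;> linarith [hr.1, hr.2]
  · rw [two_n]; split_ifs <;> omega
  · rw [Part.four_n] at hk
    rw [Part.four_t (by omega)]
    interval_cases k <;> norm_num [two_t]
  · rw [Part.four_n]; norm_num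
  · rw [Part.four_n] at hk
    obtain ⟨h0, h1, h2, h3, -⟩ := four_c (σ := ofPath γ) (τ := mk2 (Path.refl y) f γ') r
    interval_cases k
    · exact h0
    · exact h1
    · rw [h2]; simp [mk2]
    · exact h3
  · rw [Part.four_n] at hk
    obtain ⟨-, -, -, -, h0, h1, h2⟩ := four_c (σ := ofPath γ) (τ := mk2 (Path.refl y) f γ') 0
    rw [Part.four_t (by omega)]
    interval_cases k
    · rw [h0]
      simp only [step_self, if_neg (show (0 : ℕ) ≠ 3 by omega), if_neg (show 0 + 1 ≠ 3 by omega),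
        if_neg (show (0 : ℕ) ≠ 2 by omega), mk2]
      change Arrow.id _ = _
      norm_num
    · rw [h1]
      norm_num [step_self, mk2]
    · rw [h2]; rfl

lemma mk2_eq_mul_path (γ : Path x y) (f : y ⟶ z) (γ' : Path z w) :
    (mk2 γ f γ').cls = PiSet.mul (mk2 γ f (Path.refl z)).cls (PiSet.path γ') := by
  rw [PiSet.path, PiSet.mul_cls]
  refine (WayOn.cls_eq_of_map (θ := fun k => if k = 0 then 0 else 1)
    (h := fun k r => if k = 0 then 2 * r else if k = 1 then 1 / 2 else r)
    ⟨fun k hk => ?_, fun k hk r hr => ?_, fun k hk => ?_, rfl, rfl, fun k hk => ?_, by simp,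
      ?_⟩ (fun k hk r hr => ?_) fun k hk => ?_).symm
  · split_ifs <;> fun_prop
  · rw [Part.four_n] at hk
    rw [Part.mem_four hk] at hr
    interval_cases k <;> norm_num [Part.mem_two_zero, Part.mem_two_one] at hr ⊢ <;>
      constructor <;> linarith [hr.1, hr.2]
  · rw [two_n]; split_ifs <;> omega
  · rw [Part.four_n] at hk
    rw [Part.four_t (by omega)]
    interval_cases k <;> norm_num [two_t]
  · rw [Part.four_n]; norm_num
  · rw [Part.four_n] at hk
    obtain ⟨h0, h1, h2, h3, -⟩ := four_c (σ := mk2 γ f (Path.refl z)) (τ := ofPath γ') r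
    interval_cases k
    · exact h0
    · rw [h1]; simp [mk2]
    · exact h2
    · exact h3
  · rw [Part.four_n] at hk
    obtain ⟨-, -, -, -, h0, h1, h2⟩ := four_c (σ := mk2 γ f (Path.refl z)) (τ := ofPath γ') 0
    rw [Part.four_t (by omega)]
    interval_cases k
    · rw [h0]; rfl
    · rw [h1]
      simp [step_self, mk2]
    · rw [h2]
      simp only [if_neg (show (2 : ℕ) ≠ 0 by omega), if_neg (show 2 + 1 ≠ 0 by omega),
        if_neg (show (2 : ℕ) ≠ 1 by omega), step_self, mk2]
      change Arrow.id _ = _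
      norm_num

lemma mk2_path_refl (γ : Path x y) (f : y ⟶ z) :
    (mk2 γ f (Path.refl z)).cls = PiSet.mul (PiSet.path γ) (PiSet.arr f) :=
  mk2_eq_path_mul _ _ _

lemma mk2_refl_path (f : x ⟶ y) (γ : Path y z) :
    (mk2 (Path.refl x) f γ).cls = PiSet.mul (PiSet.arr f) (PiSet.path γ) :=
  mk2_eq_mul_path _ _ _

end WayOn

namespace PiSet

variable {P : Part} {x y z w x' y' : X.BasePoint}

lemma arr_id (x : X.BasePoint) : arr (𝟙 x) = one x := by
  refine WayOn.cls_eq_of_flat (fun _ => x) continuousOn_const (fun k hk r hr => ?_)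
    (fun k hk => ?_) (fun k hk r hr => ?_) fun k hk => ?_
  · simp [mk2]
  · exact ofHom_id x
  · simp [ofPath]
  · rw [ofPath_g _ hk]; simp

lemma arr_comp (f : x ⟶ y) (g : y ⟶ z) : arr (f ≫ g) = mul (arr f) (arr g) := by
  rw [arr, arr, arr, mul_cls]
  set σ := mk2 (Path.refl x) (f ≫ g) (Path.refl z)
  set τ := mk2 (Path.refl x) f (Path.refl y)
  set υ := mk2 (Path.refl y) g (Path.refl z)
  have c0 : ∀ r, σ.c 0 r = x := fun r => by simp [σ, mk2]
  have c1 : ∀ r, σ.c 1 r = z := fun r => by simp [σ, mk2]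
  have d0 : ∀ r, (τ.concat υ).c 0 r = x := fun r => by rw [(WayOn.four_c r).1]; simp [τ, mk2]
  have d1 : ∀ r, (τ.concat υ).c 1 r = y := fun r => by aesop
  have d2 : ∀ r, (τ.concat υ).c 2 r = y := fun r => by aesop
  have d3 : ∀ r, (τ.concat υ).c 3 r = z := fun r => by aesop
  obtain ⟨-, -, -, -, g0, g1, g2⟩ := WayOn.four_c (σ := τ) (τ := υ) 0
  let J : ℕ → X.Arrow := fun k => if k = 0 then Arrow.id x else if k = 1 then ofHom f else
    if k = 2 then ofHom (Groupoid.inv g) else Arrow.id z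
  refine WayOn.Equiv.cls_eq ⟨two.concat two, fun k => k / 2, id, fun k _ => J k,
    Part.four_sub, Part.Sub.refl _, fun k hk => ⟨_, fun _ _ => rfl⟩, fun k hk s hs => ?_,
    fun k hk s hs => ?_, fun s _ => ?_, fun s _ => ?_, fun k hk => ?_⟩
  · rw [Part.four_n] at hk
    interval_cases k
    · exact (c0 s).symm
    · exact (c0 s).symm
    · exact (c1 s).symm
    · exact (c1 s).symm
  · rw [Part.four_n] at hk
    interval_cases k
    · exact (id_target x).trans (d0 s).symm
    · exact (ofHom_target f).trans (d1 s).symm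
    · exact (ofHom_target _).trans (d2 s).symm
    · exact (id_target z).trans (d3 s).symm
  · change Arrow.id x = Arrow.id _
    rw [c0]
  · aesop
  · rw [Part.four_n] at hk
    interval_cases k
    · change IsSq (σ.step 0 0 _) ((τ.concat υ).g 0) (Arrow.id x) (ofHom f)
      rw [g0, step_self, c0]
      exact Arrow.isSq_id_left _ rfl
    · change IsSq (ofHom (f ≫ g)) ((τ.concat υ).g 1) (ofHom f)
        (ofHom (Groupoid.inv g))
      rw [g1, ← ofHom_id, isSq_ofHom, Groupoid.inv_eq_inv]
      simp
    · change IsSq (σ.step 1 1 _) ((τ.concat υ).g 2) (ofHom (Groupoid.inv g))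
        (Arrow.id z)
      rw [g2, step_self, c1, ← ofHom_id]
      change IsSq _ (ofHom g) _ _
      rw [isSq_ofHom, Groupoid.inv_eq_inv]
      simp

/-- Transition maps along a path. -/
lemma path_mul_arr (γ : Path x y) (γ' : Path x' y') (f : x ⟶ x') (f' : y ⟶ y')
    (J : unitInterval → X.Arrow) (hJ : Continuous fun s => (J s).trans)
    (hs : ∀ s, (J s).source = γ s) (ht : ∀ s, (J s).target = γ' s)
    (h0 : J 0 = ofHom f) (h1 : J 1 = ofHom f') :
    mul (path γ) (arr f') = mul (arr f) (path γ') := by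
  rw [← WayOn.mk2_path_refl, ← WayOn.mk2_refl_path]
  let F : unitInterval → WayOn two x y' := fun s =>
    { c := fun k r => if k = 0 then γ.extend (2 * r * s) else γ'.extend (s + (2 * r - 1) * (1 - s))
      c_cont := fun k _ => by
        split_ifs
        · exact (γ.continuous_extend.comp (by fun_prop)).continuousOn
        · exact (γ'.continuous_extend.comp (by fun_prop)).continuousOn
      g := fun _ => J s
      g_source := fun k hk => by
        obtain rfl : k = 0 := by rw [two_n] at hk; omega
        rw [if_pos rfl, two_t_one, show 2 * (1 / 2 : ℝ) * s = s by ring, hs,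
          Path.extend_apply _ s.2]
      g_target := fun k hk => by
        obtain rfl : k = 0 := by rw [two_n] at hk; omega
        rw [if_neg (by omega), two_t_one, show (s : ℝ) + (2 * (1 / 2) - 1) * (1 - s) = s by ring,
          ht, Path.extend_apply _ s.2]
      start := by rw [if_pos rfl]; simp
      finish := by rw [two_n, if_neg (by omega)]; norm_num }
  have key := WayOn.cls_eq_of_family F (fun k hk => ?_) fun k hk => hJ
  · have e0 : (F 0).cls = (mk2 (Path.refl x) f γ').cls := by
      refine (WayOn.equiv_of_eqOn (σ := F 0) (τ := mk2 (Path.refl x) f γ')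
        (fun k hk r hr => ?_) fun k hk => h0).cls_eq
      change (if k = 0 then _ else _) = (if k = 0 then _ else _)
      split_ifs
      · simp
      · simp
    have e1 : (F 1).cls = (mk2 γ f' (Path.refl y')).cls := by
      refine (WayOn.equiv_of_eqOn (σ := F 1) (τ := mk2 γ f' (Path.refl y'))
        (fun k hk r hr => ?_) fun k hk => h1).cls_eq
      change (if k = 0 then _ else _) = (if k = 0 then _ else _)
      split_ifs
      · simp
      · simp
    rw [← e0, ← e1, key]
  · change ContinuousOn (fun p : unitInterval × ℝ => if k = 0 then _ else _) _
    split_ifs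
    · exact (γ.continuous_extend.comp (by fun_prop)).continuousOn
    · exact (γ'.continuous_extend.comp (by fun_prop)).continuousOn

lemma path_mul_symm (γ : Path x y) : mul (path γ) (path γ.symm) = one x := by
  rw [← path_trans]
  exact path_eq_of_homotopic ⟨(Path.Homotopy.reflTransSymm γ).symm⟩

lemma path_symm_mul (γ : Path x y) : mul (path γ.symm) (path γ) = one y := by
  rw [← path_trans]
  exact path_eq_of_homotopic ⟨(Path.Homotopy.reflSymmTrans γ).symm⟩

end PiSet

/-! ### Stopped ways -/

namespace WayOn

variable {P : Part} {x y : X.BasePoint} (σ : WayOn P x y)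

/-- A way stopped at time `r` of its `k`-th piece. -/
def cut (hk : k ≤ P.n) (hr : r ∈ P.piece k) : WayOn P x (σ.c k r) where
  c j s := if j < k then σ.c j s else if j = k then σ.c k (min s r) else σ.c k r
  c_cont j hj := by
    split_ifs with h h'
    · exact σ.c_cont j hj
    · subst h'
      exact (σ.c_cont j hj).comp (by fun_prop) fun s hs =>
        ⟨le_min hs.1 hr.1, (min_le_right _ _).trans hr.2⟩
    · exact continuousOn_const
  g j := if j < k then σ.g j else Arrow.id (σ.c k r)
  g_source j hj := by
    split_ifs with h h'
    · exact σ.g_source j hj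
    · subst h'; rw [min_eq_right hr.2]; rfl
    · rfl
  g_target j hj := by
    split_ifs with h h' h'' h''
    · exact σ.g_target j hj
    · subst h''; rw [min_eq_left hr.1]; exact σ.g_target j hj
    · omega
    · omega
    · omega
    · exact id_target _
  start := by
    split_ifs with h h'
    · exact σ.start
    · subst h'
      have := hr.1
      rw [P.t_zero] at this
      rw [min_eq_left this, σ.start]
    · omega
  finish := by
    split_ifs with h h'
    · omega
    · subst h'
      have := hr.2
      rw [P.t_last] at this
      rw [min_eq_right this]
    · rfl

/-- The segment of a piece of a way. -/
def seg (hk : k ≤ P.n) (hr : r ∈ P.piece k) (hr' : r' ∈ P.piece k) :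
    Path (σ.c k r) (σ.c k r') where
  toFun s := σ.c k ((1 - s) * r + s * r')
  continuous_toFun := by
    refine (σ.c_cont k hk).comp_continuous (by fun_prop) fun s => ?_
    exact convex_Icc _ _ hr hr' (by linarith [s.2.2]) s.2.1 (by ring)
  source' := by simp
  target' := by simp

lemma cut_cls_path (hk : k ≤ P.n) (hr : r ∈ P.piece k) (hr' : r' ∈ P.piece k) :
    (σ.cut hk hr').cls = PiSet.mul (σ.cut hk hr).cls (PiSet.path (σ.seg hk hr hr')) := by
  have hm : ∀ s : unitInterval, (1 - (s : ℝ)) * r + s * r' ∈ P.piece k := fun s =>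
    convex_Icc _ _ hr hr' (by linarith [s.2.2]) s.2.1 (by ring)
  let F : unitInterval → WayOn (P.concat two) x (σ.c k r') := fun s =>
    (σ.cut hk (hm s)).concat (ofPath (σ.seg hk (hm s) hr'))
  have hfst : ∀ s, (σ.c k ((1 - (s : unitInterval)) * r + s * r')).1 = (σ.c k r).1 := fun s =>
    σ.fst_eq hk (hm s) hr
  have hseg : ∀ s p : unitInterval, (σ.seg hk (hm s) hr' p).1 = (σ.c k r).1 := fun s p =>
    σ.fst_eq hk (convex_Icc _ _ (hm s) hr' (by linarith [p.2.2]) p.2.1 (by ring)) hr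
  have key := WayOn.cls_eq_of_family F (fun j hj => ?_) fun j hj => ?_
  · have e0 : ∀ ρ (hρ : ρ ∈ P.piece k), ρ = r →
        ((σ.cut hk hρ).concat (ofPath (σ.seg hk hρ hr'))).cls =
          PiSet.mul (σ.cut hk hr).cls (PiSet.path (σ.seg hk hr hr')) := by
      rintro ρ hρ rfl; rfl
    have e1 : ∀ ρ (hρ : ρ ∈ P.piece k), ρ = r' →
        ((σ.cut hk hρ).concat (ofPath (σ.seg hk hρ hr'))).cls = (σ.cut hk hr').cls := by
      rintro ρ hρ rfl
      rw [← PiSet.mul_one (σ.cut hk hr').cls, PiSet.one, PiSet.path, PiSet.mul_cls]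
      congr 3
      refine Path.ext (funext fun s => ?_)
      change σ.c k _ = σ.c k _
      congr 1; ring
    aesop
  · rcases concat_cases hj with h | ⟨i, hi, rfl⟩
    · simp only [F, concat_c_left _ _ h]
      change ContinuousOn (fun p : unitInterval × ℝ => if j < k then _ else if j = k then _ else _) _
      split_ifs with h1 h2
      · refine (σ.c_cont j h).comp (by fun_prop) fun p hp => ?_
        exact (mem_concat_left _ _ h).1 hp.2
      · subst h2
        refine (σ.c_cont j h).comp (by fun_prop) fun p hp => ?_
        have := (mem_concat_left _ _ h).1 hp.2
        grind
      · exact ((σ.c_cont k hk).comp_continuous (by fun_prop)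
          fun p : unitInterval × ℝ => hm p.1).continuousOn
    · simp only [F, concat_c_right]
      refine ((σ.c_cont k hk).comp_continuous (f := fun p : unitInterval × ℝ =>
        (1 - (projIcc (0 : ℝ) 1 zero_le_one (2 * p.2 - 1) : ℝ)) * ((1 - p.1) * r + p.1 * r') +
          projIcc (0 : ℝ) 1 zero_le_one (2 * p.2 - 1) * r') ?_ fun p => ?_).continuousOn
      · have : Continuous fun p : unitInterval × ℝ => projIcc (0 : ℝ) 1 zero_le_one (2 * p.2 - 1) :=
          continuous_projIcc.comp (by fun_prop)
        fun_prop
      · have h01 := (projIcc (0 : ℝ) 1 zero_le_one (2 * p.2 - 1)).2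
        exact convex_Icc _ _ (hm p.1) hr' (by linarith [h01.2]) h01.1 (by ring)
  · rcases concat_cases_lt hj with h | rfl | ⟨i, hi, rfl⟩
    · simp only [F, concat_g_left _ _ h]
      refine continuous_const.congr (f := fun _ => if j < k then (σ.g j).trans else
        (Arrow.id (σ.c k r)).trans) fun s => ?_
      change _ = Arrow.trans (if j < k then _ else _)
      split_ifs
      · rfl
      · exact Arrow.id_trans_congr (hfst s).symm
    · simp only [F, concat_g_mid]
      exact continuous_const.congr (f := fun _ => (Arrow.id (σ.c k r)).trans) fun s =>
        Arrow.id_trans_congr (hfst s).symm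
    · simp only [F, concat_g_right]
      refine continuous_const.congr (f := fun _ => (Arrow.id (σ.c k r)).trans) fun s =>
        Arrow.id_trans_congr ?_
      exact (hseg s _).symm

lemma cut_cls_arr (hk : k < P.n) {f : σ.c k (P.t (k + 1)) ⟶ σ.c (k + 1) (P.t (k + 1))}
    (hf : σ.g k = ofHom f) : (σ.cut (k := k + 1) hk (P.left_mem hk)).cls =
      PiSet.mul (σ.cut hk.le (P.right_mem hk.le)).cls (PiSet.arr f) := by
  rw [← PiSet.mul_one (σ.cut (k := k + 1) hk (P.left_mem hk)).cls, PiSet.one, PiSet.path,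
    PiSet.arr, PiSet.mul_cls, PiSet.mul_cls]
  set A := (σ.cut hk.le (P.right_mem hk.le)).concat (mk2 (Path.refl _) f (Path.refl _)) with hA
  set B := (σ.cut (k := k + 1) hk (P.left_mem hk)).concat (ofPath (Path.refl _)) with hB
  have c1 : ∀ j ≤ k, ∀ s ∈ (P.concat two).piece j, B.c j s = A.c j s := by
    intro j hj s hs
    have hs' := (mem_concat_left _ _ (hj.trans hk.le)).1 hs
    rw [hA, hB, concat_c_left _ _ (hj.trans hk.le), concat_c_left _ _ (hj.trans hk.le)]
    change (if j < k + 1 then _ else _) = (if j < k then _ else if j = k then _ else _)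
    rw [if_pos (by omega)]
    split_ifs with h h'
    · rfl
    · subst h'; rw [min_eq_left hs'.2]
    · omega
  have c2 : ∀ j, k < j → j ≤ P.n + 1 → ∀ s, A.c j s = σ.c k (P.t (k + 1)) := by
    intro j hj hj' s
    rcases hj'.lt_or_eq with h | rfl
    · rw [hA, concat_c_left _ _ (by omega)]
      exact (if_neg (by omega)).trans (if_neg (by omega))
    · exact (concat_c_right _ _ 0 _).trans (by simp [mk2])
  have c3 : ∀ j ≤ P.n + 1 + 1, k < j → ∀ s ∈ (P.concat two).piece j,
      B.c j s = σ.c (k + 1) (P.t (k + 1)) := by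
    intro j hj hj' s hs
    rcases concat_cases hj with h | ⟨i, hi, rfl⟩
    · have hs' := (mem_concat_left _ _ h).1 hs
      rw [hB, concat_c_left _ _ h]
      refine (if_neg (by omega)).trans ?_
      split_ifs with e
      · subst e; rw [min_eq_right hs'.1]
      · rfl
    · exact (concat_c_right _ _ i _).trans (by simp [ofPath])
  have c4 : ∀ s, A.c (P.n + 1 + 1) s = σ.c (k + 1) (P.t (k + 1)) := fun s =>
    (concat_c_right _ _ 1 _).trans (by simp [mk2])
  have g1 : ∀ j < k, A.g j = B.g j := fun j hj => by
    rw [hA, hB, concat_g_left _ _ (by omega), concat_g_left _ _ (by omega)]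
    exact (if_pos hj).trans (if_pos (by omega)).symm
  have g2 : ∀ j, k ≤ j → j < P.n + 1 → A.g j = Arrow.id (σ.c k (P.t (k + 1))) := fun j hj hj' => by
    rcases (Nat.lt_succ_iff.1 hj').lt_or_eq with h | rfl
    · rw [hA, concat_g_left _ _ h]; exact if_neg (by omega)
    · exact concat_g_mid _ _
  have g3 : B.g k = ofHom f := by rw [hB, concat_g_left _ _ hk, ← hf]; exact if_pos (by omega)
  have g4 : ∀ j, k < j → j < P.n + 1 + 1 → B.g j = Arrow.id (σ.c (k + 1) (P.t (k + 1))) := by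
    intro j hj hj'
    rcases concat_cases_lt hj' with h | rfl | ⟨i, hi, rfl⟩
    · rw [hB, concat_g_left _ _ h]; exact if_neg (by omega)
    · exact concat_g_mid _ _
    · exact (concat_g_right _ _ i).trans (by simp [ofPath])
  have g5 : A.g (P.n + 1) = ofHom f := concat_g_right _ _ 0
  let J : ℕ → ℝ → X.Arrow := fun j s => if j ≤ k then Arrow.id (A.c j s) else
    if j ≤ P.n + 1 then ofHom f else Arrow.id (σ.c (k + 1) (P.t (k + 1)))
  have J1 : ∀ {j} s, j ≤ k → J j s = Arrow.id (A.c j s) := fun s h => if_pos h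
  have J2 : ∀ {j} s, k < j → j ≤ P.n + 1 → J j s = ofHom f := fun s h h' =>
    (if_neg (by omega)).trans (if_pos h')
  have J3 : ∀ s, J (P.n + 1 + 1) s = Arrow.id (σ.c (k + 1) (P.t (k + 1))) := fun s =>
    (if_neg (by omega)).trans (if_neg (by omega))
  have hn : (P.concat two).n = P.n + 1 + 1 := rfl
  have cases : ∀ j ≤ (P.concat two).n, j ≤ k ∨ (k < j ∧ j ≤ P.n + 1) ∨ j = P.n + 1 + 1 := by
    intro j hj; omega
  refine (equiv_of_gauge (σ := A) (τ := B) J (fun j hj => ?_) (fun j hj s hs => ?_)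
    (fun j hj s hs => ?_) (fun s hs => J1 _ (Nat.zero_le _)) (fun s hs => ?_)
    fun j hj => ?_).cls_eq.symm
  · rcases cases j hj with h | ⟨h, h'⟩ | rfl
    · obtain ⟨T, hT⟩ := A.flat_id hj
      exact ⟨T, fun s hs => by rw [J1 _ h]; exact hT s hs⟩
    · exact ⟨_, fun s _ => by rw [J2 _ h h']⟩
    · exact ⟨_, fun s _ => by rw [J3]⟩
  · rcases cases j hj with h | ⟨h, h'⟩ | rfl
    · rw [J1 _ h]; rfl
    · rw [J2 _ h h', c2 j h h']; rfl
    · rw [J3, c4]; rfl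
  · rcases cases j hj with h | ⟨h, h'⟩ | rfl
    · rw [J1 _ h, id_target, c1 j h s hs]
    · rw [J2 _ h h', c3 j (by omega) h s hs, ofHom_target]
    · rw [J3, c3 _ le_rfl (by omega) s hs, id_target]
  · rw [hn, J3, c4]
  · have hj' : j < P.n + 1 + 1 := hj
    rcases lt_trichotomy j k with h | rfl | h
    · rw [J1 _ h.le, J1 _ h, g1 j h]
      have e1 := B.g_source j hj
      have e2 := B.g_target j hj
      rw [c1 j h.le _ ((P.concat two).right_mem hj.le)] at e1
      rw [c1 (j + 1) h _ ((P.concat two).left_mem hj)] at e2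
      exact Arrow.isSq_id _ e1 e2
    · rw [J1 _ le_rfl, J2 _ (by omega) (by omega), g2 j le_rfl (by omega), g3]
      have e1 := A.g_source j hj
      rw [g2 j le_rfl (by omega)] at e1
      rw [← e1]
      exact Arrow.isSq_id_left _ rfl
    · rcases (Nat.lt_succ_iff.1 hj').lt_or_eq with h' | rfl
      · rw [J2 _ h (by omega), J2 _ (by omega) (by omega), g2 j h.le h', g4 j h hj', ← ofHom_id,
          ← ofHom_id, isSq_ofHom, comp_id, id_comp]
      · rw [J2 _ h le_rfl, J3, g5, g4 _ h hj']
        exact Arrow.isSq_id_right _ (ofHom_target f)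

lemma cut_cls_zero : (⟨σ.c 0 0, (σ.cut (Nat.zero_le _) P.zero_mem).cls⟩ :
    (b : X.BasePoint) × PiSet x b) = ⟨x, PiSet.one x⟩ := by
  have key : ∀ (b : X.BasePoint) (τ : WayOn P x b), b = x →
      (∀ k ≤ P.n, ∀ r ∈ P.piece k, τ.c k r = x) → (∀ k, τ.g k = Arrow.id x) →
      (⟨b, τ.cls⟩ : (b : X.BasePoint) × PiSet x b) = ⟨x, PiSet.one x⟩ := by
    rintro b τ rfl hc hg
    congr 1
    refine cls_eq_of_flat (fun _ => b) continuousOn_const hc (fun k _ => hg k) (fun k hk r hr => ?_)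
      fun k hk => ?_
    · simp [ofPath]
    · rw [ofPath_g _ hk]; simp
  refine key _ _ σ.start (fun k hk r hr => ?_) fun k => ?_
  · change (if k < 0 then σ.c k r else if k = 0 then _ else _) = _
    rw [if_neg (Nat.not_lt_zero k)]
    split_ifs with h
    · subst h
      have := hr.1
      rw [P.t_zero] at this
      rw [min_eq_right this, σ.start]
    · exact σ.start
  · change (if k < 0 then σ.g k else Arrow.id (σ.c 0 0)) = _
    rw [if_neg (Nat.not_lt_zero k)]
    exact congrArg Arrow.id σ.start

lemma cut_cls_last : (⟨σ.c P.n 1, (σ.cut le_rfl P.one_mem).cls⟩ :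
    (b : X.BasePoint) × PiSet x b) = ⟨y, σ.cls⟩ := by
  have key : ∀ (b : X.BasePoint) (τ : WayOn P x b), b = y →
      (∀ k ≤ P.n, ∀ r ∈ P.piece k, τ.c k r = σ.c k r) → (∀ k < P.n, τ.g k = σ.g k) →
      (⟨b, τ.cls⟩ : (b : X.BasePoint) × PiSet x b) = ⟨y, σ.cls⟩ := by
    rintro b τ rfl hc hg
    congr 1
    exact (equiv_of_eqOn (σ := τ) (τ := σ) hc hg).cls_eq
  refine key _ _ σ.finish (fun k hk r hr => ?_) fun k hk => if_pos hk
  change (if k < P.n then _ else if k = P.n then _ else _) = _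
  split_ifs with h h'
  · rfl
  · subst h'
    have := hr.2
    rw [P.t_last] at this
    rw [min_eq_left this]
  · omega

/-- A statement about classes of ways can be checked on paths and on transition maps. -/
lemma cls_induction (M : ℕ → ℝ → ∀ b : X.BasePoint, PiSet x b → Prop)
    (start : M 0 0 x (PiSet.one x))
    (path : ∀ k (hk : k ≤ P.n) r r' (hr : r ∈ P.piece k) (hr' : r' ∈ P.piece k) (α), r ≤ r' →
      M k r _ α → M k r' _ (PiSet.mul α (PiSet.path (σ.seg hk hr hr'))))
    (arr : ∀ k < P.n, ∀ f : σ.c k (P.t (k + 1)) ⟶ σ.c (k + 1) (P.t (k + 1)),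
      σ.g k = ofHom f → ∀ α, M k (P.t (k + 1)) _ α →
        M (k + 1) (P.t (k + 1)) _ (PiSet.mul α (PiSet.arr f))) :
    M P.n 1 y σ.cls := by
  have transport : ∀ (N : ∀ b : X.BasePoint, PiSet x b → Prop) {b b' : X.BasePoint}
      {α : PiSet x b} {α' : PiSet x b'}, (⟨b, α⟩ : (b : X.BasePoint) × PiSet x b) = ⟨b', α'⟩ →
      N b α → N b' α' := by
    rintro N b b' α α' ⟨⟩ h; exact h
  have h1 : ∀ k (hk : k ≤ P.n), M k (P.t k) _ (σ.cut hk (P.left_mem hk)).cls := by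
    intro k
    induction k with
    | zero =>
      intro hk
      have : ∀ r (hr : r ∈ P.piece 0), r = 0 → M 0 r _ (σ.cut (Nat.zero_le _) hr).cls := by
        rintro r hr rfl
        exact transport (M 0 0) σ.cut_cls_zero.symm start
      exact this _ _ P.t_zero
    | succ k ih =>
      intro hk
      obtain ⟨f, hf⟩ := σ.exists_hom_g (k := k) hk
      rw [σ.cut_cls_arr hk hf]
      refine arr k hk f hf _ ?_
      rw [σ.cut_cls_path (by omega : k ≤ P.n) (P.left_mem (by omega)) (P.right_mem (by omega))]
      exact path k _ _ _ _ _ _ (P.t_lt k (by omega)).le (ih (by omega))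
  have h2 : M P.n 1 _ (σ.cut le_rfl P.one_mem).cls := by
    rw [σ.cut_cls_path le_rfl (P.left_mem le_rfl) P.one_mem]
    exact path _ _ _ _ _ _ _ P.one_mem.1 (h1 _ le_rfl)
  exact transport (M P.n 1) σ.cut_cls_last h2

end WayOn

namespace PiSet

variable {x y z : X.BasePoint}

lemma arr_mul_inv (f : x ⟶ y) : mul (arr f) (arr (Groupoid.inv f)) = one x := by
  rw [← arr_comp, Groupoid.comp_inv, arr_id]

lemma inv_mul_arr (f : x ⟶ y) : mul (arr (Groupoid.inv f)) (arr f) = one y := by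
  rw [← arr_comp, Groupoid.inv_comp, arr_id]

lemma exists_right_inv (α : PiSet x y) : ∃ β, mul α β = one x := by
  have hmul : ∀ {z w : X.BasePoint} {α : PiSet x z} {γ : PiSet z w} {γ' : PiSet w z},
      mul γ γ' = one z → (∃ β, mul α β = one x) → ∃ β, mul (mul α γ) β = one x := by
    rintro z w α γ γ' h ⟨β, hβ⟩
    exact ⟨mul γ' β, by rw [← mul_assoc, mul_assoc α, h, mul_one, hβ]⟩
  obtain ⟨P, σ, rfl⟩ := exists_cls α
  exact σ.cls_induction (fun _ _ b α => ∃ β, mul α β = one x) ⟨one x, mul_one _⟩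
    (fun k hk r r' hr hr' α _ h => hmul (path_mul_symm _) h)
    fun k hk f hf α h => hmul (arr_mul_inv f) h

lemma exists_inv (α : PiSet x y) : ∃ β, mul α β = one x ∧ mul β α = one y := by
  obtain ⟨β, h⟩ := exists_right_inv α
  obtain ⟨γ, h'⟩ := exists_right_inv β
  refine ⟨β, h, ?_⟩
  rw [← mul_one (mul β α), ← h', mul_assoc β, ← mul_assoc α, h, ← mul_assoc, mul_one]

lemma one_mul (α : PiSet x y) : mul (one x) α = α := by
  obtain ⟨β, h, h'⟩ := exists_inv α
  rw [← h, mul_assoc, h', mul_one]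

end PiSet

namespace Loop

variable {i : X.ι} {x : X.hat i}

lemma ofPath_way_cls (γ : Path x x) :
    (ofPath γ).way.cls = PiSet.path (γ.map (continuous_sigmaMk (σ := X.hat))) := rfl

lemma const_way_cls (p : X.BasePoint) : (const p).way.cls = PiSet.one p := rfl

end Loop

end

section

variable {i j : X.ι} {b : X.BasePoint}

/-- A local system of sets on an orbispace: the homotopy classes of ways act on its fibres. It is
assumed to be trivial on the charts of a cover. -/
structure LocSys (X : Orbispace.{u}) where
  F : X.BasePoint → Type u
  act : ∀ {x y : X.BasePoint}, PiSet x y → F x → F y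
  act_one : ∀ {x : X.BasePoint} (e : F x), act (PiSet.one x) e = e
  act_mul : ∀ {x y z : X.BasePoint} (α : PiSet x y) (β : PiSet y z) (e : F x),
    act (PiSet.mul α β) e = act β (act α e)
  loc : X.LocallyStronglyPathConnected
  even : ∀ x : X.carrier, ∃ i, x ∈ X.U i ∧ ∀ (y : X.hat i) (γ : Path y y) (e : F ⟨i, y⟩),
    act (PiSet.path (γ.map (continuous_sigmaMk (σ := X.hat)))) e = e

namespace LocSys

variable (L : LocSys X) {x y z : X.BasePoint}

/-- The action of a transition map. -/
def arr (f : x ⟶ y) (e : L.F x) : L.F y := L.act (PiSet.arr f) e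

/-- The action of a path in one of the spaces `hat i`. -/
def trav {x y : X.hat i} (γ : Path x y) (e : L.F ⟨i, x⟩) : L.F ⟨i, y⟩ :=
  L.act (PiSet.path (γ.map (continuous_sigmaMk (σ := X.hat)))) e

lemma arr_id (e : L.F x) : L.arr (𝟙 x) e = e := by rw [arr, PiSet.arr_id, L.act_one]

lemma arr_comp (f : x ⟶ y) (g : y ⟶ z) (e : L.F x) :
    L.arr (f ≫ g) e = L.arr g (L.arr f e) := by rw [arr, PiSet.arr_comp, L.act_mul]; rfl

lemma arr_inv_eq_iff (f : x ⟶ y) {e : L.F x} {e' : L.F y} :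
    L.arr (Groupoid.inv f) e' = e ↔ L.arr f e = e' := by
  constructor <;> rintro rfl <;> rw [← arr_comp] <;> simp [arr_id]

lemma arr_injective (f : x ⟶ y) : Function.Injective (L.arr f) := fun e e' h => by
  exact ((L.arr_inv_eq_iff f).2 h).symm.trans ((L.arr_inv_eq_iff f).2 rfl)

lemma trav_trans {x y z : X.hat i} (γ : Path x y) (γ' : Path y z) (e : L.F ⟨i, x⟩) :
    L.trav (γ.trans γ') e = L.trav γ' (L.trav γ e) := by
  rw [trav, Path.map_trans, PiSet.path_trans, L.act_mul]; rfl

lemma trav_symm {x y : X.hat i} (γ : Path x y) (e : L.F ⟨i, x⟩) :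
    L.trav γ.symm (L.trav γ e) = e := by
  rw [trav, trav, ← L.act_mul, ← Path.map_symm, PiSet.path_mul_symm, L.act_one]

/-- A parallel section over the space `hat i`. -/
structure Sec where
  i : X.ι
  val : ∀ x : X.hat i, L.F ⟨i, x⟩
  par : ∀ {x y : X.hat i} (γ : Path x y), L.trav γ (val x) = val y

variable {L}

lemma isPathConnected_source (L : LocSys X) (ξ : X.Tran i j) :
    IsPathConnected (X.φ ξ).source := by
  have := L.loc i
  exact (IsOpen.isConnected_iff_isPathConnected (X.φ ξ).open_source).1
    ⟨X.source_nonempty ξ, isPreconnected_source ξ⟩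

/-- Parallel translation commutes with transition maps. -/
lemma arr_trav (L : LocSys X) (ξ : X.Tran i j) {x z : X.hat i} (γ : Path x z)
    (hγ : ∀ t, γ t ∈ (X.φ ξ).source) {x' z' : X.hat j} (f : (⟨i, x⟩ : X.BasePoint) ⟶ ⟨j, x'⟩)
    (g : (⟨i, z⟩ : X.BasePoint) ⟶ ⟨j, z'⟩) (hf : f.1 = ξ) (hg : g.1 = ξ) :
    ∃ γ' : Path x' z', (∀ t, γ' t = X.φ ξ (γ t)) ∧
      ∀ e, L.arr g (L.trav γ e) = L.trav γ' (L.arr f e) := by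
  have hx : X.φ ξ x = x' := by rw [← hf]; exact f.2.2
  have hz : X.φ ξ z = z' := by rw [← hg]; exact g.2.2
  have hc : Continuous fun t => X.φ ξ (γ t) := (X.φ ξ).continuousOn.comp_continuous γ.continuous hγ
  let γ' : Path x' z' := ⟨⟨fun t => X.φ ξ (γ t), hc⟩, by simp [hx], by simp [hz]⟩
  refine ⟨γ', fun t => rfl, fun e => ?_⟩
  rw [trav, arr, ← L.act_mul, trav, arr, ← L.act_mul]
  congr 1
  refine PiSet.path_mul_arr _ _ _ _ (fun t => ⟨ξ, γ t, hγ t⟩)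
    (continuous_const (y := (⟨i, j, ξ⟩ : X.Trans))) (fun t => rfl)
    (fun t => rfl) ?_ ?_
  · aesop
  · exact Arrow.ext_of_trans (congrArg (fun η => (⟨i, j, η⟩ : X.Trans)) hg.symm)
      (congrArg (Sigma.mk i) γ.target)

namespace Sec

/-- A transition map carries one section to another. -/
def Maps (S S' : L.Sec) (ξ : X.Tran S.i S'.i) : Prop :=
  ∀ ⦃x x'⦄ (f : (⟨S.i, x⟩ : X.BasePoint) ⟶ ⟨S'.i, x'⟩), f.1 = ξ → L.arr f (S.val x) = S'.val x'

lemma maps_of_hom {S S' : L.Sec} {x : X.hat S.i} {x' : X.hat S'.i}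
    (f : (⟨S.i, x⟩ : X.BasePoint) ⟶ ⟨S'.i, x'⟩) (h : L.arr f (S.val x) = S'.val x') :
    S.Maps S' f.1 := by
  intro z z' g hg
  obtain ⟨γ, hγ⟩ := (L.isPathConnected_source f.1).joinedIn x f.2.1 z (hg ▸ g.2.1)
  obtain ⟨γ', -, h'⟩ := L.arr_trav f.1 γ hγ f g rfl hg
  rw [← S.par γ, h', h, S'.par]

lemma maps_one (S : L.Sec) : S.Maps S (X.one S.i) := by
  obtain ⟨x⟩ : Nonempty (X.hat S.i) := inferInstance
  exact maps_of_hom (𝟙 (⟨S.i, x⟩ : X.BasePoint)) (L.arr_id _)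

lemma Maps.comp {S S' S'' : L.Sec} {ξ : X.Tran S.i S'.i} {η : X.Tran S'.i S''.i}
    (h : S.Maps S' ξ) (h' : S'.Maps S'' η) (x : X.hat S.i) (hx) (hy) :
    S.Maps S'' (X.comp η ξ x hx hy) := by
  refine maps_of_hom (homMk ξ x hx ≫ homMk η (X.φ ξ x) hy) ?_
  rw [L.arr_comp, h (homMk ξ x hx) rfl, h' (homMk η (X.φ ξ x) hy) rfl]

lemma Maps.inv {S S' : L.Sec} {ξ : X.Tran S.i S'.i} (h : S.Maps S' ξ) :
    S'.Maps S (Orbispace.inv ξ) := by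
  obtain ⟨x, hx⟩ := X.source_nonempty ξ
  rw [show ξ = (homMk ξ x hx).1 from rfl, ← Hom.inv_val]
  exact maps_of_hom _ ((L.arr_inv_eq_iff _).2 (h (homMk ξ x hx) rfl))

/-- The subgroup that preserves a section. -/
def stab (S : L.Sec) : Subgroup (X.G S.i) where
  carrier := {g | S.Maps S (X.ofG S.i g)}
  one_mem' := by
    change S.Maps S (X.ofG S.i 1)
    rw [ofG_one]; exact S.maps_one
  mul_mem' {a b} ha hb := by
    obtain ⟨x⟩ : Nonempty (X.hat S.i) := inferInstance
    have := Maps.comp hb ha x (mem_ofG _ _) (mem_ofG _ _)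
    rwa [ofG_comp, ofG, X.bi_bi, _root_.mul_one] at this
  inv_mem' {a} ha := by
    obtain ⟨x⟩ : Nonempty (X.hat S.i) := inferInstance
    have h := Maps.inv ha
    have e : Orbispace.inv (X.ofG S.i a) = X.ofG S.i a⁻¹ := by
      have h1 := inv_comp (X.ofG S.i a) x (mem_ofG _ _) (φ_mem_inv (mem_ofG _ _))
      rw [comp_ofG] at h1
      obtain ⟨b, hb⟩ := exists_ofG (Orbispace.inv (X.ofG S.i a))
      have h2 := comp_ofG (X.ofG S.i b) a x (mem_ofG _ _) (mem_ofG _ _)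
      rw [ofG_comp, ofG, X.bi_bi, _root_.mul_one, ← hb, h1] at h2
      rw [hb, ← eq_inv_of_mul_eq_one_left (ofG_injective S.i (h2.trans (ofG_one _).symm))]
    change S.Maps S _
    rwa [← e]

lemma mem_stab {S : L.Sec} {g : X.G S.i} : g ∈ S.stab ↔ S.Maps S (X.ofG S.i g) := Iff.rfl

lemma Maps.bi {S S' : L.Sec} {ξ : X.Tran S.i S'.i} (h : S.Maps S' ξ) {a : X.G S'.i}
    {g : X.G S.i} (ha : a ∈ S'.stab) (hg : g ∈ S.stab) : S.Maps S' (X.bi a ξ g) := by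
  obtain ⟨x, hx⟩ := X.source_nonempty ξ
  have h1 := Maps.comp hg h (g⁻¹ • x) (mem_ofG _ _) (by rwa [φ_ofG, smul_inv_smul])
  rw [comp_ofG] at h1
  have h2 := Maps.comp h1 ha (g⁻¹ • x) (by rwa [X.bi_source, smul_inv_smul]) (mem_ofG _ _)
  rwa [ofG_comp, X.bi_bi, _root_.mul_one, _root_.mul_one] at h2

/-- Elements that carry one point of the section to another preserve the section. -/
lemma mem_stab_of_arr {S : L.Sec} {g : X.G S.i} {x : X.hat S.i}
    (h : L.arr (homG g x) (S.val x) = S.val (g • x)) : g ∈ S.stab :=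
  maps_of_hom (S := S) (S' := S) (homG g x) h

lemma exists_sec (hi : ∀ (y : X.hat i) (γ : Path y y) (e : L.F ⟨i, y⟩), L.trav γ e = e)
    (x : X.hat i) (e : L.F ⟨i, x⟩) :
    ∃ s : ∀ y : X.hat i, L.F ⟨i, y⟩, (∀ {y z} (γ : Path y z), L.trav γ (s y) = s z) ∧ s x = e := by
  have := L.loc i
  have : PathConnectedSpace (X.hat i) := pathConnectedSpace_iff_connectedSpace.2 inferInstance
  have key : ∀ {y z : X.hat i} (γ γ' : Path y z) (e), L.trav γ e = L.trav γ' e := by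
    intro y z γ γ' e
    have := hi y (γ.trans γ'.symm) e
    rw [trav_trans] at this
    have h2 := L.trav_symm γ'.symm (L.trav γ e)
    rw [this, Path.symm_symm] at h2
    exact h2.symm
  refine ⟨fun y => L.trav (PathConnectedSpace.somePath x y) e, fun γ => ?_, hi _ _ _⟩
  rw [← trav_trans]
  exact key _ _ _

end Sec

/-! ### The total space -/

variable (L)

/-- Two points of the fibres are identified if a transition map carries one to the other. -/
instance setoid : Setoid ((b : X.BasePoint) × L.F b) where
  r a a' := ∃ f : a.1 ⟶ a'.1, L.arr f a.2 = a'.2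
  iseqv := ⟨fun a => ⟨𝟙 _, L.arr_id _⟩,
    fun ⟨f, hf⟩ => ⟨Groupoid.inv f, (L.arr_inv_eq_iff f).2 hf⟩,
    fun ⟨f, hf⟩ ⟨g, hg⟩ => ⟨f ≫ g, by rw [L.arr_comp, hf, hg]⟩⟩

/-- The underlying set of the covering that belongs to a local system. -/
def Pt : Type u := Quotient L.setoid

variable {L}

/-- The point of the covering given by a point of a fibre. -/
def pt (e : L.F b) : L.Pt := Quotient.mk L.setoid ⟨b, e⟩

lemma pt_eq_iff {b' : X.BasePoint} {e : L.F b} {e' : L.F b'} :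
    L.pt e = L.pt e' ↔ ∃ f : b ⟶ b', L.arr f e = e' := Quotient.eq (r := L.setoid)

lemma exists_pt (c : L.Pt) : ∃ (b : X.BasePoint) (e : L.F b), L.pt e = c := by
  obtain ⟨⟨b, e⟩, rfl⟩ := Quotient.exists_rep c
  exact ⟨b, e, rfl⟩

variable (L) in
/-- The projection. -/
def top : L.Pt → X.carrier :=
  Quotient.lift (fun a => X.proj a.1.1 a.1.2) fun _ _ ⟨f, _⟩ => Hom.proj_eq f

namespace Sec

/-- The map into the covering given by a section. -/
def P (S : L.Sec) (x : X.hat S.i) : L.Pt := L.pt (S.val x)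

lemma top_P (S : L.Sec) (x : X.hat S.i) : L.top (S.P x) = X.proj S.i x := rfl

lemma P_eq_iff {S S' : L.Sec} {x : X.hat S.i} {x' : X.hat S'.i} :
    S.P x = S'.P x' ↔ ∃ f : (⟨S.i, x⟩ : X.BasePoint) ⟶ ⟨S'.i, x'⟩, S.Maps S' f.1 :=
  pt_eq_iff.trans ⟨fun ⟨f, hf⟩ => ⟨f, maps_of_hom f hf⟩, fun ⟨f, hf⟩ => ⟨f, hf f rfl⟩⟩

lemma Maps.P_eq {S S' : L.Sec} {ξ : X.Tran S.i S'.i} (h : S.Maps S' ξ) {x : X.hat S.i}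
    (hx : x ∈ (X.φ ξ).source) : S'.P (X.φ ξ x) = S.P x :=
  (P_eq_iff.2 ⟨homMk ξ x hx, h⟩).symm

lemma P_smul {S : L.Sec} {g : X.G S.i} (hg : g ∈ S.stab) (x : X.hat S.i) :
    S.P (g • x) = S.P x := by
  rw [← φ_ofG]; exact Maps.P_eq hg (mem_ofG _ _)

lemma exists_smul_of_P_eq {S : L.Sec} {x y : X.hat S.i} (h : S.P x = S.P y) :
    ∃ g ∈ S.stab, g • x = y := by
  obtain ⟨f, hf⟩ := P_eq_iff.1 h
  obtain ⟨g, hg⟩ := exists_ofG f.1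
  refine ⟨g, mem_stab.2 (hg ▸ hf), ?_⟩
  rw [← φ_ofG, ← hg]; exact f.2.2

end Sec

instance : TopologicalSpace L.Pt := ⨆ S : L.Sec, TopologicalSpace.coinduced S.P inferInstance

namespace Sec

lemma continuous_P (S : L.Sec) : Continuous S.P :=
  continuous_iff_coinduced_le.2 (le_iSup (fun S : L.Sec =>
    TopologicalSpace.coinduced S.P inferInstance) S)

lemma isOpen_iff {A : Set L.Pt} : IsOpen A ↔ ∀ S : L.Sec, IsOpen (S.P ⁻¹' A) := isOpen_iSup_iff

lemma isOpenMap_P (S : L.Sec) : IsOpenMap S.P := by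
  intro D hD
  refine isOpen_iff.2 fun S' => isOpen_iff_mem_nhds.2 ?_
  rintro x' ⟨x, hxD, hx⟩
  obtain ⟨f, hf⟩ := P_eq_iff.1 hx
  have h1 : (X.φ f.1).source ∩ D ∈ 𝓝 x := ((X.φ f.1).open_source.inter hD).mem_nhds ⟨f.2.1, hxD⟩
  have h2 := (X.φ f.1).image_mem_nhds f.2.1 h1
  rw [f.2.2] at h2
  refine mem_of_superset h2 ?_
  rintro _ ⟨z, ⟨hz, hzD⟩, rfl⟩
  exact ⟨z, hzD, (hf.P_eq hz).symm⟩

lemma exists_pt_eq_P (e : L.F b) (hi : X.proj b.1 b.2 ∈ X.U i)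
    (heven : ∀ (y : X.hat i) (γ : Path y y) (e : L.F ⟨i, y⟩), L.trav γ e = e) :
    ∃ (S : L.Sec) (x : X.hat S.i), S.i = i ∧ L.pt e = S.P x := by
  obtain ⟨x, hx⟩ := exists_proj hi
  obtain ⟨f⟩ := exists_hom (X := X) (b := b) (b' := ⟨i, x⟩) hx.symm
  obtain ⟨s, hs, hsx⟩ := exists_sec heven x (L.arr f e)
  exact ⟨⟨i, s, hs⟩, x, rfl, pt_eq_iff.2 ⟨f, hsx.symm⟩⟩

lemma exists_P (c : L.Pt) : ∃ (S : L.Sec) (x : X.hat S.i), S.P x = c := by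
  obtain ⟨b, e, rfl⟩ := exists_pt c
  obtain ⟨i, hi, heven⟩ := L.even (X.proj b.1 b.2)
  obtain ⟨S, x, -, h⟩ := exists_pt_eq_P e hi heven
  exact ⟨S, x, h.symm⟩

end Sec

lemma continuous_top : Continuous L.top :=
  continuous_iSup_dom.2 fun S => continuous_coinduced_dom.2 (X.proj_continuous S.i)

end LocSys

end

lemma smul_mem_connectedComponentIn {G A : Type*} [Group G] [TopologicalSpace A]
    [TopologicalSpace G] [MulAction G A] [ContinuousSMul G A] {s : Set A} {g : G}
    (hg : MapsTo (fun x => g • x) s s) {x y : A} (h : x ∈ connectedComponentIn s y) :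
    g • x ∈ connectedComponentIn s (g • y) := by
  have hy : y ∈ s := by
    by_contra hy
    rw [connectedComponentIn_eq_empty hy] at h
    exact h
  refine (isPreconnected_connectedComponentIn.image (fun x => g • x)
    (continuous_const_smul g).continuousOn).subset_connectedComponentIn
    (mem_image_of_mem _ (mem_connectedComponentIn hy)) ?_ (mem_image_of_mem _ h)
  exact (hg.mono_left (connectedComponentIn_subset _ _)).image_subset

lemma smul_connectedComponentIn {G A : Type*} [Group G] [TopologicalSpace A]
    [TopologicalSpace G] [MulAction G A] [ContinuousSMul G A] {s : Set A} {g : G}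
    (hg : g • s = s) {x y : A} (hx : x ∈ connectedComponentIn s y)
    (h : g • x ∈ connectedComponentIn s y) :
    g • connectedComponentIn s y = connectedComponentIn s y := by
  have hg' : g⁻¹ • s = s := by rw [inv_smul_eq_iff, hg]
  have h1 : MapsTo (fun x => g • x) s s := fun z hz => hg ▸ smul_mem_smul_set hz
  have h2 : MapsTo (fun x => g⁻¹ • x) s s := fun z hz => hg' ▸ smul_mem_smul_set hz
  refine Subset.antisymm ?_ fun z hz => ?_
  · rintro _ ⟨z, hz, rfl⟩
    rw [connectedComponentIn_eq hx] at hz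
    have := smul_mem_connectedComponentIn h1 hz
    rwa [← connectedComponentIn_eq h] at this
  · rw [connectedComponentIn_eq h] at hz
    have := smul_mem_connectedComponentIn h2 hz
    rw [inv_smul_smul, ← connectedComponentIn_eq hx] at this
    exact mem_smul_set_iff_inv_smul_mem.2 this

namespace LocSys

variable {L : LocSys X}

variable (L) in
/-- A chart of the covering: a section, and a part of its domain. -/
structure Chart where
  S : L.Sec
  D : Set (X.hat S.i)
  isOpen : IsOpen D
  isConn : IsConnected D
  block : ∀ g ∈ S.stab, ∀ x ∈ D, g • x ∈ D → g • D = D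

namespace Chart

/-- The basic open set of a chart. -/
def W (c : L.Chart) : Set L.Pt := c.S.P '' c.D

/-- The group of a chart. -/
def grp (c : L.Chart) : Subgroup (X.G c.S.i) := c.S.stab ⊓ stabilizer (X.G c.S.i) c.D

lemma mem_grp_of_mem {c : L.Chart} {g : X.G c.S.i} (hg : g ∈ c.S.stab) {x : X.hat c.S.i}
    (hx : x ∈ c.D) (hgx : g • x ∈ c.D) : g ∈ c.grp := ⟨hg, c.block g hg x hx hgx⟩

lemma smul_mem {c : L.Chart} {g : X.G c.S.i} (hg : g ∈ c.grp) {x : X.hat c.S.i}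
    (hx : x ∈ c.D) : g • x ∈ c.D := by
  have := smul_mem_smul_set (a := g) hx
  rwa [hg.2] at this

lemma exists_smul {c : L.Chart} {x y : X.hat c.S.i} (hx : x ∈ c.D) (hy : y ∈ c.D)
    (h : c.S.P x = c.S.P y) : ∃ g ∈ c.grp, g • x = y := by
  obtain ⟨g, hg, rfl⟩ := Sec.exists_smul_of_P_eq h
  exact ⟨g, mem_grp_of_mem hg hx hy, rfl⟩

lemma isOpen_W (c : L.Chart) : IsOpen c.W := c.S.isOpenMap_P _ c.isOpen

lemma isConnected_W (c : L.Chart) : IsConnected c.W :=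
  c.isConn.image _ c.S.continuous_P.continuousOn

/-- The chart given by a whole section. -/
def univ (S : L.Sec) : L.Chart where
  S := S
  D := Set.univ
  isOpen := isOpen_univ
  isConn := isConnected_univ
  block _ _ _ _ _ := smul_set_univ

lemma univ_W (S : L.Sec) : (univ S).W = range S.P := image_univ

/-- The restriction of a chart to a connected open subset. -/
lemma exists_restrict (c : L.Chart) {W : Set L.Pt} (hW : IsOpen W) (hW' : IsConnected W)
    (hsub : W ⊆ c.W) : ∃ c' : L.Chart, c'.W = W := by
  obtain ⟨q, hq⟩ := hW'.nonempty
  obtain ⟨x, hx, rfl⟩ := hsub hq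
  set A := c.D ∩ c.S.P ⁻¹' W with hA
  have hAo : IsOpen A := c.isOpen.inter (hW.preimage c.S.continuous_P)
  have hxA : x ∈ A := ⟨hx, hq⟩
  have hstab : ∀ g ∈ c.grp, g • A = A := by
    have h : ∀ g ∈ c.grp, g • A ⊆ A := by
      rintro g hg _ ⟨z, hz, rfl⟩
      refine ⟨smul_mem hg hz.1, ?_⟩
      rw [mem_preimage, Sec.P_smul hg.1]; exact hz.2
    refine fun g hg => (h g hg).antisymm ?_
    rw [← smul_inv_smul g A]
    exact smul_set_mono (by simpa using h _ (inv_mem hg))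
  refine ⟨⟨c.S, connectedComponentIn A x, hAo.connectedComponentIn,
    isConnected_connectedComponentIn_iff.2 hxA, fun g hg z hz hgz => ?_⟩, ?_⟩
  · have h1 := connectedComponentIn_subset _ _ hz
    have h2 := connectedComponentIn_subset _ _ hgz
    exact smul_connectedComponentIn (hstab g (mem_grp_of_mem hg h1.1 h2.1)) hz hgz
  · change c.S.P '' connectedComponentIn A x = W
    have hsub' : ∀ z, c.S.P '' connectedComponentIn A z ⊆ W := by
      rintro z _ ⟨y, hy, rfl⟩
      exact (connectedComponentIn_subset _ _ hy).2
    refine (hsub' x).antisymm ?_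
    set V := ⋃ z ∈ {z | z ∈ A ∧ c.S.P z ∉ c.S.P '' connectedComponentIn A x},
      c.S.P '' connectedComponentIn A z with hV
    have hdis : Disjoint (c.S.P '' connectedComponentIn A x) V := by
      rw [Set.disjoint_left]
      rintro _ ⟨y, hy, rfl⟩ hyV
      simp only [hV, mem_iUnion] at hyV
      obtain ⟨z, ⟨hz, hz'⟩, y', hy', e⟩ := hyV
      have h1 := connectedComponentIn_subset _ _ hy
      have h2 := connectedComponentIn_subset _ _ hy'
      obtain ⟨g, hg, rfl⟩ := exists_smul h2.1 h1.1 e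
      refine hz' ⟨g • z, ?_, Sec.P_smul hg.1 z⟩
      have hm : MapsTo (fun x => g • x) A A := fun z hz => hstab g hg ▸ smul_mem_smul_set hz
      have h3 : z ∈ connectedComponentIn A y' := by
        rw [← connectedComponentIn_eq hy']; exact mem_connectedComponentIn hz
      rw [connectedComponentIn_eq hy]
      exact smul_mem_connectedComponentIn hm h3
    refine hW'.isPreconnected.subset_left_of_subset_union (c.S.isOpenMap_P _
      hAo.connectedComponentIn) (isOpen_biUnion fun z _ => c.S.isOpenMap_P _
      hAo.connectedComponentIn) hdis (fun q hq => ?_)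
      ⟨_, hq, x, mem_connectedComponentIn hxA, rfl⟩
    obtain ⟨z, hz, rfl⟩ := hsub hq
    by_cases h : c.S.P z ∈ c.S.P '' connectedComponentIn A x
    · exact Or.inl h
    · refine Or.inr (mem_biUnion (x := z) ⟨⟨hz, hq⟩, h⟩ ?_)
      exact mem_image_of_mem _ (mem_connectedComponentIn ⟨hz, hq⟩)

lemma exists_chart {q : L.Pt} {O : Set L.Pt} (hO : IsOpen O) (hq : q ∈ O) :
    ∃ c : L.Chart, q ∈ c.W ∧ c.W ⊆ O := by
  obtain ⟨S, x, rfl⟩ := Sec.exists_P q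
  have hO' := hO.preimage S.continuous_P
  have hx : x ∈ S.P ⁻¹' O := hq
  obtain ⟨c, hc⟩ := (univ S).exists_restrict (W := S.P '' connectedComponentIn (S.P ⁻¹' O) x)
    (S.isOpenMap_P _ hO'.connectedComponentIn)
    ((isConnected_connectedComponentIn_iff.2 hx).image _ S.continuous_P.continuousOn)
    (by rw [univ_W]; exact image_subset_range _ _)
  refine ⟨c, hc ▸ mem_image_of_mem _ (mem_connectedComponentIn hx), hc ▸ ?_⟩
  rintro _ ⟨y, hy, rfl⟩
  have := connectedComponentIn_subset _ _ hy
  exact this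

end Chart

variable (L) in
/-- The basic open sets of the covering. -/
def Idx : Type u := {W : Set L.Pt // ∃ c : L.Chart, c.W = W}

lemma exists_rep (w : L.Idx) : ∃ c : L.Chart, c.W = w.1 ∧
    ((∃ c' : L.Chart, c'.W = w.1 ∧ c'.D = univ) → c.D = univ) := by
  by_cases h : ∃ c' : L.Chart, c'.W = w.1 ∧ c'.D = univ
  · grind
  · obtain ⟨c, hc⟩ := w.2
    exact ⟨c, hc, fun h' => absurd h' h⟩

/-- The chosen chart for a basic open set of the covering; if possible, it is a whole section. -/
def Idx.c (w : L.Idx) : L.Chart := (exists_rep w).choose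

lemma Idx.c_W (w : L.Idx) : w.c.W = w.1 := (exists_rep w).choose_spec.1

lemma Idx.c_D (w : L.Idx) (h : ∃ c' : L.Chart, c'.W = w.1 ∧ c'.D = univ) : w.c.D = univ :=
  (exists_rep w).choose_spec.2 h

instance (c : L.Chart) : MulAction c.grp c.D where
  smul g x := ⟨(g : X.G c.S.i) • (x : X.hat c.S.i), Chart.smul_mem g.2 x.2⟩
  one_smul x := Subtype.ext (one_smul (X.G c.S.i) (x : X.hat c.S.i))
  mul_smul g h x := Subtype.ext (mul_smul (g : X.G c.S.i) (h : X.G c.S.i) (x : X.hat c.S.i))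

lemma Chart.coe_smul {c : L.Chart} (g : c.grp) (x : c.D) :
    ((g • x : c.D) : X.hat c.S.i) = (g : X.G c.S.i) • (x : X.hat c.S.i) := rfl

instance (c : L.Chart) : ContinuousSMul c.grp c.D where
  continuous_smul := by
    refine Continuous.subtype_mk (f := fun p : c.grp × c.D =>
      (p.1 : X.G c.S.i) • (p.2 : X.hat c.S.i)) ?_ _
    fun_prop

instance : LocallyConnectedSpace L.Pt := by
  rw [locallyConnectedSpace_iff_subsets_isOpen_isConnected]
  intro q O hO
  obtain ⟨O', hO', ho, hq⟩ := mem_nhds_iff.1 hO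
  obtain ⟨c, hc, hcO⟩ := Chart.exists_chart ho hq
  exact ⟨c.W, hcO.trans hO', c.isOpen_W, hc, c.isConnected_W⟩

variable (L) in
/-- The base of the covering that belongs to a local system. -/
def base : ChartedBase.{u} where
  carrier := L.Pt
  ι := L.Idx
  U w := w.1
  U_injective := Subtype.val_injective
  isBasis := by
    refine TopologicalSpace.isTopologicalBasis_of_isOpen_of_nhds ?_ fun q O hq hO => ?_
    · rintro _ ⟨w, rfl⟩
      change IsOpen w.1
      rw [← w.c_W]; exact w.c.isOpen_W
    · obtain ⟨c, hc, hcO⟩ := Chart.exists_chart hO hq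
      exact ⟨c.W, ⟨⟨c.W, c, rfl⟩, rfl⟩, hc, hcO⟩
  U_connected w := by rw [← w.c_W]; exact w.c.isConnected_W
  saturated w W hW hW' hsub := by
    rw [← w.c_W] at hsub
    obtain ⟨c, hc⟩ := w.c.exists_restrict hW hW' hsub
    exact ⟨⟨W, c, hc⟩, rfl⟩
  hat w := w.c.D
  connHat w := isConnected_iff_connectedSpace.1 w.c.isConn
  locConnHat w := w.c.isOpen.locallyConnectedSpace
  G w := w.c.grp
  proj w x := w.c.S.P x
  proj_continuous w := w.c.S.continuous_P.comp continuous_subtype_val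
  proj_isOpenMap w := w.c.S.isOpenMap_P.comp w.c.isOpen.isOpenMap_subtype_val
  range_proj w := by rw [← w.c_W, Chart.W, image_eq_range]
  proj_eq_iff w x y := by
    constructor
    · intro h
      obtain ⟨g, hg, e⟩ := Chart.exists_smul x.2 y.2 h
      exact ⟨⟨g, hg⟩, Subtype.ext e⟩
    · rintro ⟨g, rfl⟩
      exact (Sec.P_smul g.2.1 _).symm

end LocSys

lemma connectedComponentIn_preimage_val {A : Type*} [TopologicalSpace A] {D s : Set A}
    (hs : s ⊆ D) (x : D) :
    connectedComponentIn (Subtype.val ⁻¹' s : Set D) x =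
      Subtype.val ⁻¹' connectedComponentIn s (x : A) := by
  by_cases hx : (x : A) ∈ s
  · refine Subset.antisymm (fun y hy => ?_) fun y hy => ?_
    · refine (isPreconnected_connectedComponentIn.image Subtype.val
        continuous_subtype_val.continuousOn).subset_connectedComponentIn
        (mem_image_of_mem _ (mem_connectedComponentIn (F := Subtype.val ⁻¹' s) hx)) ?_
        (mem_image_of_mem _ hy)
      rintro _ ⟨z, hz, rfl⟩
      exact connectedComponentIn_subset (Subtype.val ⁻¹' s : Set D) x hz
    · have hK : _root_.IsPreconnected (Subtype.val ⁻¹' connectedComponentIn s (x : A) : Set D) := by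
        rw [← IsInducing.subtypeVal.isPreconnected_image, Subtype.image_preimage_coe,
          inter_eq_self_of_subset_right ((connectedComponentIn_subset _ _).trans hs)]
        exact isPreconnected_connectedComponentIn
      exact hK.subset_connectedComponentIn (mem_connectedComponentIn hx : (x : A) ∈ _)
        (preimage_mono (connectedComponentIn_subset _ _)) hy
  · rw [connectedComponentIn_eq_empty hx, connectedComponentIn_eq_empty (by exact hx)]; rfl

/-- The restriction of an isomorphism of topological groups. -/
def restrictEquiv {A B K K' : Type*} [Group A] [TopologicalSpace A] [Group B]
    [TopologicalSpace B] [Group K] [TopologicalSpace K] [Group K'] [TopologicalSpace K']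
    (e : A ≃ₜ* B) (i : K →* A) (i' : K' →* B) (hi : IsEmbedding i) (hi' : IsEmbedding i')
    (h : ∀ k, ∃ k', i' k' = e (i k)) (h' : ∀ k', ∃ k, i' k' = e (i k)) : K ≃ₜ* K' where
  toFun k := (h k).choose
  invFun k := (h' k).choose
  left_inv k := hi.injective (e.injective
    ((h' (h k).choose).choose_spec.symm.trans (h k).choose_spec))
  right_inv k := hi'.injective ((h (h' k).choose).choose_spec.trans (h' k).choose_spec.symm)
  map_mul' a b := hi'.injective ((h (a * b)).choose_spec.trans (by
    rw [map_mul, map_mul, map_mul, (h a).choose_spec, (h b).choose_spec]))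
  continuous_toFun := hi'.continuous_iff.2 <| by
    refine (e.continuous.comp hi.continuous).congr fun k => (h k).choose_spec.symm
  continuous_invFun := hi.continuous_iff.2 <| by
    refine (e.symm.continuous.comp hi'.continuous).congr fun k => ?_
    exact e.injective ((e.apply_symm_apply _).trans (h' k).choose_spec)

lemma restrictEquiv_spec {A B K K' : Type*} [Group A] [TopologicalSpace A] [Group B]
    [TopologicalSpace B] [Group K] [TopologicalSpace K] [Group K'] [TopologicalSpace K']
    (e : A ≃ₜ* B) (i : K →* A) (i' : K' →* B) (hi : IsEmbedding i) (hi' : IsEmbedding i')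
    (h : ∀ k, ∃ k', i' k' = e (i k)) (h' : ∀ k', ∃ k, i' k' = e (i k)) (k : K) :
    i' (restrictEquiv e i i' hi hi' h h' k) = e (i k) := (h k).choose_spec

namespace LocSys

variable {L : LocSys X}

namespace Sec

variable {S S' : L.Sec} {ξ : X.Tran S.i S'.i}

lemma Maps.mem_stab_left (h : S.Maps S' ξ) {g : X.G S'.i} (h' : S.Maps S' (X.bi g ξ 1)) :
    g ∈ S'.stab := by
  obtain ⟨x, hx⟩ := X.source_nonempty ξ
  refine mem_stab_of_arr (x := X.φ ξ x) ?_
  rw [← h (homMk ξ x hx) rfl, ← L.arr_comp]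
  exact h' _ (ofG_comp _ _ _ _ _)

lemma Maps.mem_stab_right (h : S.Maps S' ξ) {g : X.G S.i} (h' : S.Maps S' (X.bi 1 ξ g)) :
    g ∈ S.stab := by
  obtain ⟨x, hx⟩ := X.source_nonempty ξ
  refine mem_stab_of_arr (x := g⁻¹ • x) ?_
  have hx' : g • g⁻¹ • x ∈ (X.φ ξ).source := by rwa [smul_inv_smul]
  refine L.arr_injective (homMk ξ _ hx') ?_
  rw [← L.arr_comp, h (homMk ξ _ hx') rfl]
  exact h' _ (comp_ofG _ _ _ _ _)

end Sec

namespace Chart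

variable {c c' c'' : L.Chart}

lemma subset_D {K : Set (X.hat c.S.i)} (hK : _root_.IsPreconnected K)
    (hKW : K ⊆ c.S.P ⁻¹' c.W) {x : X.hat c.S.i} (hx : x ∈ K) (hxD : x ∈ c.D) : K ⊆ c.D := by
  set V := ⋃ g ∈ {g : X.G c.S.i | g ∈ c.S.stab ∧ Disjoint c.D (g • c.D)}, g • c.D with hV
  refine hK.subset_left_of_subset_union c.isOpen
    (isOpen_biUnion fun g _ => c.isOpen.smul g) (v := V) ?_ (fun z hz => ?_) ⟨x, hx, hxD⟩
  · simp_all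
  · obtain ⟨y, hy, e⟩ := hKW hz
    obtain ⟨g, hg, rfl⟩ := Sec.exists_smul_of_P_eq e
    by_cases h : Disjoint c.D (g • c.D)
    · exact Or.inr (mem_biUnion (x := g) ⟨hg, h⟩ (smul_mem_smul_set hy))
    · left
      obtain ⟨w, hw, v, hv, rfl⟩ := Set.not_disjoint_iff.1 h
      rw [← c.block g hg v hv hw]
      exact smul_mem_smul_set hy

/-- The part of a chart that lies over another one. -/
def region (c c' : L.Chart) : Set (X.hat c.S.i) := c.D ∩ c.S.P ⁻¹' c'.W

/-- The components of that part. -/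
def cc (c c' : L.Chart) (x : X.hat c.S.i) : Set (X.hat c.S.i) :=
  connectedComponentIn (c.region c') x

lemma isOpen_region : IsOpen (c.region c') :=
  c.isOpen.inter (c'.isOpen_W.preimage c.S.continuous_P)

lemma smul_region {g : X.G c.S.i} (hg : g ∈ c.grp) : g • c.region c' = c.region c' := by
  have h : ∀ g ∈ c.grp, g • c.region c' ⊆ c.region c' := by
    rintro g hg _ ⟨z, hz, rfl⟩
    refine ⟨smul_mem hg hz.1, ?_⟩
    rw [mem_preimage, Sec.P_smul hg.1]; exact hz.2
  refine (h g hg).antisymm ?_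
  rw [← smul_inv_smul g (c.region c')]
  exact smul_set_mono (by simpa using h _ (inv_mem hg))

lemma smul_mem_cc {g : X.G c.S.i} (hg : g ∈ c.grp) {x y : X.hat c.S.i} :
    g • x ∈ c.cc c' (g • y) ↔ x ∈ c.cc c' y := by
  have hm : ∀ g ∈ c.grp, MapsTo (fun x => g • x) (c.region c') (c.region c') := fun g hg z hz =>
    smul_region hg ▸ smul_mem_smul_set hz
  refine ⟨fun h => ?_, fun h => smul_mem_connectedComponentIn (hm g hg) h⟩
  have := smul_mem_connectedComponentIn (hm _ (inv_mem hg)) h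
  rwa [inv_smul_smul, inv_smul_smul] at this

lemma mem_region {ξ : X.Tran c.S.i c'.S.i} (h : c.S.Maps c'.S ξ) {x : X.hat c.S.i}
    (hx : x ∈ c.D) (hs : x ∈ (X.φ ξ).source) (ht : X.φ ξ x ∈ c'.D) : x ∈ c.region c' :=
  ⟨hx, X.φ ξ x, ht, h.P_eq hs⟩

lemma mem_of_mem_cc {ξ : X.Tran c.S.i c'.S.i} (h : c.S.Maps c'.S ξ) {x : X.hat c.S.i}
    (hx : x ∈ c.D) (hs : x ∈ (X.φ ξ).source) (ht : X.φ ξ x ∈ c'.D) {z : X.hat c.S.i}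
    (hz : z ∈ c.cc c' x) : z ∈ c.D ∧ z ∈ (X.φ ξ).source ∧ X.φ ξ z ∈ c'.D := by
  have hxr := mem_region h hx hs ht
  have hxK : x ∈ c.cc c' x := mem_connectedComponentIn hxr
  have hK : _root_.IsPreconnected (c.cc c' x) := isPreconnected_connectedComponentIn
  have hKs : c.cc c' x ⊆ (X.φ ξ).source := by
    rw [X.source_eq ξ x hs]
    refine hK.subset_connectedComponentIn hxK fun z hz => ⟨proj_mem z, ?_⟩
    obtain ⟨y, hy, e⟩ := (connectedComponentIn_subset _ _ hz).2
    have := congrArg L.top e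
    rw [Sec.top_P, Sec.top_P] at this
    rw [← this]; exact proj_mem y
  refine ⟨(connectedComponentIn_subset _ _ hz).1, hKs hz, ?_⟩
  refine subset_D (hK.image _ ((X.φ ξ).continuousOn.mono hKs)) ?_ (mem_image_of_mem _ hxK) ht
    (mem_image_of_mem _ hz)
  rintro _ ⟨z, hz, rfl⟩
  rw [mem_preimage, h.P_eq (hKs hz)]
  exact (connectedComponentIn_subset _ _ hz).2

lemma image_subset_cc {ξ : X.Tran c.S.i c'.S.i} (h : c.S.Maps c'.S ξ) {x : X.hat c.S.i}
    (hx : x ∈ c.D) (hs : x ∈ (X.φ ξ).source) (ht : X.φ ξ x ∈ c'.D) :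
    X.φ ξ '' c.cc c' x ⊆ c'.cc c (X.φ ξ x) := by
  have hm := fun z (hz : z ∈ c.cc c' x) => mem_of_mem_cc h hx hs ht hz
  refine (isPreconnected_connectedComponentIn.image _ ((X.φ ξ).continuousOn.mono
    fun z hz => (hm z hz).2.1)).subset_connectedComponentIn
    (mem_image_of_mem _ (mem_connectedComponentIn (mem_region h hx hs ht))) ?_
  rintro _ ⟨z, hz, rfl⟩
  refine ⟨(hm z hz).2.2, ?_⟩
  rw [mem_preimage, h.P_eq (hm z hz).2.1]
  exact mem_image_of_mem _ (hm z hz).1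

/-- A transition map between charts of the covering. -/
@[ext]
structure Tr (c c' : L.Chart) where
  ξ : X.Tran c.S.i c'.S.i
  C : Set (X.hat c.S.i)
  maps : c.S.Maps c'.S ξ
  ex : ∃ x ∈ c.D, x ∈ (X.φ ξ).source ∧ X.φ ξ x ∈ c'.D ∧ C = c.cc c' x

namespace Tr

/-- The transition map that belongs to the component of a point. -/
def at' (ξ : X.Tran c.S.i c'.S.i) (h : c.S.Maps c'.S ξ) (x : X.hat c.S.i) (hx : x ∈ c.D)
    (hs : x ∈ (X.φ ξ).source) (ht : X.φ ξ x ∈ c'.D) : Tr c c' :=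
  ⟨ξ, c.cc c' x, h, x, hx, hs, ht, rfl⟩

lemma mem_at (ξ : X.Tran c.S.i c'.S.i) (h : c.S.Maps c'.S ξ) (x : X.hat c.S.i) (hx : x ∈ c.D)
    (hs : x ∈ (X.φ ξ).source) (ht : X.φ ξ x ∈ c'.D) : x ∈ (at' ξ h x hx hs ht).C :=
  mem_connectedComponentIn (mem_region h hx hs ht)

variable (a : Tr c c')

lemma nonempty : a.C.Nonempty := by
  obtain ⟨x, hx, hs, ht, e⟩ := a.ex
  exact ⟨x, e ▸ mem_connectedComponentIn (mem_region a.maps hx hs ht)⟩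

lemma eq_cc {x : X.hat c.S.i} (hx : x ∈ a.C) : a.C = c.cc c' x := by
  obtain ⟨y, -, -, -, e⟩ := a.ex
  rw [e] at hx ⊢
  exact connectedComponentIn_eq hx

lemma mem {x : X.hat c.S.i} (hx : x ∈ a.C) :
    x ∈ c.D ∧ x ∈ (X.φ a.ξ).source ∧ X.φ a.ξ x ∈ c'.D := by
  obtain ⟨y, hy, hs, ht, e⟩ := a.ex
  exact mem_of_mem_cc a.maps hy hs ht (e ▸ hx)

lemma isOpen_C : IsOpen a.C := by
  obtain ⟨y, -, -, -, e⟩ := a.ex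
  rw [e]; exact isOpen_region.connectedComponentIn

lemma ext' {a b : Tr c c'} (h : a.ξ = b.ξ) {x : X.hat c.S.i} (ha : x ∈ a.C) (hb : x ∈ b.C) :
    a = b := Tr.ext h ((a.eq_cc ha).trans (b.eq_cc hb).symm)

lemma image_C {x : X.hat c.S.i} (hx : x ∈ a.C) : X.φ a.ξ '' a.C = c'.cc c (X.φ a.ξ x) := by
  obtain ⟨hD, hs, ht⟩ := a.mem hx
  rw [a.eq_cc hx]
  refine (image_subset_cc a.maps hD hs ht).antisymm fun y hy => ?_
  have h2 : X.φ (Orbispace.inv a.ξ) (X.φ a.ξ x) ∈ c.D := by rwa [φ_inv_φ hs]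
  have h3 := image_subset_cc a.maps.inv ht (φ_mem_inv hs) h2
  have h4 := (mem_of_mem_cc a.maps.inv ht (φ_mem_inv hs) h2 hy).2.1
  rw [inv_source] at h4
  rw [φ_inv_φ hs] at h3
  refine ⟨_, h3 (mem_image_of_mem _ hy), ?_⟩
  obtain ⟨z, hz, rfl⟩ := (X.φ a.ξ).image_source_eq_target ▸ h4
  rw [φ_inv_φ hz]

instance (c : L.Chart) : Nonempty c.D := c.isConn.nonempty.to_subtype

/-- The inclusion of a chart. -/
def incl (c : L.Chart) : OpenPartialHomeomorph c.D (X.hat c.S.i) :=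
  c.isOpen.isOpenEmbedding_subtypeVal.toOpenPartialHomeomorph

/-- The homeomorphism that underlies a transition map. -/
def φ : OpenPartialHomeomorph c.D c'.D :=
  ((incl c).trans ((X.φ a.ξ).restr a.C)).trans (incl c').symm

lemma φ_source : a.φ.source = Subtype.val ⁻¹' a.C := by
  ext x
  simp only [φ, incl, OpenPartialHomeomorph.trans_source, mem_inter_iff, mem_preimage]
  simp [a.isOpen_C.interior_eq]
  exact ⟨fun h => h.1.2, fun h => ⟨⟨(a.mem h).2.1, h⟩, (a.mem h).2.2⟩⟩

lemma φ_coe {x : c.D} (hx : (x : X.hat c.S.i) ∈ a.C) : (a.φ x : X.hat c'.S.i) = X.φ a.ξ x := by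
  have h : X.φ a.ξ x ∈ (incl c').target := by simp [incl]; exact (a.mem hx).2.2
  exact (incl c').right_inv h

lemma φ_target : a.φ.target = Subtype.val ⁻¹' (X.φ a.ξ '' a.C) := by
  ext y
  rw [← a.φ.image_source_eq_target, φ_source]
  constructor
  · rintro ⟨x, hx, rfl⟩
    exact ⟨x, hx, (a.φ_coe hx).symm⟩
  · rintro ⟨x, hx, e⟩
    exact ⟨⟨x, (a.mem hx).1⟩, hx, Subtype.ext ((a.φ_coe (x := ⟨x, (a.mem hx).1⟩) hx).trans e)⟩

lemma mem_stabilizer {k : c.grp} {x : X.hat c.S.i} (hx : x ∈ a.C)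
    (hk : (k : X.G c.S.i) • x ∈ a.C) : k ∈ stabilizer c.grp a.φ.source := by
  rw [φ_source]
  have h : (k : X.G c.S.i) • a.C = a.C := by
    rw [a.eq_cc hx] at hk ⊢
    exact smul_connectedComponentIn (smul_region k.2)
      (mem_connectedComponentIn (mem_region a.maps (a.mem hx).1 (a.mem hx).2.1 (a.mem hx).2.2)) hk
  ext z
  rw [mem_smul_set_iff_inv_smul_mem]
  change ((k⁻¹ : c.grp) : X.G c.S.i) • (z : X.hat c.S.i) ∈ a.C ↔ (z : X.hat c.S.i) ∈ a.C
  rw [Subgroup.coe_inv, ← mem_smul_set_iff_inv_smul_mem, h]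

lemma smul_mem_C (k : stabilizer c.grp a.φ.source) {x : X.hat c.S.i} (hx : x ∈ a.C) :
    (k : X.G c.S.i) • x ∈ a.C := by
  have h : (k : c.grp) • a.φ.source = a.φ.source := k.2
  have h1 : (⟨x, (a.mem hx).1⟩ : c.D) ∈ a.φ.source := by rw [φ_source]; exact hx
  have h2 := smul_mem_smul_set (a := (k : c.grp)) h1
  rw [h] at h2
  exact a.φ_source.subset h2

lemma mem_stabilizer' {k : c'.grp} {x : X.hat c.S.i} (hx : x ∈ a.C)
    (hk : (k : X.G c'.S.i) • X.φ a.ξ x ∈ X.φ a.ξ '' a.C) :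
    k ∈ stabilizer c'.grp a.φ.target := by
  rw [φ_target]
  have h : (k : X.G c'.S.i) • X.φ a.ξ '' a.C = X.φ a.ξ '' a.C := by
    have h0 := mem_image_of_mem (X.φ a.ξ) hx
    rw [a.image_C hx] at hk h0 ⊢
    exact smul_connectedComponentIn (smul_region k.2) h0 hk
  ext z
  rw [mem_smul_set_iff_inv_smul_mem]
  change ((k⁻¹ : c'.grp) : X.G c'.S.i) • (z : X.hat c'.S.i) ∈ X.φ a.ξ '' a.C ↔ _
  rw [Subgroup.coe_inv, ← mem_smul_set_iff_inv_smul_mem, h]; rfl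

lemma smul_mem_C' (k : stabilizer c'.grp a.φ.target) {y : X.hat c'.S.i}
    (hy : y ∈ X.φ a.ξ '' a.C) : (k : X.G c'.S.i) • y ∈ X.φ a.ξ '' a.C := by
  have h : (k : c'.grp) • a.φ.target = a.φ.target := k.2
  have hyD : y ∈ c'.D := by obtain ⟨x, hx, rfl⟩ := hy; exact (a.mem hx).2.2
  have h1 : (⟨y, hyD⟩ : c'.D) ∈ a.φ.target := by rw [φ_target]; exact hy
  have h2 := smul_mem_smul_set (a := (k : c'.grp)) h1
  rw [h] at h2
  exact a.φ_target.subset h2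

/-- The inclusion of stabilizers. -/
def stabLeft : stabilizer c.grp a.φ.source →* stabilizer (X.G c.S.i)
    (X.φ a.ξ).source where
  toFun k := ⟨k, by
    obtain ⟨x, hx⟩ := a.nonempty
    exact mem_stabilizer_source a.ξ (a.mem hx).2.1 (a.mem (a.smul_mem_C k hx)).2.1⟩
  map_one' := rfl
  map_mul' _ _ := rfl

/-- The inclusion of stabilizers. -/
def stabRight : stabilizer c'.grp a.φ.target →* stabilizer (X.G c'.S.i)
    (X.φ a.ξ).target where
  toFun k := ⟨k, by
    obtain ⟨x, hx⟩ := a.nonempty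
    rw [← inv_source]
    refine mem_stabilizer_source (Orbispace.inv a.ξ) (x := X.φ a.ξ x) (φ_mem_inv (a.mem hx).2.1) ?_
    obtain ⟨z, hz, e⟩ := a.smul_mem_C' k (mem_image_of_mem _ hx)
    rw [← e]
    exact φ_mem_inv (a.mem hz).2.1⟩
  map_one' := rfl
  map_mul' _ _ := rfl

lemma isEmbedding_stabLeft : IsEmbedding a.stabLeft :=
  .of_comp (Continuous.subtype_mk (continuous_subtype_val.comp continuous_subtype_val) _)
    continuous_subtype_val (g := (Subtype.val : _ → X.G c.S.i))
    (show IsEmbedding ((Subtype.val : c.grp → X.G c.S.i) ∘ Subtype.val) from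
      IsEmbedding.subtypeVal.comp IsEmbedding.subtypeVal)

lemma isEmbedding_stabRight : IsEmbedding a.stabRight :=
  .of_comp (Continuous.subtype_mk (continuous_subtype_val.comp continuous_subtype_val) _)
    continuous_subtype_val (g := (Subtype.val : _ → X.G c'.S.i))
    (show IsEmbedding ((Subtype.val : c'.grp → X.G c'.S.i) ∘ Subtype.val) from
      IsEmbedding.subtypeVal.comp IsEmbedding.subtypeVal)

lemma exists_lam (k : stabilizer c.grp a.φ.source) :
    ∃ k', a.stabRight k' = X.lam a.ξ (a.stabLeft k) := by
  obtain ⟨x, hx⟩ := a.nonempty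
  have hkx := a.smul_mem_C k hx
  have h1 : X.φ a.ξ ((k : X.G c.S.i) • x) = _ := X.φ_smul a.ξ (a.stabLeft k) x (a.mem hx).2.1
  have h2 : (X.lam a.ξ (a.stabLeft k) : X.G c'.S.i) ∈ c'.S.stab := by
    refine a.maps.mem_stab_left ?_
    rw [← bi_lam]
    exact a.maps.bi (one_mem _) k.1.2.1
  have h3 : (X.lam a.ξ (a.stabLeft k) : X.G c'.S.i) ∈ c'.grp :=
    mem_grp_of_mem h2 (a.mem hx).2.2 (h1 ▸ (a.mem hkx).2.2)
  exact ⟨⟨⟨_, h3⟩, a.mem_stabilizer' hx (h1 ▸ mem_image_of_mem _ hkx)⟩, rfl⟩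

lemma exists_lam' (k' : stabilizer c'.grp a.φ.target) :
    ∃ k, a.stabRight k' = X.lam a.ξ (a.stabLeft k) := by
  obtain ⟨x, hx⟩ := a.nonempty
  obtain ⟨g, hg⟩ := (X.lam a.ξ).surjective (a.stabRight k')
  have h1 := X.φ_smul a.ξ g x (a.mem hx).2.1
  obtain ⟨z, hz, e⟩ := a.smul_mem_C' k' (mem_image_of_mem _ hx)
  have hgs : (g : X.G c.S.i) • x ∈ (X.φ a.ξ).source := by
    have := smul_mem_smul_set (a := (g : X.G c.S.i)) (a.mem hx).2.1
    rwa [MulAction.mem_stabilizer_iff.1 g.2] at this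
  have h2 : (g : X.G c.S.i) • x = z := by
    refine (X.φ a.ξ).injOn hgs (a.mem hz).2.1 ?_
    rw [h1, hg, e]; rfl
  have h3 : (g : X.G c.S.i) ∈ c.S.stab := by
    refine a.maps.mem_stab_right ?_
    rw [bi_lam, hg]
    exact a.maps.bi k'.1.2.1 (one_mem _)
  have h4 : (g : X.G c.S.i) ∈ c.grp := mem_grp_of_mem h3 (a.mem hx).1 (h2 ▸ (a.mem hz).1)
  exact ⟨⟨⟨g, h4⟩, a.mem_stabilizer hx (h2 ▸ hz)⟩, hg.symm⟩

/-- The isomorphism of groups that underlies a transition map. -/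
def lam : stabilizer c.grp a.φ.source ≃ₜ* stabilizer c'.grp a.φ.target :=
  restrictEquiv (X.lam a.ξ) a.stabLeft a.stabRight a.isEmbedding_stabLeft a.isEmbedding_stabRight
    a.exists_lam a.exists_lam'

lemma lam_coe (k : stabilizer c.grp a.φ.source) :
    (a.lam k : X.G c'.S.i) = X.lam a.ξ (a.stabLeft k) :=
  congrArg Subtype.val (restrictEquiv_spec (X.lam a.ξ) a.stabLeft a.stabRight
    a.isEmbedding_stabLeft a.isEmbedding_stabRight a.exists_lam a.exists_lam' k)

/-- Composition with group elements. -/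
def bi (h : c'.grp) (g : c.grp) : Tr c c' where
  ξ := X.bi h a.ξ g
  C := {x | (g : X.G c.S.i) • x ∈ a.C}
  maps := a.maps.bi h.2.1 g.2.1
  ex := by
    obtain ⟨x, hx⟩ := a.nonempty
    obtain ⟨h1, h2, h3⟩ := a.mem hx
    have e : (g : X.G c.S.i) • (g : X.G c.S.i)⁻¹ • x = x := smul_inv_smul _ _
    refine ⟨(g : X.G c.S.i)⁻¹ • x, smul_mem (inv_mem g.2) h1, ?_, ?_, ?_⟩
    · rwa [X.bi_source, e]
    · rw [X.φ_bi _ _ _ _ (by rwa [e]), e]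
      exact smul_mem h.2 h3
    · ext z
      rw [Set.mem_ofPred_eq, ← smul_mem_cc g.2, e, ← a.eq_cc hx]

/-- The identity. -/
def one (c : L.Chart) : Tr c c where
  ξ := X.one c.S.i
  C := c.D
  maps := c.S.maps_one
  ex := by
    obtain ⟨x, hx⟩ := c.isConn.nonempty
    refine ⟨x, hx, mem_one _ _, by rwa [X.φ_one], ?_⟩
    have : c.region c = c.D := inter_eq_self_of_subset_left fun y hy => mem_image_of_mem _ hy
    rw [cc, this]
    exact (c.isConn.isPreconnected.connectedComponentIn hx).symm

variable {a}

/-- The composition at a point. -/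
def comp (b : Tr c' c'') (a : Tr c c') (x : X.hat c.S.i) (hx : x ∈ a.C) (hy : X.φ a.ξ x ∈ b.C) :
    Tr c c'' :=
  at' (X.comp b.ξ a.ξ x (a.mem hx).2.1 (b.mem hy).2.1) (a.maps.comp b.maps _ _ _) x (a.mem hx).1
    (X.comp_mem _ _ _ _ _) (by rw [X.φ_comp]; exact (b.mem hy).2.2)

lemma mem_comp (b : Tr c' c'') (a : Tr c c') (x : X.hat c.S.i) (hx : x ∈ a.C)
    (hy : X.φ a.ξ x ∈ b.C) : x ∈ (comp b a x hx hy).C := mem_at _ _ _ _ _ _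

lemma comp_const (b : Tr c' c'') (a : Tr c c') {K : Set (X.hat c.S.i)}
    (hK : _root_.IsPreconnected K) (hKs : ∀ z ∈ K, z ∈ a.C ∧ X.φ a.ξ z ∈ b.C) {x x' : X.hat c.S.i}
    (hx : x ∈ K) (hx' : x' ∈ K) (h₁) (h₂) (h₃) (h₄) : comp b a x' h₃ h₄ = comp b a x h₁ h₂ := by
  have e : (comp b a x' h₃ h₄).ξ = (comp b a x h₁ h₂).ξ :=
    comp_eq_of_isPreconnected b.ξ a.ξ hK (fun z hz => ⟨(a.mem (hKs z hz).1).2.1,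
      (b.mem (hKs z hz).2).2.1⟩) hx hx' _ _ _ _
  refine ext' e (mem_comp _ _ _ _ _) (x := x') ?_
  have hsub : K ⊆ c.region c'' := by
    intro z hz
    refine ⟨(a.mem (hKs z hz).1).1, X.φ b.ξ (X.φ a.ξ z), (b.mem (hKs z hz).2).2.2, ?_⟩
    rw [b.maps.P_eq (b.mem (hKs z hz).2).2.1, a.maps.P_eq (a.mem (hKs z hz).1).2.1]
  exact hK.subset_connectedComponentIn hx hsub hx'

end Tr

end Chart

end LocSys

namespace LocSys

variable {L : LocSys X}

namespace Chart

namespace Tr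

variable {c c' c'' c₃ : L.Chart}

lemma mem_source {a : Tr c c'} {x : c.D} : x ∈ a.φ.source ↔ (x : X.hat c.S.i) ∈ a.C := by
  rw [φ_source]; rfl

lemma mem_comp_source {a : Tr c c'} {b : Tr c' c''} {x : c.D} (hx : x ∈ a.φ.source) :
    a.φ x ∈ b.φ.source ↔ X.φ a.ξ x ∈ b.C := by
  rw [mem_source, φ_coe a (mem_source.1 hx)]

lemma exists_of_P_eq {x : X.hat c.S.i} {x' : X.hat c'.S.i} (hx : x ∈ c.D) (hx' : x' ∈ c'.D)
    (h : c.S.P x = c'.S.P x') : ∃ a : Tr c c', x ∈ a.C ∧ X.φ a.ξ x = x' := by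
  obtain ⟨f, hf⟩ := Sec.P_eq_iff.1 h
  have ht : X.φ f.1 x ∈ c'.D := by rw [f.2.2]; exact hx'
  exact ⟨at' f.1 hf x hx f.2.1 ht, mem_at _ _ _ _ _ _, f.2.2⟩

lemma P_eq (a : Tr c c') {x : X.hat c.S.i} (hx : x ∈ a.C) : c'.S.P (X.φ a.ξ x) = c.S.P x :=
  a.maps.P_eq (a.mem hx).2.1

lemma source_eq (a : Tr c c') (x : c.D) (hx : x ∈ a.φ.source) :
    a.φ.source = connectedComponentIn ((fun x : c.D => c.S.P x) ⁻¹' (c.W ∩ c'.W)) x := by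
  have h : ((fun x : c.D => c.S.P x) ⁻¹' (c.W ∩ c'.W)) = Subtype.val ⁻¹' c.region c' := by
    ext y
    exact ⟨fun h => ⟨y.2, h.2⟩, fun h => ⟨mem_image_of_mem _ y.2, h.2⟩⟩
  rw [h, connectedComponentIn_preimage_val (s := c.region c') inter_subset_left, φ_source,
    a.eq_cc (mem_source.1 hx)]; rfl

lemma target_eq (a : Tr c c') (y : c'.D) (hy : y ∈ a.φ.target) :
    a.φ.target = connectedComponentIn ((fun x : c'.D => c'.S.P x) ⁻¹' (c.W ∩ c'.W)) y := by
  have h : ((fun x : c'.D => c'.S.P x) ⁻¹' (c.W ∩ c'.W)) = Subtype.val ⁻¹' c'.region c := by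
    ext y
    exact ⟨fun h => ⟨y.2, h.1⟩, fun h => ⟨h.2, mem_image_of_mem _ y.2⟩⟩
  rw [φ_target] at hy ⊢
  obtain ⟨x, hx, e⟩ := hy
  rw [h, connectedComponentIn_preimage_val (s := c'.region c) inter_subset_left, a.image_C hx, e]; rfl

lemma bi_transitive (a b : Tr c c') (h : (fun x : c.D => c.S.P x) '' a.φ.source =
    (fun x : c.D => c.S.P x) '' b.φ.source) : ∃ (k : c'.grp) (g : c.grp), b = bi a k g := by
  obtain ⟨x, hx⟩ := b.nonempty
  have h1 : c.S.P x ∈ (fun x : c.D => c.S.P x) '' a.φ.source :=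
    h ▸ ⟨⟨x, (b.mem hx).1⟩, mem_source.2 hx, rfl⟩
  obtain ⟨y, hy, e⟩ := h1
  obtain ⟨g, hg, e1⟩ := exists_smul (b.mem hx).1 y.2 e.symm
  have hy' := mem_source.1 hy
  have e2 : c'.S.P (X.φ a.ξ y) = c'.S.P (X.φ b.ξ x) := by rw [a.P_eq hy', b.P_eq hx]; exact e
  obtain ⟨k, hk, e3⟩ := exists_smul (a.mem hy').2.2 (b.mem hx).2.2 e2
  have hx1 : x ∈ (bi a ⟨k, hk⟩ ⟨g, hg⟩).C := by change g • x ∈ a.C; rw [e1]; exact hy'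
  have hx1' := ((bi a ⟨k, hk⟩ ⟨g, hg⟩).mem hx1).2.1
  have e4 : X.φ (bi a ⟨k, hk⟩ ⟨g, hg⟩).ξ x = X.φ b.ξ x := by
    change X.φ (X.bi k a.ξ g) x = _
    rw [X.φ_bi _ _ _ _ (by rw [e1]; exact (a.mem hy').2.1), e1, e3]
  let f : (⟨c.S.i, x⟩ : X.BasePoint) ⟶ ⟨c'.S.i, X.φ b.ξ x⟩ := homMk b.ξ x (b.mem hx).2.1
  let f' : (⟨c.S.i, x⟩ : X.BasePoint) ⟶ ⟨c'.S.i, X.φ b.ξ x⟩ := ⟨_, hx1', e4⟩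
  obtain ⟨m, hm⟩ := exists_ofG (Groupoid.inv f' ≫ f).1
  have hff : f = f' ≫ (Groupoid.inv f' ≫ f) := by simp
  have hmx : m • X.φ b.ξ x = X.φ b.ξ x := by rw [← φ_ofG, ← hm]; exact (Groupoid.inv f' ≫ f).2.2
  have e5 : b.ξ = X.bi m (bi a ⟨k, hk⟩ ⟨g, hg⟩).ξ 1 := by
    have h1 : f.1 = _ := (congrArg Subtype.val hff).trans (comp_val f' _)
    refine h1.trans ?_
    refine Eq.trans ?_ (ofG_comp m (bi a ⟨k, hk⟩ ⟨g, hg⟩).ξ x hx1' (mem_ofG _ _))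
    exact comp_congr hm rfl rfl _ _
  have hm' : m ∈ c'.grp := by
    refine mem_grp_of_mem ?_ (b.mem hx).2.2 (x := X.φ b.ξ x) (by rw [hmx]; exact (b.mem hx).2.2)
    exact (bi a ⟨k, hk⟩ ⟨g, hg⟩).maps.mem_stab_left (e5 ▸ b.maps)
  refine ⟨⟨m, hm'⟩ * ⟨k, hk⟩, ⟨g, hg⟩, ext' (x := x) ?_ hx hx1⟩
  rw [e5]
  change X.bi m (X.bi k a.ξ g) 1 = X.bi (m * k) a.ξ g
  rw [X.bi_bi, _root_.mul_one]

lemma bi_eq_iff (h : c'.grp) (a : Tr c c') (g : c.grp) :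
    bi a h⁻¹ g = a ↔ ∃ hg : g ∈ stabilizer c.grp a.φ.source, (a.lam ⟨g, hg⟩ : c'.grp) = h := by
  obtain ⟨x, hx⟩ := a.nonempty
  have hxk (z : X.hat c.S.i) : z ∈ (bi a h⁻¹ g).C ↔ (g : X.G c.S.i) • z ∈ a.C := Iff.rfl
  constructor
  · intro e
    have h1 : (g : X.G c.S.i) • x ∈ a.C := by rw [← hxk, e]; exact hx
    have hg := a.mem_stabilizer hx h1
    refine ⟨hg, ?_⟩
    obtain ⟨hg', e'⟩ := (X.bi_eq_iff _ _ _).1 (congrArg Tr.ξ e)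
    exact Subtype.ext ((a.lam_coe _).trans e')
  · rintro ⟨hg, e⟩
    have e1 := (X.bi_eq_iff (h : X.G c'.S.i) a.ξ g).2
      ⟨(a.stabLeft ⟨g, hg⟩).2, (a.lam_coe ⟨g, hg⟩).symm.trans (congrArg Subtype.val e)⟩
    have h2 := a.smul_mem_C (⟨g, hg⟩⁻¹) hx
    refine ext' (x := (g : X.G c.S.i)⁻¹ • x) e1 ?_ h2
    rw [hxk, smul_inv_smul]; exact hx

lemma φ_smul (a : Tr c c') (g : stabilizer c.grp a.φ.source) (x : c.D)
    (hx : x ∈ a.φ.source) : a.φ ((g : c.grp) • x) = (a.lam g : c'.grp) • a.φ x := by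
  have hx' := mem_source.1 hx
  refine Subtype.ext ((a.φ_coe (a.smul_mem_C g hx')).trans ?_)
  refine (X.φ_smul a.ξ (a.stabLeft g) x (a.mem hx').2.1).trans ?_
  rw [← a.lam_coe, ← a.φ_coe hx']; rfl

lemma bi_one (a : Tr c c') : bi a 1 1 = a := by
  obtain ⟨x, hx⟩ := a.nonempty
  refine ext' (X.bi_one _) (x := x) ?_ hx
  change (1 : X.G _) • x ∈ a.C
  rwa [one_smul]

lemma bi_bi (a : Tr c c') (h h' : c'.grp) (g g' : c.grp) :
    bi (bi a h g) h' g' = bi a (h' * h) (g * g') := by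
  refine Tr.ext (X.bi_bi _ _ _ _ _) ?_
  ext x
  change (g : X.G c.S.i) • (g' : X.G c.S.i) • x ∈ a.C ↔ (g * g').1 • x ∈ a.C
  rw [← mul_smul]; rfl

lemma bi_source (a : Tr c c') (h : c'.grp) (g : c.grp) (x : c.D) :
    x ∈ (bi a h g).φ.source ↔ g • x ∈ a.φ.source := by rw [mem_source, mem_source]; rfl

lemma φ_bi (a : Tr c c') (h : c'.grp) (g : c.grp) (x : c.D) (hx : g • x ∈ a.φ.source) :
    (bi a h g).φ x = h • a.φ (g • x) := by
  have hx' := mem_source.1 hx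
  refine Subtype.ext ((φ_coe (bi a h g) hx').trans ((X.φ_bi _ _ _ _ (a.mem hx').2.1).trans ?_))
  rw [coe_smul, a.φ_coe hx']; rfl

lemma lam_bi (a : Tr c c') (h : c'.grp) (g : c.grp)
    (k : stabilizer c.grp (bi a h g).φ.source)
    (k' : stabilizer c.grp a.φ.source) (e : (k' : c.grp) = g * (k : c.grp) * g⁻¹) :
    ((bi a h g).lam k : c'.grp) = h * (a.lam k' : c'.grp) * h⁻¹ := by
  refine Subtype.ext (((bi a h g).lam_coe k).trans ((X.lam_bi h a.ξ g ((bi a h g).stabLeft k)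
    (a.stabLeft k') (congrArg Subtype.val e)).trans ?_))
  rw [← a.lam_coe]; rfl

/-- The composition of transition maps at a point of a chart. -/
def comp' (b : Tr c' c'') (a : Tr c c') (x : c.D) (hx : x ∈ a.φ.source)
    (hy : a.φ x ∈ b.φ.source) : Tr c c'' :=
  comp b a x (mem_source.1 hx) ((mem_comp_source hx).1 hy)

lemma φ_comp' (b : Tr c' c'') (a : Tr c c') (x : c.D) (hx : x ∈ a.φ.source)
    (hy : a.φ x ∈ b.φ.source) : (comp' b a x hx hy).φ x = b.φ (a.φ x) := by
  refine Subtype.ext ((φ_coe (comp' b a x hx hy) (mem_comp _ _ _ _ _)).trans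
    ((X.φ_comp _ _ _ _ _).trans ?_))
  rw [b.φ_coe (mem_source.1 hy), a.φ_coe (mem_source.1 hx)]

lemma comp_const' (b : Tr c' c'') (a : Tr c c') (x x' : c.D) (hx : x ∈ a.φ.source)
    (hy : a.φ x ∈ b.φ.source) (hx' : x' ∈ a.φ.source) (hy' : a.φ x' ∈ b.φ.source)
    (h : x' ∈ connectedComponentIn {z | z ∈ a.φ.source ∧ a.φ z ∈ b.φ.source} x) :
    comp' b a x' hx' hy' = comp' b a x hx hy := by
  refine comp_const b a (K := Subtype.val '' connectedComponentIn
    {z | z ∈ a.φ.source ∧ a.φ z ∈ b.φ.source} x) (isPreconnected_connectedComponentIn.image _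
    continuous_subtype_val.continuousOn) ?_ ⟨x, mem_connectedComponentIn ⟨hx, hy⟩, rfl⟩
    ⟨x', h, rfl⟩ _ _ _ _
  rintro _ ⟨z, hz, rfl⟩
  have hz' := connectedComponentIn_subset _ _ hz
  exact ⟨mem_source.1 hz'.1, (mem_comp_source hz'.1).1 hz'.2⟩

lemma comp_assoc' (d : Tr c'' c₃) (b : Tr c' c'') (a : Tr c c') (x : c.D)
    (hx : x ∈ a.φ.source) (hy : a.φ x ∈ b.φ.source) (hz : b.φ (a.φ x) ∈ d.φ.source)
    (hx' : x ∈ (comp' b a x hx hy).φ.source) (hy' : (comp' b a x hx hy).φ x ∈ d.φ.source)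
    (hz' : a.φ x ∈ (comp' d b (a.φ x) hy hz).φ.source) :
    comp' d (comp' b a x hx hy) x hx' hy' = comp' (comp' d b (a.φ x) hy hz) a x hx hz' := by
  refine ext' (x := x) ?_ (mem_comp _ _ _ _ _) (mem_comp _ _ _ _ _)
  have key : ∀ (y : X.hat c'.S.i) (_ : y = X.φ a.ξ x) (h1 : y ∈ (X.φ b.ξ).source)
      (h2 : X.φ b.ξ y ∈ (X.φ d.ξ).source) (h3) (h4) (h5) (h6) (h7) (h8),
      X.comp d.ξ (X.comp b.ξ a.ξ x h3 h4) x h5 h6 = X.comp (X.comp d.ξ b.ξ y h1 h2) a.ξ x h7 h8 := by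
    rintro y rfl h1 h2 h3 h4 h5 h6 h7 h8
    exact X.comp_assoc _ _ _ _ _ _ h2 _ _ _
  exact key _ (a.φ_coe (mem_source.1 hx)) _ _ _ _ _ _ _ _

lemma comp_bi_one' (a : Tr c c') (g : c.grp) (x : c.D) (hx : x ∈ (bi (one c) g 1).φ.source)
    (hy : (bi (one c) g 1).φ x ∈ a.φ.source) : comp' a (bi (one c) g 1) x hx hy = bi a 1 g := by
  refine ext' (x := x) (X.comp_bi_one _ _ _ _ _) (mem_comp _ _ _ _ _) ?_
  have : X.φ (X.ofG _ _) (x : X.hat c.S.i) ∈ a.C := (mem_comp_source hx).1 hy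
  rwa [φ_ofG] at this

lemma bi_one_comp' (h : c'.grp) (a : Tr c c') (x : c.D) (hx : x ∈ a.φ.source)
    (hy : a.φ x ∈ (bi (one c') h 1).φ.source) : comp' (bi (one c') h 1) a x hx hy = bi a h 1 := by
  refine ext' (x := x) (X.bi_one_comp _ _ _ _ _) (mem_comp _ _ _ _ _) ?_
  change (1 : X.G _) • (x : X.hat c.S.i) ∈ a.C
  rw [one_smul]; exact mem_source.1 hx

end Tr

end Chart

open Chart

variable (L) in
/-- The covering that belongs to a local system. -/
def cover : Orbispace.{u} where
  toChartedBase := L.base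
  Tran w w' := Tr w.c w'.c
  φ a := a.φ
  source_nonempty a := by
    obtain ⟨x, hx⟩ := a.nonempty
    exact ⟨⟨x, (a.mem hx).1⟩, Tr.mem_source.2 hx⟩
  source_eq {w w'} a x hx := by
    change _ = connectedComponentIn ((fun x : w.c.D => w.c.S.P x) ⁻¹' (w.1 ∩ w'.1)) x
    rw [← w.c_W, ← w'.c_W]; exact a.source_eq x hx
  target_eq {w w'} a x hx := by
    change _ = connectedComponentIn ((fun x : w'.c.D => w'.c.S.P x) ⁻¹' (w.1 ∩ w'.1)) x
    rw [← w.c_W, ← w'.c_W]; exact a.target_eq x hx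
  proj_φ a x hx := (congrArg _ (a.φ_coe (Tr.mem_source.1 hx))).trans (a.P_eq (Tr.mem_source.1 hx))
  lam a := a.lam
  φ_smul a g x hx := a.φ_smul g x hx
  tran_nonempty w w' h := by
    obtain ⟨q, h1, h2⟩ := h
    change q ∈ w.1 at h1
    change q ∈ w'.1 at h2
    rw [← w.c_W] at h1
    rw [← w'.c_W] at h2
    obtain ⟨x, hx, rfl⟩ := h1
    obtain ⟨x', hx', e⟩ := h2
    obtain ⟨a, -⟩ := Tr.exists_of_P_eq hx hx' e.symm
    exact ⟨a⟩
  bi h a g := Tr.bi a h g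
  bi_one a := a.bi_one
  bi_bi h h' a g g' := a.bi_bi h h' g g'
  bi_source h a g x := a.bi_source h g x
  φ_bi h a g x hx := a.φ_bi h g x hx
  lam_bi h a g k k' e := a.lam_bi h g k k' e
  bi_transitive a b h := Tr.bi_transitive a b h
  bi_eq_iff h a g := Tr.bi_eq_iff h a g
  one w := Tr.one w.c
  one_source w := by
    ext x
    exact (Tr.mem_source (a := Tr.one w.c) (x := x)).trans (iff_of_true x.2 trivial)
  φ_one w x := Subtype.ext (((Tr.one w.c).φ_coe (x := x) x.2).trans (X.φ_one _ _))
  lam_one w g := Subtype.ext (((Tr.one w.c).lam_coe g).trans (X.lam_one _ _))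
  comp b a x hx hy := Tr.comp' b a x hx hy
  comp_mem b a x hx hy := Tr.mem_source.2 (Tr.mem_comp _ _ _ _ _)
  φ_comp b a x hx hy := Tr.φ_comp' b a x hx hy
  comp_const b a x x' hx hy hx' hy' h := Tr.comp_const' b a x x' hx hy hx' hy' h
  comp_assoc d b a x hx hy hz hx' hy' hz' := Tr.comp_assoc' d b a x hx hy hz hx' hy' hz'
  comp_bi_one a g x hx hy := Tr.comp_bi_one' a g x hx hy
  bi_one_comp h a x hx hy := Tr.bi_one_comp' h a x hx hy

lemma locallyStronglyPathConnected_cover : L.cover.LocallyStronglyPathConnected := fun w => by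
  have := L.loc w.c.S.i
  exact w.c.isOpen.locallyPathConnectedSpace

/-- The transition map of the base that underlies one of the covering. -/
def fst {w w' : L.cover.ι} (a : L.cover.Tran w w') : X.Tran w.c.S.i w'.c.S.i := Tr.ξ a

lemma mem_fst {w w' : L.cover.ι} {a : L.cover.Tran w w'} {x : L.cover.hat w}
    (hx : x ∈ (L.cover.φ a).source) : (x : w.c.D).1 ∈ (X.φ (fst a)).source :=
  (Tr.mem a (Tr.mem_source.1 hx)).2.1

lemma φ_fst {w w' : L.cover.ι} {a : L.cover.Tran w w'} {x : L.cover.hat w}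
    (hx : x ∈ (L.cover.φ a).source) :
    (L.cover.φ a x : w'.c.D).1 = X.φ (fst a) (x : w.c.D).1 := Tr.φ_coe a (Tr.mem_source.1 hx)

lemma tran_ext {w w' : L.cover.ι} {a b : L.cover.Tran w w'} (h : fst a = fst b)
    {x : L.cover.hat w} (ha : x ∈ (L.cover.φ a).source) (hb : x ∈ (L.cover.φ b).source) :
    a = b := Tr.ext' h (Tr.mem_source.1 ha) (Tr.mem_source.1 hb)

lemma maps_fst {w w' : L.cover.ι} (a : L.cover.Tran w w') : w.c.S.Maps w'.c.S (fst a) := a.maps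

end LocSys

namespace WayOn

variable {P : Part} {x y : X.BasePoint} (σ : WayOn P x y)

lemma eventually_seg {k : ℕ} (hk : k ≤ P.n) {r : ℝ} (hr : r ∈ P.piece k) {O : Set X.BasePoint}
    (hO : O ∈ 𝓝 (σ.c k r)) :
    ∀ᶠ r' in 𝓝[P.piece k] r, ∀ hr' : r' ∈ P.piece k, ∀ t, σ.seg hk hr hr' t ∈ O := by
  obtain ⟨ε, hε, h⟩ := Metric.mem_nhdsWithin_iff.1 ((σ.c_cont k hk r hr) hO)
  filter_upwards [nhdsWithin_le_nhds (Metric.ball_mem_nhds r hε)] with r' h' hr' t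
  refine h ⟨?_, convex_Icc _ _ hr hr' (by linarith [t.2.2]) t.2.1 (by ring)⟩
  rw [Metric.mem_ball, Real.dist_eq] at h' ⊢
  have : (1 - (t : ℝ)) * r + t * r' - r = t * (r' - r) := by ring
  rw [this, abs_mul, abs_of_nonneg t.2.1]
  nlinarith [abs_nonneg (r' - r), t.2.2]

/-- A statement about classes of ways can be checked locally on paths and on transition maps. -/
lemma cut_induction (M : ℕ → ℝ → ∀ b : X.BasePoint, PiSet x b → Prop)
    (start : M 0 0 x (PiSet.one x))
    (path : ∀ k (hk : k ≤ P.n) r (hr : r ∈ P.piece k), ∀ᶠ r' in 𝓝[P.piece k] r,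
      ∀ (hr' : r' ∈ P.piece k) (α),
        M k r _ α ↔ M k r' _ (PiSet.mul α (PiSet.path (σ.seg hk hr hr'))))
    (arr : ∀ k < P.n, ∀ f : σ.c k (P.t (k + 1)) ⟶ σ.c (k + 1) (P.t (k + 1)),
      σ.g k = ofHom f → ∀ α, M k (P.t (k + 1)) _ α →
        M (k + 1) (P.t (k + 1)) _ (PiSet.mul α (PiSet.arr f)))
    {k : ℕ} (hk : k ≤ P.n) {r : ℝ} (hr : r ∈ P.piece k) : M k r _ (σ.cut hk hr).cls := by
  have transport : ∀ (N : ∀ b : X.BasePoint, PiSet x b → Prop) {b b' : X.BasePoint}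
      {α : PiSet x b} {α' : PiSet x b'}, (⟨b, α⟩ : (b : X.BasePoint) × PiSet x b) = ⟨b', α'⟩ →
      N b α → N b' α' := by
    rintro N b b' α α' ⟨⟩ h; exact h
  have h1 : ∀ k (hk : k ≤ P.n) r r' (hr : r ∈ P.piece k) (hr' : r' ∈ P.piece k),
      M k r _ (σ.cut hk hr).cls → M k r' _ (σ.cut hk hr').cls := by
    intro k hk r r' hr hr'
    have := isPreconnected_Icc (a := P.t k) (b := P.t (k + 1)) |>.induction₂
      (fun r r' => ∀ (hr : r ∈ P.piece k) (hr' : r' ∈ P.piece k),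
        M k r _ (σ.cut hk hr).cls ↔ M k r' _ (σ.cut hk hr').cls) (fun r hr => ?_)
      (fun a b c _ hb _ h h' ha hc => (h ha hb).trans (h' hb hc))
      (fun a b _ _ h hb ha => (h ha hb).symm) hr hr'
    · exact (this hr hr').1
    · filter_upwards [path k hk r hr] with r' h hr hr'
      rw [σ.cut_cls_path hk hr hr']
      exact h hr' _
  induction k generalizing r with
  | zero => exact h1 0 hk 0 r P.zero_mem hr (transport (M 0 0) σ.cut_cls_zero.symm start)
  | succ k ih =>
    obtain ⟨f, hf⟩ := σ.exists_hom_g hk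
    refine h1 (k + 1) hk (P.t (k + 1)) r (P.left_mem hk) hr ?_
    rw [σ.cut_cls_arr hk hf]
    grind

end WayOn

/-- A path in the disjoint union of the charts lies in one of them. -/
lemma exists_path_map {i : X.ι} {x : X.hat i} {b : X.BasePoint}
    (β : Path (⟨i, x⟩ : X.BasePoint) b) : ∃ (y : X.hat i) (h : b = ⟨i, y⟩) (γ : Path x y),
      h ▸ β = γ.map (continuous_sigmaMk (σ := X.hat)) := by
  obtain ⟨j, g, hg, e⟩ := β.continuous.exists_lift_sigma
  have e0 : (⟨j, g 0⟩ : X.BasePoint) = ⟨i, x⟩ := (congrFun e 0).symm.trans β.source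
  obtain rfl : j = i := congrArg Sigma.fst e0
  have e0' := eq_of_heq (Sigma.mk.inj e0).2
  obtain rfl : b = ⟨j, g 1⟩ := β.target.symm.trans (congrFun e 1)
  exact ⟨g 1, rfl, ⟨⟨g, hg⟩, e0', rfl⟩, Path.ext e⟩

namespace LocSys

variable {L : LocSys X}

lemma arr_path {b b' : X.BasePoint} (β : Path b b') {i : X.ι} {z : X.hat i} (f : b ⟶ ⟨i, z⟩)
    {A : Set (X.hat b.1)} (hA : A ⊆ (X.φ f.1).source) (hβ : ∀ t, β t ∈ Sigma.mk b.1 '' A) :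
    ∃ z' ∈ X.φ f.1 '' A, ∃ (g : b' ⟶ ⟨i, z'⟩) (γ : Path z z'),
      (ofHom g).trans = (ofHom f).trans ∧
      ∀ e, L.arr g (L.act (PiSet.path β) e) = L.trav γ (L.arr f e) := by
  obtain ⟨j, x⟩ := b
  obtain ⟨y, rfl, γ, hγ⟩ := exists_path_map β
  obtain rfl : β = γ.map continuous_sigmaMk := hγ
  have hs : ∀ t, γ t ∈ A := fun t => by aesop
  obtain ⟨γ', -, h⟩ := L.arr_trav f.1 γ (fun t => hA (hs t)) f (homMk f.1 y (hA (by simpa using hs 1))) rfl rfl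
  exact ⟨_, ⟨y, by simpa using hs 1, rfl⟩, _, γ', rfl, h⟩

/-- The base point of the base given by a base point of the covering. -/
def can (b : L.cover.BasePoint) : X.BasePoint := ⟨b.1.c.S.i, b.2.1⟩

/-- The element of the fibre that corresponds to a base point of the covering. -/
def sec (b : L.cover.BasePoint) : L.F (can b) := b.1.c.S.val b.2.1

lemma can_mk_injective (w : L.cover.ι) :
    Function.Injective fun x : L.cover.hat w => can (⟨w, x⟩ : L.cover.BasePoint) := fun _ _ h =>
  Subtype.ext (eq_of_heq (Sigma.mk.inj h).2)

lemma isEmbedding_can_mk (w : L.cover.ι) :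
    IsEmbedding fun x : L.cover.hat w => can (⟨w, x⟩ : L.cover.BasePoint) :=
  IsEmbedding.sigmaMk.comp IsEmbedding.subtypeVal

lemma continuous_can : Continuous (can (L := L)) :=
  continuous_sigma fun w => (isEmbedding_can_mk w).continuous

variable {b b' b'' : L.cover.BasePoint}

/-- The functor on transition maps. -/
def canHom (f : b ⟶ b') : can b ⟶ can b' :=
  ⟨fst f.1, mem_fst f.2.1, (φ_fst f.2.1).symm.trans (congrArg Subtype.val f.2.2)⟩

lemma canHom_comp (f : b ⟶ b') (g : b' ⟶ b'') : canHom (f ≫ g) = canHom f ≫ canHom g :=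
  Subtype.ext rfl

lemma arr_canHom (f : b ⟶ b') : L.arr (canHom f) (sec b) = sec b' := maps_fst f.1 (canHom f) rfl

lemma canHom_injective : Function.Injective (canHom : (b ⟶ b') → _) := fun f f' h =>
  Subtype.ext (tran_ext (congrArg Subtype.val h) f.2.1 f'.2.1)

lemma exists_lift_hom (f : can b ⟶ can b') (h : L.arr f (sec b) = sec b') :
    ∃ g : b ⟶ b', canHom g = f := by
  have hm : b.1.c.S.Maps b'.1.c.S f.1 := Sec.maps_of_hom f h
  have ht : X.φ f.1 b.2.1 ∈ b'.1.c.D := by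
    have : X.φ f.1 b.2.1 = b'.2.1 := f.2.2
    rw [this]; exact b'.2.2
  let a : Chart.Tr b.1.c b'.1.c := Chart.Tr.at' f.1 hm b.2.1 b.2.2 f.2.1 ht
  have ha : b.2.1 ∈ a.C := Chart.Tr.mem_at _ _ _ _ _ _
  refine ⟨⟨a, Chart.Tr.mem_source.2 ha, Subtype.ext ?_⟩, Subtype.ext rfl⟩
  exact (a.φ_coe ha).trans f.2.2

/-- The arrow of the base given by one of the covering. -/
def canArr (a : L.cover.Arrow) : X.Arrow := ⟨fst a.tr, a.pt.1, mem_fst a.mem⟩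

lemma canArr_ofHom (f : b ⟶ b') : canArr (ofHom f) = ofHom (canHom f) := rfl

lemma canArr_target (a : L.cover.Arrow) : (canArr a).target = can a.target :=
  congrArg (Sigma.mk _) (φ_fst a.mem).symm

/-- The transition map of the base given by one of the covering. -/
def canTrans (T : L.cover.Trans) : X.Trans := ⟨_, _, fst T.2.2⟩

lemma canArr_trans (a : L.cover.Arrow) : (canArr a).trans = canTrans a.trans := rfl

/-- The way in the base given by a way in the covering. -/
def _root_.Orbispace.WayOn.can {P : Part} (γ : WayOn P b b') : WayOn P (can b) (can b') where
  c k r := LocSys.can (γ.c k r)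
  c_cont k hk := continuous_can.comp_continuousOn (γ.c_cont k hk)
  g k := canArr (γ.g k)
  g_source k hk := congrArg LocSys.can (γ.g_source k hk)
  g_target k hk := (canArr_target _).trans (congrArg LocSys.can (γ.g_target k hk))
  start := congrArg LocSys.can γ.start
  finish := congrArg LocSys.can γ.finish

lemma act_path_sec (β : Path b b') :
    L.act (PiSet.path (β.map continuous_can)) (sec b) = sec b' := by
  obtain ⟨w, x⟩ := b
  obtain ⟨y, rfl, γ, hγ⟩ := exists_path_map β
  obtain rfl : β = γ.map continuous_sigmaMk := hγ
  exact w.c.S.par (γ.map continuous_subtype_val)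

lemma act_path_injective {c c' : X.BasePoint} (β : Path c c') :
    Function.Injective (L.act (PiSet.path β)) := fun e e' h => by
  have h2 := congrArg (L.act (PiSet.path β.symm)) h
  rwa [← L.act_mul, ← L.act_mul, PiSet.path_mul_symm, L.act_one, L.act_one] at h2

lemma sigma_act_iff {c c' : X.BasePoint} (β : Path c c') {e s : L.F c} {s' : L.F c'}
    (h : L.act (PiSet.path β) s = s') :
    (⟨c, e⟩ : (c : X.BasePoint) × L.F c) = ⟨c, s⟩ ↔
      (⟨c', L.act (PiSet.path β) e⟩ : (c : X.BasePoint) × L.F c) = ⟨c', s'⟩ := by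
  subst h
  refine ⟨fun h => ?_, fun h => ?_⟩
  · rw [eq_of_heq (Sigma.mk.inj h).2]
  · rw [act_path_injective β (eq_of_heq (Sigma.mk.inj h).2)]

/-- Parallel translation along a way whose pieces lift to the covering. -/
lemma act_cut_of_lift {P : Part} {x y : X.BasePoint} (τ : WayOn P x y)
    (c : ℕ → ℝ → L.cover.BasePoint) (hc : ∀ k ≤ P.n, ContinuousOn (c k) (P.piece k))
    (hτ : τ.c = fun k r => can (c k r)) {e₀ : L.F x}
    (h₀ : (⟨x, e₀⟩ : (b : X.BasePoint) × L.F b) = ⟨can (c 0 0), sec (c 0 0)⟩) (m : ℕ)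
    (hg : ∀ k < P.n, k < m → ∀ f : can (c k (P.t (k + 1))) ⟶ can (c (k + 1) (P.t (k + 1))),
      τ.g k = ofHom f → L.arr f (sec _) = sec _)
    {k : ℕ} (hk : k ≤ P.n) {r : ℝ} (hr : r ∈ P.piece k) (hkm : k ≤ m) :
    (⟨τ.c k r, L.act (τ.cut hk hr).cls e₀⟩ : (b : X.BasePoint) × L.F b) =
      ⟨can (c k r), sec (c k r)⟩ := by
  obtain ⟨τc, h1, τg, h2, h3, h4, h5⟩ := τ
  obtain rfl : τc = _ := hτ
  set τ : WayOn P x y := ⟨_, h1, τg, h2, h3, h4, h5⟩ with hτ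
  refine τ.cut_induction (fun k r b α => k ≤ m →
    (⟨b, L.act α e₀⟩ : (b : X.BasePoint) × L.F b) = ⟨can (c k r), sec (c k r)⟩)
    (fun _ => by rw [L.act_one]; exact h₀) (fun k hk r hr => ?_) (fun k hk f hf α h hkm => ?_) hk hr hkm
  · refine Eventually.of_forall fun r' hr' α => imp_congr_right fun _ => ?_
    rw [L.act_mul]
    let β : Path (c k r) (c k r') :=
      { toFun := fun s => c k ((1 - s) * r + s * r')
        continuous_toFun := (hc k hk).comp_continuous (by fun_prop) fun s =>
          convex_Icc _ _ hr hr' (by linarith [s.2.2]) s.2.1 (by ring)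
        source' := by simp
        target' := by simp }
    exact sigma_act_iff (τ.seg hk hr hr') (act_path_sec β)
  · rw [L.act_mul, eq_of_heq (Sigma.mk.inj (h (by omega))).2]
    exact congrArg (Sigma.mk _) (hg k hk (by omega) f hf)

/-- Parallel translation along a way of the covering. -/
lemma act_cut_can {P : Part} (γ : WayOn P b b') {k : ℕ} (hk : k ≤ P.n) {r : ℝ}
    (hr : r ∈ P.piece k) : L.act (γ.can.cut hk hr).cls (sec b) = sec (γ.c k r) := by
  refine eq_of_heq (Sigma.mk.inj (act_cut_of_lift γ.can γ.c γ.c_cont rfl (by rw [γ.start]) P.n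
    (fun k hk _ f hf => ?_) hk hr hk)).2
  obtain ⟨f', hf'⟩ := γ.exists_hom_g hk
  obtain rfl : f = canHom f' := ofHom_injective (hf.symm.trans (congrArg canArr hf'))
  exact arr_canHom f'

lemma act_cut_last {P : Part} {x y : X.BasePoint} (τ : WayOn P x y) (e₀ : L.F x) :
    (⟨τ.c P.n 1, L.act (τ.cut le_rfl P.one_mem).cls e₀⟩ : (b : X.BasePoint) × L.F b) =
      ⟨y, L.act τ.cls e₀⟩ := by
  have key : ∀ {c c' : X.BasePoint} {α : PiSet x c} {α' : PiSet x c'},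
      (⟨c, α⟩ : (c : X.BasePoint) × PiSet x c) = ⟨c', α'⟩ →
      (⟨c, L.act α e₀⟩ : (c : X.BasePoint) × L.F c) = ⟨c', L.act α' e₀⟩ := by
    rintro c c' α α' ⟨⟩; rfl
  exact key τ.cut_cls_last

lemma act_can {P : Part} (γ : WayOn P b b') : L.act γ.can.cls (sec b) = sec b' := by
  have h2 : (⟨can (γ.c P.n 1), sec (γ.c P.n 1)⟩ : (c : X.BasePoint) × L.F c) = ⟨can b', sec b'⟩ := by
    rw [γ.finish]
  exact eq_of_heq (Sigma.mk.inj ((act_cut_last γ.can (sec b)).symm.trans ((congrArg (Sigma.mk _)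
    (act_cut_can γ le_rfl P.one_mem)).trans h2))).2

lemma basePoint_ext (h : b.1 = b'.1) (h' : can b = can b') : b = b' := by
  obtain ⟨w, x⟩ := b
  obtain ⟨w', x'⟩ := b'
  obtain rfl : w = w' := h
  rw [can_mk_injective _ h']

end LocSys

lemma Part.exists_lebesgue (P : Part) {ι : Type*} (G : ℕ → ℝ → ι → Prop)
    (hG : ∀ k ≤ P.n, ∀ r ∈ P.piece k, ∃ i, ∀ᶠ r' in 𝓝[P.piece k] r, G k r' i) :
    ∀ᶠ ε in 𝓝[>] (0 : ℝ), ∀ k ≤ P.n, ∀ r ∈ P.piece k, ∃ i, ∀ r' ∈ P.piece k, |r' - r| < ε →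
      G k r' i := by
  refine (eventually_all_finite (finite_le_nat P.n)).2 fun k hk => ?_
  obtain ⟨δ, hδ, h⟩ := lebesgue_number_lemma_of_metric (s := P.piece k)
    (c := fun i => interior {r' | r' ∈ P.piece k → G k r' i}) isCompact_Icc
    (fun _ => isOpen_interior) fun r hr => by
      obtain ⟨i, hi⟩ := hG k hk r hr
      refine mem_iUnion.2 ⟨i, mem_interior_iff_mem_nhds.2 ?_⟩
      exact eventually_nhdsWithin_iff.1 hi
  filter_upwards [Ioo_mem_nhdsGT hδ] with ε hε r hr
  obtain ⟨i, hi⟩ := h r hr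
  refine ⟨i, fun r' hr' hd => interior_subset (hi ?_) hr'⟩
  rw [Metric.mem_ball, Real.dist_eq]
  exact hd.trans hε.2

namespace LocSys

variable {L : LocSys X} {P : Part} {x y : X.BasePoint}

/-- The parallel translates of an element of a fibre along a way. -/
def At (τ : WayOn P x y) (e₀ : L.F x) (k : ℕ) (r : ℝ) (e : L.F (τ.c k r)) : Prop :=
  ∃ (hk : k ≤ P.n) (hr : r ∈ P.piece k), L.act (τ.cut hk hr).cls e₀ = e

lemma At.unique {τ : WayOn P x y} {e₀ : L.F x} {k : ℕ} {r : ℝ} {e e' : L.F (τ.c k r)}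
    (h : At τ e₀ k r e) (h' : At τ e₀ k r e') : e = e' := by
  obtain ⟨_, _, rfl⟩ := h
  exact h'.2.2

lemma at_zero (τ : WayOn P x y) (e₀ : L.F x) {f : τ.c 0 0 ⟶ x} (hf : ofHom f = Arrow.id x)
    {e : L.F (τ.c 0 0)} (h : At τ e₀ 0 0 e) : L.arr f e = e₀ := by
  obtain ⟨hk, hr, rfl⟩ := h
  have key : ∀ (b : X.BasePoint) (α : PiSet x b) (f : b ⟶ x), ofHom f = Arrow.id x →
      (⟨b, α⟩ : (b : X.BasePoint) × PiSet x b) = ⟨x, PiSet.one x⟩ →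
      L.arr f (L.act α e₀) = e₀ := by
    rintro b α f hf ⟨⟩
    rw [← ofHom_id] at hf
    rw [ofHom_injective hf, arr_id, L.act_one]
  exact key _ _ f hf τ.cut_cls_zero

lemma at_one (τ : WayOn P x y) (e₀ : L.F x) {f : τ.c P.n 1 ⟶ y} (hf : ofHom f = Arrow.id y)
    {e : L.F (τ.c P.n 1)} (h : At τ e₀ P.n 1 e) : L.arr f e = L.act τ.cls e₀ := by
  obtain ⟨hk, hr, rfl⟩ := h
  have key : ∀ (b : X.BasePoint) (α : PiSet x b) (f : b ⟶ y), ofHom f = Arrow.id y →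
      (⟨b, α⟩ : (b : X.BasePoint) × PiSet x b) = ⟨y, τ.cls⟩ →
      L.arr f (L.act α e₀) = L.act τ.cls e₀ := by
    rintro b α f hf ⟨⟩
    rw [← ofHom_id] at hf
    rw [ofHom_injective hf, arr_id]
  exact key _ _ f hf τ.cut_cls_last

lemma at_step (τ : WayOn P x y) (e₀ : L.F x) {k m : ℕ} {r : ℝ} (hm : m ≤ P.n)
    (h : m = k ∨ m = k + 1 ∧ r = P.t (k + 1)) {s : τ.c k r ⟶ τ.c m r}
    (hs : τ.step k m r = ofHom s) {e : L.F (τ.c k r)} (he : At τ e₀ k r e) :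
    At τ e₀ m r (L.arr s e) := by
  rcases h with rfl | ⟨rfl, rfl⟩
  · rw [τ.step_self, ← ofHom_id] at hs
    rwa [← ofHom_injective hs, arr_id]
  · rw [τ.step_succ] at hs
    obtain ⟨hk, hr, rfl⟩ := he
    refine ⟨hm, P.left_mem hm, ?_⟩
    rw [τ.cut_cls_arr hm hs, L.act_mul]; rfl

/-- The transition map `T` carries the parallel translate at `r` into the chart `w`. -/
def Good (τ : WayOn P x y) (e₀ : L.F x) (k : ℕ) (r : ℝ) (w : L.cover.ι) (T : X.Trans)
    (z : L.cover.hat w) : Prop :=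
  ∃ e, At τ e₀ k r e ∧ ∃ f : τ.c k r ⟶ can (⟨w, z⟩ : L.cover.BasePoint),
    (ofHom f).trans = T ∧ L.arr f e = sec ⟨w, z⟩

lemma Good.eventually {τ : WayOn P x y} {e₀ : L.F x} {k : ℕ} {r : ℝ} {w : L.cover.ι}
    {T : X.Trans} {z : L.cover.hat w} (h : Good τ e₀ k r w T z) :
    ∀ᶠ r' in 𝓝[P.piece k] r, ∃ z, Good τ e₀ k r' w T z := by
  obtain ⟨_, ⟨hk, hr, rfl⟩, f, rfl, hf⟩ := h
  set A := (X.φ f.1).source ∩ X.φ f.1 ⁻¹' w.c.D with hA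
  have hAo : IsOpen A := (X.φ f.1).isOpen_inter_preimage w.c.isOpen
  have hO : Sigma.mk (τ.c k r).1 '' A ∈ 𝓝 (τ.c k r) := by
    refine (isOpenMap_sigmaMk _ hAo).mem_nhds ⟨(τ.c k r).2, ⟨f.2.1, ?_⟩, rfl⟩
    have h : X.φ f.1 (τ.c k r).2 = z.1 := f.2.2
    exact (congrArg (· ∈ w.c.D) h).mpr z.2
  filter_upwards [τ.eventually_seg hk hr hO, self_mem_nhdsWithin] with r' h hr'
  obtain ⟨z', ⟨y, hy, rfl⟩, g, γ, hg, hγ⟩ :=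
    L.arr_path (τ.seg hk hr hr') f inter_subset_left (h hr')
  refine ⟨⟨X.φ f.1 y, hy.2⟩, _, ⟨hk, hr', rfl⟩, g, hg, ?_⟩
  rw [τ.cut_cls_path hk hr hr', L.act_mul]
  refine (hγ (L.act (τ.cut hk hr).cls e₀)).trans ?_
  exact (congrArg (L.trav γ) hf).trans (w.c.S.par γ)

lemma exists_good (τ : WayOn P x y) (e₀ : L.F x) {k : ℕ} (hk : k ≤ P.n) {r : ℝ}
    (hr : r ∈ P.piece k) : ∃ w T z, Good τ e₀ k r w T z := by
  set e := L.act (τ.cut hk hr).cls e₀ with he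
  obtain ⟨_, ⟨w, rfl⟩, hw, -⟩ := L.base.isBasis.exists_subset_of_mem_open
    (mem_univ (L.pt e)) isOpen_univ
  change L.pt e ∈ w.1 at hw
  rw [← w.c_W] at hw
  obtain ⟨z, hz, h⟩ := hw
  obtain ⟨f, hf⟩ := pt_eq_iff.1 h.symm
  exact ⟨w, _, ⟨z, hz⟩, e, ⟨hk, hr, rfl⟩, f, rfl, hf⟩

lemma good_zero {b b' : L.cover.BasePoint} (τ : WayOn P (can b) (can b')) :
    Good τ (sec b) 0 0 b.1 (Arrow.id (can b)).trans b.2 := by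
  have key : ∀ c, c = can b → ∃ f : c ⟶ can b, ofHom f = Arrow.id (can b) := by
    rintro _ rfl; exact ⟨𝟙 _, rfl⟩
  obtain ⟨f, hf⟩ := key _ τ.start
  refine ⟨_, ⟨Nat.zero_le _, P.zero_mem, rfl⟩, f, congrArg Arrow.trans hf, ?_⟩
  exact at_zero τ _ hf ⟨Nat.zero_le _, P.zero_mem, rfl⟩

lemma good_one {b b' : L.cover.BasePoint} (τ : WayOn P (can b) (can b'))
    (h : L.act τ.cls (sec b) = sec b') :
    Good τ (sec b) P.n 1 b'.1 (Arrow.id (can b')).trans b'.2 := by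
  have key : ∀ c, c = can b' → ∃ f : c ⟶ can b', ofHom f = Arrow.id (can b') := by
    rintro _ rfl; exact ⟨𝟙 _, rfl⟩
  obtain ⟨f, hf⟩ := key _ τ.finish
  refine ⟨_, ⟨le_rfl, P.one_mem, rfl⟩, f, congrArg Arrow.trans hf, ?_⟩
  exact (at_one τ _ hf ⟨le_rfl, P.one_mem, rfl⟩).trans h

/-- Ways in the base lift to the covering. -/
lemma exists_lift {b b' : L.cover.BasePoint} (τ : WayOn P (can b) (can b'))
    (h : L.act τ.cls (sec b) = sec b') :
    ∃ (R : Part) (γ : WayOn R b b'), WayOn.Equiv γ.can τ := by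
  classical
  have h0 := (good_zero τ).eventually
  have h1 := (good_one τ h).eventually
  obtain ⟨ε₀, hε₀, h0⟩ := Metric.mem_nhdsWithin_iff.1 h0
  obtain ⟨ε₁, hε₁, h1⟩ := Metric.mem_nhdsWithin_iff.1 h1
  obtain ⟨ε, hG, hε', hε⟩ := ((P.exists_lebesgue
    (fun k r (d : L.cover.ι × X.Trans) => ∃ z, Good τ (sec b) k r d.1 d.2 z) fun k hk r hr => by
      obtain ⟨w, T, z, hz⟩ := exists_good τ (sec b) hk hr
      exact ⟨(w, T), hz.eventually⟩).and ((eventually_mem_set.2 (Ioo_mem_nhdsGT (lt_min hε₀ hε₁))).and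
        self_mem_nhdsWithin)).exists
  obtain ⟨R, θ, hR, mesh⟩ := P.exists_fine (mem_Ioi.1 hε)
  have hlt0 := hε'.2.trans_le (min_le_left _ _)
  have hlt1 := hε'.2.trans_le (min_le_right _ _)
  have data : ∀ k, ∃ d : L.cover.ι × X.Trans, k ≤ R.n →
      (k = 0 → d = (b.1, (Arrow.id (can b)).trans)) ∧
      (k = R.n → d = (b'.1, (Arrow.id (can b')).trans)) ∧
      ∀ r ∈ R.piece k, ∃ z, Good τ (sec b) (θ k) r d.1 d.2 z := by
    intro k
    by_cases hk : k ≤ R.n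
    swap; · exact ⟨(b.1, (Arrow.id (can b)).trans), fun h => absurd h hk⟩
    have hm := mesh k hk
    have hn := R.one_le
    by_cases hk0 : k = 0
    · subst hk0
      refine ⟨_, fun _ => ⟨fun _ => rfl, fun h => by omega, fun r hr => ?_⟩⟩
      have hr' := hR.sub 0 hk hr
      rw [hR.zero] at hr' ⊢
      refine h0 ⟨?_, hr'⟩
      have h2 := hr.1; have h3 := hr.2
      rw [R.t_zero] at h2 hm
      rw [Metric.mem_ball, Real.dist_eq, abs_lt]; constructor <;> linarith
    · by_cases hkn : k = R.n
      · subst hkn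
        refine ⟨_, fun _ => ⟨fun h => absurd h hk0, fun _ => rfl, fun r hr => ?_⟩⟩
        have hr' := hR.sub _ hk hr
        rw [hR.last] at hr' ⊢
        refine h1 ⟨?_, hr'⟩
        have h2 := hr.1; have h3 := hr.2
        rw [R.t_last] at h3 hm
        rw [Metric.mem_ball, Real.dist_eq, abs_lt]; constructor <;> linarith
      · obtain ⟨d, hd⟩ := hG (θ k) (hR.le k hk) _ (hR.sub k hk (R.left_mem hk))
        refine ⟨d, fun _ => ⟨fun h => absurd h hk0, fun h => absurd h hkn, fun r hr => ?_⟩⟩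
        refine hd r (hR.sub k hk hr) ?_
        rw [abs_lt]; constructor <;> linarith [hr.1, hr.2]
  choose d hd using data
  have hz : ∀ k r, ∃ z : L.cover.hat (d k).1, k ≤ R.n → r ∈ R.piece k →
      Good τ (sec b) (θ k) r (d k).1 (d k).2 z := by
    intro k r
    by_cases h : k ≤ R.n ∧ r ∈ R.piece k
    · grind
    · obtain ⟨z⟩ : Nonempty (L.cover.hat (d k).1) := inferInstance
      exact ⟨z, fun h1 h2 => absurd ⟨h1, h2⟩ h⟩
  choose z hz using hz
  have hf : ∀ k r, k ≤ R.n → r ∈ R.piece k → ∃ e, At τ (sec b) (θ k) r e ∧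
    ∃ f : τ.c (θ k) r ⟶ can (⟨(d k).1, z k r⟩ : L.cover.BasePoint),
      Arrow.of (d k).2 (τ.c (θ k) r) = ofHom f ∧ L.arr f e = sec ⟨(d k).1, z k r⟩ := by
    intro k r hk hr
    obtain ⟨e, he, f, hfT, hfe⟩ := hz k r hk hr
    exact ⟨e, he, f, Arrow.of_eq hfT rfl, hfe⟩
  set J : ℕ → ℝ → X.Arrow := fun k r => Arrow.of (d k).2 (τ.c (θ k) r) with hJ
  have Jflat : ∀ k ≤ R.n, ∀ r ∈ R.piece k, (J k r).trans = (d k).2 := by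
    intro k hk r hr
    obtain ⟨e, he, f, hfT, hfe⟩ := hz k r hk hr
    exact (congrArg Arrow.trans (Arrow.of_eq hfT rfl)).trans hfT
  have Jsource : ∀ k ≤ R.n, ∀ r ∈ R.piece k, (J k r).source = τ.c (θ k) r := by
    intro k hk r hr
    obtain ⟨-, -, f, h, -⟩ := hf k r hk hr
    exact (congrArg Arrow.source h).trans (ofHom_source f)
  have Jtarget : ∀ k ≤ R.n, ∀ r ∈ R.piece k, (J k r).target = can ⟨(d k).1, z k r⟩ := by
    intro k hk r hr
    obtain ⟨-, -, f, h, -⟩ := hf k r hk hr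
    exact (congrArg Arrow.target h).trans (ofHom_target f)
  have J0 : ∀ r ∈ R.piece 0, J 0 r = Arrow.id (τ.c (θ 0) r) := fun r hr => by
    refine Arrow.of_eq ?_ rfl
    rw [(hd 0 (Nat.zero_le _)).1 rfl]
    refine Arrow.id_trans_congr (Eq.trans ?_ (congrArg Sigma.fst τ.start))
    rw [hR.zero]
    exact τ.fst_eq (Nat.zero_le _) (by simpa [hR.zero] using hR.sub 0 (Nat.zero_le _) hr) P.zero_mem
  have J1 : ∀ r ∈ R.piece R.n, J R.n r = Arrow.id (τ.c (θ R.n) r) := fun r hr => by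
    refine Arrow.of_eq ?_ rfl
    rw [(hd R.n le_rfl).2.1 rfl]
    refine Arrow.id_trans_congr (Eq.trans ?_ (congrArg Sigma.fst τ.finish))
    rw [hR.last]
    exact τ.fst_eq le_rfl (by simpa [hR.last] using hR.sub _ le_rfl hr) P.one_mem
  have hg : ∀ k, ∃ a : L.cover.Arrow, k < R.n →
      a.source = ⟨(d k).1, z k (R.t (k + 1))⟩ ∧ a.target = ⟨(d (k + 1)).1, z (k + 1) (R.t (k + 1))⟩ ∧
      IsSq (τ.step (θ k) (θ (k + 1)) (R.t (k + 1))) (canArr a) (J k (R.t (k + 1)))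
        (J (k + 1) (R.t (k + 1))) := by
    intro k
    by_cases hk : k < R.n
    swap; · exact ⟨Arrow.id b, fun h => absurd h hk⟩
    obtain ⟨e, he, f, hf1, hf2⟩ := hf k _ hk.le (R.right_mem hk.le)
    obtain ⟨e', he', f', hf1', hf2'⟩ := hf (k + 1) _ hk (R.left_mem hk)
    obtain ⟨s, hs⟩ := exists_ofHom (τ.step_source hR hk) (τ.step_target hR hk)
    have hse : L.arr s e = e' := by
      refine (at_step τ _ (hR.le (k + 1) hk) ?_ hs he).unique he'
      rcases hR.step hk with h | h
      · exact Or.inl h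
      · exact Or.inr ⟨h, hR.t_eq hk h⟩
    obtain ⟨g, hg⟩ := exists_lift_hom (Groupoid.inv f ≫ s ≫ f') (by
      rw [arr_comp, arr_comp, (L.arr_inv_eq_iff f).2 hf2, hse, hf2'])
    refine ⟨ofHom g, fun _ => ⟨rfl, ofHom_target g, ?_⟩⟩
    change IsSq _ _ (Arrow.of _ _) (Arrow.of _ _)
    rw [canArr_ofHom, hg, hf1, hf1', hs, isSq_ofHom, Groupoid.inv_eq_inv]
    simp
  choose g hg using hg
  let γ : WayOn R b b' :=
    { c := fun k r => ⟨(d k).1, z k r⟩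
      c_cont := fun k hk => by
        refine (continuous_sigmaMk (σ := L.cover.hat)).comp_continuousOn
          ((isEmbedding_can_mk (d k).1).continuousOn_iff.2 ?_)
        refine (Arrow.continuousOn_target (Jflat k hk) ?_).congr fun r hr => (Jtarget k hk r hr).symm
        exact ((τ.c_cont _ (hR.le k hk)).mono (hR.sub k hk)).congr (Jsource k hk)
      g := g
      g_source := fun k hk => (hg k hk).1
      g_target := fun k hk => (hg k hk).2.1
      start := by
        refine basePoint_ext (by dsimp only; rw [(hd 0 (Nat.zero_le _)).1 rfl]) ?_
        rw [← Jtarget 0 (Nat.zero_le _) 0 R.zero_mem, J0 0 R.zero_mem, id_target, hR.zero,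
          τ.start]
      finish := by
        refine basePoint_ext (by dsimp only; rw [(hd R.n le_rfl).2.1 rfl]) ?_
        rw [← Jtarget R.n le_rfl 1 R.one_mem, J1 1 R.one_mem, id_target, hR.last,
          τ.finish] }
  refine ⟨R, γ, WayOn.Equiv.trans (WayOn.Equiv.symm ?_) (WayOn.equiv_sub τ hR)⟩
  exact WayOn.equiv_of_gauge (σ := τ.sub hR) (τ := γ.can) J (fun k hk => ⟨_, Jflat k hk⟩) Jsource
    Jtarget J0 J1 fun k hk => (hg k hk).2.2

end LocSys

lemma continuous_proj : Continuous fun b : X.BasePoint => X.proj b.1 b.2 :=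
  continuous_sigma fun i => X.proj_continuous i

lemma WayOn.proj_mem_connectedComponent {P : Part} {x y : X.BasePoint} (σ : WayOn P x y) :
    X.proj y.1 y.2 ∈ connectedComponent (X.proj x.1 x.2) := by
  have hK : ∀ k ≤ P.n, _root_.IsPreconnected ((fun r => X.proj (σ.c k r).1 (σ.c k r).2) '' P.piece k) :=
    fun k hk => isPreconnected_Icc.image _ (continuous_proj.comp_continuousOn (σ.c_cont k hk))
  have key : ∀ k ≤ P.n, ∀ r ∈ P.piece k, X.proj (σ.c k r).1 (σ.c k r).2 ∈
      connectedComponent (X.proj x.1 x.2) := by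
    intro k
    induction k with
    | zero =>
      intro hk r hr
      refine (hK 0 hk).subset_connectedComponent (x := X.proj x.1 x.2) ?_ (mem_image_of_mem _ hr)
      exact ⟨0, P.zero_mem, congrArg (fun b : X.BasePoint => X.proj b.1 b.2) σ.start⟩
    | succ k ih =>
      intro hk r hr
      obtain ⟨f, -⟩ := σ.exists_hom_g hk
      have h := ih (by omega) _ (P.right_mem (by omega))
      rw [Hom.proj_eq f] at h
      rw [connectedComponent_eq h]
      exact (hK _ hk).subset_connectedComponent (mem_image_of_mem _ (P.left_mem hk))
        (mem_image_of_mem _ hr)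
  have := key P.n le_rfl 1 P.one_mem
  rwa [σ.finish] at this

lemma exists_arrow_of_homs {K : Set ℝ} (hK : _root_.IsPreconnected K) {c c' : ℝ → X.BasePoint}
    (hc : ContinuousOn c K) (hc' : ContinuousOn c' K) (g : ∀ r ∈ K, Nonempty (c r ⟶ c' r))
    {r₀ r : ℝ} (h₀ : r₀ ∈ K) (hr : r ∈ K) (f : c r₀ ⟶ c' r₀) :
    ∃ a : X.Arrow, a.trans = (ofHom f).trans ∧ a.source = c r := by
  have h1 : ∀ r ∈ K, (c r).1 = (c r₀).1 := fun r hr => fst_eq_of_isPreconnected hK hc hr h₀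
  have h1' : ∀ r ∈ K, (c' r).1 = (c' r₀).1 := fun r hr => fst_eq_of_isPreconnected hK hc' hr h₀
  set A : Set (X.hat (c r₀).1) := {x | ∃ r ∈ K, c r = ⟨(c r₀).1, x⟩} with hA
  have hex : ∀ r ∈ K, ∃ x, c r = ⟨(c r₀).1, x⟩ := fun r hr =>
    ⟨h1 r hr ▸ (c r).2, by rw [Sigma.ext_iff]; exact ⟨h1 r hr, by simp⟩⟩
  have hAp : _root_.IsPreconnected A := by
    rw [← (IsEmbedding.sigmaMk (σ := X.hat)).isInducing.isPreconnected_image]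
    convert hK.image c hc using 1
    ext b
    constructor
    · grind
    · grind
  have hsub : A ⊆ X.proj (c r₀).1 ⁻¹' (X.U (c r₀).1 ∩ X.U (c' r₀).1) := by
    rintro x ⟨r, hr, e⟩
    obtain ⟨g⟩ := g r hr
    have h2 := Hom.proj_eq g
    have h3 : X.proj (c r).1 (c r).2 = X.proj (c r₀).1 x := by rw [e]
    refine ⟨proj_mem x, ?_⟩
    rw [← h3, h2, ← h1' r hr]
    exact proj_mem _
  obtain ⟨x, hx⟩ := hex r hr
  have hxs : x ∈ (X.φ f.1).source := by
    rw [X.source_eq f.1 _ f.2.1]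
    exact hAp.subset_connectedComponentIn ⟨r₀, h₀, rfl⟩ hsub ⟨r, hr, hx⟩
  exact ⟨⟨f.1, x, hxs⟩, rfl, hx.symm⟩

namespace LocSys

variable {L : LocSys X}

lemma arrow_ext {a a' : L.cover.Arrow} (hs : a.source = a'.source)
    (ht : a.target.1 = a'.target.1) (h : (canArr a).trans = (canArr a').trans) : a = a' := by
  obtain ⟨ξ, x, hx⟩ := a
  obtain ⟨ξ', x', hx'⟩ := a'
  obtain rfl := congrArg Sigma.fst hs
  obtain rfl : x = x' := eq_of_heq (Sigma.mk.inj hs).2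
  change _ = _ at ht
  dsimp only [Arrow.target] at ht
  subst ht
  obtain rfl := tran_ext (trans_mk_inj h) hx hx'
  rfl

lemma arr_sec_of_trans {b₁ b₁' b₂ b₂' : L.cover.BasePoint} (h : b₁.1 = b₂.1) (h' : b₁'.1 = b₂'.1)
    {f₁ : can b₁ ⟶ can b₁'} {f₂ : can b₂ ⟶ can b₂'}
    (hf : (ofHom f₁).trans = (ofHom f₂).trans) (h₁ : L.arr f₁ (sec b₁) = sec b₁') :
    L.arr f₂ (sec b₂) = sec b₂' := by
  obtain ⟨w, x₁⟩ := b₁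
  obtain ⟨w', x₁'⟩ := b₁'
  obtain ⟨_, x₂⟩ := b₂
  obtain ⟨_, x₂'⟩ := b₂'
  obtain rfl : w = _ := h
  obtain rfl : w' = _ := h'
  exact Sec.maps_of_hom (S := w.c.S) (S' := w'.c.S) f₁ h₁ f₂ (trans_mk_inj hf).symm

variable {P Q R : Part} {b b' : L.cover.BasePoint}

lemma can_step (γ : WayOn P b b') (k m : ℕ) (s : ℝ) :
    canArr (γ.step k m s) = γ.can.step k m s := by
  unfold WayOn.step
  split_ifs <;> rfl

lemma equiv_of_can_gauge {γ γ' : WayOn R b b'} (J : ℕ → ℝ → X.Arrow)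
    (flat : ∀ k ≤ R.n, ∃ T : X.Trans, ∀ s ∈ R.piece k, (J k s).trans = T)
    (source : ∀ k ≤ R.n, ∀ s ∈ R.piece k, (J k s).source = can (γ.c k s))
    (target : ∀ k ≤ R.n, ∀ s ∈ R.piece k, (J k s).target = can (γ'.c k s))
    (zero : ∀ s ∈ R.piece 0, J 0 s = Arrow.id (can (γ.c 0 s)))
    (last : ∀ s ∈ R.piece R.n, J R.n s = Arrow.id (can (γ.c R.n s)))
    (sq : ∀ k < R.n, IsSq (canArr (γ.g k)) (canArr (γ'.g k)) (J k (R.t (k + 1)))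
      (J (k + 1) (R.t (k + 1)))) : WayOn.Equiv γ γ' := by
  have hom : ∀ k ≤ R.n, ∀ r ∈ R.piece k, ∃ f : can (γ.c k r) ⟶ can (γ'.c k r),
      J k r = ofHom f := fun k hk r hr => exists_ofHom (source k hk r hr) (target k hk r hr)
  have spread : ∀ k (hk : k ≤ R.n) r (_ : r ∈ R.piece k) r' (_ : r' ∈ R.piece k),
      (∃ f : can (γ.c k r) ⟶ can (γ'.c k r), J k r = ofHom f ∧ L.arr f (sec _) = sec _) →
      ∃ f : can (γ.c k r') ⟶ can (γ'.c k r'), J k r' = ofHom f ∧ L.arr f (sec _) = sec _ := by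
    rintro k hk r hr r' hr' ⟨f, hf, h⟩
    obtain ⟨f', hf'⟩ := hom k hk r' hr'
    obtain ⟨T, hT⟩ := flat k hk
    refine ⟨f', hf', arr_sec_of_trans (γ.fst_eq hk hr hr') (γ'.fst_eq hk hr hr') ?_ h⟩
    rw [← hf, ← hf', hT r hr, hT r' hr']
  have good : ∀ k ≤ R.n, ∀ r ∈ R.piece k, ∃ f : can (γ.c k r) ⟶ can (γ'.c k r),
      J k r = ofHom f ∧ L.arr f (sec _) = sec _ := by
    intro k
    induction k with
    | zero =>
      intro hk r hr
      refine spread 0 hk 0 R.zero_mem r hr ?_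
      have key : ∀ c c' : L.cover.BasePoint, c = b → c' = b → ∃ f : can c ⟶ can c',
          Arrow.id (can c) = ofHom f ∧ L.arr f (sec c) = sec c' := by
        rintro _ _ rfl rfl
        exact ⟨𝟙 _, rfl, arr_id _ _⟩
      rw [zero 0 R.zero_mem]
      exact key _ _ γ.start γ'.start
    | succ k ih =>
      intro hk r hr
      refine spread (k + 1) hk _ (R.left_mem hk) r hr ?_
      obtain ⟨f, hf, h⟩ := ih (by omega) _ (R.right_mem (by omega))
      obtain ⟨f', hf'⟩ := hom (k + 1) hk _ (R.left_mem hk)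
      obtain ⟨s, hs⟩ := γ.exists_hom_g hk
      obtain ⟨s', hs'⟩ := γ'.exists_hom_g hk
      have := sq k hk
      rw [hs, hs', hf, hf', canArr_ofHom, canArr_ofHom, isSq_ofHom] at this
      refine ⟨f', hf', ?_⟩
      rw [← arr_canHom s, ← arr_comp, this, arr_comp, h, arr_canHom]
  have lift : ∀ k r, ∃ a : L.cover.Arrow, k ≤ R.n → r ∈ R.piece k →
      ∃ f : γ.c k r ⟶ γ'.c k r, a = ofHom f ∧ canArr a = J k r := by
    intro k r
    by_cases h : k ≤ R.n ∧ r ∈ R.piece k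
    · obtain ⟨f, hf, h'⟩ := good k h.1 r h.2
      obtain ⟨g, rfl⟩ := exists_lift_hom f h'
      exact ⟨_, fun _ _ => ⟨g, rfl, hf.symm⟩⟩
    · exact ⟨Arrow.id b, fun h1 h2 => absurd ⟨h1, h2⟩ h⟩
  choose J' hJ' using lift
  have ends : ∀ k (hk : k ≤ R.n), (∀ s ∈ R.piece k, (γ'.c k s).1 = (γ.c k s).1) →
      (∀ s ∈ R.piece k, J k s = Arrow.id (can (γ.c k s))) →
      ∀ s ∈ R.piece k, J' k s = Arrow.id (γ.c k s) := by
    intro k hk h1 h2 s hs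
    obtain ⟨f, hf, hc⟩ := hJ' k s hk hs
    refine arrow_ext (hf ▸ rfl) ?_ ?_
    · rw [hf, ofHom_target, id_target, h1 s hs]
    · rw [hc, h2 s hs]; rfl
  refine WayOn.equiv_of_gauge J' (fun k hk => ?_) (fun k hk r hr => ?_) (fun k hk r hr => ?_)
    (ends 0 (Nat.zero_le _) (fun s hs => ?_) zero) (ends R.n le_rfl (fun s hs => ?_) last)
    fun k hk => ?_
  · refine ⟨(J' k (R.t k)).trans, fun r hr => ?_⟩
    obtain ⟨f, hf, hc⟩ := hJ' k r hk hr
    obtain ⟨f₀, hf₀, hc₀⟩ := hJ' k _ hk (R.left_mem hk)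
    obtain ⟨T, hT⟩ := flat k hk
    obtain ⟨a, ha, ha'⟩ := exists_arrow_of_homs isPreconnected_Icc (γ.c_cont k hk) (γ'.c_cont k hk)
      (fun r hr => (hJ' k r hk hr).elim fun f _ => ⟨f⟩) (R.left_mem hk) hr f₀
    rw [hf₀, ← ha]
    refine congrArg Arrow.trans (arrow_ext ?_ ?_ ?_)
    · rw [hf, ha']; rfl
    · rw [hf, ofHom_target]
      exact (γ'.fst_eq hk hr (R.left_mem hk)).trans (congrArg (fun T => T.2.1) ha).symm
    · rw [hc, hT r hr, canArr_trans a, ha, ← hf₀, ← canArr_trans, hc₀, hT _ (R.left_mem hk)]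
  · obtain ⟨f, hf, -⟩ := hJ' k r hk hr
    rw [hf]; rfl
  · obtain ⟨f, hf, -⟩ := hJ' k r hk hr
    rw [hf, ofHom_target]
  · rw [γ.fst_eq (Nat.zero_le _) hs R.zero_mem, γ'.fst_eq (Nat.zero_le _) hs R.zero_mem, γ.start,
      γ'.start]
  · rw [γ.fst_eq le_rfl hs R.one_mem, γ'.fst_eq le_rfl hs R.one_mem, γ.finish, γ'.finish]
  · obtain ⟨f, hf, hc⟩ := hJ' k _ hk.le (R.right_mem hk.le)
    obtain ⟨f', hf', hc'⟩ := hJ' (k + 1) _ hk (R.left_mem hk)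
    obtain ⟨s, hs⟩ := γ.exists_hom_g hk
    obtain ⟨s', hs'⟩ := γ'.exists_hom_g hk
    have := sq k hk
    rw [← hc, ← hc', hs, hs', hf, hf', canArr_ofHom, canArr_ofHom, canArr_ofHom, canArr_ofHom,
      isSq_ofHom, ← canHom_comp, ← canHom_comp] at this
    rw [hs, hs', hf, hf', isSq_ofHom]
    exact canHom_injective this

lemma equiv_of_can {γ : WayOn P b b'} {γ' : WayOn Q b b'} (h : WayOn.Equiv γ.can γ'.can) :
    WayOn.Equiv γ γ' := by
  obtain ⟨R, θ, θ', J, G⟩ := h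
  refine (WayOn.equiv_sub γ G.left).symm.trans (WayOn.Equiv.trans ?_ (WayOn.equiv_sub γ' G.right))
  refine equiv_of_can_gauge J G.flat G.source G.target (fun s hs => ?_) (fun s hs => ?_)
    fun k hk => ?_
  · rw [G.zero s hs]
    change _ = Arrow.id (can (γ.c (θ 0) s))
    rw [G.left.zero]; rfl
  · rw [G.last s hs]
    change _ = Arrow.id (can (γ.c (θ R.n) s))
    rw [G.left.last]; rfl
  · have := G.sq k hk
    rwa [← can_step, ← can_step] at this

end LocSys

namespace LocSys

variable {L : LocSys X} {R : Part} {b b' : L.cover.BasePoint} {S : Type*} {l : Filter S}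

lemma tendsto_tran {w w' : L.cover.ι} {η : L.cover.Tran w w'} {η' : S → L.cover.Tran w w'}
    {x : S → L.cover.hat w} {x₀ : L.cover.hat w} (hx₀ : x₀ ∈ (L.cover.φ η).source)
    (hx : Tendsto x l (𝓝 x₀)) (hxs : ∀ᶠ s in l, x s ∈ (L.cover.φ (η' s)).source)
    (h : Tendsto (fun s => fst (η' s)) l (𝓝 (fst η))) : Tendsto η' l (𝓝 η) := by
  classical
  obtain ⟨v, hv, hv'⟩ := exists_bi_of_tendsto h
  have hy₀ : X.φ (fst η) x₀.1 ∈ w'.c.D := by rw [← φ_fst hx₀]; exact (L.cover.φ η x₀).2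
  have hD : ∀ᶠ s in l, v s • X.φ (fst η) x₀.1 ∈ w'.c.D := by
    have : Tendsto (fun s => v s • X.φ (fst η) x₀.1) l (𝓝 ((1 : X.G _) • X.φ (fst η) x₀.1)) :=
      hv.smul_const _
    rw [one_smul] at this
    exact this (w'.c.isOpen.mem_nhds hy₀)
  have hgrp : ∀ᶠ s in l, v s ∈ w'.c.grp := by
    filter_upwards [hv', hD] with s h1 h2
    refine Chart.mem_grp_of_mem ?_ hy₀ h2
    exact (maps_fst η).mem_stab_left (h1 ▸ maps_fst (η' s))
  let u : S → L.cover.G w' := fun s => if h : v s ∈ w'.c.grp then ⟨v s, h⟩ else 1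
  have hu : ∀ᶠ s in l, (u s).1 = v s := by grind
  have hu' : Tendsto u l (𝓝 1) :=
    (IsEmbedding.subtypeVal (p := (· ∈ w'.c.grp))).tendsto_nhds_iff.2
      (hv.congr' (hu.mono fun s h => h.symm))
  have h1 : Tendsto (fun s => L.cover.bi (u s) η 1) l (𝓝 (L.cover.bi 1 η 1)) :=
    ((continuous_bi_left η).tendsto 1).comp hu'
  rw [L.cover.bi_one] at h1
  refine h1.congr' ?_
  filter_upwards [hv', hu, hxs, hx ((L.cover.φ η).open_source.mem_nhds hx₀)] with s h1 h2 h3 h4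
  refine tran_ext (x := x s) ?_ ?_ h3
  · rw [h1, ← h2]; rfl
  · rw [L.cover.bi_source, one_smul]; exact h4

lemma exists_lift_near (γ₀ : WayOn R b b') {σ' : S → WayOn R (can b) (can b')}
    (hσ : WayOn.Lim l σ' γ₀.can)
    (hfix : ∀ᶠ s in l, ∀ k < R.n, k ≠ R.n - 1 → ((σ' s).g k).trans = (γ₀.can.g k).trans)
    (hact : ∀ᶠ s in l, L.act (σ' s).cls (sec b) = sec b') :
    ∃ γ' : S → WayOn R b b', (∀ᶠ s in l, WayOn.Equiv (γ' s).can (σ' s)) ∧ WayOn.Lim l γ' γ₀ := by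
  set w : ℕ → L.cover.ι := γ₀.ch with hw
  let m : ∀ k, L.cover.hat (w k) → X.BasePoint := fun k x => can ⟨w k, x⟩
  have hm : ∀ k, IsEmbedding (m k) := fun k => isEmbedding_can_mk (w k)
  have hmo : ∀ k, IsOpen (range (m k)) := fun k =>
    (IsOpenEmbedding.sigmaMk.comp (w k).c.isOpen.isOpenEmbedding_subtypeVal).isOpen_range
  let z : S → ∀ (k : ℕ), ℝ → L.cover.hat (w k) := fun s k r => Function.invFun (m k) ((σ' s).c k r)
  have h₀ : ∀ k ≤ R.n, ∀ r ∈ R.piece k, ∃ x, γ₀.c k r = ⟨w k, x⟩ := by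
    intro k hk r hr
    have gen : ∀ (c : L.cover.BasePoint) (i), c.1 = i → ∃ x, c = ⟨i, x⟩ := by grind
    exact gen _ _ (γ₀.fst_eq_ch hk hr)
  have hin : ∀ᶠ s in l, ∀ k ≤ R.n, ∀ r ∈ R.piece k, m k (z s k r) = (σ' s).c k r := by
    refine (eventually_all_finite (finite_le_nat R.n)).2 fun k hk => ?_
    filter_upwards [hσ.eventually_mem hk (K := R.piece k) isCompact_Icc Subset.rfl (hmo k)
      (fun r hr => by
        obtain ⟨x, hx⟩ := h₀ k hk r hr
        exact singleton_subset_iff.2 ⟨x, congrArg can hx.symm⟩)] with s hs r hr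
    exact Function.invFun_eq (hs hr)
  have key : ∀ᶠ s in l, ∃ γ : WayOn R b b', WayOn.Equiv γ.can (σ' s) ∧
      (∀ k r, γ.c k r = ⟨w k, z s k r⟩) ∧
      ∀ k < R.n, (canArr (γ.g k)).trans = ((σ' s).g k).trans := by
    filter_upwards [hin, hfix, hact] with s hin hfix hact
    have hc : ∀ k ≤ R.n, ContinuousOn (fun r => (⟨w k, z s k r⟩ : L.cover.BasePoint)) (R.piece k) := by
      intro k hk
      refine (continuous_sigmaMk (σ := L.cover.hat)).comp_continuousOn
        ((hm k).continuousOn_iff.2 ?_)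
      exact ((σ' s).c_cont k hk).congr fun r hr => hin k hk r hr
    have hstart : (⟨w 0, z s 0 0⟩ : L.cover.BasePoint) = b := by
      refine basePoint_ext ?_ ((hin 0 (Nat.zero_le _) 0 R.zero_mem).trans (σ' s).start)
      exact (γ₀.fst_eq_ch (Nat.zero_le _) R.zero_mem).symm.trans (by rw [γ₀.start])
    have hfinish : (⟨w R.n, z s R.n 1⟩ : L.cover.BasePoint) = b' := by
      refine basePoint_ext ?_ ((hin R.n le_rfl 1 R.one_mem).trans (σ' s).finish)
      exact (γ₀.fst_eq_ch le_rfl R.one_mem).symm.trans (by rw [γ₀.finish])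
    let κ : WayOn R (can b) (can b') :=
      { c := fun k r => can ⟨w k, z s k r⟩
        c_cont := fun k hk => continuous_can.comp_continuousOn (hc k hk)
        g := (σ' s).g
        g_source := fun k hk => ((σ' s).g_source k hk).trans
          (hin k hk.le _ (R.right_mem hk.le)).symm
        g_target := fun k hk => ((σ' s).g_target k hk).trans (hin (k + 1) hk _ (R.left_mem hk)).symm
        start := congrArg can hstart
        finish := congrArg can hfinish }
    have hκ : WayOn.Equiv κ (σ' s) := WayOn.equiv_of_eqOn hin fun _ _ => rfl
    have hfirst : ∀ k < R.n, k < R.n - 1 →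
        ∀ f : can (⟨w k, z s k (R.t (k + 1))⟩ : L.cover.BasePoint) ⟶
          can (⟨w (k + 1), z s (k + 1) (R.t (k + 1))⟩ : L.cover.BasePoint),
        κ.g k = ofHom f → L.arr f (sec _) = sec _ := by
      intro k hk hk' f hf
      obtain ⟨f₀, hf₀⟩ := γ₀.exists_hom_g hk
      refine arr_sec_of_trans (b₁ := γ₀.c k (R.t (k + 1))) (b₁' := γ₀.c (k + 1) (R.t (k + 1)))
        (b₂ := ⟨w k, z s k (R.t (k + 1))⟩) (b₂' := ⟨w (k + 1), z s (k + 1) (R.t (k + 1))⟩)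
        (γ₀.fst_eq_ch hk.le (R.right_mem hk.le))
        (γ₀.fst_eq_ch hk (R.left_mem hk)) (f₁ := canHom f₀) ?_ (arr_canHom f₀)
      rw [← canArr_ofHom, ← hf₀, ← hf]
      exact (hfix k hk (by omega)).symm
    have hlift := fun {k : ℕ} {r : ℝ} => act_cut_of_lift (k := k) (r := r) κ (fun k r => ⟨w k, z s k r⟩) hc rfl (e₀ := sec b)
      (by rw [hstart]) (R.n - 1) hfirst
    have hall : ∀ k < R.n, ∀ f : can (⟨w k, z s k (R.t (k + 1))⟩ : L.cover.BasePoint) ⟶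
          can (⟨w (k + 1), z s (k + 1) (R.t (k + 1))⟩ : L.cover.BasePoint),
        κ.g k = ofHom f → L.arr f (sec _) = sec _ := by
      intro k hk f hf
      by_cases hk' : k < R.n - 1
      · exact hfirst k hk hk' f hf
      obtain hkn : R.n = k + 1 := by omega
      have h1 := eq_of_heq (Sigma.mk.inj (hlift hk.le (R.right_mem hk.le) (by omega))).2
      have h1mem : (1 : ℝ) ∈ R.piece (k + 1) := hkn ▸ R.one_mem
      have h2 := κ.cut_cls_path (k := k + 1) hk (R.left_mem hk) h1mem
      rw [κ.cut_cls_arr hk hf] at h2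
      have h3 : (⟨κ.c (k + 1) 1, L.act (κ.cut (k := k + 1) hk h1mem).cls (sec b)⟩ :
          (b : X.BasePoint) × L.F b) =
          ⟨can ⟨w (k + 1), z s (k + 1) 1⟩, sec ⟨w (k + 1), z s (k + 1) 1⟩⟩ := by
        have gen : ∀ n (hn : n ≤ R.n) (h : (1 : ℝ) ∈ R.piece n), n = R.n →
            (⟨κ.c n 1, L.act (κ.cut hn h).cls (sec b)⟩ : (b : X.BasePoint) × L.F b) =
            ⟨can ⟨w n, z s n 1⟩, sec ⟨w n, z s n 1⟩⟩ := by
          rintro n hn h rfl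
          refine (act_cut_last κ (sec b)).trans ?_
          rw [hκ.cls_eq, hact, hfinish]
        exact gen _ _ _ hkn.symm
      replace h3 := eq_of_heq (Sigma.mk.inj h3).2
      rw [h2, L.act_mul, L.act_mul, h1] at h3
      let β : Path (⟨w (k + 1), z s (k + 1) (R.t (k + 1))⟩ : L.cover.BasePoint)
          ⟨w (k + 1), z s (k + 1) 1⟩ :=
        { toFun := fun t => ⟨w (k + 1), z s (k + 1) ((1 - t) * R.t (k + 1) + t * 1)⟩
          continuous_toFun := (hc (k + 1) hk).comp_continuous
            (f := fun t : unitInterval => (1 - (t : ℝ)) * R.t (k + 1) + t * 1) (by fun_prop)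
            fun t => convex_Icc _ _ (R.left_mem hk) h1mem (by linarith [t.2.2]) t.2.1 (by ring)
          source' := by simp
          target' := by simp }
      exact act_path_injective (β.map continuous_can) (h3.trans (act_path_sec β).symm)
    have hg : ∀ k, ∃ a : L.cover.Arrow, k < R.n → a.source = ⟨w k, z s k (R.t (k + 1))⟩ ∧
        a.target = ⟨w (k + 1), z s (k + 1) (R.t (k + 1))⟩ ∧ canArr a = (σ' s).g k := by
      intro k
      by_cases hk : k < R.n
      · obtain ⟨f, hf⟩ := κ.exists_hom_g hk
        obtain ⟨g, hg⟩ := exists_lift_hom f (hall k hk f hf)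
        refine ⟨ofHom g, fun _ => ⟨rfl, ofHom_target g, ?_⟩⟩
        rw [canArr_ofHom, hg]; exact hf.symm
      · exact ⟨Arrow.id b, fun h => absurd h hk⟩
    choose g hg using hg
    refine ⟨⟨fun k r => ⟨w k, z s k r⟩, hc, g, fun k hk => (hg k hk).1, fun k hk => (hg k hk).2.1,
      hstart, hfinish⟩, ?_, fun _ _ => rfl, fun k hk => congrArg Arrow.trans (hg k hk).2.2⟩
    exact WayOn.equiv_of_eqOn hin fun k hk => (hg k hk).2.2
  obtain ⟨γ', hγ'⟩ := exists_of_eventually (fun _ => γ₀) key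
  have hlim : ∀ k ≤ R.n, ∀ r ∈ R.piece k,
      Tendsto (fun p : S × ℝ => (γ' p.1).c k p.2) (l ×ˢ 𝓝[R.piece k] r) (𝓝 (γ₀.c k r)) := by
    intro k hk r hr
    obtain ⟨x, hx⟩ := h₀ k hk r hr
    have h1 : Tendsto (fun p : S × ℝ => z p.1 k p.2) (l ×ˢ 𝓝[R.piece k] r) (𝓝 x) := by
      rw [(hm k).tendsto_nhds_iff]
      have h2 := hσ.tendsto hk hr
      have h3 : γ₀.can.c k r = m k x := congrArg can hx
      rw [h3] at h2
      refine h2.congr' ?_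
      filter_upwards [(hin.prod_mk (self_mem_nhdsWithin (a := r) (s := R.piece k)))] with p hp
      exact (hp.1 k hk p.2 hp.2).symm
    rw [hx]
    refine ((continuous_sigmaMk (σ := L.cover.hat)).continuousAt.tendsto.comp h1).congr' ?_
    filter_upwards [hγ'.prod_mk (self_mem_nhdsWithin (a := r) (s := R.piece k))] with p hp
    exact (hp.1.2.1 k p.2).symm
  refine ⟨γ', hγ'.mono fun s h => h.1, WayOn.Lim.mk hlim fun k hk => ?_⟩
  obtain ⟨η, hη⟩ := γ₀.exists_trans hk
  have hη' : ∀ᶠ s in l, ∃ η' : L.cover.Tran (w k) (w (k + 1)), ((γ' s).g k).trans = ⟨_, _, η'⟩ ∧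
      z s k (R.t (k + 1)) ∈ (L.cover.φ η').source := by
    filter_upwards [hγ'] with s h
    obtain ⟨f, hf⟩ := (γ' s).exists_hom_g hk
    have gen : ∀ (c c' : L.cover.BasePoint) (x : L.cover.hat (w k)) (y : L.cover.hat (w (k + 1)))
        (f : c ⟶ c'), c = ⟨w k, x⟩ → c' = ⟨w (k + 1), y⟩ → ∃ η' : L.cover.Tran (w k) (w (k + 1)),
          (ofHom f).trans = ⟨_, _, η'⟩ ∧ x ∈ (L.cover.φ η').source := by
      rintro _ _ x y f rfl rfl
      exact ⟨f.1, rfl, f.2.1⟩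
    rw [hf]
    exact gen _ _ _ _ f (h.2.1 k _) (h.2.1 (k + 1) _)
  obtain ⟨η', hη'⟩ := exists_of_eventually (fun _ => η) hη'
  rw [hη]
  obtain ⟨x, hx⟩ := h₀ k hk.le _ (R.right_mem hk.le)
  have hxη : x ∈ (L.cover.φ η).source := by
    obtain ⟨a, ha⟩ : ∃ a : L.cover.Arrow, a = γ₀.g k := ⟨_, rfl⟩
    have h1 := γ₀.g_source k hk
    rw [← ha] at h1 hη
    rw [hx] at h1
    obtain ⟨y, hy, rfl⟩ := Arrow.exists_of_trans hη
    exact eq_of_heq (Sigma.mk.inj h1).2 ▸ hy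
  refine (tendsto_trans_mk (tendsto_tran (x := fun s => z s k (R.t (k + 1))) hxη ?_
    (hη'.mono fun s h => h.2) ?_)).congr' (hη'.mono fun s h => h.1.symm)
  · rw [(hm k).tendsto_nhds_iff]
    have h2 := hσ.tendsto_apply hk.le (R.right_mem hk.le)
    have h3 : γ₀.can.c k (R.t (k + 1)) = m k x := congrArg can hx
    rw [h3] at h2
    exact h2.congr' (hin.mono fun s h => (h k hk.le _ (R.right_mem hk.le)).symm)
  · have h1 := hσ.g k hk
    have h2 : (γ₀.can.g k).trans = ⟨_, _, fst η⟩ := congrArg canTrans hη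
    rw [h2] at h1
    obtain ⟨ζ, hζ, hζ'⟩ := exists_of_tendsto_trans h1
    refine hζ.congr' ?_
    filter_upwards [hζ', hη', hγ'] with s h3 h4 h5
    have h6 := h5.2.2 k hk
    rw [canArr_trans, h4.1, h3] at h6
    exact (trans_mk_inj h6).symm

/-- The covering is injective on classes of ways. -/
lemma cls_eq_of_can {P Q : Part} {γ : WayOn P b b'} {γ' : WayOn Q b b'}
    (h : γ.can.cls = γ'.can.cls) : γ.cls = γ'.cls := by
  obtain ⟨Γ⟩ := WayOn.cls_eq_iff.1 h
  have hΓ : ∀ t {R : Part} (τ : WayOn R (can b) (can b')), τ.q = Γ t →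
      L.act τ.cls (sec b) = sec b' := by
    intro t R τ hτ
    have h1 : γ.can.cls = τ.cls := by
      rw [WayOn.cls_eq_iff, hτ]
      exact ⟨(Γ.subpath 0 t).cast Γ.source.symm rfl⟩
    rw [← h1, act_can]
  have hlift : ∀ t, ∃ (R : Part) (δ : WayOn R b b'), δ.can.q = Γ t := by
    intro t
    obtain ⟨R, τ, hτ⟩ := WayOn.exists_q (Γ t)
    obtain ⟨R', δ, hδ⟩ := exists_lift τ (hΓ t τ hτ)
    exact ⟨R', δ, (WayOn.q_eq_iff.2 hδ).trans hτ⟩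
  choose R δ hδ using hlift
  have huniq : ∀ {P Q : Part} (α : WayOn P b b') (β : WayOn Q b b'), α.can.q = β.can.q →
      α.q = β.q := fun α β h => WayOn.q_eq_iff.2 (equiv_of_can (WayOn.q_eq_iff.1 h))
  refine WayOn.cls_eq_iff.2 ⟨⟨⟨fun t => (δ t).q, ?_⟩, huniq _ _ ?_, huniq _ _ ?_⟩⟩
  · refine continuous_iff_continuousAt.2 fun t N hN => ?_
    have hlim := (WayOn.lim_nhd (δ t).can).mono_filter
      (inf_le_left : WayOn.nhd (δ t).can ⊓ 𝓟 {τ | L.act τ.cls (sec b) = sec b'} ≤ _)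
    obtain ⟨τ', h1, h2, h3⟩ := hlim.exists_fix (k₀ := (R t).n - 1) (Nat.sub_lt (R t).one_le one_pos)
    obtain ⟨γ', h4, h5⟩ := exists_lift_near (δ t) h2 h3 (by
      filter_upwards [h1, mem_inf_of_right (mem_principal_self _)] with τ h1 h2
      rw [h1.cls_eq]
      exact h2)
    have h6 : ∀ᶠ τ in WayOn.nhd (δ t).can, L.act τ.cls (sec b) = sec b' →
        ∃ α : WayOn (R t) b b', WayOn.Equiv α.can τ ∧ α.q ∈ N := by
      refine eventually_inf_principal.1 ?_
      filter_upwards [h1, h4, h5.tendsto_q hN] with τ h1 h4 h5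
      exact ⟨γ' τ, h4.trans h1, h5⟩
    have h7 : {z | ∃ τ : WayOn (R t) (can b) (can b'), τ.q = z ∧
        (L.act τ.cls (sec b) = sec b' → ∃ α : WayOn (R t) b b', WayOn.Equiv α.can τ ∧ α.q ∈ N)} ∈
        𝓝 (Γ t) := by
      rw [← hδ, WayOn.nhds_q, mem_map]
      filter_upwards [h6] with τ hτ
      exact ⟨τ, rfl, hτ⟩
    rw [mem_map]
    filter_upwards [Γ.continuous.continuousAt h7] with s hs
    obtain ⟨τ, hτ, hs⟩ := hs
    obtain ⟨α, h8, h9⟩ := hs (hΓ s τ hτ)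
    rwa [mem_preimage, huniq (δ s) α ((hδ s).trans (hτ.symm.trans (WayOn.q_eq_iff.2 h8).symm))]
  · rw [hδ, Γ.source]
  · rw [hδ, Γ.target]

end LocSys

lemma Hom.comp_val_eq {i j k : X.ι} {x x' : X.hat i} {y y' : X.hat j} {z z' : X.hat k}
    {s : Set (X.hat i)} (hs : _root_.IsPreconnected s) (hx : x ∈ s) (hx' : x' ∈ s)
    (f : (⟨i, x⟩ : X.BasePoint) ⟶ ⟨j, y⟩) (g : (⟨j, y⟩ : X.BasePoint) ⟶ ⟨k, z⟩)
    (f' : (⟨i, x'⟩ : X.BasePoint) ⟶ ⟨j, y'⟩) (g' : (⟨j, y'⟩ : X.BasePoint) ⟶ ⟨k, z'⟩)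
    (hf : f.1 = f'.1) (hg : g.1 = g'.1)
    (hsub : ∀ w ∈ s, w ∈ (X.φ f.1).source ∧ X.φ f.1 w ∈ (X.φ g.1).source) :
    (f ≫ g).1 = (f' ≫ g').1 := by
  obtain ⟨ξ, h1, h2⟩ := f
  obtain ⟨η, h3, h4⟩ := g
  obtain ⟨_, h5, h6⟩ := f'
  obtain ⟨_, h7, h8⟩ := g'
  obtain rfl : ξ = _ := hf
  obtain rfl : η = _ := hg
  exact (X.comp_eq_of_isPreconnected η ξ hs hsub hx hx' _ _ _ _).symm

lemma Hom.inv_comp_val_eq {i j k : X.ι} {x x' : X.hat i} {y y' : X.hat j} {z z' : X.hat k}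
    {s : Set (X.hat i)} (hs : _root_.IsPreconnected s) (hx : x ∈ s) (hx' : x' ∈ s)
    (f : (⟨i, x⟩ : X.BasePoint) ⟶ ⟨j, y⟩) (g : (⟨i, x⟩ : X.BasePoint) ⟶ ⟨k, z⟩)
    (f' : (⟨i, x'⟩ : X.BasePoint) ⟶ ⟨j, y'⟩) (g' : (⟨i, x'⟩ : X.BasePoint) ⟶ ⟨k, z'⟩)
    (hf : f.1 = f'.1) (hg : g.1 = g'.1)
    (hsub : ∀ w ∈ s, w ∈ (X.φ f.1).source ∧ w ∈ (X.φ g.1).source) :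
    (Groupoid.inv f ≫ g).1 = (Groupoid.inv f' ≫ g').1 := by
  refine Hom.comp_val_eq (s := X.φ f.1 '' s) (hs.image _ ((X.φ f.1).continuousOn.mono
    fun w hw => (hsub w hw).1)) ⟨x, hx, f.2.2⟩ ⟨x', hx', ?_⟩ _ _ _ _ ?_ hg ?_
  · rw [hf]; exact f'.2.2
  · rw [Hom.inv_val, Hom.inv_val, hf]
  · rintro _ ⟨w, hw, rfl⟩
    rw [Hom.inv_val, φ_inv_φ (hsub w hw).1]
    exact ⟨φ_mem_inv (hsub w hw).1, (hsub w hw).2⟩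

namespace LocSys

variable {L : LocSys X}

variable (L) in
/-- The data that define a system from the covering to the base: basic open sets, and transition
maps that are defined on them. -/
structure Twist where
  Λ : Type u
  V : Λ → L.cover.ι
  W : Λ → X.ι
  κ : ∀ α, X.Tran (V α).c.S.i (W α)
  mem : ∀ α, ∀ x ∈ (V α).c.D, x ∈ (X.φ (κ α)).source
  cover : ∀ y : L.cover.carrier, ∃ α, y ∈ L.cover.U (V α)

namespace Twist

variable (T : L.Twist) {α β γ : T.Λ} {x : L.cover.hat (T.V α)} {y : L.cover.hat (T.V β)}
  {z : L.cover.hat (T.V γ)}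

/-- The local maps. -/
def f (α : T.Λ) (x : L.cover.hat (T.V α)) : X.hat (T.W α) := X.φ (T.κ α) x.1

/-- The transition map from the canonical chart. -/
def hom (α : T.Λ) (x : L.cover.hat (T.V α)) :
    can (⟨T.V α, x⟩ : L.cover.BasePoint) ⟶ (⟨T.W α, T.f α x⟩ : X.BasePoint) :=
  ⟨T.κ α, T.mem α _ x.2, rfl⟩

/-- The action on transition maps at a point. -/
def map (g : (⟨T.V α, x⟩ : L.cover.BasePoint) ⟶ ⟨T.V β, y⟩) :
    (⟨T.W α, T.f α x⟩ : X.BasePoint) ⟶ ⟨T.W β, T.f β y⟩ :=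
  Groupoid.inv (T.hom α x) ≫ canHom g ≫ T.hom β y

lemma hom_map (g : (⟨T.V α, x⟩ : L.cover.BasePoint) ⟶ ⟨T.V β, y⟩) :
    T.hom α x ≫ T.map g = canHom g ≫ T.hom β y := by
  rw [map, Groupoid.inv_eq_inv, IsIso.hom_inv_id_assoc]

lemma map_comp (g : (⟨T.V α, x⟩ : L.cover.BasePoint) ⟶ ⟨T.V β, y⟩)
    (g' : (⟨T.V β, y⟩ : L.cover.BasePoint) ⟶ ⟨T.V γ, z⟩) :
    T.map (g ≫ g') = T.map g ≫ T.map g' := by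
  rw [map, map, map, canHom_comp]
  simp only [assoc, Groupoid.inv_eq_inv, IsIso.hom_inv_id_assoc]

lemma map_val_eq {x' : L.cover.hat (T.V α)} {y' : L.cover.hat (T.V β)}
    (g : (⟨T.V α, x⟩ : L.cover.BasePoint) ⟶ ⟨T.V β, y⟩)
    (g' : (⟨T.V α, x'⟩ : L.cover.BasePoint) ⟶ ⟨T.V β, y'⟩) (h : g.1 = g'.1) :
    (T.map g).1 = (T.map g').1 := by
  have hs : _root_.IsPreconnected (Subtype.val '' (L.cover.φ g.1).source :
      Set (X.hat (T.V α).c.S.i)) :=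
    (isPreconnected_source (X := L.cover) g.1).image _ continuous_subtype_val.continuousOn
  have hx : x.1 ∈ (Subtype.val '' (L.cover.φ g.1).source : Set (X.hat (T.V α).c.S.i)) :=
    ⟨x, g.2.1, rfl⟩
  have hx' : x'.1 ∈ (Subtype.val '' (L.cover.φ g.1).source : Set (X.hat (T.V α).c.S.i)) :=
    ⟨x', h ▸ g'.2.1, rfl⟩
  have hκ : ∀ w ∈ (L.cover.φ g.1).source, X.φ (fst g.1) w.1 ∈ (X.φ (T.κ β)).source := by
    intro w hw
    rw [← φ_fst hw]
    exact T.mem β _ (L.cover.φ g.1 w).2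
  have hc : ∀ {x' y'} (g' : (⟨T.V α, x'⟩ : L.cover.BasePoint) ⟶ ⟨T.V β, y'⟩), g.1 = g'.1 →
      (canHom g ≫ T.hom β y).1 = (canHom g' ≫ T.hom β y').1 := by
    intro x' y' g' h
    refine Hom.comp_val_eq hs hx ⟨x', h ▸ g'.2.1, rfl⟩ (canHom g) (T.hom β y) (canHom g')
      (T.hom β y') (congrArg fst h) rfl ?_
    rintro _ ⟨w, hw, rfl⟩
    exact ⟨mem_fst hw, hκ w hw⟩
  refine Hom.inv_comp_val_eq hs hx hx' (T.hom α x) _ (T.hom α x') _ rfl (hc g' h) ?_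
  rintro _ ⟨w, hw, rfl⟩
  refine ⟨T.mem α _ w.2, ?_⟩
  rw [hc (homMk g.1 w hw) rfl]
  exact (canHom (homMk g.1 w hw) ≫ T.hom β _).2.1

/-- The action on transition maps. -/
def ρ (a : L.cover.Tran (T.V α) (T.V β)) : X.Tran (T.W α) (T.W β) :=
  (T.map (homMk a _ (L.cover.source_nonempty a).some_mem)).1

lemma ρ_eq (g : (⟨T.V α, x⟩ : L.cover.BasePoint) ⟶ ⟨T.V β, y⟩) : T.ρ g.1 = (T.map g).1 :=
  T.map_val_eq _ g rfl

lemma map_homG (k : L.cover.G (T.V α)) (x : L.cover.hat (T.V α)) :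
    (T.map (homG k x)).1 = X.ofG (T.W α) (lamExt (T.κ α) k.1) := by
  have hk : k.1 ∈ stabilizer (X.G _) (X.φ (T.κ α)).source :=
    mem_stabilizer_source _ (T.mem α _ x.2) (T.mem α _ (k • x).2)
  have h1 : (canHom (homG k x) ≫ T.hom α (k • x)).1 =
      (T.hom α x ≫ homG (lamExt (T.κ α) k.1) (T.f α x)).1 :=
    (comp_ofG _ _ _ _ _).trans ((bi_lamExt _ hk).trans (ofG_comp _ _ _ _ _).symm)
  have h2 : (⟨T.W α, T.f α (k • x)⟩ : X.BasePoint) =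
      ⟨T.W α, lamExt (T.κ α) k.1 • T.f α x⟩ := congrArg (Sigma.mk _) (φ_lamExt _ hk (T.mem α _ x.2))
  have gen : ∀ {a b c c' : X.BasePoint} (u : a ⟶ b) (v : a ⟶ c) (w : b ⟶ c'), c = c' → c.1 = b.1 →
      HEq v.1 (u ≫ w).1 → HEq (Groupoid.inv u ≫ v).1 w.1 := by
    rintro a b c _ u v w rfl - h
    obtain rfl : v = u ≫ w := Subtype.ext (eq_of_heq h)
    rw [Groupoid.inv_eq_inv, IsIso.inv_hom_id_assoc]
  exact eq_of_heq (gen (T.hom α x) _ (homG (lamExt (T.κ α) k.1) (T.f α x)) h2 rfl (heq_of_eq h1))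

lemma continuous_ρ (α β : T.Λ) :
    Continuous (T.ρ : L.cover.Tran (T.V α) (T.V β) → X.Tran (T.W α) (T.W β)) := by
  refine continuous_iff_continuousAt.2 fun a => ?_
  rw [ContinuousAt, nhds_tran, tendsto_map'_iff]
  obtain ⟨x, hx⟩ := L.cover.source_nonempty a
  have key : ∀ k : L.cover.G (T.V β), T.ρ (L.cover.bi k a 1) =
      X.bi (lamExt (T.κ β) k.1) (T.ρ a) 1 := by
    intro k
    have h1 := T.ρ_eq (homMk a x hx ≫ homG k _)
    rw [T.map_comp] at h1
    refine (congrArg T.ρ (ofG_comp k a x hx (mem_ofG _ _)).symm).trans (h1.trans ?_)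
    have h2 := ofG_comp (lamExt (T.κ β) k.1) (T.map (homMk a x hx)).1 _ (T.map (homMk a x hx)).2.1
      (mem_ofG _ _)
    refine Eq.trans ?_ (h2.trans (congrArg (fun ξ => X.bi _ ξ 1) (T.ρ_eq (homMk a x hx)).symm))
    rw [comp_val]
    exact comp_congr (T.map_homG _ _) rfl rfl _ _
  have h1 : Tendsto (fun k : L.cover.G (T.V β) => lamExt (T.κ β) k.1) (𝓝 1) (𝓝 1) :=
    (tendsto_lamExt _).comp (continuous_subtype_val.tendsto (1 : (T.V β).c.grp))
  have h2 := ((continuous_bi_left (T.ρ a)).tendsto 1).comp h1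
  rw [X.bi_one] at h2
  exact h2.congr fun k => (key k).symm

/-- The system given by the data. -/
def sys : Sys L.cover X where
  Λ := T.Λ
  V := T.V
  W := T.W
  cover := T.cover
  f := T.f
  f_cont α := (X.φ (T.κ α)).continuousOn.comp_continuous continuous_subtype_val
    fun x => T.mem α _ x.2
  ρ := T.ρ
  ρ_cont := T.continuous_ρ
  map_mem a x hx := by
    rw [show a = (homMk a x hx).1 from rfl, T.ρ_eq]
    exact (T.map (homMk a x hx)).2.1
  map_φ a x hx := by
    have := (T.map (homMk a x hx)).2.2
    rw [← T.ρ_eq] at this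
    exact this.symm
  map_comp b a x hx hy hx' hy' := by
    have h1 := T.ρ_eq (homMk a x hx ≫ homMk b _ hy)
    rw [T.map_comp] at h1
    exact h1.trans (comp_congr (T.ρ_eq (homMk b _ hy)).symm (T.ρ_eq (homMk a x hx)).symm rfl _ _)
  top := L.top
  top_cont := continuous_top
  top_proj α x := (X.proj_φ (T.κ α) x.1 (T.mem α _ x.2)).symm

end Twist

end LocSys

/-! ### Loops -/

namespace WayOn

variable {P : Part} {x y x' y' : X.BasePoint}

/-- A family of transition maps between two systems is a homotopy with moving ends. -/
lemma arr_mul_cls {σ : WayOn P x y} {δ : WayOn P x' y'} (J : ℕ → ℝ → X.Arrow)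
    (flat : ∀ k ≤ P.n, ∃ T, ∀ r ∈ P.piece k, (J k r).trans = T)
    (source : ∀ k ≤ P.n, ∀ r ∈ P.piece k, (J k r).source = σ.c k r)
    (target : ∀ k ≤ P.n, ∀ r ∈ P.piece k, (J k r).target = δ.c k r)
    (sq : ∀ k < P.n, IsSq (σ.g k) (δ.g k) (J k (P.t (k + 1))) (J (k + 1) (P.t (k + 1))))
    (j₀ : x ⟶ x') (j₁ : y ⟶ y') (h₀ : J 0 0 = ofHom j₀) (h₁ : J P.n 1 = ofHom j₁) :
    PiSet.mul (PiSet.arr j₀) δ.cls = PiSet.mul σ.cls (PiSet.arr j₁) := by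
  have key := σ.cls_induction (fun k r b α => ∀ (hk : k ≤ P.n) (hr : r ∈ P.piece k)
    (f : b ⟶ δ.c k r), J k r = ofHom f →
      PiSet.mul (PiSet.arr j₀) (δ.cut hk hr).cls = PiSet.mul α (PiSet.arr f)) ?_ ?_ ?_
  · have gen : ∀ {b} {β : PiSet x' b}, (⟨b, β⟩ : (b : X.BasePoint) × PiSet x' b) = ⟨y', δ.cls⟩ →
        (∀ f : y ⟶ b, J P.n 1 = ofHom f →
          PiSet.mul (PiSet.arr j₀) β = PiSet.mul σ.cls (PiSet.arr f)) →
        PiSet.mul (PiSet.arr j₀) δ.cls = PiSet.mul σ.cls (PiSet.arr j₁) := by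
      rintro b β ⟨⟩ h
      exact h j₁ h₁
    exact gen δ.cut_cls_last (key le_rfl P.one_mem)
  · have gen : ∀ {b} {β : PiSet x' b}, (⟨b, β⟩ : (b : X.BasePoint) × PiSet x' b) = ⟨x', PiSet.one x'⟩ →
        ∀ f : x ⟶ b, J 0 0 = ofHom f →
          PiSet.mul (PiSet.arr j₀) β = PiSet.mul (PiSet.one x) (PiSet.arr f) := by
      rintro b β ⟨⟩ f hf
      obtain rfl := ofHom_injective (h₀.symm.trans hf)
      rw [PiSet.mul_one, PiSet.one_mul]
    exact fun _ _ => gen δ.cut_cls_zero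
  · intro k hk r r' hr hr' α _ h _ _ f' hf'
    obtain ⟨f, hf⟩ := exists_ofHom (source k hk r hr) (target k hk r hr)
    obtain ⟨T, hT⟩ := flat k hk
    have hm : ∀ s : unitInterval, (1 - (s : ℝ)) * r + s * r' ∈ P.piece k := fun s =>
      convex_Icc _ _ hr hr' (by linarith [s.2.2]) s.2.1 (by ring)
    have h1 := PiSet.path_mul_arr (σ.seg hk hr hr') (δ.seg hk hr hr') f f'
      (fun s => J k ((1 - s) * r + s * r'))
      (continuous_const.congr fun s => (hT _ (hm s)).symm)
      (fun s => source k hk _ (hm s)) (fun s => target k hk _ (hm s)) (by simpa using hf)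
      (by simpa using hf')
    rw [δ.cut_cls_path hk hr hr', ← PiSet.mul_assoc, h hk hr f hf, PiSet.mul_assoc, ← h1,
      ← PiSet.mul_assoc]
  · intro k hk f hf α h hk' hr g hg
    obtain ⟨f', hf'⟩ := δ.exists_hom_g hk
    obtain ⟨g₀, hg₀⟩ := exists_ofHom (source k hk.le _ (P.right_mem hk.le))
      (target k hk.le _ (P.right_mem hk.le))
    have h1 := sq k hk
    rw [hf, hf', hg₀, hg, isSq_ofHom] at h1
    rw [δ.cut_cls_arr hk hf', ← PiSet.mul_assoc, h hk.le _ g₀ hg₀, PiSet.mul_assoc,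
      PiSet.mul_assoc, ← PiSet.arr_comp, ← PiSet.arr_comp, h1]

end WayOn

namespace LocSys

variable {L : LocSys X}

/-- A way in the covering can be mapped by the system. -/
lemma Twist.exists_push (T : L.Twist) {P : Part} {α₀ α₁ : T.Λ} {x₀ : L.cover.hat (T.V α₀)}
    {x₁ : L.cover.hat (T.V α₁)}
    (γ : WayOn P (⟨T.V α₀, x₀⟩ : L.cover.BasePoint) ⟨T.V α₁, x₁⟩) (α : ℕ → T.Λ)
    (h₀ : α 0 = α₀) (h₁ : α P.n = α₁)
    (hα : ∀ k ≤ P.n, ∀ r ∈ P.piece k, ∃ x, γ.c k r = ⟨T.V (α k), x⟩) :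
    ∃ δ : WayOn P (⟨T.W α₀, T.f α₀ x₀⟩ : X.BasePoint) ⟨T.W α₁, T.f α₁ x₁⟩,
      PiSet.mul (PiSet.arr (T.hom α₀ x₀)) δ.cls =
        PiSet.mul γ.can.cls (PiSet.arr (T.hom α₁ x₁)) ∧
      (∀ k ≤ P.n, ∀ r ∈ P.piece k, ∃ x : L.cover.hat (T.V (α k)),
        γ.c k r = ⟨T.V (α k), x⟩ ∧ δ.c k r = ⟨T.W (α k), T.f (α k) x⟩) ∧
      ∀ k < P.n, ∃ ξ : L.cover.Tran (T.V (α k)) (T.V (α (k + 1))),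
        (γ.g k).trans = ⟨_, _, ξ⟩ ∧ (δ.g k).trans = ⟨_, _, T.ρ ξ⟩ := by
  subst h₀ h₁
  have h : ∀ k r, ∃ x : L.cover.hat (T.V (α k)), k ≤ P.n → r ∈ P.piece k →
      γ.c k r = ⟨T.V (α k), x⟩ := by
    intro k r
    by_cases h : k ≤ P.n ∧ r ∈ P.piece k
    · grind
    · simp_all
  choose x hx using h
  have hc : ∀ k ≤ P.n, ContinuousOn (x k) (P.piece k) := fun k hk =>
    (IsEmbedding.sigmaMk (σ := L.cover.hat)).continuousOn_iff.2
      ((γ.c_cont k hk).congr fun r hr => (hx k r hk hr).symm)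
  have hg : ∀ k, ∃ a : X.Arrow, k < P.n →
      ∃ g : (⟨_, x k (P.t (k + 1))⟩ : L.cover.BasePoint) ⟶ ⟨_, x (k + 1) (P.t (k + 1))⟩,
        γ.g k = ofHom g ∧ a = ofHom (T.map g) := by
    intro k
    by_cases hk : k < P.n
    · obtain ⟨g, hg⟩ := exists_ofHom
        ((γ.g_source k hk).trans (hx k _ hk.le (P.right_mem hk.le)))
        ((γ.g_target k hk).trans (hx (k + 1) _ hk (P.left_mem hk)))
      exact ⟨_, fun _ => ⟨g, hg, rfl⟩⟩
    · exact ⟨Arrow.id ⟨_, T.f _ x₀⟩, fun h => absurd h hk⟩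
  choose g hg using hg
  let δ : WayOn P (⟨T.W (α 0), T.f (α 0) x₀⟩ : X.BasePoint) ⟨T.W (α P.n), T.f (α P.n) x₁⟩ :=
    { c := fun k r => ⟨T.W (α k), T.f (α k) (x k r)⟩
      c_cont := fun k hk => (continuous_sigmaMk.comp (T.sys.f_cont (α k))).comp_continuousOn (hc k hk)
      g := g
      g_source := fun k hk => by
        obtain ⟨g', -, h⟩ := hg k hk
        rw [h]; rfl
      g_target := fun k hk => by
        obtain ⟨g', -, h⟩ := hg k hk
        rw [h, ofHom_target]
      start := by
        have h := (hx 0 0 (Nat.zero_le _) P.zero_mem).symm.trans γ.start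
        rw [eq_of_heq (Sigma.mk.inj h).2]
      finish := by
        have h := (hx P.n 1 le_rfl P.one_mem).symm.trans γ.finish
        rw [eq_of_heq (Sigma.mk.inj h).2] }
  refine ⟨δ, ?_, fun k hk r hr => ⟨x k r, hx k r hk hr, rfl⟩, fun k hk => ?_⟩
  · have e0 := eq_of_heq (Sigma.mk.inj ((hx 0 0 (Nat.zero_le _) P.zero_mem).symm.trans γ.start)).2
    have e1 := eq_of_heq (Sigma.mk.inj ((hx P.n 1 le_rfl P.one_mem).symm.trans γ.finish)).2
    refine WayOn.arr_mul_cls (σ := γ.can) (δ := δ) (fun k r => ofHom (T.hom (α k) (x k r)))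
      (fun k hk => ⟨⟨_, _, T.κ (α k)⟩, fun r hr => rfl⟩)
      (fun k hk r hr => congrArg can (hx k r hk hr).symm) (fun k hk r hr => ofHom_target _)
      (fun k hk => ?_) _ _ (by rw [e0]) (by rw [e1])
    obtain ⟨g', h1, h2⟩ := hg k hk
    have h3 : γ.can.g k = ofHom (canHom g') := congrArg canArr h1
    have h4 : δ.g k = _ := h2
    rw [h3, h4]
    exact Arrow.isSq_ofHom.2 (T.hom_map g').symm
  · obtain ⟨g', h1, h2⟩ := hg k hk
    refine ⟨g'.1, congrArg Arrow.trans h1, (congrArg Arrow.trans h2).trans ?_⟩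
    rw [T.ρ_eq]; rfl

end LocSys

/-! ### Lifts of local systems along systems -/

namespace Sys

variable (σ κ : Sys Y X)

section Map

variable {σ} {α β γ : σ.Λ} {x : Y.hat (σ.V α)} {y : Y.hat (σ.V β)} {z : Y.hat (σ.V γ)}

/-- The action on transition maps at a point. -/
def map (g : (⟨σ.V α, x⟩ : Y.BasePoint) ⟶ ⟨σ.V β, y⟩) :
    (⟨σ.W α, σ.f α x⟩ : X.BasePoint) ⟶ ⟨σ.W β, σ.f β y⟩ :=
  ⟨σ.ρ g.1, σ.map_mem g.1 x g.2.1, (σ.map_φ g.1 x g.2.1).symm.trans (congrArg _ g.2.2)⟩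

lemma map_comp' (g : (⟨σ.V α, x⟩ : Y.BasePoint) ⟶ ⟨σ.V β, y⟩)
    (g' : (⟨σ.V β, y⟩ : Y.BasePoint) ⟶ ⟨σ.V γ, z⟩) : map (g ≫ g') = map g ≫ map g' :=
  Subtype.ext (σ.map_comp g'.1 g.1 x g.2.1 (g.2.2.symm ▸ g'.2.1) _ _)

lemma map_id' : map (𝟙 (⟨σ.V α, x⟩ : Y.BasePoint)) = 𝟙 _ := by
  have h : map (𝟙 (⟨σ.V α, x⟩ : Y.BasePoint)) = map (𝟙 _) ≫ map (𝟙 _) := by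
    rw [← map_comp', id_comp]
  rwa [← cancel_epi (map (𝟙 (⟨σ.V α, x⟩ : Y.BasePoint))), comp_id, eq_comm]

end Map

/-- A section of the inverse image of a local system along a system of maps. -/
structure Lift (L : LocSys X) where
  val : ∀ (α : σ.Λ) (y : Y.hat (σ.V α)), L.F ⟨σ.W α, σ.f α y⟩
  par : ∀ (α : σ.Λ) (y : Y.hat (σ.V α)), ∃ N ∈ 𝓝 y, ∀ (y₁ y₂) (γ : Path y₁ y₂),
    (∀ t, γ t ∈ N) → L.trav (γ.map (σ.f_cont α)) (val α y₁) = val α y₂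
  compat : ∀ {α β : σ.Λ} {x : Y.hat (σ.V α)} {y : Y.hat (σ.V β)}
    (g : (⟨σ.V α, x⟩ : Y.BasePoint) ⟶ ⟨σ.V β, y⟩), L.arr (map g) (val α x) = val β y

variable {σ κ} {L : LocSys X} {θ : κ.Λ → σ.Λ} {j : ∀ α, Y.Tran (κ.V α) (σ.V (θ α))}
  {j' : ∀ α, X.Tran (κ.W α) (σ.W (θ α))} (h : RefinesVia κ σ θ j j')

namespace RefinesVia

lemma mem (h : RefinesVia κ σ θ j j') (α : κ.Λ) (x : Y.hat (κ.V α)) : x ∈ (Y.φ (j α)).source :=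
  (h.2.2 α α (Y.one _) x (mem_one _ _)).choose_spec.1

/-- The inclusion of a chart of the refinement. -/
def u (α : κ.Λ) (x : Y.hat (κ.V α)) :
    (⟨κ.V α, x⟩ : Y.BasePoint) ⟶ ⟨σ.V (θ α), Y.φ (j α) x⟩ := ⟨j α, h.mem α x, rfl⟩

/-- The corresponding transition map of the target. -/
def u' (α : κ.Λ) (x : Y.hat (κ.V α)) :
    (⟨κ.W α, κ.f α x⟩ : X.BasePoint) ⟶ ⟨σ.W (θ α), σ.f (θ α) (Y.φ (j α) x)⟩ :=
  ⟨j' α, (h.2.1 α x).1, (h.2.1 α x).2⟩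

/-- The action on transition maps from a chart of the refinement to one of the system. -/
def mixed {α : κ.Λ} {β : σ.Λ} {x : Y.hat (κ.V α)} {y : Y.hat (σ.V β)}
    (c : (⟨κ.V α, x⟩ : Y.BasePoint) ⟶ ⟨σ.V β, y⟩) :
    (⟨κ.W α, κ.f α x⟩ : X.BasePoint) ⟶ ⟨σ.W β, σ.f β y⟩ :=
  h.u' α x ≫ map (Groupoid.inv (h.u α x) ≫ c)

variable {α α' : κ.Λ} {β β' : σ.Λ} {x : Y.hat (κ.V α)} {x' : Y.hat (κ.V α')} {y : Y.hat (σ.V β)}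
  {y' : Y.hat (σ.V β')}

lemma mixed_map (c : (⟨κ.V α, x⟩ : Y.BasePoint) ⟶ ⟨σ.V β, y⟩)
    (g : (⟨σ.V β, y⟩ : Y.BasePoint) ⟶ ⟨σ.V β', y'⟩) : h.mixed c ≫ map g = h.mixed (c ≫ g) := by
  rw [mixed, mixed, assoc, ← map_comp', assoc]

lemma mixed_u (α : κ.Λ) (x : Y.hat (κ.V α)) : h.mixed (h.u α x) = h.u' α x := by
  rw [mixed, Groupoid.inv_comp, map_id', comp_id]

lemma map_mixed (g : (⟨κ.V α, x⟩ : Y.BasePoint) ⟶ ⟨κ.V α', x'⟩)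
    (c : (⟨κ.V α', x'⟩ : Y.BasePoint) ⟶ ⟨σ.V β, y⟩) : map g ≫ h.mixed c = h.mixed (g ≫ c) := by
  obtain ⟨b, h₁, h₂, h₃, h₄, k₁, k₂, k₃, k₄, e, e'⟩ := h.2.2 α α' g.1 x g.2.1
  have hg : Y.φ g.1 x = x' := g.2.2
  have hb : Y.φ b (Y.φ (j α) x) = Y.φ (j α') x' := by
    rw [← Y.φ_comp b (j α) x h₁ h₂, ← hg, ← Y.φ_comp (j α') g.1 x h₃ h₄, e]
  let B : (⟨σ.V (θ α), Y.φ (j α) x⟩ : Y.BasePoint) ⟶ ⟨σ.V (θ α'), Y.φ (j α') x'⟩ := ⟨b, h₂, hb⟩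
  have e1 : h.u α x ≫ B = g ≫ h.u α' x' := Subtype.ext e
  have e2 : h.u' α x ≫ map B = map g ≫ h.u' α' x' := Subtype.ext e'
  have e3 : B = Groupoid.inv (h.u α x) ≫ g ≫ h.u α' x' := by simp_all
  rw [mixed, mixed, ← assoc, ← e2, assoc, ← map_comp', e3]
  simp only [assoc, Groupoid.inv_eq_inv, IsIso.hom_inv_id_assoc]

lemma mixed_trav {x x' : Y.hat (κ.V α)} {y y' : Y.hat (σ.V β)} (d : Path x x') (d' : Path y y')
    (c : (⟨κ.V α, x⟩ : Y.BasePoint) ⟶ ⟨σ.V β, y⟩) (c' : (⟨κ.V α, x'⟩ : Y.BasePoint) ⟶ ⟨σ.V β, y'⟩)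
    (hc : c.1 = c'.1) (hd : ∀ t, d t ∈ (Y.φ c.1).source) (hd' : ∀ t, d' t = Y.φ c.1 (d t))
    (e : L.F ⟨κ.W α, κ.f α x⟩) :
    L.arr (h.mixed c') (L.trav (d.map (κ.f_cont α)) e) =
      L.trav (d'.map (σ.f_cont β)) (L.arr (h.mixed c) e) := by
  have hs : _root_.IsPreconnected (range d) := isPreconnected_range d.continuous
  have hs' : _root_.IsPreconnected (κ.f α '' range d) := hs.image _ (κ.f_cont α).continuousOn
  have key : ∀ {w v} (b : (⟨κ.V α, w⟩ : Y.BasePoint) ⟶ ⟨σ.V β, v⟩), w ∈ range d → c.1 = b.1 →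
      (h.mixed c).1 = (h.mixed b).1 := by
    have h1 : ∀ {w v} (b : (⟨κ.V α, w⟩ : Y.BasePoint) ⟶ ⟨σ.V β, v⟩), w ∈ range d → c.1 = b.1 →
        (Groupoid.inv (h.u α x) ≫ c).1 = (Groupoid.inv (h.u α w) ≫ b).1 := fun b hw hb =>
      Hom.inv_comp_val_eq hs ⟨0, d.source⟩ hw _ _ _ _ rfl hb (by
        rintro _ ⟨t, rfl⟩
        exact ⟨h.mem α _, hd t⟩)
    intro w v b hw hb
    refine Hom.comp_val_eq hs' ⟨x, ⟨0, d.source⟩, rfl⟩ ⟨w, hw, rfl⟩ _ _ _ _ rfl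
      (congrArg σ.ρ (h1 b hw hb)) ?_
    rintro _ ⟨_, ⟨t, rfl⟩, rfl⟩
    have h2 := h1 (homMk c.1 (d t) (hd t)) ⟨t, rfl⟩ rfl
    refine ⟨(h.u' α (d t)).2.1, ?_⟩
    have h3 := (map (Groupoid.inv (h.u α (d t)) ≫ homMk c.1 (d t) (hd t))).2.1
    change _ ∈ (X.φ (σ.ρ _)).source at h3
    rw [← h2] at h3
    have h4 : X.φ (h.u' α x).1 (κ.f α (d t)) = σ.f (θ α) (Y.φ (j α) (d t)) := (h.u' α (d t)).2.2
    rw [h4]; exact h3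
  obtain ⟨γ', h1, h2⟩ := L.arr_trav (h.mixed c).1 (d.map (κ.f_cont α)) (fun t => by
    rw [key (homMk c.1 (d t) (hd t)) ⟨t, rfl⟩ rfl]
    exact (h.mixed (homMk c.1 (d t) (hd t))).2.1) (h.mixed c) (h.mixed c') rfl
    (key c' ⟨1, d.target⟩ hc).symm
  have h3 : γ' = d'.map (σ.f_cont β) := by
    ext t
    refine (h1 t).trans ?_
    have h4 := (h.mixed (homMk c.1 (d t) (hd t))).2.2
    rw [← key (homMk c.1 (d t) (hd t)) ⟨t, rfl⟩ rfl] at h4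
    exact h4.trans (congrArg _ (hd' t).symm)
  rw [h2, h3]

/-- A lift to a system can be restricted to a refinement. -/
lemma exists_lift_of_lift (ℓ : σ.Lift L) : ∃ ℓ' : κ.Lift L, ∀ (α : κ.Λ) (x : Y.hat (κ.V α)),
    L.arr (h.u' α x) (ℓ'.val α x) = ℓ.val (θ α) (Y.φ (j α) x) := by
  have hval : ∀ (α : κ.Λ) (x : Y.hat (κ.V α)), L.arr (h.u' α x)
      (L.arr (Groupoid.inv (h.u' α x)) (ℓ.val (θ α) (Y.φ (j α) x))) =
      ℓ.val (θ α) (Y.φ (j α) x) := fun α x => (L.arr_inv_eq_iff _).1 rfl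
  refine ⟨⟨fun α x => L.arr (Groupoid.inv (h.u' α x)) (ℓ.val (θ α) (Y.φ (j α) x)),
    fun α y => ?_, fun {α β x y} g => ?_⟩, hval⟩
  · obtain ⟨N, hN, hpar⟩ := ℓ.par (θ α) (Y.φ (j α) y)
    have hcont : Continuous (Y.φ (j α)) := continuousOn_univ.1
      ((Y.φ (j α)).continuousOn.mono fun x _ => h.mem α x)
    refine ⟨_, hcont.continuousAt hN, fun y₁ y₂ γ hγ => ?_⟩
    apply L.arr_injective (h.u' α y₂)
    have h1 := h.mixed_trav γ (γ.map hcont) (h.u α y₁) (h.u α y₂) rfl (fun t => h.mem α _)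
      (fun t => rfl) (L.arr (Groupoid.inv (h.u' α y₁)) (ℓ.val (θ α) (Y.φ (j α) y₁)))
    rw [h.mixed_u, h.mixed_u, hval, hpar _ _ (γ.map hcont) hγ] at h1
    rw [h1, hval]
  · have h1 : map g ≫ h.u' β y = h.u' α x ≫ map (Groupoid.inv (h.u α x) ≫ g ≫ h.u β y) := by
      rw [← h.mixed_u, ← h.mixed_u, h.map_mixed, h.mixed_map, Groupoid.inv_eq_inv,
        IsIso.hom_inv_id_assoc]
    apply L.arr_injective (h.u' β y)
    rw [← L.arr_comp (map g), h1, L.arr_comp, hval, hval, ℓ.compat]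

/-- A lift to a refinement can be extended to the system. -/
lemma exists_lift_of_lift' (ℓ : κ.Lift L) : ∃ ℓ' : σ.Lift L, ∀ (α : κ.Λ) (x : Y.hat (κ.V α)),
    L.arr (h.u' α x) (ℓ.val α x) = ℓ'.val (θ α) (Y.φ (j α) x) := by
  have hex : ∀ (β : σ.Λ) (y : Y.hat (σ.V β)), ∃ (α : κ.Λ) (x : Y.hat (κ.V α)),
      Nonempty ((⟨κ.V α, x⟩ : Y.BasePoint) ⟶ ⟨σ.V β, y⟩) := by
    intro β y
    obtain ⟨α, hα⟩ := κ.cover (Y.proj _ y)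
    obtain ⟨x, hx⟩ := exists_proj hα
    exact ⟨α, x, exists_hom hx⟩
  choose A x c using hex
  let val : ∀ (β : σ.Λ) (y : Y.hat (σ.V β)), L.F ⟨σ.W β, σ.f β y⟩ := fun β y =>
    L.arr (h.mixed (c β y).some) (ℓ.val (A β y) (x β y))
  have hval : ∀ {α : κ.Λ} {β : σ.Λ} {x : Y.hat (κ.V α)} {y : Y.hat (σ.V β)}
      (c : (⟨κ.V α, x⟩ : Y.BasePoint) ⟶ ⟨σ.V β, y⟩),
      L.arr (h.mixed c) (ℓ.val α x) = val β y := by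
    intro α β z y b
    have h1 : b = (b ≫ Groupoid.inv (c β y).some) ≫ (c β y).some := by simp
    rw [h1, ← h.map_mixed, L.arr_comp, ℓ.compat]
  refine ⟨⟨val, fun β y => ?_, fun {α β x y} g => ?_⟩, fun α x => ?_⟩
  · set b := (c β y).some
    obtain ⟨N, hN, hpar⟩ := ℓ.par (A β y) (x β y)
    have hby : Y.φ b.1 (x β y) = y := b.2.2
    have gen : ∀ {i j : Y.ι} {x : Y.hat i} {y : Y.hat j} (ξ : Y.Tran i j), x ∈ (Y.φ ξ).source →
        Y.φ ξ x = y → y ∈ (Y.φ ξ).target ∧ (Y.φ ξ).symm y = x := by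
      rintro i j x _ ξ hx rfl
      exact ⟨(Y.φ ξ).map_source hx, (Y.φ ξ).left_inv hx⟩
    obtain ⟨hyt, hy⟩ := gen b.1 b.2.1 hby
    have h1 : (Y.φ b.1).symm ⁻¹' N ∈ 𝓝 y := ((Y.φ b.1).continuousAt_symm hyt) (by rw [hy]; exact hN)
    refine ⟨_, inter_mem h1 ((Y.φ b.1).open_target.mem_nhds hyt), fun y₁ y₂ γ hγ => ?_⟩
    have hc : Continuous fun t => (Y.φ b.1).symm (γ t) :=
      (Y.φ b.1).continuousOn_symm.comp_continuous γ.continuous fun t => (hγ t).2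
    let d : Path ((Y.φ b.1).symm y₁) ((Y.φ b.1).symm y₂) := ⟨⟨_, hc⟩, by simp, by simp⟩
    have hs : ∀ t, d t ∈ (Y.φ b.1).source := fun t => (Y.φ b.1).map_target (hγ t).2
    have hr : ∀ t, Y.φ b.1 (d t) = γ t := fun t => (Y.φ b.1).right_inv (hγ t).2
    let c₁ : (⟨κ.V (A β y), (Y.φ b.1).symm y₁⟩ : Y.BasePoint) ⟶ ⟨σ.V β, y₁⟩ :=
      ⟨b.1, by simpa using hs 0, by simpa using hr 0⟩
    let c₂ : (⟨κ.V (A β y), (Y.φ b.1).symm y₂⟩ : Y.BasePoint) ⟶ ⟨σ.V β, y₂⟩ :=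
      ⟨b.1, by simpa using hs 1, by simpa using hr 1⟩
    have h2 := h.mixed_trav d γ c₁ c₂ rfl hs (fun t => (hr t).symm) (ℓ.val _ _)
    grind
  · change L.arr (map g) (L.arr (h.mixed _) (ℓ.val _ _)) = val β y
    rw [← L.arr_comp, h.mixed_map]
    exact hval _
  · rw [← h.mixed_u]; exact hval _

end RefinesVia

end Sys

lemma Hom.mk_eq_id {b b' : X.BasePoint} (f : b ⟶ b') {i : X.ι}
    (h : (⟨b.1, b'.1, f.1⟩ : X.Trans) = ⟨i, i, X.one i⟩) :
    (⟨b', f⟩ : (c : X.BasePoint) × (b ⟶ c)) = ⟨b, 𝟙 b⟩ := by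
  obtain ⟨k, x⟩ := b
  obtain ⟨l, y⟩ := b'
  obtain ⟨ξ, h1, h2⟩ := f
  obtain rfl : k = i := congrArg Sigma.fst h
  obtain rfl : l = k := congrArg (fun t : X.Trans => t.2.1) h
  obtain rfl : ξ = X.one l := trans_mk_inj h
  have : x = y := (X.φ_one _ _).symm.trans h2
  subst this
  rfl

lemma LocSys.arr_mk_eq {L : LocSys X} {b b' : X.BasePoint} (f : b ⟶ b') {i : X.ι}
    (h : (⟨b.1, b'.1, f.1⟩ : X.Trans) = ⟨i, i, X.one i⟩) (e : L.F b) :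
    (⟨b', L.arr f e⟩ : (c : X.BasePoint) × L.F c) = ⟨b, e⟩ := by
  have gen : ∀ {c} {f : b ⟶ c}, (⟨c, f⟩ : (c : X.BasePoint) × (b ⟶ c)) = ⟨b, 𝟙 b⟩ →
      (⟨c, L.arr f e⟩ : (c : X.BasePoint) × L.F c) = ⟨b, e⟩ := by
    rintro c f ⟨⟩
    rw [L.arr_id]
  exact gen (f.mk_eq_id h)

namespace BasedSys

variable {q : Y.BasePoint} {p : X.BasePoint} {σ κ : BasedSys Y q X p} {L : LocSys X} {e₀ : L.F p}

variable (e₀) in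
/-- A lift that has the value `e₀` at the base point. -/
def IsBase (ℓ : σ.toSys.Lift L) : Prop := ∀ x, (⟨σ.V σ.o, x⟩ : Y.BasePoint) = q →
  (⟨⟨σ.W σ.o, σ.f σ.o x⟩, ℓ.val σ.o x⟩ : (b : X.BasePoint) × L.F b) = ⟨p, e₀⟩

lemma Refines.exists_lift_iff (h : κ.Refines σ) :
    (∃ ℓ : κ.toSys.Lift L, IsBase e₀ ℓ) ↔ ∃ ℓ : σ.toSys.Lift L, IsBase e₀ ℓ := by
  obtain ⟨θ, j, j', h, hθ, ⟨i, hj⟩, i', hj'⟩ := h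
  have hx (x) : (⟨σ.V (θ κ.o), Y.φ (j κ.o) x⟩ : Y.BasePoint) = ⟨κ.V κ.o, x⟩ :=
    congrArg Sigma.fst ((h.u κ.o x).mk_eq_id hj)
  have hb (ℓ : σ.toSys.Lift L) : IsBase e₀ ℓ ↔ ∀ x, (⟨σ.V (θ κ.o), x⟩ : Y.BasePoint) = q →
      (⟨⟨σ.W (θ κ.o), σ.f _ x⟩, ℓ.val _ x⟩ : (b : X.BasePoint) × L.F b) = ⟨p, e₀⟩ := by
    rw [hθ]; rfl
  have key : ∀ (ℓ : κ.toSys.Lift L) (ℓ' : σ.toSys.Lift L), (∀ α x, L.arr (h.u' α x) (ℓ.val α x) =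
      ℓ'.val (θ α) (Y.φ (j α) x)) → (IsBase e₀ ℓ ↔ IsBase e₀ ℓ') := by
    intro ℓ ℓ' hℓ
    have h2 (x) : (⟨⟨σ.W (θ κ.o), σ.f _ (Y.φ (j κ.o) x)⟩, ℓ'.val _ (Y.φ (j κ.o) x)⟩ :
        (b : X.BasePoint) × L.F b) = ⟨⟨κ.W κ.o, κ.f κ.o x⟩, ℓ.val κ.o x⟩ := by
      rw [← hℓ]
      exact L.arr_mk_eq (h.u' κ.o x) hj' _
    rw [hb]
    refine ⟨fun H y hy => ?_, fun H x hxq => ?_⟩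
    · obtain ⟨x, hxq, -⟩ := κ.base
      obtain rfl := eq_of_heq (Sigma.mk.inj (hy.trans ((hx x).trans hxq).symm)).2
      rw [h2]; exact H x hxq
    · rw [← h2]; exact H _ ((hx x).trans hxq)
  constructor
  · rintro ⟨ℓ, hℓ⟩
    obtain ⟨ℓ', h'⟩ := h.exists_lift_of_lift' ℓ
    exact ⟨ℓ', (key _ _ h').1 hℓ⟩
  · rintro ⟨ℓ, hℓ⟩
    obtain ⟨ℓ', h'⟩ := h.exists_lift_of_lift ℓ
    exact ⟨ℓ', (key _ _ h').2 hℓ⟩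

lemma exists_lift_of_mk_eq (h : (Quot.mk _ σ : BasedMor Y q X p) = Quot.mk _ κ)
    (hℓ : ∃ ℓ : κ.toSys.Lift L, IsBase e₀ ℓ) : ∃ ℓ : σ.toSys.Lift L, IsBase e₀ ℓ := by
  have := congrArg (Quot.lift (fun σ : BasedSys Y q X p => ∃ ℓ : σ.toSys.Lift L, IsBase e₀ ℓ)
    fun σ κ ⟨υ, h1, h2⟩ => propext (h1.exists_lift_iff.symm.trans h2.exists_lift_iff)) h
  exact (eq_iff_iff.1 this).2 hℓ

/-- Parallel translation along the image of a way. -/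
lemma _root_.Orbispace.Sys.Lift.act_cls {σ : Sys Y X} (ℓ : σ.Lift L) {P : Part}
    {q q' : Y.BasePoint} {p p' : X.BasePoint} (γ : WayOn P q q') (δ : WayOn P p p') (α : ℕ → σ.Λ)
    (hc : ∀ k ≤ P.n, ∀ r ∈ P.piece k, ∃ x : Y.hat (σ.V (α k)),
      γ.c k r = ⟨σ.V (α k), x⟩ ∧ δ.c k r = ⟨σ.W (α k), σ.f (α k) x⟩)
    (hg : ∀ k < P.n, ∃ ξ : Y.Tran (σ.V (α k)) (σ.V (α (k + 1))),
      (γ.g k).trans = ⟨_, _, ξ⟩ ∧ (δ.g k).trans = ⟨_, _, σ.ρ ξ⟩) {e₀ : L.F p} {e₁ : L.F p'}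
    (h0 : ∀ x, q = ⟨σ.V (α 0), x⟩ →
      (⟨p, e₀⟩ : (b : X.BasePoint) × L.F b) = ⟨⟨σ.W (α 0), σ.f _ x⟩, ℓ.val _ x⟩)
    (h1 : ∀ x, q' = ⟨σ.V (α P.n), x⟩ →
      (⟨p', e₁⟩ : (b : X.BasePoint) × L.F b) = ⟨⟨σ.W (α P.n), σ.f _ x⟩, ℓ.val _ x⟩) :
    L.act δ.cls e₀ = e₁ := by
  have key := δ.cut_induction (fun k r b a => ∀ x : Y.hat (σ.V (α k)),
    γ.c k r = ⟨σ.V (α k), x⟩ →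
      (⟨b, L.act a e₀⟩ : (b : X.BasePoint) × L.F b) = ⟨⟨σ.W (α k), σ.f _ x⟩, ℓ.val _ x⟩)
    ?_ ?_ ?_ le_rfl P.one_mem
  · obtain ⟨x, hx, -⟩ := hc P.n le_rfl 1 P.one_mem
    have h3 := ((LocSys.act_cut_last δ e₀).symm.trans (key x hx)).trans
      (h1 x (γ.finish.symm.trans hx)).symm
    exact eq_of_heq (Sigma.mk.inj h3).2
  · intro x hx
    rw [L.act_one]
    exact h0 x (γ.start.symm.trans hx)
  · intro k hk r hr
    obtain ⟨x, hx, hδ⟩ := hc k hk r hr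
    obtain ⟨N, hN, hpar⟩ := ℓ.par (α k) x
    have hO : Sigma.mk (σ.V (α k)) '' N ∈ 𝓝 (γ.c k r) := by
      rw [hx]; exact IsOpenEmbedding.sigmaMk.isOpenMap.image_mem_nhds hN
    filter_upwards [γ.eventually_seg hk hr hO] with r' hr'' hr' a
    obtain ⟨x', hx', hδ'⟩ := hc k hk r' hr'
    have gen : ∀ {b b' : Y.BasePoint} {c c' : X.BasePoint} (d : Path b b') (β : Path c c'),
        b = ⟨σ.V (α k), x⟩ → b' = ⟨σ.V (α k), x'⟩ → c = ⟨σ.W (α k), σ.f _ x⟩ →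
        c' = ⟨σ.W (α k), σ.f _ x'⟩ → (∀ t, d t ∈ Sigma.mk (σ.V (α k)) '' N) →
        (∀ t, ∃ z, d t = ⟨σ.V (α k), z⟩ ∧ β t = ⟨σ.W (α k), σ.f _ z⟩) → ∀ e,
        ((⟨c, e⟩ : (b : X.BasePoint) × L.F b) = ⟨⟨σ.W (α k), σ.f _ x⟩, ℓ.val _ x⟩ ↔
        (⟨c', L.act (PiSet.path β) e⟩ : (b : X.BasePoint) × L.F b) =
          ⟨⟨σ.W (α k), σ.f _ x'⟩, ℓ.val _ x'⟩) := by
      rintro _ b' _ _ d β rfl h rfl rfl hd hβ e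
      obtain ⟨y, rfl, d', rfl : d = _⟩ := _root_.Orbispace.exists_path_map d
      obtain rfl := eq_of_heq (Sigma.mk.inj h).2
      have hβ' : β = (d'.map (σ.f_cont (α k))).map continuous_sigmaMk := by
        ext1
        funext t
        obtain ⟨z, hz, h⟩ := hβ t
        rw [h, ← eq_of_heq (Sigma.mk.inj hz).2]
        rfl
      refine LocSys.sigma_act_iff β ?_
      rw [hβ']
      refine hpar _ _ d' fun t => ?_
      obtain ⟨z, hz, h⟩ := hd t
      rwa [← eq_of_heq (Sigma.mk.inj h).2]
    have h2 := gen (γ.seg hk hr hr') (δ.seg hk hr hr') hx hx' hδ hδ' (hr'' hr')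
      (fun t => hc k hk _ (convex_Icc _ _ hr hr' (by linarith [t.2.2]) t.2.1 (by ring)))
      (L.act a e₀)
    rw [← L.act_mul] at h2
    grind
  · intro k hk f hf a H x' hx'
    obtain ⟨ξ, hξ, hξ'⟩ := hg k hk
    obtain ⟨x, hx, hδ⟩ := hc k hk.le _ (P.right_mem hk.le)
    obtain ⟨z, hz, hδ'⟩ := hc (k + 1) hk _ (P.left_mem hk)
    obtain rfl := eq_of_heq (Sigma.mk.inj (hz.symm.trans hx')).2
    obtain ⟨g, hg⟩ := exists_ofHom ((γ.g_source k hk).trans hx) ((γ.g_target k hk).trans hz)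
    have hg' : g.1 = ξ := trans_mk_inj ((congrArg Arrow.trans hg).symm.trans hξ)
    have gen : ∀ {c c' : X.BasePoint} (f : c ⟶ c') (e : L.F c), c = ⟨σ.W (α k), σ.f _ x⟩ →
        c' = ⟨σ.W (α (k + 1)), σ.f _ z⟩ → (ofHom f).trans = ⟨_, _, σ.ρ ξ⟩ →
        (⟨c, e⟩ : (b : X.BasePoint) × L.F b) = ⟨⟨σ.W (α k), σ.f _ x⟩, ℓ.val _ x⟩ →
        (⟨c', L.arr f e⟩ : (b : X.BasePoint) × L.F b) =
          ⟨⟨σ.W (α (k + 1)), σ.f _ z⟩, ℓ.val _ z⟩ := by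
      rintro _ _ f e rfl rfl hf h
      obtain rfl := eq_of_heq (Sigma.mk.inj h).2
      obtain rfl : f = Sys.map g := Subtype.ext ((trans_mk_inj hf).trans (congrArg σ.ρ hg'.symm))
      rw [ℓ.compat]
    rw [L.act_mul]
    exact gen f _ hδ hδ' (hf ▸ hξ') (H x hx)

/-- Parallel translation along the image of a loop. -/
lemma Push.act_cls {ℓ : σ.toSys.Lift L} (hℓ : IsBase e₀ ℓ) {γ : Y.Loop q} {δ : X.Loop p}
    (h : σ.Push γ δ) : L.act δ.way.cls e₀ = e₀ := by
  obtain ⟨hn, ht, α, h0, h1, hc, hg⟩ := h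
  obtain ⟨n, o, t, t1, t2, t3, c, c1, g, g1, g2, c2, c3⟩ := γ
  obtain rfl : n = δ.n := hn
  have ht' : ∀ k ≤ δ.n, t (k + 1) = δ.t (k + 1) := fun k hk => ht _ (Nat.succ_le_succ hk)
  have hp : ∀ k ≤ δ.n, Icc (t k) (t (k + 1)) = δ.part.piece k := by
    intro k hk
    change _ = Icc (δ.t k) (δ.t (k + 1))
    rw [← ht k (Nat.le_succ_of_le hk), ← ht' k hk]
  let γ' : WayOn δ.part q q := ⟨c, fun k hk => hp k hk ▸ c1 k hk, g,
    fun k hk => (g1 k hk).trans (congrArg _ (ht' k (le_of_lt hk))),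
    fun k hk => (g2 k hk).trans (congrArg _ (ht' k (le_of_lt hk))), c2, c3⟩
  have hbase : ∀ β, β = σ.o → ∀ x : Y.hat (σ.V β), q = ⟨σ.V β, x⟩ →
      (⟨p, e₀⟩ : (b : X.BasePoint) × L.F b) = ⟨⟨σ.W β, σ.f β x⟩, ℓ.val β x⟩ := by
    rintro _ rfl x hx
    exact (hℓ x hx.symm).symm
  exact ℓ.act_cls γ' δ.way α (fun k hk r hr => hc k hk r ((hp k hk).ge hr)) hg (hbase _ h0)
    (hbase _ h1)

end BasedSys

namespace Sys

/-- The system with a different family of indices. -/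
def reindex (σ : Sys Y X) {Λ : Type u} (θ : Λ → σ.Λ) (h : ∀ y, ∃ α, y ∈ Y.U (σ.V (θ α))) :
    Sys Y X where
  Λ := Λ
  V α := σ.V (θ α)
  W α := σ.W (θ α)
  cover := h
  f α := σ.f (θ α)
  f_cont α := σ.f_cont (θ α)
  ρ a := σ.ρ a
  ρ_cont α β := σ.ρ_cont (θ α) (θ β)
  map_mem a x hx := σ.map_mem a x hx
  map_φ a x hx := σ.map_φ a x hx
  map_comp b a x hx hy hx' hy' := σ.map_comp b a x hx hy hx' hy'
  top := σ.top
  top_cont := σ.top_cont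
  top_proj α x := σ.top_proj (θ α) x

lemma reindex_refines (σ : Sys Y X) {Λ : Type u} (θ : Λ → σ.Λ) (h) :
    (σ.reindex θ h).Refines σ := by
  refine ⟨θ, fun α => Y.one _, fun α => X.one _, fun α => Subset.rfl, fun α x => ?_,
    fun α β a x hx => ?_⟩
  · exact ⟨mem_one _ _, (X.φ_one _ _).trans (congrArg (σ.f (θ α)) (Y.φ_one _ x).symm)⟩
  · have h1 := σ.map_mem a x hx
    have gen : ∀ {A : Type u} {s : Set A} {x y : A}, y = x → x ∈ s → y ∈ s := fun h hx => h ▸ hx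
    exact ⟨a, mem_one _ _, gen (Y.φ_one _ x) hx, hx, mem_one _ _, mem_one _ _,
      gen (X.φ_one _ _) h1, h1, mem_one _ _, (comp_one _ _ _ _).trans (one_comp _ _ _ _).symm,
      (comp_one _ _ _ _).trans (one_comp _ _ _ _).symm⟩

lemma mk_reindex (σ : Sys Y X) {Λ : Type u} (θ : Λ → σ.Λ) (h) :
    (Quot.mk _ (σ.reindex θ h) : Mor Y X) = Quot.mk _ σ :=
  Quot.sound ⟨σ.reindex θ h, (σ.reindex θ h).reindex_refines id h, σ.reindex_refines θ h⟩

end Sys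

namespace LocSys

variable {L : LocSys X}

variable (L) in
/-- The local system is trivial on `hat i`. -/
def IsEven (i : X.ι) : Prop := ∀ (y : X.hat i) (γ : Path y y) (e : L.F ⟨i, y⟩), L.trav γ e = e

lemma exists_idx {i : X.ι} (hi : L.IsEven i) {y : L.Pt} (hy : L.top y ∈ X.U i) :
    ∃ w : L.Idx, w.c.D = univ ∧ w.c.S.i = i ∧ y ∈ w.1 ∧
      w.1 = connectedComponentIn (L.top ⁻¹' X.U i) y := by
  obtain ⟨b, e, rfl⟩ := exists_pt y
  obtain ⟨S, x, rfl, hS⟩ := Sec.exists_pt_eq_P e hy hi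
  let w : L.Idx := ⟨range S.P, Chart.univ S, Chart.univ_W S⟩
  have hw : w.c.D = univ := w.c_D ⟨Chart.univ S, Chart.univ_W S, rfl⟩
  have htop : ∀ S : L.Sec, L.top '' range S.P = X.U S.i := fun S => by
    rw [← X.range_proj, ← range_comp]; rfl
  refine ⟨w, hw, ?_, hS ▸ mem_range_self x, ?_⟩
  · apply X.U_injective
    rw [← htop, ← htop]
    congr 1
    have h1 := w.c_W
    rwa [Chart.W, hw, image_univ] at h1
  · have hr : range S.P ⊆ L.top ⁻¹' X.U S.i := by rw [← image_subset_iff, htop]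
    have hyr : L.pt e ∈ range S.P := hS ▸ mem_range_self x
    refine Subset.antisymm (IsPreconnected.subset_connectedComponentIn
      (isPreconnected_range S.continuous_P) hyr hr) ?_
    let O : Set L.Pt := ⋃ S' : {S' : L.Sec // S'.i = S.i ∧ Disjoint (range S.P) (range S'.P)},
      range S'.1.P
    refine isPreconnected_connectedComponentIn.subset_left_of_subset_union
      S.isOpenMap_P.isOpen_range (isOpen_iUnion fun S' => S'.1.isOpenMap_P.isOpen_range)
      (disjoint_iUnion_right.2 fun S' => S'.2.2) (v := O) (fun z hz => ?_)
      ⟨_, mem_connectedComponentIn (hr hyr), hyr⟩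
    have hz' := connectedComponentIn_subset _ _ hz
    obtain ⟨b', e', rfl⟩ := exists_pt z
    obtain ⟨S', x', hi', hS'⟩ := Sec.exists_pt_eq_P e' hz' hi
    rw [hS']
    by_cases hdis : Disjoint (range S.P) (range S'.P)
    · exact Or.inr (mem_iUnion.2 ⟨⟨S', hi', hdis⟩, mem_range_self x'⟩)
    · left
      obtain ⟨_, ⟨a, rfl⟩, a', ha'⟩ := not_disjoint_iff.1 hdis
      obtain ⟨f, hf⟩ := Sec.P_eq_iff.1 ha'
      have gen : ∀ {i j : X.ι} (ξ : X.Tran i j), i = j → ∀ x, x ∈ (X.φ ξ).source := by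
        rintro i _ ξ rfl x
        rw [source_self]; trivial
      exact ⟨_, hf.P_eq (gen f.1 hi' x')⟩

lemma connected_cover {p : X.BasePoint} (e₀ : L.F p)
    (h : ∀ {x} (e : L.F x), ∃ α : PiSet p x, L.act α e₀ = e) : L.cover.Connected := by
  have hp : ∀ c : L.Pt, ∃ b : L.cover.BasePoint, L.cover.proj b.1 b.2 = c := by
    intro c
    obtain ⟨_, ⟨w, rfl⟩, hw, -⟩ := L.cover.isBasis.exists_subset_of_mem_open (mem_univ c) isOpen_univ
    obtain ⟨x, hx⟩ := exists_proj hw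
    exact ⟨⟨w, x⟩, hx⟩
  change ConnectedSpace L.Pt
  refine connectedSpace_iff_connectedComponent.2 ⟨L.pt e₀, eq_univ_of_forall fun c => ?_⟩
  obtain ⟨b, hb⟩ := hp (L.pt e₀)
  obtain ⟨b', rfl⟩ := hp c
  obtain ⟨α, hα⟩ := h (sec b)
  obtain ⟨β, hβ⟩ := h (sec b')
  obtain ⟨α', h1, -⟩ := PiSet.exists_inv α
  obtain ⟨P, τ, hτ⟩ := PiSet.exists_cls (PiSet.mul α' β)
  obtain ⟨R, γ, -⟩ := exists_lift (b := b) (b' := b') τ (by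
    rw [hτ, ← hα, ← L.act_mul, ← PiSet.mul_assoc, h1, PiSet.one_mul, hβ])
  have := γ.proj_mem_connectedComponent
  rwa [hb] at this

/-- A path in the group of a chart acts on sections like its lift to the chart. -/
lemma Sec.mem_stab_of_joined {S : L.Sec} {g h : X.G S.i} (hgh : Joined g h) :
    g * h⁻¹ ∈ S.stab := by
  obtain ⟨c⟩ := hgh.symm
  obtain ⟨x⟩ : Nonempty (X.hat S.i) := inferInstance
  have hu : Continuous fun t => c t * h⁻¹ := by fun_prop
  let γ : Path x ((g * h⁻¹) • x) := ⟨⟨fun t => (c t * h⁻¹) • x, by fun_prop⟩, by simp, by simp⟩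
  refine mem_stab_of_arr (x := x) ?_
  rw [← S.par γ, arr, trav]
  have h1 := PiSet.path_mul_arr (Path.refl (⟨S.i, x⟩ : X.BasePoint))
    (γ.map (continuous_sigmaMk (σ := X.hat))) (𝟙 _) (homG (g * h⁻¹) x)
    (fun t => ofHom (homG (c t * h⁻¹) x)) ?_ (fun t => rfl)
    (fun t => ofHom_target _) ?_ ?_
  · rw [PiSet.arr_id, PiSet.one_mul] at h1
    rw [← h1]
    exact congrArg (fun α => L.act α _) (PiSet.one_mul _).symm
  · have h2 : Continuous fun t => X.ofG S.i (c t * h⁻¹) := (continuous_bi_left _).comp hu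
    exact (continuous_sigmaMk (σ := fun i => (j : X.ι) × X.Tran i j)).comp
      ((continuous_sigmaMk (σ := X.Tran S.i)).comp h2)
  · refine Arrow.ext_of_trans ?_ rfl
    change (⟨S.i, S.i, X.ofG S.i (c 0 * h⁻¹)⟩ : X.Trans) = ⟨S.i, S.i, X.one S.i⟩
    rw [c.source, mul_inv_cancel, ofG_one]
  · grind

/-- A basic open set around a point of the covering, with a transition map to a given chart. -/
lemma exists_base {p : X.BasePoint} (e₀ : L.F p) : ∃ (w : L.Idx) (ζ : X.Tran w.c.S.i p.1)
    (x : L.cover.hat w) (f : can (⟨w, x⟩ : L.cover.BasePoint) ⟶ p), f.1 = ζ ∧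
      L.arr f (sec ⟨w, x⟩) = e₀ ∧ ∀ z ∈ w.c.D, z ∈ (X.φ ζ).source := by
  obtain ⟨c, h1, h2⟩ := Chart.exists_chart ((isOpen_U p.1).preimage (continuous_top (L := L)))
    (q := L.pt e₀) (proj_mem p.2)
  let w : L.Idx := ⟨c.W, c, rfl⟩
  have hw : w.c.W = c.W := w.c_W
  obtain ⟨x, hx, hxe⟩ := hw.ge h1
  obtain ⟨f, hf⟩ := pt_eq_iff.1 hxe
  refine ⟨w, f.1, ⟨x, hx⟩, f, rfl, hf, fun z hz => ?_⟩
  rw [X.source_eq f.1 x f.2.1]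
  refine w.c.isConn.isPreconnected.subset_connectedComponentIn hx (fun z hz => ?_) hz
  exact ⟨X.range_proj _ ▸ mem_range_self z, h2 (hw.le ⟨z, hz, rfl⟩)⟩

/-- The index set, the basic open sets, and the transition maps of the system that defines the
covering morphism. -/
def twist {p : X.BasePoint} (w : L.Idx) (ζ : X.Tran w.c.S.i p.1)
    (h : ∀ z ∈ w.c.D, z ∈ (X.φ ζ).source) : L.Twist where
  Λ := Option L.Idx
  V o := o.elim w id
  W o := o.elim p.1 fun v => v.c.S.i
  κ | none => ζ
    | some v => X.one v.c.S.i
  mem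
    | none => h
    | some v => fun z _ => mem_one _ z
  cover y := by
    obtain ⟨_, ⟨v, rfl⟩, hv, -⟩ := L.cover.isBasis.exists_subset_of_mem_open (mem_univ y) isOpen_univ
    exact ⟨some v, hv⟩

end LocSys

lemma PiSet.mul_left_cancel {x y z : X.BasePoint} {α : PiSet x y} {β β' : PiSet y z}
    (h : PiSet.mul α β = PiSet.mul α β') : β = β' := by
  obtain ⟨α', -, h'⟩ := PiSet.exists_inv α
  have := congrArg (PiSet.mul α') h
  rwa [← PiSet.mul_assoc, ← PiSet.mul_assoc, h', PiSet.one_mul, PiSet.one_mul] at this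

namespace LocSys

variable {L : LocSys X}

lemma Twist.exists_lift (T : L.Twist) : ∃ ℓ : T.sys.Lift L, ∀ (α : T.Λ) (x : L.cover.hat (T.V α)),
    ℓ.val α x = L.arr (T.hom α x) (sec ⟨T.V α, x⟩) := by
  refine ⟨⟨fun α x => L.arr (T.hom α x) (sec ⟨T.V α, x⟩), fun α y => ⟨univ, univ_mem,
    fun y₁ y₂ γ _ => ?_⟩, fun {α β x y} g => ?_⟩, fun α x => rfl⟩
  · obtain ⟨γ', h1, h2⟩ := L.arr_trav (T.κ α) (γ.map continuous_subtype_val)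
      (fun t => T.mem α _ (γ t).2) (T.hom α y₁) (T.hom α y₂) rfl rfl
    have h3 : γ' = γ.map (T.sys.f_cont α) := by
      ext t
      exact h1 t
    rw [← h3]
    exact (h2 _).symm.trans (congrArg _ ((T.V α).c.S.par _))
  · have h1 : Sys.map (σ := T.sys) g = T.map g := Subtype.ext (T.ρ_eq g)
    rw [h1]
    refine (L.arr_comp _ _ _).symm.trans ?_
    exact (congrArg (fun k => L.arr k _) (T.hom_map g)).trans
      ((L.arr_comp _ _ _).trans (congrArg _ (arr_canHom g)))

lemma isHomeomorph_val {A B : Type*} [TopologicalSpace A] [TopologicalSpace B] {D : Set A}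
    (hD : D = univ) {f : D → A} (hf : ∀ x, f x = x) : IsHomeomorph f := by
  subst hD
  obtain rfl : f = Subtype.val := funext hf
  exact (Homeomorph.Set.univ A).isHomeomorph

/-- The morphism from the covering is a covering morphism. -/
lemma isCovering_twist {p : X.BasePoint} (w : L.Idx) (ζ : X.Tran w.c.S.i p.1)
    (h : ∀ z ∈ w.c.D, z ∈ (X.φ ζ).source) (hne : ∀ x, Nonempty (L.F x)) :
    Mor.IsCovering (Quot.mk _ (twist w ζ h).sys) := by
  set T := twist w ζ h
  let Λ := {v : L.Idx // v.c.D = univ ∧ L.IsEven v.c.S.i}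
  have hcov : ∀ y, ∃ α : Λ, y ∈ L.cover.U (T.sys.V (some α.1)) := by
    intro y
    obtain ⟨i, hi, heven⟩ := L.even (L.top y)
    obtain ⟨v, h1, h2, h3, -⟩ := exists_idx (L := L) heven hi
    exact ⟨⟨v, h1, h2.symm ▸ heven⟩, h3⟩
  have hρ : ∀ (v : L.Idx) (k : L.cover.G v),
      T.sys.ρ (α := some v) (β := some v) (L.cover.ofG v k) = X.ofG v.c.S.i k.1 := by
    intro v k
    obtain ⟨x⟩ := (L.cover.connHat v).toNonempty
    refine (T.ρ_eq (α := some v) (β := some v) (homG k x)).trans ?_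
    have h1 := congrArg Subtype.val (T.hom_map (α := some v) (β := some v) (homG k x))
    exact (comp_one _ _ _ _).symm.trans (h1.trans (one_comp _ _ _ _))
  refine ⟨T.sys.reindex (fun α : Λ => some α.1) hcov, Sys.mk_reindex _ _ _, ?_, ?_, ?_, ?_, ?_⟩
  · rintro ⟨v, h1, h2⟩ y hy
    obtain ⟨v', h3, h4, h5, h6⟩ := exists_idx (L := L) h2 hy
    exact ⟨⟨v', h3, h4.symm ▸ h2⟩, h6, h4⟩
  · rintro ⟨v, h1, h2⟩ k k' hk
    exact Subtype.ext (ofG_injective _ ((hρ v k).symm.trans (hk.trans (hρ v k'))))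
  · rintro ⟨v, h1, h2⟩ g k hgk
    have gen : ∀ {D : Set (X.hat v.c.S.i)} (a : X.G v.c.S.i), D = univ → a • D = D := by
      rintro _ a rfl
      exact smul_set_univ
    have h3 : g * k⁻¹ ∈ v.c.grp := ⟨Sec.mem_stab_of_joined (S := v.c.S) hgk, gen _ h1⟩
    exact ⟨⟨_, h3⟩, hρ v ⟨_, h3⟩⟩
  · rintro ⟨v, h1, h2⟩
    exact isHomeomorph_val (B := X.hat v.c.S.i) h1 fun x => X.φ_one _ _
  · intro c
    obtain ⟨_, ⟨i, rfl⟩, hi, -⟩ := X.isBasis.exists_subset_of_mem_open (mem_univ c) isOpen_univ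
    obtain ⟨x, hx⟩ := exists_proj hi
    obtain ⟨e⟩ := hne ⟨i, x⟩
    exact ⟨L.pt e, hx⟩

lemma exists_covering_of_twist {i : X.ι} {z : X.hat i} {e₀ : L.F ⟨i, z⟩} (w : L.Idx)
    (ζ : X.Tran w.c.S.i i) (h : ∀ z ∈ w.c.D, z ∈ (X.φ ζ).source) (x : L.cover.hat w)
    (hζ : x.1 ∈ (X.φ ζ).source) (hz : X.φ ζ x.1 = z)
    (hf : L.arr (⟨ζ, hζ, hz⟩ : can (⟨w, x⟩ : L.cover.BasePoint) ⟶ ⟨i, z⟩) (sec ⟨w, x⟩) = e₀)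
    (hne : ∀ x, Nonempty (L.F x)) :
    ∃ (q : L.cover.BasePoint) (m : BasedMor L.cover q X ⟨i, z⟩), m.toMor.IsCovering ∧
      m.imagePi1 = {a | ∃ δ : X.Loop ⟨i, z⟩, δ.cls = a ∧ L.act δ.way.cls e₀ = e₀} := by
  subst hz
  let T := twist (p := ⟨i, X.φ ζ x.1⟩) w ζ h
  let B : BasedSys L.cover ⟨w, x⟩ X ⟨i, X.φ ζ x.1⟩ := ⟨T.sys, none, x, rfl, rfl⟩
  refine ⟨⟨w, x⟩, Quot.mk _ B, isCovering_twist (p := ⟨i, X.φ ζ x.1⟩) w ζ h hne, Subset.antisymm ?_ ?_⟩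
  · rintro _ ⟨_, s, γ, δ, hs, hpush, -, rfl⟩
    refine ⟨δ, rfl, ?_⟩
    obtain ⟨ℓ, hℓ⟩ := T.exists_lift
    obtain ⟨ℓ', hℓ'⟩ := BasedSys.exists_lift_of_mk_eq (e₀ := e₀) hs ⟨ℓ, fun y hy => by
      obtain rfl : x = y := (eq_of_heq (Sigma.mk.inj hy).2).symm
      exact congrArg (Sigma.mk _) ((hℓ none x).trans hf)⟩
    exact hpush.act_cls hℓ'
  · rintro _ ⟨δ, rfl, hδ⟩
    let f : can (⟨w, x⟩ : L.cover.BasePoint) ⟶ (⟨i, X.φ ζ x.1⟩ : X.BasePoint) := ⟨ζ, hζ, rfl⟩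
    obtain ⟨P, τ, hτ⟩ := PiSet.exists_cls
      (PiSet.mul (PiSet.arr f) (PiSet.mul δ.way.cls (PiSet.arr (Groupoid.inv f))))
    obtain ⟨R, γ, hγ⟩ := LocSys.exists_lift (b := ⟨w, x⟩) (b' := ⟨w, x⟩) τ (by
      have h1 : L.act (PiSet.arr f) (sec ⟨w, x⟩) = e₀ := hf
      rw [hτ, L.act_mul, L.act_mul, h1, hδ]
      exact (L.arr_inv_eq_iff f).2 hf)
    let α : ℕ → T.Λ := fun k => if k = 0 ∨ k = R.n then none else some (γ.ch k)
    have hV : ∀ k ≤ R.n, T.V (α k) = γ.ch k := by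
      intro k hk
      by_cases hk' : k = 0 ∨ k = R.n
      · have h1 : α k = none := if_pos hk'
        rw [h1]
        rcases hk' with rfl | rfl
        · rw [← γ.fst_eq_ch hk R.zero_mem, γ.start]; rfl
        · rw [← γ.fst_eq_ch hk R.one_mem, γ.finish]; rfl
      · have h1 : α k = some (γ.ch k) := if_neg hk'
        rw [h1]; rfl
    obtain ⟨δ', h1, h2, h3⟩ := T.exists_push (α₀ := none) (α₁ := none) (x₀ := x) (x₁ := x) γ α
      (if_pos (Or.inl rfl)) (if_pos (Or.inr rfl)) fun k hk r hr => by
        have gen : ∀ (c : L.cover.BasePoint) (i), c.1 = i → ∃ x, c = ⟨i, x⟩ := by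
          rintro ⟨i, x⟩ _ rfl
          exact ⟨x, rfl⟩
        exact gen _ _ ((γ.fst_eq_ch hk hr).trans (hV k hk).symm)
    refine ⟨_, B, Loop.ofWay γ, Loop.ofWay δ', rfl, ⟨rfl, fun _ _ => rfl, α, if_pos (Or.inl rfl),
      if_pos (Or.inr rfl), h2, h3⟩, rfl, Loop.cls_eq_iff.2 ?_⟩
    change δ'.cls = δ.way.cls
    refine PiSet.mul_left_cancel (α := PiSet.arr f) (h1.trans ?_)
    have h4 : PiSet.mul (PiSet.mul (PiSet.arr f) (PiSet.mul δ.way.cls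
        (PiSet.arr (Groupoid.inv f)))) (PiSet.arr f) = PiSet.mul (PiSet.arr f) δ.way.cls := by
      rw [PiSet.mul_assoc, PiSet.mul_assoc, PiSet.inv_mul_arr, PiSet.mul_one]
    exact (congrArg (fun β => PiSet.mul β (PiSet.arr f)) (hγ.cls_eq.trans hτ)).trans h4

lemma exists_covering (L : LocSys X) {p : X.BasePoint} (e₀ : L.F p)
    (hne : ∀ x, Nonempty (L.F x)) : ∃ (q : L.cover.BasePoint) (m : BasedMor L.cover q X p),
      m.toMor.IsCovering ∧
      m.imagePi1 = {a | ∃ δ : X.Loop p, δ.cls = a ∧ L.act δ.way.cls e₀ = e₀} := by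
  obtain ⟨w, ζ, x, f, rfl, hf, h⟩ := exists_base e₀
  exact exists_covering_of_twist w f.1 h x f.2.1 f.2.2 hf hne

/-- If the classes of loops act freely, then the covering has trivial fundamental groups. -/
lemma cls_eq_const (h : ∀ {x} (e : L.F x) (α : PiSet x x), L.act α e = e → α = PiSet.one x)
    {q : L.cover.BasePoint} (γ : L.cover.Loop q) : γ.cls = (Loop.const q).cls := by
  refine Loop.cls_eq_iff.2 (cls_eq_of_can ?_)
  rw [h _ _ (act_can γ.way), h _ _ (act_can (Loop.const q).way)]

end LocSys

/-! ### The local system of a subgroup -/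

lemma nonempty_piSet (hconn : X.Connected) (hloc : X.LocallyStronglyPathConnected)
    (p x : X.BasePoint) : Nonempty (PiSet p x) := by
  have : ConnectedSpace X.carrier := hconn
  let A : Set X.carrier := {c | ∃ b : X.BasePoint, X.proj b.1 b.2 = c ∧ Nonempty (PiSet p b)}
  have hA : ∀ {b b' : X.BasePoint} (i), X.proj b.1 b.2 ∈ X.U i → X.proj b'.1 b'.2 ∈ X.U i →
      Nonempty (PiSet p b) → Nonempty (PiSet p b') := by
    rintro b b' i hb hb' ⟨α⟩
    obtain ⟨y, hy⟩ := exists_proj hb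
    obtain ⟨y', hy'⟩ := exists_proj hb'
    obtain ⟨f⟩ := exists_hom (b := b) (b' := ⟨i, y⟩) hy.symm
    obtain ⟨f'⟩ := exists_hom (b := ⟨i, y'⟩) (b' := b') hy'
    have := hloc i
    have : PathConnectedSpace (X.hat i) := pathConnectedSpace_iff_connectedSpace.2 inferInstance
    exact ⟨PiSet.mul (PiSet.mul α (PiSet.arr f)) (PiSet.mul (PiSet.path
      ((PathConnectedSpace.somePath y y').map (continuous_sigmaMk (σ := X.hat)))) (PiSet.arr f'))⟩
  have hU : ∀ c, ∃ i, c ∈ X.U i := fun c => by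
    obtain ⟨i, hi, -⟩ := exists_U_subset isOpen_univ (mem_univ c)
    exact ⟨i, hi⟩
  have hclopen : IsClopen A := by
    constructor
    · refine isOpen_compl_iff.1 (isOpen_iff_mem_nhds.2 fun c hc => ?_)
      obtain ⟨i, hi⟩ := hU c
      refine mem_of_superset ((isOpen_U i).mem_nhds hi) ?_
      rintro _ hc' ⟨b, rfl, hb⟩
      obtain ⟨y, rfl⟩ := exists_proj hi
      exact hc ⟨⟨i, y⟩, rfl, hA i hc' hi hb⟩
    · refine isOpen_iff_mem_nhds.2 fun c hc => ?_
      obtain ⟨i, hi⟩ := hU c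
      refine mem_of_superset ((isOpen_U i).mem_nhds hi) fun c' hc' => ?_
      obtain ⟨b, rfl, hb⟩ := hc
      obtain ⟨y, rfl⟩ := exists_proj hc'
      exact ⟨⟨i, y⟩, rfl, hA i hi hc' hb⟩
  have huniv := hclopen.eq_univ ⟨_, p, rfl, ⟨PiSet.one p⟩⟩
  obtain ⟨b, hb, hb'⟩ : X.proj x.1 x.2 ∈ A := huniv ▸ mem_univ _
  exact hA x.1 (hb ▸ proj_mem x.2) (proj_mem x.2) hb'

lemma SemilocallyOneConnected.exists_path_eq_one (hsemi : X.SemilocallyOneConnected)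
    (hloc : X.LocallyStronglyPathConnected) (c : X.carrier) :
    ∃ i, c ∈ X.U i ∧ ∀ (y : X.hat i) (γ : Path y y),
      PiSet.path (γ.map (continuous_sigmaMk (σ := X.hat))) = PiSet.one _ := by
  obtain ⟨i, hi, h⟩ := hsemi c
  refine ⟨i, hi, fun y γ => ?_⟩
  obtain ⟨z, hz⟩ := exists_proj hi
  have := hloc i
  have : PathConnectedSpace (X.hat i) := pathConnectedSpace_iff_connectedSpace.2 inferInstance
  let β : Path z y := PathConnectedSpace.somePath z y
  have h1 := Loop.cls_eq_iff.1 (h z hz ((β.trans γ).trans β.symm))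
  rw [Loop.ofPath_way_cls, Loop.const_way_cls, Path.map_trans, Path.map_trans, PiSet.path_trans,
    PiSet.path_trans, ← Path.map_symm, PiSet.mul_assoc] at h1
  rw [← PiSet.path_mul_symm (β.map (continuous_sigmaMk (σ := X.hat)))] at h1
  have h2 := congrArg (fun α => PiSet.mul α (PiSet.path (β.map (continuous_sigmaMk (σ := X.hat)))))
    (PiSet.mul_left_cancel h1)
  simpa only [PiSet.mul_assoc, PiSet.path_symm_mul, PiSet.mul_one] using h2

variable {p : X.BasePoint} {H : Set (X.Pi1 p)}

namespace IsSubgroupPi1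

/-- Classes of ways modulo the subgroup. -/
def setoid (hH : X.IsSubgroupPi1 p H) (x : X.BasePoint) : Setoid (PiSet p x) where
  r a b := ∃ h : X.Loop p, h.cls ∈ H ∧ b = PiSet.mul h.way.cls a
  iseqv := by
    refine ⟨fun a => ⟨_, hH.one_mem, ?_⟩, ?_, ?_⟩
    · rw [Loop.const_way_cls, PiSet.one_mul]
    · rintro a _ ⟨h, hh, rfl⟩
      obtain ⟨β, h1, h2⟩ := PiSet.exists_inv h.way.cls
      obtain ⟨k, rfl⟩ := Loop.exists_way_cls β
      refine ⟨k, hH.inv_mem h k hh (Loop.cls_eq_iff.2 h1), ?_⟩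
      rw [← PiSet.mul_assoc, h2, PiSet.one_mul]
    · rintro a _ _ ⟨h, hh, rfl⟩ ⟨k, hk, rfl⟩
      exact ⟨k.concat h, hH.mul_mem k h hk hh, (PiSet.mul_assoc _ _ _).symm⟩

/-- The local system of a subgroup of the fundamental group. -/
def locSys (hH : X.IsSubgroupPi1 p H) (hloc : X.LocallyStronglyPathConnected)
    (hsemi : X.SemilocallyOneConnected) : LocSys X where
  F x := Quotient (hH.setoid x)
  act β := Quotient.map' (s₁ := hH.setoid _) (s₂ := hH.setoid _) (fun a => PiSet.mul a β) (by
    rintro a _ ⟨h, hh, rfl⟩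
    exact ⟨h, hh, PiSet.mul_assoc _ _ _⟩)
  act_one e := by
    induction e using Quotient.ind
    exact congrArg _ (PiSet.mul_one _)
  act_mul α β e := by
    induction e using Quotient.ind
    exact congrArg _ (PiSet.mul_assoc _ _ _).symm
  loc := hloc
  even c := by
    obtain ⟨i, hi, h⟩ := hsemi.exists_path_eq_one hloc c
    refine ⟨i, hi, fun y γ e => ?_⟩
    rw [h]
    induction e using Quotient.ind
    exact congrArg _ (PiSet.mul_one _)

/-- The constant way as a point of the local system. -/
def pt (hH : X.IsSubgroupPi1 p H) (hloc : X.LocallyStronglyPathConnected)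
    (hsemi : X.SemilocallyOneConnected) : (hH.locSys hloc hsemi).F p :=
  Quotient.mk (hH.setoid p) (PiSet.one p)

variable (hH : X.IsSubgroupPi1 p H) (hloc : X.LocallyStronglyPathConnected)
  (hsemi : X.SemilocallyOneConnected)

lemma act_pt {x : X.BasePoint} (α : PiSet p x) :
    (hH.locSys hloc hsemi).act α (hH.pt hloc hsemi) = Quotient.mk (hH.setoid x) α :=
  congrArg (Quotient.mk (hH.setoid x)) (PiSet.one_mul α)

lemma act_pt_eq_iff (δ : X.Loop p) :
    (hH.locSys hloc hsemi).act δ.way.cls (hH.pt hloc hsemi) = hH.pt hloc hsemi ↔ δ.cls ∈ H := by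
  rw [act_pt]
  refine Iff.trans eq_comm ((Quotient.eq (r := hH.setoid p)).trans ⟨?_, fun h => ⟨δ, h, (PiSet.mul_one _).symm⟩⟩)
  rintro ⟨h, hh, e⟩
  rw [PiSet.mul_one] at e
  rwa [Loop.cls_eq_iff.2 e]

end IsSubgroupPi1

lemma isSubgroupPi1_singleton (p : X.BasePoint) : X.IsSubgroupPi1 p {(Loop.const p).cls} where
  one_mem := rfl
  mul_mem a b ha hb := by
    rw [mem_singleton_iff, Loop.cls_eq_iff, Loop.const_way_cls] at *
    rw [Loop.concat_way_cls, ha, hb, PiSet.one_mul]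
  inv_mem a b ha h := by
    rw [mem_singleton_iff, Loop.cls_eq_iff, Loop.const_way_cls] at *
    rw [Loop.concat_way_cls, ha, PiSet.one_mul] at h
    exact h

end

end Orbispace

theorem theorem4p1p9 (X : Orbispace.{u}) (hconn : X.Connected)
    (hloc : X.LocallyStronglyPathConnected) (hsemi : X.SemilocallyOneConnected)
    (p : X.BasePoint) :
    (∀ H : Set (X.Pi1 p), X.IsSubgroupPi1 p H →
      ∃ (Y : Orbispace.{u}) (q : Y.BasePoint) (m : Orbispace.BasedMor Y q X p),
        Y.Connected ∧ m.toMor.IsCovering ∧ m.imagePi1 = H) ∧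
    ∃ (Y : Orbispace.{u}) (m : Orbispace.Mor Y X), m.IsUniversalCovering := by
  have key : ∀ {H : Set (X.Pi1 p)} (hH : X.IsSubgroupPi1 p H),
      (hH.locSys hloc hsemi).cover.Connected ∧ ∀ x, Nonempty ((hH.locSys hloc hsemi).F x) := by
    intro H hH
    refine ⟨Orbispace.LocSys.connected_cover (hH.pt hloc hsemi) fun e => ?_, fun x => ?_⟩
    · induction e using Quotient.ind with | _ a
      exact ⟨a, hH.act_pt hloc hsemi a⟩
    · obtain ⟨a⟩ := Orbispace.nonempty_piSet hconn hloc p x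
      exact ⟨Quotient.mk (hH.setoid x) a⟩
  constructor
  · intro H hH
    obtain ⟨q, m, h1, h2⟩ := Orbispace.LocSys.exists_covering _ (hH.pt hloc hsemi) (key hH).2
    refine ⟨_, q, m, (key hH).1, h1, h2.trans (Set.ext fun a => ?_)⟩
    constructor
    · rintro ⟨δ, rfl, hδ⟩
      exact (hH.act_pt_eq_iff hloc hsemi δ).1 hδ
    · intro ha
      obtain ⟨⟨δ⟩, rfl⟩ := Quotient.exists_rep a
      exact ⟨δ, rfl, (hH.act_pt_eq_iff hloc hsemi δ).2 ha⟩
  · have hH := Orbispace.isSubgroupPi1_singleton p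
    obtain ⟨q, m, h1, -⟩ := Orbispace.LocSys.exists_covering _ (hH.pt hloc hsemi) (key hH).2
    refine ⟨_, m.toMor, h1, (key hH).1, Orbispace.LocSys.locallyStronglyPathConnected_cover,
      fun q γ => Orbispace.LocSys.cls_eq_const (fun {x} e α h => ?_) γ⟩
    induction e using Quotient.ind with | _ a
    obtain ⟨k, hk, e⟩ := (Quotient.eq (r := hH.setoid x)).1 h
    rw [Set.mem_singleton_iff, Orbispace.Loop.cls_eq_iff, Orbispace.Loop.const_way_cls] at hk
    rw [hk, Orbispace.PiSet.one_mul] at e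
    exact Orbispace.PiSet.mul_left_cancel (e.symm.trans (Orbispace.PiSet.mul_one a).symm)
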